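/- Let $\mathbf F=\mathbb C((t))$, $\mathbf O=\mathbb C[[t]]$. Let $V=\mathbb C^6$ have basis $v_1,\dots,v_6$ and the symplectic form with $\langle v_i,v_{7-i}\rangle=1=-\langle v_{7-i},v_i\rangle$ for $i=1,2,3$ and all other products of basis vectors zero; $\mathrm{PSp}(6)=\mathrm{GSp}(6)/\mathbb G_m$, and $\mathrm{Gr}=\mathrm{PSp}(6,\mathbf F)/\mathrm{PSp}(6,\mathbf O)$ is its affine Grassmannian. Let $U\subset \mathrm{PSp}(6)$ be the unipotent radical of the stabilizer of $\langle v_1,v_2\rangle$, let $L$ be the Levi subgroup of this stabilizer that preserves $\langle v_1,v_2\rangle$, $\langle v_3,v_4\rangle$ and $\langle v_5,v_6\rangle$, and let $\mathrm{PGL}(2)\hookrightarrow L$ be induced by $A=\begin{pmatrix}a&b\\c&d\end{pmatrix}\mapsto \mathrm{diag}(A,A,A')$, $A'=\begin{pmatrix}a&-b\\-c&d\end{pmatrix}$. Let $\chi\colon \mathrm{PGL}(2,\mathbf O)\ltimes U(\mathbf F)\to\mathbb G_a$ be the character trivial on the first factor and equal to $u\mapsto \mathrm{Res}_{t=0}(u_{13}+u_{24})$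 on the second one. Let $\mathcal P$ be the determinant line bundle on $\mathrm{Gr}$ whose fiber at the class of $M\in \mathrm{GSp}(6,\mathbf F)$ with multiplier $\nu$ is $\det(M\mathbf O^6:\mathbf O^6)^{-4}\otimes\det(\nu\mathbf O:\mathbf O)^{6}$, with its natural $\mathrm{PGL}(2,\mathbf O)\ltimes U(\mathbf F)$-equivariant structure. Let $\kappa\in\mathbb C$ be irrational, i.e. $\kappa\notin\mathbb Q$ (for instance such that $\exp(\pi\sqrt{-1}\kappa)$ is transcendental). We say that the closure of a $\mathrm{PGL}(2,\mathbf O)\ltimes U(\mathbf F)$-orbit in $\mathrm{Gr}$ supports a $\chi$-equivariant D-module (resp. a $\chi$-equivariant $\kappa$-twisted D-module) if there is a nonzero $(\mathrm{PGL}(2,\mathbf O)\ltimes U(\mathbf F),\chi)$-equivariant D-module (resp. $\mathcal P^{\kappa}$-twisted D-module) on this orbit; here D-modules are understood as crystals of quasi-coherent sheaves. For half-integers $\lambda_1,\lambda_2,\lambda_3\in\frac12\mathbb Z$ with $\lambda_1-\lambda_2,\lambda_2-\lambda_3\in\mathbb Z$ let $t^{(\lambda_1,\lambda_2,\lambda_3)}=\mathrm{diag}(t^{\lambda_1},t^{\lambda_2},t^{\lambda_3},t^{-\lambda_3},t^{-\lambda_2},t^{-\lambda_1})\in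 \mathrm{PSp}(6,\mathbf F)$ (taken modulo scalars), for $\lambda_4\in\frac12\mathbb Z$ let $t^{\lambda_4}\in\mathrm{PSp}(6,\mathbf F)$ be the image of the class of $\mathrm{diag}(t^{2\lambda_4},1)$ in $\mathrm{PGL}(2,\mathbf F)$, and let $g=\mathrm{Id}+E_{34}$. Then: (a) The points $t^{\lambda_4}gt^{(\lambda_1,\lambda_2,\lambda_3)}$ with $\lambda_1,\lambda_2\in\frac12\mathbb Z$, $\lambda_3,\lambda_4\in\frac12\mathbb N$, $\lambda_1-\lambda_2\in\mathbb N$, $\lambda_2-\lambda_3\in\mathbb Z$ (that is, with $(\lambda_1,\lambda_2,\lambda_3)$ an $L$-dominant coweight) form a full set of representatives of the $\mathrm{PGL}(2,\mathbf O)\ltimes U(\mathbf F)$-orbits in $\mathrm{Gr}$, different $(\lambda_1,\dots,\lambda_4)$ giving different orbits. (b) The points $t^{\lambda_4}gt^{(\lambda_1,\lambda_2,\lambda_3)}$ with $\lambda_1,\dots,\lambda_4\in\frac12\mathbb N$ and $\lambda_1-\lambda_2,\lambda_2-\lambda_3\in\mathbb N$ (that is, with $(\lambda_1,\lambda_2,\lambda_3)$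 a dominant coweight of $\mathrm{PSp}(6)$) form a full set of representatives of those orbits whose closure supports a $\chi$-equivariant D-module. (c) The points $t^{\lambda_4}gt^{(\lambda_1,\lambda_2,\lambda_3)}$ with $(\lambda_1,\dots,\lambda_4)$ as in (b) and moreover $\lambda_1=\lambda_2+\lambda_3$ if $\lambda_4=0$, and $\lambda_1>\lambda_2\ge\lambda_3>0$ if $\lambda_4>0$, form a full set of representatives of those orbits whose closure supports a $\chi$-equivariant $\kappa$-twisted D-module. -/

import Mathlib

namespace Gaiotto

open Matrix
open scoped LaurentSeries PowerSeries

noncomputable section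

/-! ### The groups `GSp(6)`, `PSp(6)`, `PGL(2) ⋉ U` -/

/-- The Gram matrix of the symplectic form in the basis `v₁, …, v₆`:
`⟨vᵢ, v₇₋ᵢ⟩ = 1 = -⟨v₇₋ᵢ, vᵢ⟩` for `i = 1, 2, 3`, all other products being zero
(the indices of `Fin 6` start with `0`). -/
def gram (B : Type*) [CommRing B] : Matrix (Fin 6) (Fin 6) B :=
  Matrix.of fun i j => if i.val + j.val = 5 then (if i.val < 3 then 1 else -1) else 0

/-- The group `GSp(6, B)` of symplectic similitudes. -/
def GSp (B : Type*) [CommRing B] : Subgroup (GL (Fin 6) B) where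
  carrier := {M | ∃ ν : Bˣ, (M : Matrix (Fin 6) (Fin 6) B)ᵀ * gram B * M = (ν : B) • gram B}
  one_mem' := ⟨1, by simp⟩
  mul_mem' := by
    rintro M N ⟨μ, hμ⟩ ⟨ν, hν⟩
    refine ⟨μ * ν, ?_⟩
    calc ((M * N : GL (Fin 6) B) : Matrix (Fin 6) (Fin 6) B)ᵀ * gram B * (M * N : GL (Fin 6) B)
        = (N : Matrix (Fin 6) (Fin 6) B)ᵀ *
            ((M : Matrix (Fin 6) (Fin 6) B)ᵀ * gram B * M) * N := by
          simp only [Units.val_mul, Matrix.transpose_mul, Matrix.mul_assoc]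
      _ = _ := by
          rw [hμ, Matrix.mul_smul, Matrix.smul_mul, hν, smul_smul, Units.val_mul]
  inv_mem' := by
    rintro M ⟨ν, hν⟩
    refine ⟨ν⁻¹, ?_⟩
    have h1 : (M : Matrix (Fin 6) (Fin 6) B) * (M⁻¹ : GL (Fin 6) B) = 1 := by
      rw [← Units.val_mul, mul_inv_cancel, Units.val_one]
    have h2 : ((M⁻¹ : GL (Fin 6) B) : Matrix (Fin 6) (Fin 6) B)ᵀ *
        (M : Matrix (Fin 6) (Fin 6) B)ᵀ = 1 := by
      rw [← Matrix.transpose_mul, h1, Matrix.transpose_one]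
    have h3 : gram B = (ν : B) • (((M⁻¹ : GL (Fin 6) B) : Matrix (Fin 6) (Fin 6) B)ᵀ *
        gram B * (M⁻¹ : GL (Fin 6) B)) := by
      calc gram B = (((M⁻¹ : GL (Fin 6) B) : Matrix (Fin 6) (Fin 6) B)ᵀ *
            (M : Matrix (Fin 6) (Fin 6) B)ᵀ) * gram B *
            ((M : Matrix (Fin 6) (Fin 6) B) * (M⁻¹ : GL (Fin 6) B)) := by
            rw [h1, h2, Matrix.one_mul, Matrix.mul_one]
        _ = ((M⁻¹ : GL (Fin 6) B) : Matrix (Fin 6) (Fin 6) B)ᵀ *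
            ((M : Matrix (Fin 6) (Fin 6) B)ᵀ * gram B * M) * (M⁻¹ : GL (Fin 6) B) := by
            simp only [Matrix.mul_assoc]
        _ = _ := by rw [hν, Matrix.mul_smul, Matrix.smul_mul]
    rw [h3, smul_smul, ← h3]
    simp

/-- The subgroup of scalar matrices in `GSp(6, B)`. -/
def scalars (B : Type*) [CommRing B] : Subgroup (GSp B) :=
  (Units.map (Matrix.scalar (Fin 6) : B →+* Matrix (Fin 6) (Fin 6) B).toMonoidHom).range.subgroupOf
    (GSp B)

instance (B : Type*) [CommRing B] : (scalars B).Normal where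
  conj_mem := by
    rintro ⟨n, hn⟩ ⟨c, hc⟩ ⟨g, hg⟩
    refine ⟨c, ?_⟩
    have hc' : Units.map (Matrix.scalar (Fin 6) : B →+* Matrix (Fin 6) (Fin 6) B).toMonoidHom c
        = n := hc
    change _ = g * n * g⁻¹
    rw [← hc', eq_mul_inv_iff_mul_eq]
    ext1
    exact (Matrix.scalar_commute (c : B) (fun r => Commute.all _ _) (g.val : Matrix (Fin 6) (Fin 6) B)).eq

/-- The group `PSp(6, B) = GSp(6, B) / Bˣ`. -/
abbrev PSp (B : Type*) [CommRing B] : Type _ := GSp B ⧸ scalars B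

/-- The projection `GSp(6, B) → PSp(6, B)`. -/
def PSp.mk {B : Type*} [CommRing B] : GSp B →* PSp B := QuotientGroup.mk' (scalars B)

lemma gram_map {B C : Type*} [CommRing B] [CommRing C] (f : B →+* C) :
    f.mapMatrix (gram B) = gram C := by
  ext i j
  simp only [gram, RingHom.mapMatrix_apply, Matrix.map_apply, Matrix.of_apply]
  split_ifs <;> simp

/-- Functoriality of `GSp(6)` in the ring. -/
def GSp.map {B C : Type*} [CommRing B] [CommRing C] (f : B →+* C) : GSp B →* GSp C :=
  ((Matrix.GeneralLinearGroup.map f).comp (GSp B).subtype).codRestrict (GSp C) (by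
    rintro ⟨M, ν, hν⟩
    refine ⟨Units.map f.toMonoidHom ν, ?_⟩
    have h := congrArg f.mapMatrix hν
    rw [map_mul, map_mul, gram_map] at h
    have h2 : f.mapMatrix ((ν : B) • gram B) = f ν • gram C := by
      rw [← gram_map f]
      ext i j
      simp
    rw [h2] at h
    simpa [Matrix.transpose_map] using h)

/-- Functoriality of `PSp(6)` in the ring. -/
def PSp.map {B C : Type*} [CommRing B] [CommRing C] (f : B →+* C) : PSp B →* PSp C :=
  QuotientGroup.map (scalars B) (scalars C) (GSp.map f) (by
    rintro ⟨M, hM⟩ ⟨c, hc⟩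
    refine ⟨Units.map f.toMonoidHom c, ?_⟩
    have hc' : Units.map (Matrix.scalar (Fin 6) : B →+* Matrix (Fin 6) (Fin 6) B).toMonoidHom c
        = M := hc
    change _ = Matrix.GeneralLinearGroup.map f M
    rw [← hc']
    ext i j
    simp [Matrix.GeneralLinearGroup.map, Matrix.scalar_apply, Matrix.diagonal_apply, apply_ite f])

/-- The matrix `diag(A, A, A')` where `A'` is `A` with the signs of the off-diagonal entries
changed: the diagonal embedding of `GL(2)` into the Levi subgroup of block diagonal matrices
with respect to `V = V₁₂ ⊕ V₃₄ ⊕ V₅₆`. -/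
def leviMatrix {B : Type*} [CommRing B] (A : Matrix (Fin 2) (Fin 2) B) :
    Matrix (Fin 6) (Fin 6) B :=
  !![A 0 0, A 0 1, 0, 0, 0, 0;
     A 1 0, A 1 1, 0, 0, 0, 0;
     0, 0, A 0 0, A 0 1, 0, 0;
     0, 0, A 1 0, A 1 1, 0, 0;
     0, 0, 0, 0, A 0 0, -A 0 1;
     0, 0, 0, 0, -A 1 0, A 1 1]

/-- `leviMatrix` as a homomorphism of multiplicative monoids. -/
def leviMonoidHom (B : Type*) [CommRing B] :
    Matrix (Fin 2) (Fin 2) B →* Matrix (Fin 6) (Fin 6) B where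
  toFun := leviMatrix
  map_one' := by
    ext i j
    fin_cases i <;> fin_cases j <;> simp [leviMatrix]
  map_mul' A A' := by
    ext i j
    fin_cases i <;> fin_cases j <;>
      simp [leviMatrix, Matrix.mul_apply, Fin.sum_univ_succ] <;> ring

/-- The embedding `GL(2, B) → GSp(6, B)`, `A ↦ diag(A, A, A')`; modulo scalars it is the diagonal
embedding of `PGL(2)` into the Levi subgroup `L ⊂ PSp(6)`. -/
def levi (B : Type*) [CommRing B] : GL (Fin 2) B →* GSp B :=
  (Units.map (leviMonoidHom B)).codRestrict (GSp B) (by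
    intro A
    refine ⟨Matrix.GeneralLinearGroup.det A, ?_⟩
    ext i j
    fin_cases i <;> fin_cases j <;>
      simp [leviMonoidHom, leviMatrix, gram, Matrix.mul_apply, Fin.sum_univ_succ,
        Matrix.det_fin_two] <;> ring)

/-- The unipotent radical `U(B)` of the stabilizer of `V₁₂ = ⟨v₁, v₂⟩`: the elements of `GSp(6, B)`
which are block upper triangular with identity diagonal blocks with respect to
`V = V₁₂ ⊕ V₃₄ ⊕ V₅₆` (index `i` lies in block `i / 2`). It maps isomorphically to its image
in `PSp(6, B)`. -/
def unip (B : Type*) [CommRing B] : Subgroup (GSp B) where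
  carrier := {u | ∀ i j : Fin 6, j.val / 2 ≤ i.val / 2 →
    (u.1 : Matrix (Fin 6) (Fin 6) B) i j = (1 : Matrix (Fin 6) (Fin 6) B) i j}
  one_mem' := fun _ _ _ => rfl
  mul_mem' := by
    rintro u v hu hv i j hij
    change ((u.1 : Matrix (Fin 6) (Fin 6) B) * (v.1 : Matrix (Fin 6) (Fin 6) B)) i j = _
    rw [Matrix.mul_apply]
    trans ∑ k, (1 : Matrix (Fin 6) (Fin 6) B) i k * (1 : Matrix (Fin 6) (Fin 6) B) k j
    · refine Finset.sum_congr rfl fun k _ => ?_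
      by_cases h1 : k.val / 2 ≤ i.val / 2
      · rw [hu i k h1]
        by_cases h2 : j.val / 2 ≤ k.val / 2
        · rw [hv k j h2]
        · have : i ≠ k := by rintro rfl; exact h2 hij
          simp [Matrix.one_apply_ne this]
      · have h2 : j.val / 2 ≤ k.val / 2 := by omega
        have : k ≠ j := by rintro rfl; exact h1 hij
        simp [hv k j h2, Matrix.one_apply_ne this]
    · rw [← Matrix.mul_apply, Matrix.one_mul]
  inv_mem' := by
    rintro u hu
    set N : Matrix (Fin 6) (Fin 6) B := (u.1 : Matrix (Fin 6) (Fin 6) B) - 1 with hN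
    have hN0 : ∀ i j : Fin 6, j.val / 2 ≤ i.val / 2 → N i j = 0 := by
      intro i j hij
      simp [hN, hu i j hij]
    have hN2 : ∀ i j : Fin 6, j.val / 2 ≤ i.val / 2 + 1 → (N * N) i j = 0 := by
      intro i j hij
      rw [Matrix.mul_apply]
      refine Finset.sum_eq_zero fun k _ => ?_
      by_cases h1 : k.val / 2 ≤ i.val / 2
      · rw [hN0 i k h1, zero_mul]
      · rw [hN0 k j (by omega), mul_zero]
    have hN3 : N * (N * N) = 0 := by
      ext i j
      rw [Matrix.mul_apply, Matrix.zero_apply]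
      refine Finset.sum_eq_zero fun k _ => ?_
      by_cases h1 : k.val / 2 ≤ i.val / 2
      · rw [hN0 i k h1, zero_mul]
      · rw [hN2 k j (by omega), mul_zero]
    have hu1 : (u.1 : Matrix (Fin 6) (Fin 6) B) = 1 + N := by rw [hN]; abel
    have hmul : (u.1 : Matrix (Fin 6) (Fin 6) B) * (1 - N + N * N) = 1 := by
      rw [hu1]
      have : (1 + N) * (1 - N + N * N) = 1 + N * (N * N) := by noncomm_ring
      rw [this, hN3, add_zero]
    have hinv : ((u⁻¹ : GSp B).1 : Matrix (Fin 6) (Fin 6) B) = 1 - N + N * N := by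
      have h : ((u⁻¹ : GSp B).1 : Matrix (Fin 6) (Fin 6) B) *
          (u.1 : Matrix (Fin 6) (Fin 6) B) = 1 := by
        exact congrArg (fun x : GSp B => (x.1 : Matrix (Fin 6) (Fin 6) B)) (inv_mul_cancel u)
      calc _ = ((u⁻¹ : GSp B).1 : Matrix (Fin 6) (Fin 6) B) *
            ((u.1 : Matrix (Fin 6) (Fin 6) B) * (1 - N + N * N)) := by rw [hmul, Matrix.mul_one]
        _ = _ := by rw [← Matrix.mul_assoc, h, Matrix.one_mul]
    intro i j hij
    rw [hinv]
    simp [hN0 i j hij, hN2 i j (by omega)]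

/-! ### Loop groups and the affine Grassmannian -/

/-- Functoriality of `R((t))` in `R`. -/
def laurentMap {R S : Type*} [CommRing R] [CommRing S] (f : R →+* S) : R⸨X⸩ →+* S⸨X⸩ where
  toFun x := HahnSeries.map x f
  map_one' := HahnSeries.map_one f.toMonoidWithZeroHom
  map_mul' _ _ := HahnSeries.map_mul f.toNonUnitalRingHom
  map_zero' := HahnSeries.map_zero f.toMonoidWithZeroHom.toZeroHom
  map_add' _ _ := HahnSeries.map_add f.toAddMonoidHom

/-- The subgroup `PGL(2, R[[t]]) ⋉ U(R((t)))` of `PSp(6, R((t)))`. -/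
def H (R : Type*) [CommRing R] : Subgroup (PSp R⸨X⸩) :=
  (PSp.mk.comp ((levi R⸨X⸩).comp
    (Matrix.GeneralLinearGroup.map (HahnSeries.ofPowerSeries ℤ R)))).range ⊔
  (unip R⸨X⸩).map PSp.mk

lemma coeff_ofPowerSeries_neg {R : Type*} [CommRing R] (x : R⟦X⟧) {n : ℤ} (hn : n < 0) :
    (HahnSeries.ofPowerSeries ℤ R x).coeff n = 0 := by
  rw [HahnSeries.ofPowerSeries_apply]
  refine HahnSeries.embDomain_of_notMem_range ?_
  rintro ⟨k, hk⟩
  have : (k : ℤ) = n := hk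
  omega

lemma laurentMap_ofPowerSeries {R S : Type*} [CommRing R] [CommRing S] (f : R →+* S)
    (x : R⟦X⟧) : laurentMap f (HahnSeries.ofPowerSeries ℤ R x) =
      HahnSeries.ofPowerSeries ℤ S (PowerSeries.map f x) := by
  ext n
  change f ((HahnSeries.ofPowerSeries ℤ R x).coeff n) = _
  rcases lt_or_ge n 0 with hn | hn
  · rw [coeff_ofPowerSeries_neg _ hn, coeff_ofPowerSeries_neg _ hn, map_zero]
  · lift n to ℕ using hn
    rw [HahnSeries.ofPowerSeries_apply_coeff, HahnSeries.ofPowerSeries_apply_coeff,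
      PowerSeries.coeff_map]

lemma H_map_le {R S : Type*} [CommRing R] [CommRing S] (f : R →+* S) :
    (H R).map (PSp.map (laurentMap f)) ≤ H S := by
  rw [H, H, Subgroup.map_sup]
  refine sup_le_sup ?_ ?_
  · rintro _ ⟨_, ⟨A, rfl⟩, rfl⟩
    refine ⟨Matrix.GeneralLinearGroup.map (PowerSeries.map f) A, ?_⟩
    change PSp.mk _ = PSp.mk _
    congr 1
    apply Subtype.ext
    apply Units.ext
    refine Matrix.ext fun i j => ?_
    change leviMatrix _ i j = laurentMap f (leviMatrix _ i j)
    fin_cases i <;> fin_cases j <;>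
      simp [leviMatrix, laurentMap_ofPowerSeries]
  · rintro _ ⟨_, ⟨u, hu, rfl⟩, rfl⟩
    refine ⟨GSp.map (laurentMap f) u, ?_, rfl⟩
    intro i j hij
    change laurentMap f ((u.1 : Matrix (Fin 6) (Fin 6) R⸨X⸩) i j) = _
    rw [hu i j hij, Matrix.one_apply, Matrix.one_apply]
    split_ifs <;> simp

/-- Functoriality of `PGL(2, R[[t]]) ⋉ U(R((t)))` in `R`. -/
def H.map {R S : Type*} [CommRing R] [CommRing S] (f : R →+* S) : H R →* H S :=
  ((PSp.map (laurentMap f)).comp (H R).subtype).codRestrict (H S)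
    fun h => H_map_le f ⟨h.1, h.2, rfl⟩

/-- The affine Grassmannian `R ↦ PSp(6, R((t))) / PSp(6, R[[t]])` (as a presheaf). -/
abbrev Gr (R : Type*) [CommRing R] : Type _ :=
  PSp R⸨X⸩ ⧸ (PSp.map (HahnSeries.ofPowerSeries ℤ R)).range

/-- Functoriality of the affine Grassmannian in `R`. -/
def Gr.map {R S : Type*} [CommRing R] [CommRing S] (f : R →+* S) : Gr R → Gr S :=
  Quotient.map' (PSp.map (laurentMap f)) (by
    intro a b hab
    rw [QuotientGroup.leftRel_apply] at hab ⊢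
    obtain ⟨x, hx⟩ := hab
    rw [← map_inv, ← map_mul, ← hx]
    obtain ⟨M, rfl⟩ := QuotientGroup.mk_surjective x
    refine ⟨PSp.mk (GSp.map (PowerSeries.map f) M), ?_⟩
    change PSp.mk _ = PSp.mk _
    congr 1
    apply Subtype.ext
    apply Units.ext
    refine Matrix.ext fun i j => ?_
    exact (laurentMap_ofPowerSeries f _).symm)

/-- The relation `χ(h) = c` for the character `χ` of `PGL(2, R[[t]]) ⋉ U(R((t)))` which is trivial
on the first factor and is `u ↦ Res_{t=0} (u₁₃ + u₂₄)` on the second one. -/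
def IsChi {R : Type*} [CommRing R] (h : PSp R⸨X⸩) (c : R) : Prop :=
  ∃ (A : GL (Fin 2) R⟦X⟧) (u : GSp R⸨X⸩), u ∈ unip R⸨X⸩ ∧
    h = PSp.mk (levi R⸨X⸩ (Matrix.GeneralLinearGroup.map (HahnSeries.ofPowerSeries ℤ R) A) * u) ∧
    c = ((u.1 : Matrix (Fin 6) (Fin 6) R⸨X⸩) 0 2 + (u.1 : Matrix (Fin 6) (Fin 6) R⸨X⸩) 1 3).coeff
      (-1)

/-! ### The determinant line bundle -/

/-- Multiplication by the matrix `T`, as an `R`-linear map. -/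
def mulVecLin {ι : Type*} [Fintype ι] {R : Type*} [CommRing R] (T : Matrix ι ι R⸨X⸩) :
    (ι → R⸨X⸩) →ₗ[R] (ι → R⸨X⸩) where
  toFun v := T *ᵥ v
  map_add' := Matrix.mulVec_add T
  map_smul' c v := by
    have h : ∀ w : ι → R⸨X⸩, c • w = (HahnSeries.C c : R⸨X⸩) • w := fun w => by
      funext i
      exact HahnSeries.C_mul_eq_smul.symm
    rw [RingHom.id_apply, h, h, Matrix.mulVec_smul]

/-- The lattice `M · R[[t]]^ι ⊂ R((t))^ι`, as an `R`-module. -/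
def lattice {ι : Type*} [Fintype ι] {R : Type*} [CommRing R] (M : Matrix ι ι R⸨X⸩) :
    Submodule R (ι → R⸨X⸩) where
  carrier := {v | ∃ w : ι → R⟦X⟧, v = M *ᵥ fun i => HahnSeries.ofPowerSeries ℤ R (w i)}
  zero_mem' := ⟨0, by
    have h : (fun i => HahnSeries.ofPowerSeries ℤ R ((0 : ι → R⟦X⟧) i)) = 0 := by
      funext i
      simp
    rw [h, Matrix.mulVec_zero]⟩
  add_mem' := by
    rintro _ _ ⟨w, rfl⟩ ⟨w', rfl⟩
    refine ⟨w + w', ?_⟩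
    rw [← Matrix.mulVec_add]
    congr 1
    funext i
    simp
  smul_mem' := by
    rintro c _ ⟨w, rfl⟩
    refine ⟨fun i => PowerSeries.C c * w i, ?_⟩
    have h := (mulVecLin M).map_smul c fun i => HahnSeries.ofPowerSeries ℤ R (w i)
    refine h.symm.trans ?_
    change M *ᵥ _ = M *ᵥ _
    congr 1
    funext i
    rw [map_mul, HahnSeries.ofPowerSeries_C]
    exact HahnSeries.C_mul_eq_smul.symm

/-- `d` is the determinant of the endomorphism of the free `R`-module of finite rank `L / C`
induced by `T`. -/
def IsDetOn {R E : Type*} [CommRing R] [AddCommGroup E] [Module R E] (T : E →ₗ[R] E)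
    (L C : Submodule R E) (d : R) : Prop :=
  ∃ (hL : ∀ v ∈ L, T v ∈ L)
    (hC : C.submoduleOf L ≤ (C.submoduleOf L).comap (T.restrict hL)),
    C ≤ L ∧ Module.Free R (L ⧸ C.submoduleOf L) ∧ Module.Finite R (L ⧸ C.submoduleOf L) ∧
      LinearMap.det ((C.submoduleOf L).mapQ (C.submoduleOf L) (T.restrict hL) hC) = d

/-- `T` preserves the lattices `L = M · R[[t]]^ι` and `L₀ = B · R[[t]]^ι`, and acts by `r` on the
relative determinant line `det(L : L₀) = det(L / C) ⊗ det(L₀ / C)⁻¹`, where `C = t^N L₀ ⊂ L`. -/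
def IsRelDet {ι : Type*} [Fintype ι] [DecidableEq ι] {R : Type*} [CommRing R]
    (T M B : Matrix ι ι R⸨X⸩) (r : Rˣ) : Prop :=
  (lattice M).map (mulVecLin T) = lattice M ∧
  (lattice B).map (mulVecLin T) = lattice B ∧
  ∃ (N : ℕ) (d d₀ : R),
    IsDetOn (mulVecLin T) (lattice M)
      (lattice ((HahnSeries.single (N : ℤ) (1 : R) : R⸨X⸩) • B)) d ∧
    IsDetOn (mulVecLin T) (lattice B)
      (lattice ((HahnSeries.single (N : ℤ) (1 : R) : R⸨X⸩) • B)) d₀ ∧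
    d = r * d₀

/-- The matrix `diag(t⁻ᵃ, t⁻ᵃ, 1, 1, tᵃ, tᵃ)`. -/
def balanced (R : Type*) [CommRing R] (a : ℕ) : Matrix (Fin 6) (Fin 6) R⸨X⸩ :=
  Matrix.diagonal fun i => HahnSeries.single ((a : ℤ) * ![-1, -1, 0, 0, 1, 1] i) (1 : R)

/-- A point `M ∈ GSp(6, R((t)))` gives rise to the lattice `L = M · R[[t]]^6` with the symplectic
form with values in the rank one lattice `ν · R[[t]]`, where `ν` is the multiplier of `M`.
The fiber of the determinant line bundle `𝒫` of `Gr` at the class of `M` is the line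
`det(L : L₀)^{-4} ⊗ det(ν R[[t]] : R[[t]])^{6}`, `L₀ = R[[t]]^6`; it depends only on the class of
`M` in `Gr`. The line bundle `𝒫` is equivariant with respect to `PGL(2, R[[t]]) ⋉ U(R((t)))`: for
an element `p = A u` of this group, `p : det(L : L₀) → det(p L : p L₀) = det(p L : L₀)`, where the
line `det(p L₀ : L₀)` is trivialized by comparing `L₀` with the lattice
`diag(t⁻ᵃ, t⁻ᵃ, 1, 1, tᵃ, tᵃ) L₀`, preserved by `p` for `a` large enough.

The relation `IsFibreWeight y s w` says that an element `s` of this group which stabilizes a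
`ℂ`-point `y` of `Gr` acts by `w` on the fiber of `𝒫` at `y` (extended to `R`). -/
def IsFibreWeight {R : Type*} [CommRing R] [Algebra ℂ R] (y : Gr ℂ) (s : PSp R⸨X⸩) (w : Rˣ) :
    Prop :=
  ∃ (M : GSp ℂ⸨X⸩) (ν : ℂ⸨X⸩ˣ) (A : GL (Fin 2) R⟦X⟧) (u : GSp R⸨X⸩) (a : ℕ) (d e : Rˣ),
    QuotientGroup.mk (PSp.mk M) = y ∧
    (M.1 : Matrix (Fin 6) (Fin 6) ℂ⸨X⸩)ᵀ * gram ℂ⸨X⸩ * M.1 = (ν : ℂ⸨X⸩) • gram ℂ⸨X⸩ ∧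
    u ∈ unip R⸨X⸩ ∧
    s = PSp.mk (levi R⸨X⸩ (Matrix.GeneralLinearGroup.map (HahnSeries.ofPowerSeries ℤ R) A) * u) ∧
    IsRelDet
      (levi R⸨X⸩ (Matrix.GeneralLinearGroup.map (HahnSeries.ofPowerSeries ℤ R) A) * u).1.1
      ((GSp.map (laurentMap (algebraMap ℂ R)) M).1.1) (balanced R a) d ∧
    IsRelDet (Matrix.of fun _ _ : Fin 1 => HahnSeries.ofPowerSeries ℤ R A.1.det)
      (Matrix.of fun _ _ : Fin 1 => laurentMap (algebraMap ℂ R) ν) 1 e ∧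
    w = d ^ (-4 : ℤ) * e ^ (6 : ℤ)

/-! ### Equivariant twisted D-modules -/

/-- The reduced quotient of a ring. -/
abbrev Red (R : Type) [CommRing R] : Type := R ⧸ nilradical R

/-- Functoriality of the reduced quotient. -/
def Red.map {R R' : Type} [CommRing R] [Algebra ℂ R] [CommRing R'] [Algebra ℂ R']
    (f : R →ₐ[ℂ] R') : Red R →ₐ[ℂ] Red R' :=
  Ideal.quotientMapₐ (nilradical R') f fun _ hx => IsNilpotent.map hx f

/-- A functor of points `S ↦ Pt S` on commutative `ℂ`-algebras acted upon by the group
`PGL(2, S[[t]]) ⋉ U(S((t))) × Sˣ`. Points are given by representatives, and `Rel k m x x'` says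
that `(k, m) · x` and `x'` represent the same point. -/
structure Space where
  Pt : (S : Type) → [CommRing S] → [Algebra ℂ S] → Type
  map : {S S' : Type} → [CommRing S] → [Algebra ℂ S] → [CommRing S'] → [Algebra ℂ S'] →
    (S →ₐ[ℂ] S') → Pt S → Pt S'
  Rel : {S : Type} → [CommRing S] → [Algebra ℂ S] → H S → Sˣ → Pt S → Pt S → Prop

/-- The orbit of `y`: the element `h` of the group represents the point `h y`. -/
def orbitSpace (y : Gr ℂ) : Space where
  Pt S _ _ := H S
  map f := H.map f.toRingHom
  Rel {S} _ _ k m h h' := m = 1 ∧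
    ((k * h : H S) : PSp S⸨X⸩) • Gr.map (algebraMap ℂ S) y =
      (h' : PSp S⸨X⸩) • Gr.map (algebraMap ℂ S) y

/-- The total space (without the zero section) of the restriction of the determinant line bundle
`𝒫` to the orbit of `y`. As `𝒫` is an equivariant line bundle, a nonzero vector of its fiber at
`h y` is `r · h ξ`, where `ξ` is a fixed generator of the fiber at `y`; it is represented by
the pair `(h, r)`. One has `r · (h s) ξ = r w · h ξ` when `s` stabilizes `y` and acts on the fiber
of `𝒫` at `y` by `w`. The second factor of the group acts by scaling. -/
def detSpace (y : Gr ℂ) : Space where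
  Pt S _ _ := H S × Sˣ
  map f x := (H.map f.toRingHom x.1, Units.map f.toRingHom.toMonoidHom x.2)
  Rel {S} _ _ k m x x' := ∃ (s : H S) (w : Sˣ),
    (s : PSp S⸨X⸩) • Gr.map (algebraMap ℂ S) y = Gr.map (algebraMap ℂ S) y ∧
    IsFibreWeight y (s : PSp S⸨X⸩) w ∧ k * x.1 = x'.1 * s ∧ m * x.2 * w = x'.2

/-- The exponential of a nilpotent element. -/
def nilExp {R : Type*} [CommRing R] [Algebra ℂ R] (n : R) : R :=
  ∑ k ∈ Finset.range (nilpotencyClass n), ((k.factorial : ℂ)⁻¹) • n ^ k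

/-- The power `(1 + n) ^ κ` for a nilpotent element `n`, given by the binomial series. -/
def onePlusPow {R : Type*} [CommRing R] [Algebra ℂ R] (κ : ℂ) (n : R) : R :=
  ∑ k ∈ Finset.range (nilpotencyClass n),
    ((∏ i ∈ Finset.range k, (κ - i)) / (k.factorial : ℂ)) • n ^ k

/-- A D-module on the functor `𝒳`, that is a crystal: a quasi-coherent sheaf on the de Rham functor
`R ↦ 𝒳(R_red)`, together with an equivariant structure with respect to the group
`PGL(2, S[[t]]) ⋉ U(S((t))) × Sˣ` and the character D-module `χ^*(exp) ⊠ m^κ`.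

The D-modules `exp` on the additive group and `m^κ` on the multiplicative group are regarded as
multiplicative crystals of lines: over a point `c̄` of `R_red` (resp. `m̄` of `R_redˣ`), the
line has a generator for any lift `c` of `c̄` (resp. `m` of `m̄`) to `R` (resp. `Rˣ`), and for `n`
nilpotent the generator corresponding to `c + n` (resp. `m (1 + n)`) is `exp n` (resp.
`(1 + n) ^ κ`) times the one corresponding to `c` (resp. `m`). So an equivariant structure is a
compatible system of maps `act` depending on such lifts. -/
structure EquivariantDModule (𝒳 : Space) (κ : ℂ) where
  /-- the `R`-module attached to a point of `𝒳(R_red)` -/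
  fib : (R : Type) → [CommRing R] → [Algebra ℂ R] → 𝒳.Pt (Red R) → ModuleCat.{0} R
  /-- base change maps -/
  bc : {R R' : Type} → [CommRing R] → [Algebra ℂ R] → [CommRing R'] → [Algebra ℂ R'] →
    (f : R →ₐ[ℂ] R') → (x : 𝒳.Pt (Red R)) → (x' : 𝒳.Pt (Red R')) →
    𝒳.map (Red.map f) x = x' → (fib R x →ₛₗ[f.toRingHom] fib R' x')
  /-- `fib R' x'` is the base change of `fib R x` along `f` -/
  bc_universal : ∀ {R R' : Type} [CommRing R] [Algebra ℂ R] [CommRing R'] [Algebra ℂ R']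
    (f : R →ₐ[ℂ] R') (x : 𝒳.Pt (Red R)) (x' : 𝒳.Pt (Red R')) (h : 𝒳.map (Red.map f) x = x')
    (N : ModuleCat.{0} R') (φ : fib R x →ₛₗ[f.toRingHom] N),
    ∃! ψ : fib R' x' →ₗ[R'] N, ∀ v, ψ (bc f x x' h v) = φ v
  bc_id : ∀ {R : Type} [CommRing R] [Algebra ℂ R] (x : 𝒳.Pt (Red R))
    (h : 𝒳.map (Red.map (AlgHom.id ℂ R)) x = x) (v : fib R x), bc (AlgHom.id ℂ R) x x h v = v
  bc_comp : ∀ {R R' R'' : Type} [CommRing R] [Algebra ℂ R] [CommRing R'] [Algebra ℂ R']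
    [CommRing R''] [Algebra ℂ R''] (f : R →ₐ[ℂ] R') (g : R' →ₐ[ℂ] R'')
    (x : 𝒳.Pt (Red R)) (x' : 𝒳.Pt (Red R')) (x'' : 𝒳.Pt (Red R''))
    (h : 𝒳.map (Red.map f) x = x') (h' : 𝒳.map (Red.map g) x' = x'')
    (h'' : 𝒳.map (Red.map (g.comp f)) x = x'') (v : fib R x),
    bc (g.comp f) x x'' h'' v = bc g x' x'' h' (bc f x x' h v)
  /-- the equivariant structure -/
  act : {R : Type} → [CommRing R] → [Algebra ℂ R] → (k : H (Red R)) → (c : R) → (m : Rˣ) →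
    (x x' : 𝒳.Pt (Red R)) → IsChi (k : PSp (Red R)⸨X⸩) (Ideal.Quotient.mk (nilradical R) c) →
    𝒳.Rel k (Units.map (Ideal.Quotient.mk (nilradical R)).toMonoidHom m) x x' →
    (fib R x →ₗ[R] fib R x')
  act_one : ∀ {R : Type} [CommRing R] [Algebra ℂ R] (x : 𝒳.Pt (Red R)) (hχ) (hx)
    (v : fib R x), act 1 0 1 x x hχ hx v = v
  act_mul : ∀ {R : Type} [CommRing R] [Algebra ℂ R] (k k' : H (Red R)) (c c' : R) (m m' : Rˣ)
    (x x' x'' : 𝒳.Pt (Red R)) (hχ) (hx) (hχ') (hx') (hχ'') (hx'') (v : fib R x),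
    act (k' * k) (c' + c) (m' * m) x x'' hχ'' hx'' v =
      act k' c' m' x' x'' hχ' hx' (act k c m x x' hχ hx v)
  act_lift : ∀ {R : Type} [CommRing R] [Algebra ℂ R] (k : H (Red R)) (c n : R) (m m' : Rˣ) (n' : R)
    (x x' : 𝒳.Pt (Red R)) (hχ) (hx) (hχ') (hx') (v : fib R x),
    IsNilpotent n → IsNilpotent n' → (m' : R) = m * (1 + n') →
    act k (c + n) m' x x' hχ' hx' v = (nilExp n * onePlusPow κ n') • act k c m x x' hχ hx v
  act_bc : ∀ {R R' : Type} [CommRing R] [Algebra ℂ R] [CommRing R'] [Algebra ℂ R']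
    (f : R →ₐ[ℂ] R') (k : H (Red R)) (c : R) (m : Rˣ) (x₁ x₂ : 𝒳.Pt (Red R))
    (x₁' x₂' : 𝒳.Pt (Red R')) (h₁ : 𝒳.map (Red.map f) x₁ = x₁')
    (h₂ : 𝒳.map (Red.map f) x₂ = x₂') (hχ) (hx) (hχ') (hx') (v : fib R x₁),
    act (H.map (Red.map f).toRingHom k) (f c) (Units.map f.toRingHom.toMonoidHom m)
      x₁' x₂' hχ' hx' (bc f x₁ x₁' h₁ v) = bc f x₂ x₂' h₂ (act k c m x₁ x₂ hχ hx v)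

/-- The D-module is nonzero. -/
def EquivariantDModule.Nonzero {𝒳 : Space} {κ : ℂ} (F : EquivariantDModule 𝒳 κ) : Prop :=
  ∃ (R : Type) (_ : CommRing R) (_ : Algebra ℂ R) (x : 𝒳.Pt (Red R)), Nontrivial (F.fib R x)

/-- The closure of the orbit of `y` supports a `χ`-equivariant D-module: there is a nonzero
`χ`-equivariant D-module on the orbit. (On the orbit, the second factor of the group is absent:
it only enters through `m = 1`, and `κ = 0`.) -/
def SupportsChi (y : Gr ℂ) : Prop :=
  ∃ F : EquivariantDModule (orbitSpace y) 0, F.Nonzero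

/-- The closure of the orbit of `y` supports a `χ`-equivariant `κ`-twisted D-module: there is
a nonzero `χ`-equivariant `𝒫^κ`-twisted D-module on the orbit, that is a `χ`-equivariant
D-module on the total space of `𝒫` without the zero section, restricted to the orbit, which is
monodromic with monodromy `m^κ` along the fibers. -/
def SupportsChiTwisted (κ : ℂ) (y : Gr ℂ) : Prop :=
  ∃ F : EquivariantDModule (detSpace y) κ, F.Nonzero

/-! ### The representatives of the orbits -/

/-- `tⁿ` as an invertible element of `ℂ((t))`. -/
def tpow (n : ℤ) : ℂ⸨X⸩ˣ where
  val := HahnSeries.single n 1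
  inv := HahnSeries.single (-n) 1
  val_inv := by simp
  inv_val := by simp

/-- An invertible diagonal matrix. -/
def diagUnit {n : Type*} [Fintype n] [DecidableEq n] {B : Type*} [CommRing B] (d : n → Bˣ) :
    GL n B where
  val := Matrix.diagonal fun i => (d i : B)
  inv := Matrix.diagonal fun i => ((d i)⁻¹ : Bˣ)
  val_inv := by simp [Matrix.diagonal_mul_diagonal]
  inv_val := by simp [Matrix.diagonal_mul_diagonal]

/-- `diag(tᵃ, tᵇ, tᶜ, 1, t^{c-b}, t^{c-a}) ∈ GSp(6, ℂ((t)))`. -/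
def torus (a b c : ℤ) : GSp ℂ⸨X⸩ :=
  ⟨diagUnit ![tpow a, tpow b, tpow c, tpow 0, tpow (c - b), tpow (c - a)], tpow c, by
    have hs : ∀ x : ℤ, (HahnSeries.single x 1 : ℂ⸨X⸩) * HahnSeries.single (c - x) 1 =
        HahnSeries.single c 1 := fun x => by simp
    refine Matrix.ext fun i j => ?_
    fin_cases i <;> fin_cases j <;>
      simp [diagUnit, gram, tpow, Matrix.diagonal_transpose, mul_comm] <;>
      first
        | linear_combination -hs b
        | linear_combination -hs a⟩

/-- The matrix `g = Id + E₃₄ ∈ Sp(6, ℂ) ⊂ GSp(6, ℂ((t)))`. -/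
def gElt : GSp ℂ⸨X⸩ :=
  ⟨⟨1 + Matrix.single 2 3 1, 1 - Matrix.single 2 3 1, by
      have h : (Matrix.single (2 : Fin 6) (3 : Fin 6) (1 : ℂ⸨X⸩)) * Matrix.single 2 3 1 = 0 := by
        simp
      noncomm_ring
      simp, by
      have h : (Matrix.single (2 : Fin 6) (3 : Fin 6) (1 : ℂ⸨X⸩)) * Matrix.single 2 3 1 = 0 := by
        simp
      noncomm_ring
      simp⟩, 1, by
    ext i j
    fin_cases i <;> fin_cases j <;>
      simp [gram, Matrix.mul_apply, Fin.sum_univ_succ, Matrix.single_apply, Matrix.one_apply]⟩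

/-- `(λ₁, λ₂, λ₃)` is a dominant coweight of `L` and `λ₄ ∈ ½ℕ`
(the indices of `Fin 4` start with `0`). -/
def LDominant (l : Fin 4 → ℚ) : Prop :=
  (∀ i, ∃ n : ℤ, 2 * l i = n) ∧ (∃ n : ℤ, l 1 - l 2 = n) ∧ (∃ n : ℕ, l 0 - l 1 = n) ∧
    0 ≤ l 2 ∧ 0 ≤ l 3

/-- `(λ₁, λ₂, λ₃)` is a dominant coweight of `PSp(6)` and `λ₄ ∈ ½ℕ`. -/
def Dominant (l : Fin 4 → ℚ) : Prop :=
  (∀ i, ∃ n : ℕ, 2 * l i = n) ∧ (∃ n : ℕ, l 0 - l 1 = n) ∧ (∃ n : ℕ, l 1 - l 2 = n)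

/-- If `λ₄ = 0` then `λ₁ = λ₂ + λ₃`, and if `λ₄ > 0` then `λ₁ > λ₂ ≥ λ₃ > 0`. -/
def OddDominant (l : Fin 4 → ℚ) : Prop :=
  (l 3 = 0 → l 0 = l 1 + l 2) ∧ (0 < l 3 → l 1 < l 0 ∧ l 2 ≤ l 1 ∧ 0 < l 2)

/-- The point `t^{λ₄} g t^{(λ₁, λ₂, λ₃)}` of `Gr(ℂ)`. Modulo scalars, `t^{λ₄} ∈ PGL(2, ℂ((t)))` is
`diag(t^{2λ₄}, 1)`, and `t^{(λ₁, λ₂, λ₃)}` is `t^{λ₃} diag(t^{λ₁}, t^{λ₂}, t^{λ₃}, t^{-λ₃}, t^{-λ₂},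
t^{-λ₁})`. The numbers `2λ₄, λ₁ + λ₃, λ₂ + λ₃, 2λ₃` are integers for the coweights in question, so
that the integral parts are these numbers themselves. -/
def pt (l : Fin 4 → ℚ) : Gr ℂ :=
  QuotientGroup.mk (PSp.mk (levi ℂ⸨X⸩ (diagUnit ![tpow ⌊2 * l 3⌋, 1]) * gElt *
    torus ⌊l 0 + l 2⌋ ⌊l 1 + l 2⌋ ⌊2 * l 2⌋))

/-- The points `pt l`, `l ∈ Λ`, form a full set of representatives of the
`PGL(2, ℂ[[t]]) ⋉ U(ℂ((t)))`-orbits in `Gr(ℂ)` with property `P` (a property of the orbit of its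
argument), different `l` giving different orbits. -/
def IsFullSetOfRepresentatives (Λ : Set (Fin 4 → ℚ)) (P : Gr ℂ → Prop) : Prop :=
  (∀ l ∈ Λ, P (pt l)) ∧ ∀ y, P y → ∃! l, l ∈ Λ ∧ ∃ h ∈ H ℂ, h • pt l = y

end

end Gaiotto

open Matrix
open scoped LaurentSeries PowerSeries

namespace Gaiotto

noncomputable section

/-! ### Orders of Laurent series -/

section LaurentOrder

variable {R S : Type*} [CommRing R] [CommRing S]

/-! Orbits. By the Iwasawa decomposition (`exists_blockUpper_mul_ofInt`, `exists_unip_mul_leviPair`)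
every point of `Gr` is a `U(F)`-translate of a point of the Levi subgroup, that is, of a pair `(X,
Y)` in `GL(2, F)` giving the first two diagonal blocks. The orbits are thus the classes of such
pairs under a common left factor in `GL(2, O)`, separate right factors in `GL(2, O)` and a common
scalar. Elementary divisors of `X` and a Hermite form of `Y` lead to `X = diag(t^(n+a), t^b)` and
`Y` with rows `(t^(n+r), t^n)` and `(0, 1)`, where `n, r ≥ 0` and `b ≤ a`
(`exists_coordinates_pair`). In terms of the coweight, `n = 2λ₄`, `r = 2λ₃`, `a = λ₁ + λ₃`, `b = λ₂
+ λ₃`. The four integers are recovered from the least orders of the entries of `X`, `Y` and `X⁻¹ Y`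
and from the orders of `det X` and `det Y` (`coordinates_unique`).

D-modules on an orbit. Existence is decided by the stabilizer of a point. If the character and the
weight on the line bundle are trivial there, they descend to functions `(c, μ)`, and `c^*(exp) ⊗
μ^κ` is a nonzero equivariant D-module (`functionDModule`). For the converse
(`EquivariantDModule.not_nonzero`), let a family over `ℂ[T, T⁻¹]` stabilize the base point, with
lifts `c` and `m` of its parameters. The homomorphisms `p ↦ p` and `p ↦ p + ε T p'` to the dual
numbers agree modulo nilpotents, so the crystal identifies the pullbacks along them, and every
matrix coefficient `p` of the action on the constant fibre satisfies `T p' = (T c' + κ T m' / m) p`.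
If this equation has no nonzero Laurent polynomial solution, an invertible operator has zero matrix
coefficients, and the D-module vanishes. Two equations occur: that of `exp T` (with `c = T`, `m =
1`), and that of `T^(-κ e)` (with `c = 0`, `m = T^(-e)`, `e ≠ 0`), excluded because `κ` is
irrational.

The character. If `A u` stabilizes the point of `(X, Y)`, comparison of blocks shows that the block
`(0, 1)` of `u` is `X E Y⁻¹` with `E` integral (`blocks_of_mk_eq`), so the character is the residue
of `tr(Y⁻¹ X E)`. For the representatives `Y⁻¹ X` is integral when `r ≤ b`, which is dominance. If
`b < r`, a shear yields a family of stabilizing elements with arbitrary character (`shearH`).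

The line bundle. In coordinates adapted to the lattice, an element of the stabilizer with triangular
constant terms and diagonal `(α, β, α, β, α, β)` has weight `(α / β)^(4 (l₀ - l₁) + 2 (l₂ - l₃))`,
where `l` lists the exponents of `X` and `Y`. Determinants on quotients of lattices are computed by
ordering monomial bases so that the matrix is triangular (`isDetOn_of_triangular`). If `n = 0`, both
blocks are diagonal up to one common integral left factor with `l = (a, b, 0, r)`, and the torus
acts trivially exactly when `2 (a - b) = r`. If `n > 0` and `r = 0` or `a = b`, they are again
simultaneously diagonal and the torus weight is nonzero (`exists_eq_leviPair_mul_diagPair`). If `n >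
0`, `b < a` and `r > 0`, stability of both blocks forces the constant term of `A` to be triangular
with equal diagonal entries, so all weights are trivial (`weight_eq_one`). -/

/-- The Laurent series `x` lies in `t^s R[[t]]`. -/
def OrdGe (s : ℤ) (x : R⸨X⸩) : Prop := ∀ n < s, x.coeff n = 0

lemma coeff_single_one_mul (s n : ℤ) (x : R⸨X⸩) :
    ((HahnSeries.single s (1 : R)) * x).coeff n = x.coeff (n - s) := by
  have := HahnSeries.coeff_single_mul_add (r := (1 : R)) (x := x) (a := n - s) (b := s)
  simpa using this

lemma ordGe_ofPowerSeries (p : R⟦X⟧) : OrdGe 0 (HahnSeries.ofPowerSeries ℤ R p) :=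
  fun _ hn => coeff_ofPowerSeries_neg p hn

lemma ordGe_iff {s : ℤ} {x : R⸨X⸩} :
    OrdGe s x ↔ ∃ p, x = HahnSeries.single s (1 : R) * HahnSeries.ofPowerSeries ℤ R p := by
  constructor
  · intro h
    refine ⟨PowerSeries.mk fun n => x.coeff (s + n), ?_⟩
    ext n
    rw [coeff_single_one_mul]
    rcases lt_or_ge n s with hn | hn
    · rw [h n hn, coeff_ofPowerSeries_neg _ (by omega)]
    · obtain ⟨k, hk⟩ := Int.eq_ofNat_of_zero_le (sub_nonneg.2 hn)
      rw [hk, HahnSeries.ofPowerSeries_apply_coeff, PowerSeries.coeff_mk]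
      congr 1
      omega
  · rintro ⟨p, rfl⟩ n hn
    rw [coeff_single_one_mul, coeff_ofPowerSeries_neg _ (by omega)]

lemma ordGe_zero_iff {x : R⸨X⸩} : OrdGe 0 x ↔ ∃ p, x = HahnSeries.ofPowerSeries ℤ R p := by
  rw [ordGe_iff]
  exact exists_congr fun p => by simp

lemma OrdGe.mono {s s' : ℤ} {x : R⸨X⸩} (h : OrdGe s x) (hs : s' ≤ s) : OrdGe s' x :=
  fun n hn => h n (lt_of_lt_of_le hn hs)

lemma OrdGe.zero (s : ℤ) : OrdGe s (0 : R⸨X⸩) := fun _ _ => rfl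

lemma OrdGe.add {s : ℤ} {x y : R⸨X⸩} (hx : OrdGe s x) (hy : OrdGe s y) : OrdGe s (x + y) :=
  fun n hn => by rw [HahnSeries.coeff_add, hx n hn, hy n hn, add_zero]

lemma OrdGe.neg {s : ℤ} {x : R⸨X⸩} (hx : OrdGe s x) : OrdGe s (-x) :=
  fun n hn => by rw [HahnSeries.coeff_neg, hx n hn, neg_zero]

lemma OrdGe.sub {s : ℤ} {x y : R⸨X⸩} (hx : OrdGe s x) (hy : OrdGe s y) : OrdGe s (x - y) := by
  rw [sub_eq_add_neg]
  exact hx.add hy.neg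

lemma OrdGe.mul {s s' : ℤ} {x y : R⸨X⸩} (hx : OrdGe s x) (hy : OrdGe s' y) :
    OrdGe (s + s') (x * y) := by
  obtain ⟨p, rfl⟩ := ordGe_iff.1 hx
  obtain ⟨q, rfl⟩ := ordGe_iff.1 hy
  refine ordGe_iff.2 ⟨p * q, ?_⟩
  rw [mul_mul_mul_comm, HahnSeries.single_mul_single, mul_one, map_mul]

lemma OrdGe.sum {α : Type*} {s : ℤ} {t : Finset α} {f : α → R⸨X⸩}
    (h : ∀ i ∈ t, OrdGe s (f i)) : OrdGe s (∑ i ∈ t, f i) := by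
  classical
  induction t using Finset.induction_on with
  | empty => exact OrdGe.zero s
  | insert a t ha ih =>
    rw [Finset.sum_insert ha]
    exact (h a (Finset.mem_insert_self a t)).add
      (ih fun i hi => h i (Finset.mem_insert_of_mem hi))

lemma ordGe_single {s m : ℤ} (h : s ≤ m) (r : R) : OrdGe s (HahnSeries.single m r) :=
  fun n hn => HahnSeries.coeff_single_of_ne (by omega)

lemma le_of_ordGe_single [Nontrivial R] {s m : ℤ}
    (h : OrdGe s (HahnSeries.single m (1 : R))) : s ≤ m := by
  by_contra hc
  have := h m (by omega)
  rw [HahnSeries.coeff_single_same] at this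
  exact one_ne_zero this

lemma ordGe_one : OrdGe 0 (1 : R⸨X⸩) := ordGe_single le_rfl 1

lemma le_of_ordGe_one [Nontrivial R] {s : ℤ} (h : OrdGe s (1 : R⸨X⸩)) : s ≤ 0 :=
  le_of_ordGe_single h

lemma OrdGe.map (f : R →+* S) {s : ℤ} {x : R⸨X⸩} (h : OrdGe s x) : OrdGe s (laurentMap f x) :=
  fun n hn => by
    change f (x.coeff n) = 0
    rw [h n hn, map_zero]

lemma laurentMap_single (f : R →+* S) (n : ℤ) (r : R) :
    laurentMap f (HahnSeries.single n r) = HahnSeries.single n (f r) := by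
  ext m
  change f _ = _
  rw [HahnSeries.coeff_single, HahnSeries.coeff_single]
  split_ifs <;> simp

/-- A unit of the field of Laurent series has a valuation. -/
lemma exists_ordGe_units {K : Type*} [Field K] (c : K⸨X⸩ˣ) :
    ∃ γ : ℤ, OrdGe γ (c : K⸨X⸩) ∧ OrdGe (-γ) ((c⁻¹ : K⸨X⸩ˣ) : K⸨X⸩) := by
  have key : ∀ x : K⸨X⸩, OrdGe x.order x := fun x n hn => HahnSeries.coeff_eq_zero_of_lt_order hn
  refine ⟨(c : K⸨X⸩).order, key _, ?_⟩
  have h := HahnSeries.order_mul (x := (c : K⸨X⸩)) (y := ((c⁻¹ : K⸨X⸩ˣ) : K⸨X⸩)) c.ne_zero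
    (Units.ne_zero _)
  rw [Units.mul_inv, HahnSeries.order_one] at h
  exact (key _).mono (by omega)

end LaurentOrder

/-! ### Block matrices -/

section Blocks

variable {B : Type*} [CommRing B]

/-- `M` maps the `b`-th block into the sum of the blocks with index at most `b - k`. -/
def BlockUpper (k : ℕ) (M : Matrix (Fin 6) (Fin 6) B) : Prop :=
  ∀ i j : Fin 6, j.val / 2 < i.val / 2 + k → M i j = 0

lemma BlockUpper.mul {k k' : ℕ} {M N : Matrix (Fin 6) (Fin 6) B} (hM : BlockUpper k M)
    (hN : BlockUpper k' N) : BlockUpper (k + k') (M * N) := by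
  intro i j hij
  rw [Matrix.mul_apply]
  refine Finset.sum_eq_zero fun l _ => ?_
  by_cases h : l.val / 2 < i.val / 2 + k
  · rw [hM i l h, zero_mul]
  · rw [hN l j (by omega), mul_zero]

lemma BlockUpper.mono {k k' : ℕ} {M : Matrix (Fin 6) (Fin 6) B} (hM : BlockUpper k M)
    (h : k' ≤ k) : BlockUpper k' M := fun i j hij => hM i j (by omega)

lemma BlockUpper.add {k : ℕ} {M N : Matrix (Fin 6) (Fin 6) B} (hM : BlockUpper k M)
    (hN : BlockUpper k N) : BlockUpper k (M + N) :=
  fun i j hij => by rw [Matrix.add_apply, hM i j hij, hN i j hij, add_zero]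

lemma BlockUpper.smul {k : ℕ} {M : Matrix (Fin 6) (Fin 6) B} (hM : BlockUpper k M) (c : B) :
    BlockUpper k (c • M) :=
  fun i j hij => by rw [Matrix.smul_apply, hM i j hij, smul_zero]

lemma blockUpper_one : BlockUpper 0 (1 : Matrix (Fin 6) (Fin 6) B) := by
  intro i j hij
  exact Matrix.one_apply_ne (by rintro rfl; omega)

lemma BlockUpper.map {C : Type*} [CommRing C] (f : B →+* C) {k : ℕ}
    {M : Matrix (Fin 6) (Fin 6) B} (hM : BlockUpper k M) : BlockUpper k (M.map f) :=
  fun i j hij => by rw [Matrix.map_apply, hM i j hij, map_zero]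

lemma mem_unip_iff {u : GSp B} : u ∈ unip B ↔ BlockUpper 1 (u.1.1 - 1) := by
  refine forall₂_congr fun i j => ?_
  rw [Matrix.sub_apply, sub_eq_zero, Nat.lt_succ_iff]

lemma blockUpper_of_mem_unip {u : GSp B} (hu : u ∈ unip B) : BlockUpper 0 u.1.1 := by
  have h := ((mem_unip_iff.1 hu).mono (Nat.zero_le 1)).add blockUpper_one
  rwa [sub_add_cancel] at h

/-- The `p`-th index of the `b`-th block. -/
def bidx (b : Fin 3) (p : Fin 2) : Fin 6 := ⟨2 * b.val + p.val, by omega⟩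

/-- The block of a matrix with the given indices. -/
def block (M : Matrix (Fin 6) (Fin 6) B) (b b' : Fin 3) : Matrix (Fin 2) (Fin 2) B :=
  M.submatrix (bidx b) (bidx b')

lemma block_mul (M N : Matrix (Fin 6) (Fin 6) B) (b b' : Fin 3) :
    block (M * N) b b' = ∑ c, block M b c * block N c b' := by
  ext p q
  simp only [block, Matrix.submatrix_apply, Matrix.mul_apply, Fin.sum_univ_succ,
    Matrix.add_apply, Fin.sum_univ_zero]
  simp only [bidx]
  simp
  ring_nf

lemma block_smul (c : B) (M : Matrix (Fin 6) (Fin 6) B) (b b' : Fin 3) :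
    block (c • M) b b' = c • block M b b' := rfl

lemma block_one_self (b : Fin 3) : block (1 : Matrix (Fin 6) (Fin 6) B) b b = 1 := by
  ext p q
  fin_cases b <;> fin_cases p <;> fin_cases q <;> rfl

lemma BlockUpper.block_eq_zero {k : ℕ} {M : Matrix (Fin 6) (Fin 6) B} (hM : BlockUpper k M)
    {b b' : Fin 3} (h : b'.val < b.val + k) : block M b b' = 0 := by
  ext p q
  refine hM _ _ ?_
  simp only [bidx]
  omega

lemma blockUpper_of_block {k : ℕ} {M : Matrix (Fin 6) (Fin 6) B}
    (h : ∀ b b' : Fin 3, b'.val < b.val + k → block M b b' = 0) : BlockUpper k M := by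
  intro i j hij
  have := congrFun (congrFun (h ⟨i.val / 2, by omega⟩ ⟨j.val / 2, by omega⟩ hij)
    ⟨i.val % 2, by omega⟩) ⟨j.val % 2, by omega⟩
  simp only [block, bidx, Matrix.submatrix_apply, Nat.div_add_mod, Matrix.zero_apply] at this
  exact this

lemma ext_block {A : Type*} {M N : Matrix (Fin 6) (Fin 6) A} (h : ∀ b b', block M b b' = block N b b') :
    M = N := by
  ext i j
  have := congrFun (congrFun (h ⟨i.val / 2, by omega⟩ ⟨j.val / 2, by omega⟩)
    ⟨i.val % 2, by omega⟩) ⟨j.val % 2, by omega⟩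
  simp only [block, bidx, Matrix.submatrix_apply, Nat.div_add_mod] at this
  exact this

lemma BlockUpper.block_mul_self {M N : Matrix (Fin 6) (Fin 6) B} (hM : BlockUpper 0 M)
    (hN : BlockUpper 0 N) (b : Fin 3) : block (M * N) b b = block M b b * block N b b := by
  rw [block_mul, Finset.sum_eq_single b]
  · intro c _ hc
    rcases lt_or_gt_of_ne hc with h | h
    · rw [hM.block_eq_zero (by simpa using h), zero_mul]
    · rw [hN.block_eq_zero (by simpa using h), mul_zero]
  · simp

/-- Since `N` has no entries below the block diagonal, only two of the three summands survive. The
block `(0, 1)` is the one on which the character depends. -/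
lemma BlockUpper.block_mul_zero_one {M N : Matrix (Fin 6) (Fin 6) B}
    (hN : BlockUpper 0 N) : block (M * N) 0 1 =
      block M 0 0 * block N 0 1 + block M 0 1 * block N 1 1 := by
  rw [block_mul, Fin.sum_univ_three, hN.block_eq_zero (b := 2) (b' := 1) (by decide), mul_zero,
    add_zero]

/-- The block diagonal matrix with the given blocks. -/
def blockDiag (P Q W : Matrix (Fin 2) (Fin 2) B) : Matrix (Fin 6) (Fin 6) B :=
  !![P 0 0, P 0 1, 0, 0, 0, 0;
     P 1 0, P 1 1, 0, 0, 0, 0;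
     0, 0, Q 0 0, Q 0 1, 0, 0;
     0, 0, Q 1 0, Q 1 1, 0, 0;
     0, 0, 0, 0, W 0 0, W 0 1;
     0, 0, 0, 0, W 1 0, W 1 1]

lemma block_blockDiag_self (P Q W : Matrix (Fin 2) (Fin 2) B) (b : Fin 3) :
    block (blockDiag P Q W) b b = ![P, Q, W] b := by
  ext p q
  fin_cases b <;> fin_cases p <;> fin_cases q <;> rfl

lemma block_blockDiag_of_ne (P Q W : Matrix (Fin 2) (Fin 2) B) {b b' : Fin 3} (h : b ≠ b') :
    block (blockDiag P Q W) b b' = 0 := by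
  ext p q
  fin_cases b <;> fin_cases b' <;> first | exact absurd rfl h | skip
  all_goals fin_cases p <;> fin_cases q <;> rfl

lemma blockUpper_blockDiag (P Q W : Matrix (Fin 2) (Fin 2) B) :
    BlockUpper 0 (blockDiag P Q W) :=
  blockUpper_of_block fun b b' h => block_blockDiag_of_ne P Q W (by rintro rfl; omega)

/-- Multiplicativity of `blockDiag`. -/
def blockDiagHom (B : Type*) [CommRing B] : Matrix (Fin 2) (Fin 2) B × Matrix (Fin 2) (Fin 2) B ×
    Matrix (Fin 2) (Fin 2) B →* Matrix (Fin 6) (Fin 6) B where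
  toFun x := blockDiag x.1 x.2.1 x.2.2
  map_one' := by
    ext i j
    fin_cases i <;> fin_cases j <;> simp [blockDiag]
  map_mul' x y := by
    refine ext_block fun b b' => ?_
    by_cases h : b = b'
    · subst h
      rw [(blockUpper_blockDiag _ _ _).block_mul_self (blockUpper_blockDiag _ _ _),
        block_blockDiag_self, block_blockDiag_self, block_blockDiag_self]
      fin_cases b <;> rfl
    · rw [block_blockDiag_of_ne _ _ _ h, block_mul, Finset.sum_eq_zero]
      intro c _
      by_cases hc : b = c
      · subst hc
        rw [block_blockDiag_of_ne y.1 _ _ h, mul_zero]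
      · rw [block_blockDiag_of_ne _ _ _ hc, zero_mul]

/-- Change of the signs of the off-diagonal entries. -/
def signTwist (B : Type*) [CommRing B] : Matrix (Fin 2) (Fin 2) B →* Matrix (Fin 2) (Fin 2) B where
  toFun A := !![A 0 0, -A 0 1; -A 1 0, A 1 1]
  map_one' := by
    ext i j
    fin_cases i <;> fin_cases j <;> simp
  map_mul' A C := by
    ext i j
    fin_cases i <;> fin_cases j <;> simp [Matrix.mul_apply, Fin.sum_univ_succ] <;> ring

/-- The third block of an element of the Levi subgroup, in terms of the other two. -/
def levi₃ (B : Type*) [CommRing B] : GL (Fin 2) B × GL (Fin 2) B →* GL (Fin 2) B :=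
  MonoidHom.mk' (fun x => Units.map (Matrix.scalar (Fin 2) : B →+* _).toMonoidHom
      (GeneralLinearGroup.det x.2 * (GeneralLinearGroup.det x.1)⁻¹) *
      Units.map (signTwist B) x.1) (by
    rintro ⟨P, Q⟩ ⟨P', Q'⟩
    have hc : ∀ (z : Bˣ) (A : GL (Fin 2) B),
        Units.map (Matrix.scalar (Fin 2) : B →+* _).toMonoidHom z * A =
          A * Units.map (Matrix.scalar (Fin 2) : B →+* _).toMonoidHom z := by
      intro z A
      ext1
      exact (Matrix.scalar_commute (z : B) (fun r => Commute.all _ _) A.val).eq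
    have hq : GeneralLinearGroup.det (Q * Q') * (GeneralLinearGroup.det (P * P'))⁻¹ =
        GeneralLinearGroup.det Q * (GeneralLinearGroup.det P)⁻¹ *
          (GeneralLinearGroup.det Q' * (GeneralLinearGroup.det P')⁻¹) := by
      rw [map_mul, map_mul, mul_inv, mul_mul_mul_comm]
    simp only [Prod.fst_mul, Prod.snd_mul]
    rw [hq, map_mul, map_mul (Units.map (signTwist B)), mul_assoc, ← mul_assoc _ _
      (Units.map (signTwist B) P'),
      hc (GeneralLinearGroup.det Q' * (GeneralLinearGroup.det P')⁻¹), mul_assoc, mul_assoc])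

lemma levi₃_val (P Q : GL (Fin 2) B) : (levi₃ B (P, Q)).val =
    ((GeneralLinearGroup.det Q * (GeneralLinearGroup.det P)⁻¹ : Bˣ) : B) • signTwist B P.val := by
  rw [Matrix.smul_eq_diagonal_mul]
  rfl

/-- The Levi subgroup of block diagonal matrices in `GSp(6)` is parametrized by the first two
blocks. -/
def leviPair (B : Type*) [CommRing B] : GL (Fin 2) B × GL (Fin 2) B →* GSp B :=
  ((Units.map (blockDiagHom B)).comp ((MulEquiv.prodUnits.symm.toMonoidHom).comp
    ((MonoidHom.fst _ _).prod ((MulEquiv.prodUnits.symm.toMonoidHom).comp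
      ((MonoidHom.snd _ _).prod (levi₃ B)))))).codRestrict (GSp B) (by
    rintro ⟨P, Q⟩
    refine ⟨GeneralLinearGroup.det Q, ?_⟩
    change (blockDiag P.val Q.val (levi₃ B (P, Q)).val)ᵀ * gram B *
      (blockDiag P.val Q.val (levi₃ B (P, Q)).val) = _
    have h : ((GeneralLinearGroup.det P)⁻¹ : Bˣ).val * (P.val 0 0 * P.val 1 1 -
        P.val 0 1 * P.val 1 0) = 1 := by
      rw [← Matrix.det_fin_two, ← GeneralLinearGroup.val_det_apply, Units.inv_mul]
    have hQ : (GeneralLinearGroup.det Q).val = Q.val 0 0 * Q.val 1 1 -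
        Q.val 0 1 * Q.val 1 0 := by
      rw [← Matrix.det_fin_two, ← GeneralLinearGroup.val_det_apply]
    rw [levi₃_val, Units.val_mul]
    -- The determinants enter only through the relations `h` and `hQ`; as free variables they leave
    -- a polynomial identity in each entry.
    generalize ((GeneralLinearGroup.det P)⁻¹ : Bˣ).val = x at *
    generalize (GeneralLinearGroup.det Q).val = y at *
    ext i j
    fin_cases i <;> fin_cases j <;>
      simp [blockDiag, gram, signTwist, Matrix.mul_apply, Fin.sum_univ_succ] <;>
      first
        | ring1
        | linear_combination y * h
        | linear_combination -y * h
        | linear_combination hQ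
        | linear_combination -hQ)

lemma leviPair_val (P Q : GL (Fin 2) B) : (leviPair B (P, Q)).1.1 =
    blockDiag P.val Q.val (((GeneralLinearGroup.det Q * (GeneralLinearGroup.det P)⁻¹ : Bˣ) : B) •
      signTwist B P.val) := by
  rw [← levi₃_val]
  rfl

lemma blockUpper_leviPair (x : GL (Fin 2) B × GL (Fin 2) B) :
    BlockUpper 0 (leviPair B x).1.1 := blockUpper_blockDiag _ _ _

lemma leviPair_self (A : GL (Fin 2) B) : leviPair B (A, A) = levi B A := by
  refine Subtype.ext (Units.ext ?_)
  rw [leviPair_val, mul_inv_cancel, Units.val_one, one_smul]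
  rfl

lemma block_leviPair_zero (x : GL (Fin 2) B × GL (Fin 2) B) :
    block (leviPair B x).1.1 0 0 = x.1.val := block_blockDiag_self _ _ _ 0

lemma block_leviPair_one (x : GL (Fin 2) B × GL (Fin 2) B) :
    block (leviPair B x).1.1 1 1 = x.2.val := block_blockDiag_self _ _ _ 1

lemma GSp.coe_mul (M N : GSp B) : (M * N).1.1 = M.1.1 * N.1.1 := rfl

lemma GSp.mul_inv_val (M : GSp B) : M.1.1 * (M⁻¹).1.1 = 1 := by
  rw [← GSp.coe_mul, mul_inv_cancel]
  rfl

lemma GSp.inv_mul_val (M : GSp B) : (M⁻¹).1.1 * M.1.1 = 1 := by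
  rw [← GSp.coe_mul, inv_mul_cancel]
  rfl

lemma GSp.map_val {C : Type*} [CommRing C] (f : B →+* C) (M : GSp B) :
    (GSp.map f M).1.1 = M.1.1.map f := rfl

/-- Membership means that `u - 1` shifts the blocks by at least one, and block upper triangular
factors on both sides do not reduce the shift. -/
lemma leviPair_conj_mem_unip (x : GL (Fin 2) B × GL (Fin 2) B) {u : GSp B} (hu : u ∈ unip B) :
    leviPair B x * u * (leviPair B x)⁻¹ ∈ unip B := by
  rw [mem_unip_iff] at hu ⊢
  have h : (leviPair B x * u * (leviPair B x)⁻¹).1.1 - 1 =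
      (leviPair B x).1.1 * (u.1.1 - 1) * ((leviPair B x)⁻¹).1.1 := by
    rw [mul_sub, sub_mul, mul_one, GSp.mul_inv_val]
    rfl
  rw [h, ← map_inv]
  exact ((blockUpper_leviPair x).mul hu).mul (blockUpper_leviPair x⁻¹)

lemma block_unip_self {u : GSp B} (hu : u ∈ unip B) (b : Fin 3) : block u.1.1 b b = 1 := by
  rw [← block_one_self b]
  ext p q
  exact hu _ _ (by simp only [bidx]; omega)

end Blocks

/-! ### Points of the affine Grassmannian and the group `H` -/

section Grassmannian

variable {R S : Type*} [CommRing R] [CommRing S]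

/-- The homomorphism `GSp(6, R[[t]]) → GSp(6, R((t)))`. -/
abbrev GSp.ofInt (R : Type*) [CommRing R] : GSp R⟦X⟧ →* GSp R⸨X⸩ :=
  GSp.map (HahnSeries.ofPowerSeries ℤ R)

/-- The homomorphism `GL(2, R[[t]]) → GL(2, R((t)))`. -/
abbrev glInt (R : Type*) [CommRing R] : GL (Fin 2) R⟦X⟧ →* GL (Fin 2) R⸨X⸩ :=
  GeneralLinearGroup.map (HahnSeries.ofPowerSeries ℤ R)

/-- The homomorphism `GSp(6, R((t))) → GSp(6, S((t)))`. -/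
abbrev GSp.laurent (f : R →+* S) : GSp R⸨X⸩ →* GSp S⸨X⸩ := GSp.map (laurentMap f)

/-- The point of the affine Grassmannian given by a matrix. -/
abbrev Gr.mk (M : GSp R⸨X⸩) : Gr R := QuotientGroup.mk (PSp.mk M)

lemma PSp.mk_eq_mk {B : Type*} [CommRing B] {M N : GSp B} :
    PSp.mk M = PSp.mk N ↔ ∃ c : Bˣ, N.1.1 = (c : B) • M.1.1 := by
  rw [PSp.mk, QuotientGroup.mk'_eq_mk']
  constructor
  · rintro ⟨z, ⟨c, hc⟩, rfl⟩
    refine ⟨c, ?_⟩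
    have hc' : (z : GSp B).1.1 = Matrix.scalar (Fin 6) (c : B) := congrArg Units.val hc.symm
    rw [GSp.coe_mul, hc', Matrix.scalar_apply, ← Matrix.smul_one_eq_diagonal, Matrix.mul_smul,
      Matrix.mul_one]
  · rintro ⟨c, hc⟩
    refine ⟨M⁻¹ * N, ⟨c, Units.ext ?_⟩, by group⟩
    change Matrix.scalar (Fin 6) (c : B) = (M⁻¹).1.1 * N.1.1
    rw [hc, Matrix.mul_smul, GSp.inv_mul_val, Matrix.scalar_apply, Matrix.smul_one_eq_diagonal]

/-- The two quotients leave exactly two ambiguities, a scalar and an integral factor on the right.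
Recording them turns equalities of points into matrix equations whose blocks can be compared. -/
lemma Gr.mk_eq_mk {M N : GSp R⸨X⸩} : Gr.mk M = Gr.mk N ↔
    ∃ (c : R⸨X⸩ˣ) (k : GSp R⟦X⟧), N.1.1 = (c : R⸨X⸩) • (M.1.1 * (GSp.ofInt R k).1.1) := by
  rw [QuotientGroup.eq]
  constructor
  · rintro ⟨x, hx⟩
    obtain ⟨k, rfl⟩ := QuotientGroup.mk_surjective x
    have h : PSp.mk (GSp.ofInt R k) = PSp.mk (M⁻¹ * N) := hx
    obtain ⟨c, hc⟩ := PSp.mk_eq_mk.1 h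
    refine ⟨c, k, ?_⟩
    rw [GSp.coe_mul] at hc
    rw [← Matrix.mul_smul, ← hc, ← Matrix.mul_assoc, GSp.mul_inv_val, Matrix.one_mul]
  · rintro ⟨c, k, h⟩
    refine ⟨QuotientGroup.mk k, ?_⟩
    change PSp.mk (GSp.ofInt R k) = PSp.mk (M⁻¹ * N)
    refine PSp.mk_eq_mk.2 ⟨c, ?_⟩
    rw [GSp.coe_mul, h, Matrix.mul_smul, ← Matrix.mul_assoc, GSp.inv_mul_val, Matrix.one_mul]

lemma Gr.smul_mk (h M : GSp R⸨X⸩) : PSp.mk h • Gr.mk M = Gr.mk (h * M) := rfl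

lemma Gr.map_mk (f : R →+* S) (M : GSp R⸨X⸩) :
    Gr.map f (Gr.mk M) = Gr.mk (GSp.laurent f M) := rfl

lemma Gr.map_smul (f : R →+* S) (h : PSp R⸨X⸩) (y : Gr R) :
    Gr.map f (h • y) = PSp.map (laurentMap f) h • Gr.map f y := by
  obtain ⟨h, rfl⟩ := QuotientGroup.mk_surjective h
  obtain ⟨y, rfl⟩ := QuotientGroup.mk_surjective y
  obtain ⟨y, rfl⟩ := QuotientGroup.mk_surjective y
  change Gr.mk (GSp.laurent f (h * y)) = Gr.mk (GSp.laurent f h * GSp.laurent f y)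
  rw [map_mul]

lemma exists_gr_mk (y : Gr R) : ∃ M, Gr.mk M = y := by
  obtain ⟨y, rfl⟩ := QuotientGroup.mk_surjective y
  obtain ⟨M, rfl⟩ := QuotientGroup.mk_surjective y
  exact ⟨M, rfl⟩

/-- The element `A u` of `GSp(6, R((t)))`. -/
abbrev leviUnip (A : GL (Fin 2) R⟦X⟧) (u : GSp R⸨X⸩) : GSp R⸨X⸩ := levi R⸨X⸩ (glInt R A) * u

lemma levi_conj_mem_unip {B : Type*} [CommRing B] (A : GL (Fin 2) B) {u : GSp B}
    (hu : u ∈ unip B) : levi B A * u * (levi B A)⁻¹ ∈ unip B := by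
  rw [← leviPair_self]
  exact leviPair_conj_mem_unip _ hu

lemma leviUnip_mul (A A' : GL (Fin 2) R⟦X⟧) (u u' : GSp R⸨X⸩) :
    leviUnip A u * leviUnip A' u' = leviUnip (A * A')
      (levi R⸨X⸩ (glInt R A'⁻¹) * u * (levi R⸨X⸩ (glInt R A'⁻¹))⁻¹ * u') := by
  simp only [leviUnip, map_mul, map_inv]
  group

/-- The Levi factor normalizes the unipotent radical, so the products `A u` already form a subgroup,
and it contains both generating subgroups of `H`. -/
lemma mem_H_iff {h : PSp R⸨X⸩} :
    h ∈ H R ↔ ∃ A u, u ∈ unip R⸨X⸩ ∧ h = PSp.mk (leviUnip A u) := by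
  constructor
  · intro hh
    refine Subgroup.closure_induction (G := PSp R⸨X⸩)
      (p := fun x _ => ∃ A u, u ∈ unip R⸨X⸩ ∧ x = PSp.mk (leviUnip A u))
      ?_ ?_ ?_ ?_ (k := ((PSp.mk.comp ((levi R⸨X⸩).comp (glInt R))).range : Set (PSp R⸨X⸩)) ∪
        ((unip R⸨X⸩).map PSp.mk : Set (PSp R⸨X⸩))) (x := h) ?_
    · rintro x (⟨A, rfl⟩ | ⟨u, hu, rfl⟩)
      · exact ⟨A, 1, one_mem _, by rw [leviUnip, mul_one]; rfl⟩
      · exact ⟨1, u, hu, by rw [leviUnip, map_one, map_one, one_mul]⟩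
    · exact ⟨1, 1, one_mem _, by rw [leviUnip, map_one, map_one, one_mul, map_one]⟩
    · rintro _ _ _ _ ⟨A, u, hu, rfl⟩ ⟨A', u', hu', rfl⟩
      refine ⟨_, _, ?_, (by rw [← map_mul, leviUnip_mul])⟩
      exact mul_mem (levi_conj_mem_unip _ hu) hu'
    · rintro _ _ ⟨A, u, hu, rfl⟩
      refine ⟨A⁻¹, levi R⸨X⸩ (glInt R A) * u⁻¹ * (levi R⸨X⸩ (glInt R A))⁻¹,
        levi_conj_mem_unip _ (inv_mem hu), ?_⟩
      rw [← map_inv]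
      congr 1
      simp only [leviUnip, map_inv]
      group
    · rwa [H, Subgroup.sup_eq_closure] at hh
  · rintro ⟨A, u, hu, rfl⟩
    rw [leviUnip, map_mul]
    exact mul_mem (Subgroup.mem_sup_left ⟨A, rfl⟩) (Subgroup.mem_sup_right ⟨u, hu, rfl⟩)

lemma mk_leviUnip_mem (A : GL (Fin 2) R⟦X⟧) {u : GSp R⸨X⸩} (hu : u ∈ unip R⸨X⸩) :
    PSp.mk (leviUnip A u) ∈ H R := mem_H_iff.2 ⟨A, u, hu, rfl⟩

lemma laurent_mem_unip (f : R →+* S) {u : GSp R⸨X⸩} (hu : u ∈ unip R⸨X⸩) :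
    GSp.laurent f u ∈ unip S⸨X⸩ := by
  intro i j hij
  change laurentMap f (u.1.1 i j) = _
  rw [hu i j hij, Matrix.one_apply, Matrix.one_apply]
  split_ifs <;> simp

lemma map_laurentMap_ofPowerSeries {m : Type*} (f : R →+* S) (M : Matrix m m R⟦X⟧) :
    (M.map (HahnSeries.ofPowerSeries ℤ R)).map (laurentMap f) =
      (M.map (PowerSeries.map f)).map (HahnSeries.ofPowerSeries ℤ S) := by
  ext1 i j
  exact laurentMap_ofPowerSeries f _

lemma laurent_levi (f : R →+* S) (A : GL (Fin 2) R⸨X⸩) : GSp.laurent f (levi R⸨X⸩ A) =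
    levi S⸨X⸩ (GeneralLinearGroup.map (laurentMap f) A) := by
  refine Subtype.ext (Units.ext (Matrix.ext fun i j => ?_))
  change laurentMap f (leviMatrix _ i j) = leviMatrix _ i j
  fin_cases i <;> fin_cases j <;> simp [leviMatrix]

lemma laurent_leviUnip (f : R →+* S) (A : GL (Fin 2) R⟦X⟧) (u : GSp R⸨X⸩) :
    GSp.laurent f (leviUnip A u) =
      leviUnip (GeneralLinearGroup.map (PowerSeries.map f) A) (GSp.laurent f u) := by
  rw [leviUnip, map_mul, laurent_levi]
  congr 2
  refine Units.ext ?_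
  exact map_laurentMap_ofPowerSeries f A.val

/-! ### The character -/

/-- The value of the character at a block upper triangular unipotent matrix. -/
def residueTrace (M : Matrix (Fin 6) (Fin 6) R⸨X⸩) : R := ((block M 0 1).trace).coeff (-1)

lemma residueTrace_eq (M : Matrix (Fin 6) (Fin 6) R⸨X⸩) :
    residueTrace M = (M 0 2 + M 1 3).coeff (-1) := by
  rw [residueTrace, Matrix.trace_fin_two]
  rfl

lemma isChi_iff {h : PSp R⸨X⸩} {c : R} : IsChi h c ↔
    ∃ A u, u ∈ unip R⸨X⸩ ∧ h = PSp.mk (leviUnip A u) ∧ c = residueTrace u.1.1 := by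
  simp only [residueTrace_eq]
  rfl

lemma leviUnip_block_self (A : GL (Fin 2) R⟦X⟧) {u : GSp R⸨X⸩} (hu : u ∈ unip R⸨X⸩)
    (b : Fin 3) : block (leviUnip A u).1.1 b b = block (levi R⸨X⸩ (glInt R A)).1.1 b b := by
  rw [leviUnip, GSp.coe_mul, ← leviPair_self,
    (blockUpper_leviPair _).block_mul_self (blockUpper_of_mem_unip hu), block_unip_self hu, mul_one]

lemma block_levi (A : GL (Fin 2) R⸨X⸩) :
    block (levi R⸨X⸩ A).1.1 0 0 = A.val ∧ block (levi R⸨X⸩ A).1.1 1 1 = A.val := by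
  rw [← leviPair_self]
  exact ⟨block_leviPair_zero _, block_leviPair_one _⟩

lemma leviPair_block_zero_one {B : Type*} [CommRing B] (x : GL (Fin 2) B × GL (Fin 2) B) :
    block (leviPair B x).1.1 0 1 = 0 := block_blockDiag_of_ne _ _ _ (by decide)

lemma leviUnip_block_zero_one (A : GL (Fin 2) R⟦X⟧) {u : GSp R⸨X⸩} (hu : u ∈ unip R⸨X⸩) :
    block (leviUnip A u).1.1 0 1 = (glInt R A).val * block u.1.1 0 1 := by
  rw [leviUnip, GSp.coe_mul, (blockUpper_of_mem_unip hu).block_mul_zero_one, ← leviPair_self,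
    leviPair_block_zero_one, zero_mul, add_zero, block_leviPair_zero]

/-- A presentation `A u` of an element of `PSp` is constrained only up to a scalar `z`. The block
`(0, 0)` gives `A' = z A`, and then the block `(0, 1)` forces those of `u` and `u'` to coincide. -/
lemma isChi_unique {h : PSp R⸨X⸩} {c c' : R} (hc : IsChi h c) (hc' : IsChi h c') : c = c' := by
  obtain ⟨A, u, hu, rfl, rfl⟩ := isChi_iff.1 hc
  obtain ⟨A', u', hu', h, rfl⟩ := isChi_iff.1 hc'
  obtain ⟨z, hz⟩ := PSp.mk_eq_mk.1 h
  have h0 : (glInt R A').val = (z : R⸨X⸩) • (glInt R A).val := by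
    have := congrArg (fun M => block M 0 0) hz
    simp only [block_smul] at this
    rwa [leviUnip_block_self _ hu, leviUnip_block_self _ hu', (block_levi _).1,
      (block_levi _).1] at this
  have h1 : (glInt R A').val * block u'.1.1 0 1 =
      (glInt R A').val * block u.1.1 0 1 := by
    have := congrArg (fun M => block M 0 1) hz
    simp only [block_smul] at this
    rwa [leviUnip_block_zero_one _ hu, leviUnip_block_zero_one _ hu', ← Matrix.smul_mul,
      ← h0] at this
  have h2 := congrArg (fun M => (glInt R A')⁻¹.val * M) h1
  simp only [← Matrix.mul_assoc, Units.inv_mul, Matrix.one_mul] at h2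
  rw [residueTrace, residueTrace, h2]

/-- Moving `u` past `A'` conjugates its block `(0, 1)` by `A'⁻¹`, which does not change the trace;
the blocks `(0, 1)` of two unipotent elements add up. -/
lemma isChi_mul {h h' : PSp R⸨X⸩} {c c' : R} (hc : IsChi h c) (hc' : IsChi h' c') :
    IsChi (h * h') (c + c') := by
  obtain ⟨A, u, hu, rfl, rfl⟩ := isChi_iff.1 hc
  obtain ⟨A', u', hu', rfl, rfl⟩ := isChi_iff.1 hc'
  have hv := levi_conj_mem_unip (glInt R A'⁻¹) hu
  refine isChi_iff.2 ⟨_, _, mul_mem hv hu', by rw [← map_mul, leviUnip_mul], ?_⟩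
  rw [residueTrace, residueTrace, residueTrace, ← HahnSeries.coeff_add, ← Matrix.trace_add]
  rw [GSp.coe_mul, (blockUpper_of_mem_unip hu').block_mul_zero_one, block_unip_self hv,
    block_unip_self hu', one_mul, mul_one, Matrix.trace_add, Matrix.trace_add, add_comm]
  congr 2
  rw [← leviPair_self, ← map_inv, GSp.coe_mul, GSp.coe_mul,
    (blockUpper_leviPair _).block_mul_zero_one, leviPair_block_zero_one, mul_zero, zero_add,
    (blockUpper_of_mem_unip hu).block_mul_zero_one, leviPair_block_zero_one, zero_mul, add_zero,
    block_leviPair_zero, block_leviPair_one]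
  change _ = ((glInt R A'⁻¹).val * _ * (glInt R A'⁻¹)⁻¹.val).trace
  rw [Matrix.trace_mul_comm, ← Matrix.mul_assoc, Units.inv_mul, Matrix.one_mul]

lemma isChi_one : IsChi (1 : PSp R⸨X⸩) 0 :=
  isChi_iff.2 ⟨1, 1, one_mem _, by rw [leviUnip, map_one, map_one, one_mul, map_one], by
    rw [residueTrace_eq]
    change (0 : R) = ((1 : Matrix (Fin 6) (Fin 6) R⸨X⸩) 0 2 +
      (1 : Matrix (Fin 6) (Fin 6) R⸨X⸩) 1 3).coeff (-1)
    simp⟩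

lemma exists_isChi (h : H R) : ∃ c, IsChi (h : PSp R⸨X⸩) c := by
  obtain ⟨A, u, hu, h⟩ := mem_H_iff.1 h.2
  exact ⟨_, isChi_iff.2 ⟨A, u, hu, h, rfl⟩⟩

lemma isChi_map (f : R →+* S) {h : PSp R⸨X⸩} {c : R} (hc : IsChi h c) :
    IsChi (PSp.map (laurentMap f) h) (f c) := by
  obtain ⟨A, u, hu, rfl, rfl⟩ := isChi_iff.1 hc
  refine isChi_iff.2 ⟨GeneralLinearGroup.map (PowerSeries.map f) A, _, laurent_mem_unip f hu,
    ?_, ?_⟩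
  · rw [← laurent_leviUnip]
    rfl
  · rw [residueTrace_eq, residueTrace_eq]
    change _ = (laurentMap f _ + laurentMap f _).coeff (-1)
    rw [← map_add]
    rfl

/-- The character of `PGL(2, R[[t]]) ⋉ U(R((t)))`. -/
def chi (h : H R) : R := Classical.choose (exists_isChi h)

lemma isChi_chi (h : H R) : IsChi (h : PSp R⸨X⸩) (chi h) := Classical.choose_spec (exists_isChi h)

lemma chi_eq {h : H R} {c : R} (hc : IsChi (h : PSp R⸨X⸩) c) : chi h = c :=
  isChi_unique (isChi_chi h) hc

lemma chi_mul (h h' : H R) : chi (h * h') = chi h + chi h' :=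
  chi_eq (isChi_mul (isChi_chi h) (isChi_chi h'))

lemma chi_one : chi (1 : H R) = 0 := chi_eq isChi_one

lemma chi_inv (h : H R) : chi h⁻¹ = -chi h := by
  have := chi_mul h⁻¹ h
  rw [inv_mul_cancel, chi_one] at this
  linear_combination -this

lemma chi_map (f : R →+* S) (h : H R) : chi (H.map f h) = f (chi h) :=
  chi_eq (isChi_map f (isChi_chi h))

end Grassmannian

/-! ### Matrices of Laurent series -/

section OrdGeM

variable {R S : Type*} [CommRing R] [CommRing S] {m n p : Type*}

/-- All entries of the matrix `M` lie in `t^s R[[t]]`. -/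
def OrdGeM (s : ℤ) (M : Matrix m n R⸨X⸩) : Prop := ∀ i j, OrdGe s (M i j)

lemma OrdGeM.mul [Fintype n] {s s' : ℤ} {M : Matrix m n R⸨X⸩} {N : Matrix n p R⸨X⸩} (hM : OrdGeM s M)
    (hN : OrdGeM s' N) : OrdGeM (s + s') (M * N) := by
  intro i j
  rw [Matrix.mul_apply]
  exact OrdGe.sum fun k _ => (hM i k).mul (hN k j)

lemma OrdGeM.smul {s s' : ℤ} {M : Matrix m n R⸨X⸩} {x : R⸨X⸩} (hx : OrdGe s x)
    (hM : OrdGeM s' M) : OrdGeM (s + s') (x • M) := fun i j => hx.mul (hM i j)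

lemma OrdGeM.neg {s : ℤ} {M : Matrix m n R⸨X⸩} (hM : OrdGeM s M) : OrdGeM s (-M) :=
  fun i j => (hM i j).neg

lemma OrdGeM.map (f : R →+* S) {s : ℤ} {M : Matrix m n R⸨X⸩} (hM : OrdGeM s M) :
    OrdGeM s (M.map (laurentMap f)) := fun i j => (hM i j).map f

lemma OrdGeM.mono {s s' : ℤ} {M : Matrix m n R⸨X⸩} (hM : OrdGeM s M) (h : s' ≤ s) :
    OrdGeM s' M := fun i j => (hM i j).mono h

lemma ordGeM_ofPowerSeries (M : Matrix m n R⟦X⟧) :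
    OrdGeM 0 (M.map (HahnSeries.ofPowerSeries ℤ R)) := fun _ _ => ordGe_ofPowerSeries _

lemma OrdGeM.det {M : Matrix (Fin 2) (Fin 2) R⸨X⸩} {s : ℤ} (hM : OrdGeM s M) :
    OrdGe (s + s) M.det := by
  rw [Matrix.det_fin_two]
  exact ((hM _ _).mul (hM _ _)).sub ((hM _ _).mul (hM _ _))

end OrdGeM

/-! ### Stabilizers of points and the character on them -/

section Stabilizers

variable {R S : Type*} [CommRing R] [CommRing S]

lemma map_leviPair (f : R →+* S) (x : GL (Fin 2) R × GL (Fin 2) R) : GSp.map f (leviPair R x) =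
    leviPair S (GeneralLinearGroup.map f x.1, GeneralLinearGroup.map f x.2) := by
  obtain ⟨P, Q⟩ := x
  refine Subtype.ext (Units.ext (Matrix.ext fun i j => ?_))
  rw [GSp.map_val, Matrix.map_apply, leviPair_val, leviPair_val]
  have h : f ((GeneralLinearGroup.det Q * (GeneralLinearGroup.det P)⁻¹ : Rˣ) : R) =
      ((GeneralLinearGroup.det (GeneralLinearGroup.map f Q) *
        (GeneralLinearGroup.det (GeneralLinearGroup.map f P))⁻¹ : Sˣ) : S) := by
    rw [GeneralLinearGroup.map_det, GeneralLinearGroup.map_det, ← map_inv (Units.map (f : R →* S)),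
      ← map_mul (Units.map (f : R →* S))]
    rfl
  rw [← h]
  fin_cases i <;> fin_cases j <;> simp [blockDiag, signTwist]

/-- The diagonal blocks of a block upper triangular element of `GSp(6)` whose inverse is block upper
triangular. -/
def diagBlock {B : Type*} [CommRing B] (k : GSp B) (hk : BlockUpper 0 k.1.1)
    (hk' : BlockUpper 0 (k⁻¹).1.1) (b : Fin 3) : GL (Fin 2) B where
  val := block k.1.1 b b
  inv := block (k⁻¹).1.1 b b
  val_inv := by rw [← hk.block_mul_self hk', GSp.mul_inv_val, block_one_self]
  inv_val := by rw [← hk'.block_mul_self hk, GSp.inv_mul_val, block_one_self]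

lemma BlockUpper.of_ofPowerSeries {M : Matrix (Fin 6) (Fin 6) R⟦X⟧} {k : ℕ}
    (h : BlockUpper k (M.map (HahnSeries.ofPowerSeries ℤ R))) : BlockUpper k M := by
  intro i j hij
  exact HahnSeries.ofPowerSeries_injective (Γ := ℤ) ((h i j hij).trans (map_zero _).symm)

lemma blockUpper_leviUnip (A : GL (Fin 2) R⟦X⟧) {u : GSp R⸨X⸩} (hu : u ∈ unip R⸨X⸩) :
    BlockUpper 0 (leviUnip A u).1.1 := by
  rw [leviUnip, ← leviPair_self, GSp.coe_mul]
  exact (blockUpper_leviPair _).mul (blockUpper_of_mem_unip hu)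

lemma blockUpper_leviUnip_inv (A : GL (Fin 2) R⟦X⟧) {u : GSp R⸨X⸩} (hu : u ∈ unip R⸨X⸩) :
    BlockUpper 0 ((leviUnip A u)⁻¹).1.1 := by
  rw [leviUnip, ← leviPair_self, _root_.mul_inv_rev, ← map_inv, GSp.coe_mul]
  exact (blockUpper_of_mem_unip (inv_mem hu)).mul (blockUpper_leviPair _)

lemma GSp.inv_val_of_smul {B : Type*} [CommRing B] {g g' k : GSp B} {c : Bˣ}
    (h : g'.1.1 = (c : B) • (g.1.1 * k.1.1)) :
    k.1.1 = ((c⁻¹ : Bˣ) : B) • ((g⁻¹).1.1 * g'.1.1) ∧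
      (k⁻¹).1.1 = (c : B) • ((g'⁻¹).1.1 * g.1.1) := by
  constructor
  · rw [h, Matrix.mul_smul, smul_smul, Units.inv_mul, one_smul, ← Matrix.mul_assoc,
      GSp.inv_mul_val, Matrix.one_mul]
  · have h1 := congrArg (fun M => (g'⁻¹).1.1 * M * (k⁻¹).1.1) h
    simp only [Matrix.mul_smul, Matrix.smul_mul] at h1
    rw [GSp.inv_mul_val, Matrix.one_mul, Matrix.mul_assoc, Matrix.mul_assoc,
      GSp.mul_inv_val, Matrix.mul_one] at h1
    exact h1

/-- The integral factor `k` is `g⁻¹ g'` up to a scalar, hence block upper triangular together with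
its inverse; this descends to `R[[t]]` because power series embed in Laurent series. -/
lemma exists_of_mk_eq {g g' : GSp R⸨X⸩} (hg : BlockUpper 0 g.1.1) (hgi : BlockUpper 0 (g⁻¹).1.1)
    (hg' : BlockUpper 0 g'.1.1) (hgi' : BlockUpper 0 (g'⁻¹).1.1) (h : Gr.mk g = Gr.mk g') :
    ∃ (c : R⸨X⸩ˣ) (k : GSp R⟦X⟧), BlockUpper 0 k.1.1 ∧ BlockUpper 0 (k⁻¹).1.1 ∧
      g'.1.1 = (c : R⸨X⸩) • (g.1.1 * (GSp.ofInt R k).1.1) := by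
  obtain ⟨c, k, hk⟩ := Gr.mk_eq_mk.1 h
  obtain ⟨e1, e2⟩ := GSp.inv_val_of_smul hk
  refine ⟨c, k, ?_, ?_, hk⟩
  · refine BlockUpper.of_ofPowerSeries (R := R) ?_
    change BlockUpper 0 (GSp.ofInt R k).1.1
    rw [e1]
    exact (hgi.mul hg').smul _
  · refine BlockUpper.of_ofPowerSeries (R := R) ?_
    change BlockUpper 0 (GSp.ofInt R k⁻¹).1.1
    rw [map_inv, e2]
    exact (hgi'.mul hg).smul _

/-- Comparison of the blocks of two representatives of a point of the affine Grassmannian. -/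
lemma blocks_of_mk_eq {A : GL (Fin 2) R⟦X⟧} {u : GSp R⸨X⸩} (hu : u ∈ unip R⸨X⸩)
    {x x' : GL (Fin 2) R⸨X⸩ × GL (Fin 2) R⸨X⸩}
    (h : Gr.mk (leviUnip A u * leviPair _ x) = Gr.mk (leviPair _ x')) :
    ∃ (c : R⸨X⸩ˣ) (k₀ k₁ : GL (Fin 2) R⟦X⟧) (E : Matrix (Fin 2) (Fin 2) R⸨X⸩),
      OrdGeM 0 E ∧
      x'.1.val = (c : R⸨X⸩) • ((glInt R A).val * x.1.val * (glInt R k₀).val) ∧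
      x'.2.val = (c : R⸨X⸩) • ((glInt R A).val * x.2.val * (glInt R k₁).val) ∧
      block u.1.1 0 1 = x.1.val * E * (x.2⁻¹).val := by
  have hA := blockUpper_leviUnip A hu
  have hx := blockUpper_leviPair x
  have hg : BlockUpper 0 (leviUnip A u * leviPair _ x).1.1 := hA.mul hx
  have hgi : BlockUpper 0 ((leviUnip A u * leviPair _ x)⁻¹).1.1 := by
    rw [_root_.mul_inv_rev, ← map_inv, GSp.coe_mul]
    exact (blockUpper_leviPair _).mul (blockUpper_leviUnip_inv A hu)
  have hgi' : BlockUpper 0 ((leviPair _ x')⁻¹).1.1 := by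
    rw [← map_inv]
    exact blockUpper_leviPair _
  obtain ⟨c, k, hk1, hk2, hk⟩ := exists_of_mk_eq hg hgi (blockUpper_leviPair x') hgi' h
  have h0 : block (leviUnip A u * leviPair _ x).1.1 0 0 = (glInt R A).val * x.1.val := by
    rw [GSp.coe_mul, hA.block_mul_self hx, leviUnip_block_self A hu, (block_levi _).1,
      block_leviPair_zero]
  have h1 : block (leviUnip A u * leviPair _ x).1.1 1 1 = (glInt R A).val * x.2.val := by
    rw [GSp.coe_mul, hA.block_mul_self hx, leviUnip_block_self A hu, (block_levi _).2,
      block_leviPair_one]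
  have h01 : block (leviUnip A u * leviPair _ x).1.1 0 1 =
      (glInt R A).val * block u.1.1 0 1 * x.2.val := by
    rw [GSp.coe_mul, hx.block_mul_zero_one, leviPair_block_zero_one,
      mul_zero, zero_add, leviUnip_block_zero_one A hu, block_leviPair_one]
  have hkL : BlockUpper 0 (GSp.ofInt R k).1.1 := hk1.map _
  generalize leviUnip A u * leviPair _ x = g at *
  set K := glInt R (diagBlock k hk1 hk2 1) with hK
  have hK1 : block (GSp.ofInt R k).1.1 1 1 = K.val := rfl
  have hE : OrdGeM 0 (block (GSp.ofInt R k).1.1 0 1) := ordGeM_ofPowerSeries (block k.1.1 0 1)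
  have hKi : OrdGeM 0 (K⁻¹).val := ordGeM_ofPowerSeries (diagBlock k hk1 hk2 1)⁻¹.val
  refine ⟨c, diagBlock k hk1 hk2 0, diagBlock k hk1 hk2 1,
    -(block (GSp.ofInt R k).1.1 0 1 * (K⁻¹).val), (hE.mul hKi).neg, ?_, ?_, ?_⟩
  · rw [← block_leviPair_zero, hk, block_smul, hg.block_mul_self hkL, h0]
    rfl
  · rw [← block_leviPair_one, hk, block_smul, hg.block_mul_self hkL, h1]
    rfl
  -- The target is block diagonal, so `A X k₀₁ + A U Y k₁₁ = 0` for the blocks of `k`; solving gives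
  -- `U = -X k₀₁ k₁₁⁻¹ Y⁻¹`.
  · have h2 := congrArg (fun M => block M 0 1) hk
    simp only [block_smul] at h2
    rw [leviPair_block_zero_one, hkL.block_mul_zero_one, h0, h01, hK1] at h2
    generalize block (GSp.ofInt R k).1.1 0 1 = E at *
    generalize block u.1.1 0 1 = U at *
    generalize glInt R A = A' at *
    clear_value K
    have h3 := congrArg (fun M => A'⁻¹.val * (((c⁻¹ : R⸨X⸩ˣ) : R⸨X⸩) • M) *
      (K⁻¹.val * x.2⁻¹.val)) h2
    simp only [smul_smul, Units.inv_mul, one_smul, smul_zero, Matrix.mul_zero,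
      Matrix.zero_mul] at h3
    have h4 : A'⁻¹.val * (A'.val * x.1.val * E + A'.val * U * x.2.val * K.val) *
        (K⁻¹.val * x.2⁻¹.val) = (A'⁻¹.val * A'.val) * (x.1.val * E * K⁻¹.val * x.2⁻¹.val) +
          (A'⁻¹.val * A'.val) * (U * (x.2.val * (K.val * K⁻¹.val) * x.2⁻¹.val)) := by
      simp only [Matrix.mul_add, Matrix.add_mul, Matrix.mul_assoc]
    rw [h4, Units.inv_mul, Units.mul_inv, Matrix.one_mul, Matrix.mul_one, Units.mul_inv,
      Matrix.mul_one, Matrix.one_mul] at h3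
    rw [eq_neg_of_add_eq_zero_right h3.symm, Matrix.mul_neg, Matrix.neg_mul]
    simp only [Matrix.mul_assoc]

/-- The character vanishes on the stabilizers of the points given by `(P, Q)` with
`Q⁻¹ P` integral. -/
lemma isChi_eq_zero_of_smul_eq {x : GL (Fin 2) R⸨X⸩ × GL (Fin 2) R⸨X⸩}
    (hx : OrdGeM 0 (x.2⁻¹.val * x.1.val)) {s : PSp R⸨X⸩} {c : R} (hc : IsChi s c)
    (hs : s • Gr.mk (leviPair _ x) = Gr.mk (leviPair _ x)) : c = 0 := by
  obtain ⟨A, u, hu, rfl, rfl⟩ := isChi_iff.1 hc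
  obtain ⟨z, k₀, k₁, E, hE, -, -, h⟩ := blocks_of_mk_eq hu hs
  -- The trace of `X E Y⁻¹` is that of `Y⁻¹ X E`, which is integral and has no residue.
  rw [residueTrace, h, Matrix.trace_mul_comm, ← Matrix.mul_assoc, Matrix.trace_fin_two]
  have h1 := hx.mul hE
  exact ((h1 0 0).add (h1 1 1)) (-1) (by norm_num)

/-! ### Coordinates on the set of representatives -/

/-- The integral powers of `t`. -/
def tpowR (R : Type*) [CommRing R] (n : ℤ) : R⸨X⸩ˣ where
  val := HahnSeries.single n 1
  inv := HahnSeries.single (-n) 1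
  val_inv := by simp
  inv_val := by simp

/-- The first block of the representative with the given coordinates. -/
def repX (R : Type*) [CommRing R] (n a b : ℤ) : GL (Fin 2) R⸨X⸩ :=
  diagUnit ![tpowR R (n + a), tpowR R b]

/-- The second block of the representative with the given coordinates. -/
def repY (R : Type*) [CommRing R] (n r : ℤ) : GL (Fin 2) R⸨X⸩ where
  val := !![HahnSeries.single (n + r) 1, HahnSeries.single n 1; 0, 1]
  inv := !![HahnSeries.single (-n - r) 1, -HahnSeries.single (-r) 1; 0, 1]
  val_inv := by
    ext i j
    fin_cases i <;> fin_cases j <;> simp [Matrix.mul_apply]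
  inv_val := by
    refine Matrix.ext fun i j => ?_
    fin_cases i <;> fin_cases j <;> simp [Matrix.mul_apply, show -n - r + n = -r by ring]

/-- The representative with the given coordinates. -/
abbrev repPair (R : Type*) [CommRing R] (n a b r : ℤ) : GL (Fin 2) R⸨X⸩ × GL (Fin 2) R⸨X⸩ :=
  (repX R n a b, repY R n r)

lemma repX_val (n a b : ℤ) : (repX R n a b).val =
    !![HahnSeries.single (n + a) 1, 0; 0, HahnSeries.single b 1] := by
  ext i j
  fin_cases i <;> fin_cases j <;> simp [repX, diagUnit, tpowR]

lemma repY_val (n r : ℤ) : (repY R n r).val =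
    !![HahnSeries.single (n + r) 1, HahnSeries.single n 1; 0, 1] := rfl

lemma repY_inv_val (n r : ℤ) : (repY R n r)⁻¹.val =
    !![HahnSeries.single (-n - r) 1, -HahnSeries.single (-r) 1; 0, 1] := rfl

lemma map_repPair (f : R →+* S) (n a b r : ℤ) :
    GSp.laurent f (leviPair _ (repPair R n a b r)) = leviPair _ (repPair S n a b r) := by
  rw [map_leviPair]
  congr 2 <;> refine Units.ext (Matrix.ext fun i j => ?_)
  · change laurentMap f ((repX R n a b).val i j) = (repX S n a b).val i j
    rw [repX_val, repX_val]
    fin_cases i <;> fin_cases j <;> simp [laurentMap_single]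
  · change laurentMap f ((repY R n r).val i j) = (repY S n r).val i j
    rw [repY_val, repY_val]
    fin_cases i <;> fin_cases j <;> simp [laurentMap_single]

/-- The decisive entry is `-t^(b-r)`: its integrality is the condition `r ≤ b`, that is, dominance
of the coweight. -/
lemma ordGeM_repY_inv_mul_repX {n a b r : ℤ} (hr : 0 ≤ r) (hb : r ≤ b) (ha : b ≤ a) :
    OrdGeM 0 ((repY R n r)⁻¹.val * (repX R n a b).val) := by
  have h : (repY R n r)⁻¹.val * (repX R n a b).val =
      !![HahnSeries.single (a - r) 1, -HahnSeries.single (b - r) 1; 0, HahnSeries.single b 1] := by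
    rw [repY_inv_val, repX_val]
    ext i j
    fin_cases i <;> fin_cases j <;> simp [Matrix.mul_apply] <;> ring_nf
  rw [h]
  intro i j
  fin_cases i <;> fin_cases j
  · exact ordGe_single (by omega) _
  · exact (ordGe_single (by omega) _).neg
  · exact OrdGe.zero 0
  · exact ordGe_single (by omega) _

/-- The coweight with the given coordinates. -/
def coweight (n a b r : ℤ) : Fin 4 → ℚ := ![a - r / 2, b - r / 2, r / 2, n / 2]

/-- The integers are `n = 2λ₄`, `r = 2λ₃`, `b = λ₂ + λ₃` and `a = λ₁ + λ₃`, the exponents that occur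
in the matrices. -/
lemma lDominant_iff {l : Fin 4 → ℚ} :
    LDominant l ↔ ∃ n a b r : ℤ, 0 ≤ n ∧ 0 ≤ r ∧ b ≤ a ∧ l = coweight n a b r := by
  constructor
  · rintro ⟨h1, ⟨m, hm⟩, ⟨k, hk⟩, h2, h3⟩
    obtain ⟨r, hr⟩ := h1 2
    obtain ⟨n, hn⟩ := h1 3
    have hr0 : (0 : ℚ) ≤ r := by rw [← hr]; linarith
    have hn0 : (0 : ℚ) ≤ n := by rw [← hn]; linarith
    refine ⟨n, m + r + k, m + r, r, by exact_mod_cast hn0, by exact_mod_cast hr0, by omega, ?_⟩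
    funext i
    fin_cases i <;> simp [coweight] <;> linarith
  · rintro ⟨n, a, b, r, hn, hr, hab, rfl⟩
    have hr0 : (0 : ℚ) ≤ r := by exact_mod_cast hr
    have hn0 : (0 : ℚ) ≤ n := by exact_mod_cast hn
    refine ⟨?_, ⟨b - r, ?_⟩, ⟨(a - b).toNat, ?_⟩, ?_, ?_⟩
    · intro i
      fin_cases i
      · exact ⟨2 * a - r, by simp [coweight]; ring⟩
      · exact ⟨2 * b - r, by simp [coweight]; ring⟩
      · exact ⟨r, by simp [coweight]; ring⟩
      · exact ⟨n, by simp [coweight]; ring⟩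
    · simp [coweight]; ring
    · have : (((a - b).toNat : ℤ) : ℚ) = ((a - b : ℤ) : ℚ) := by
        rw [Int.toNat_of_nonneg (by omega)]
      rw [Int.cast_natCast] at this
      rw [this]
      simp [coweight]
    · simp [coweight]; linarith
    · simp [coweight]; linarith

lemma dominant_coweight_iff {n a b r : ℤ} (hn : 0 ≤ n) (hr : 0 ≤ r) (hab : b ≤ a) :
    Dominant (coweight n a b r) ↔ r ≤ b := by
  constructor
  · rintro ⟨-, -, k, hk⟩
    have h : (b : ℚ) - r = k := by
      simp [coweight] at hk
      linarith
    have h' : b - r = (k : ℤ) := by exact_mod_cast h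
    omega
  · intro hb
    have cast : ∀ {z : ℤ}, 0 ≤ z → ((z.toNat : ℕ) : ℚ) = z := fun {z} hz => by
      rw [← Int.cast_natCast, Int.toNat_of_nonneg hz]
    refine ⟨?_, ⟨(a - b).toNat, ?_⟩, ⟨(b - r).toNat, ?_⟩⟩
    · intro i
      fin_cases i
      · exact ⟨(2 * a - r).toNat, by rw [cast (by omega)]; simp [coweight]; ring⟩
      · exact ⟨(2 * b - r).toNat, by rw [cast (by omega)]; simp [coweight]; ring⟩
      · exact ⟨r.toNat, by rw [cast (by omega)]; simp [coweight]; ring⟩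
      · exact ⟨n.toNat, by rw [cast (by omega)]; simp [coweight]; ring⟩
    · rw [cast (by omega)]; simp [coweight]
    · rw [cast (by omega)]; simp [coweight]; ring

lemma Dominant.lDominant {l : Fin 4 → ℚ} (h : Dominant l) : LDominant l := by
  obtain ⟨h1, h2, h3⟩ := h
  refine ⟨fun i => ?_, ?_, h2, ?_, ?_⟩
  · obtain ⟨k, hk⟩ := h1 i
    exact ⟨k, by rw [hk]; simp⟩
  · obtain ⟨k, hk⟩ := h3
    exact ⟨k, by rw [hk]; simp⟩
  · obtain ⟨k, hk⟩ := h1 2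
    have : (0 : ℚ) ≤ k := Nat.cast_nonneg k
    linarith
  · obtain ⟨k, hk⟩ := h1 3
    have : (0 : ℚ) ≤ k := Nat.cast_nonneg k
    linarith

lemma oddDominant_coweight_iff {n a b r : ℤ} :
    OddDominant (coweight n a b r) ↔
      (n = 0 → 2 * (a - b) = r) ∧ (0 < n → b < a ∧ r ≤ b ∧ 0 < r) := by
  have e0 : coweight n a b r 0 = a - r / 2 := rfl
  have e1 : coweight n a b r 1 = b - r / 2 := rfl
  have e2 : coweight n a b r 2 = r / 2 := rfl
  have e3 : coweight n a b r 3 = n / 2 := rfl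
  rw [OddDominant, e0, e1, e2, e3]
  refine and_congr (imp_congr ?_ ?_) (imp_congr ?_ (and_congr ?_ (and_congr ?_ ?_)))
  · rw [div_eq_zero_iff]
    simp
  · rw [← @Int.cast_inj ℚ]
    push_cast
    constructor <;> intro h <;> linarith
  · rw [← @Int.cast_lt ℚ]
    push_cast
    constructor <;> intro h <;> linarith
  · rw [← @Int.cast_lt ℚ]
    constructor <;> intro h <;> linarith
  · rw [← @Int.cast_le ℚ]
    constructor <;> intro h <;> linarith
  · rw [← @Int.cast_lt ℚ]
    push_cast
    constructor <;> intro h <;> linarith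

/-- Upper triangular unipotent matrices. -/
def upperGL {B : Type*} [CommRing B] (x : B) : GL (Fin 2) B where
  val := !![1, x; 0, 1]
  inv := !![1, -x; 0, 1]
  val_inv := by
    ext i j
    fin_cases i <;> fin_cases j <;> simp
  inv_val := by
    ext i j
    fin_cases i <;> fin_cases j <;> simp

lemma upperGL_val {B : Type*} [CommRing B] (x : B) : (upperGL x).val = !![1, x; 0, 1] := rfl

lemma det_upperGL {B : Type*} [CommRing B] (x : B) :
    GeneralLinearGroup.det (upperGL x) = 1 := by
  refine Units.ext ?_
  rw [GeneralLinearGroup.val_det_apply, upperGL_val, Matrix.det_fin_two]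
  simp

lemma gElt_eq : gElt = leviPair _ (1, upperGL 1) := by
  refine Subtype.ext (Units.ext (Matrix.ext fun i j => ?_))
  rw [leviPair_val, det_upperGL, map_one, inv_one, mul_one]
  simp only [Units.val_one, one_smul, upperGL_val, map_one]
  fin_cases i <;> fin_cases j <;>
    simp [gElt, blockDiag]

lemma torus_eq (a b c : ℤ) :
    torus a b c = leviPair _ (diagUnit ![tpow a, tpow b], diagUnit ![tpow c, tpow 0]) := by
  refine Subtype.ext (Units.ext (Matrix.ext fun i j => ?_))
  rw [leviPair_val]
  have h : (GeneralLinearGroup.det (diagUnit ![tpow c, tpow 0]) *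
      (GeneralLinearGroup.det (diagUnit ![tpow a, tpow b]))⁻¹ : ℂ⸨X⸩ˣ) = tpow (c - a - b) := by
    rw [mul_inv_eq_iff_eq_mul]
    refine Units.ext ?_
    simp [diagUnit, tpow]
  rw [h]
  fin_cases i <;> fin_cases j <;>
    (simp [torus, diagUnit, blockDiag, signTwist, tpow]; try ring_nf)

/-- On the first block `g` is trivial and the torus elements multiply to `diag(t^(n+a), t^b)`; on
the second one `diag(t^n, 1)`, the unipotent block of `g` and `diag(t^r, 1)` multiply to `repY`. -/
lemma pt_coweight (n a b r : ℤ) :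
    pt (coweight n a b r) = Gr.mk (leviPair _ (repPair ℂ n a b r)) := by
  have e0 : ⌊coweight n a b r 0 + coweight n a b r 2⌋ = a := by
    rw [← Int.floor_intCast (R := ℚ) a]
    congr 1
    simp [coweight]
  have e1 : ⌊coweight n a b r 1 + coweight n a b r 2⌋ = b := by
    rw [← Int.floor_intCast (R := ℚ) b]
    congr 1
    simp [coweight]
  have e2 : ⌊2 * coweight n a b r 2⌋ = r := by
    rw [← Int.floor_intCast (R := ℚ) r]
    congr 1
    simp [coweight]
    ring
  have e3 : ⌊2 * coweight n a b r 3⌋ = n := by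
    rw [← Int.floor_intCast (R := ℚ) n]
    congr 1
    simp [coweight]
    ring
  rw [pt, e0, e1, e2, e3, ← leviPair_self, gElt_eq, torus_eq, ← map_mul (leviPair ℂ⸨X⸩),
    ← map_mul (leviPair ℂ⸨X⸩)]
  congr 3
  refine Prod.ext (Units.ext (Matrix.ext fun i j => ?_)) (Units.ext (Matrix.ext fun i j => ?_))
  · change _ = (repX ℂ n a b).val i j
    rw [repX_val]
    fin_cases i <;> fin_cases j <;> simp [diagUnit, tpow]
  · change _ = (repY ℂ n r).val i j
    rw [repY_val]
    fin_cases i <;> fin_cases j <;> simp [diagUnit, tpow, upperGL, Matrix.mul_apply]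

end Stabilizers

/-! ### Uniqueness of the representatives -/

section Uniqueness

variable {R : Type*} [CommRing R]

/-- Integral factors on both sides cannot lower orders, so up to the contribution of `c` the order
of the determinant is an invariant; `entry_rel` is the analogue for the least order of the entries.
-/
lemma det_rel {c : R⸨X⸩} {M M' : Matrix (Fin 2) (Fin 2) R⸨X⸩} {A k : GL (Fin 2) R⟦X⟧}
    (h : M' = c • ((glInt R A).val * M * (glInt R k).val)) {γ s : ℤ} (hc : OrdGe γ c)
    (hM : OrdGe s M.det) : OrdGe (γ + γ + s) M'.det := by
  have hi : ∀ A : GL (Fin 2) R⟦X⟧, OrdGe 0 (glInt R A).val.det := fun A =>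
    (ordGeM_ofPowerSeries A.val).det
  have := (hc.mul hc).mul (((hi A).mul hM).mul (hi k))
  rw [h, Matrix.det_smul, Matrix.det_mul, Matrix.det_mul, Fintype.card_fin, pow_two]
  exact this.mono (by omega)

lemma entry_rel {c : R⸨X⸩} {M M' : Matrix (Fin 2) (Fin 2) R⸨X⸩} {A k : GL (Fin 2) R⟦X⟧}
    (h : M' = c • ((glInt R A).val * M * (glInt R k).val)) {γ s : ℤ} (hc : OrdGe γ c)
    (hM : OrdGeM s M) : OrdGeM (γ + s) M' := by
  have := OrdGeM.smul hc
    (((ordGeM_ofPowerSeries A.val).mul hM).mul (ordGeM_ofPowerSeries k.val))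
  rw [h]
  exact this.mono (by omega)

lemma inv_rel {c : R⸨X⸩ˣ} {M M' : Matrix (Fin 2) (Fin 2) R⸨X⸩} {A k : GL (Fin 2) R⟦X⟧}
    (h : M' = (c : R⸨X⸩) • ((glInt R A).val * M * (glInt R k).val)) :
    M = ((c⁻¹ : R⸨X⸩ˣ) : R⸨X⸩) • ((glInt R A⁻¹).val * M' * (glInt R k⁻¹).val) := by
  rw [h, Matrix.mul_smul, Matrix.smul_mul, smul_smul, Units.inv_mul, one_smul, map_inv, map_inv]
  simp only [Matrix.mul_assoc, Units.mul_inv, Matrix.mul_one]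
  rw [← Matrix.mul_assoc, Units.inv_mul, Matrix.one_mul]

/-- The scalar and the common left factor both cancel in `X⁻¹ Y`, which provides an invariant
comparing the two lattices directly. -/
lemma quot_rel {c : R⸨X⸩ˣ} {X X' Y Y' : GL (Fin 2) R⸨X⸩} {A k₀ k₁ : GL (Fin 2) R⟦X⟧}
    (hX : X'.val = (c : R⸨X⸩) • ((glInt R A).val * X.val * (glInt R k₀).val))
    (hY : Y'.val = (c : R⸨X⸩) • ((glInt R A).val * Y.val * (glInt R k₁).val)) :
    X'⁻¹.val * Y'.val = (glInt R k₀⁻¹).val * (X⁻¹.val * Y.val) * (glInt R k₁).val := by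
  have h : (glInt R k₀⁻¹).val * X⁻¹.val * (glInt R A⁻¹).val * X'.val = (c : R⸨X⸩) • 1 := by
    rw [hX, Matrix.mul_smul, map_inv, map_inv]
    congr 1
    simp only [Matrix.mul_assoc]
    rw [← Matrix.mul_assoc (glInt R A)⁻¹.val, Units.inv_mul, Matrix.one_mul,
      ← Matrix.mul_assoc X⁻¹.val, Units.inv_mul, Matrix.one_mul, Units.inv_mul]
  have h2 : (c : R⸨X⸩) • X'⁻¹.val = (glInt R k₀⁻¹).val * X⁻¹.val * (glInt R A⁻¹).val := by
    have := congrArg (fun M => M * X'⁻¹.val) h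
    simp only [Matrix.mul_assoc, Units.mul_inv, Matrix.mul_one, Matrix.smul_mul,
      Matrix.one_mul] at this
    rw [← this, Matrix.mul_assoc]
  rw [hY, Matrix.mul_smul, ← Matrix.smul_mul, h2, map_inv _ A]
  simp only [Matrix.mul_assoc]
  rw [← Matrix.mul_assoc (glInt R A)⁻¹.val, Units.inv_mul, Matrix.one_mul]

variable [Nontrivial R]

/-- Each inequality compares an invariant of the two pairs: the least order of the entries is `0`
for `Y`, `b` for `X` and `-a` for `X⁻¹ Y`, and the determinants have orders `n + a + b` and `n + r`.
-/
lemma coordinates_le {c : R⸨X⸩ˣ} {A k₀ k₁ : GL (Fin 2) R⟦X⟧} {n a b r n' a' b' r' γ : ℤ}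
    (hn : 0 ≤ n) (hr : 0 ≤ r) (hab : b ≤ a) (hc : OrdGe γ (c : R⸨X⸩))
    (hX : (repX R n' a' b').val =
      (c : R⸨X⸩) • ((glInt R A).val * (repX R n a b).val * (glInt R k₀).val))
    (hY : (repY R n' r').val =
      (c : R⸨X⸩) • ((glInt R A).val * (repY R n r).val * (glInt R k₁).val)) :
    γ ≤ 0 ∧ γ + b ≤ b' ∧ a' ≤ a ∧ γ + γ + (n + a + b) ≤ n' + a' + b' ∧
      γ + γ + (n + r) ≤ n' + r' := by
  have hdX : ∀ n a b : ℤ, (repX R n a b).val.det = HahnSeries.single (n + a + b) 1 := by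
    intro n a b
    rw [repX_val, Matrix.det_fin_two]
    simp
  have hdY : ∀ n r : ℤ, (repY R n r).val.det = HahnSeries.single (n + r) 1 := by
    intro n r
    rw [repY_val, Matrix.det_fin_two]
    simp
  have hoY : OrdGeM 0 (repY R n r).val := by
    rw [repY_val]
    intro i j
    fin_cases i <;> fin_cases j
    · exact ordGe_single (by omega) _
    · exact ordGe_single (by omega) _
    · exact OrdGe.zero 0
    · exact ordGe_one
  have hoX : OrdGeM b (repX R n a b).val := by
    rw [repX_val]
    intro i j
    fin_cases i <;> fin_cases j
    · exact ordGe_single (by omega) _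
    · exact OrdGe.zero _
    · exact OrdGe.zero _
    · exact ordGe_single (by omega) _
  have hq : ∀ n a b r : ℤ, (repX R n a b)⁻¹.val * (repY R n r).val =
      !![HahnSeries.single (r - a) 1, HahnSeries.single (-a) 1; 0, HahnSeries.single (-b) 1] := by
    intro n a b r
    have h1 : (repX R n a b)⁻¹.val =
        !![HahnSeries.single (-(n + a)) 1, 0; 0, HahnSeries.single (-b) 1] := by
      change Matrix.diagonal _ = _
      ext i j
      fin_cases i <;> fin_cases j <;> rfl
    rw [h1, repY_val]
    refine Matrix.ext fun i j => ?_
    fin_cases i <;> fin_cases j <;> (simp; try ring_nf)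
  have hoq : OrdGeM (-a) ((repX R n a b)⁻¹.val * (repY R n r).val) := by
    rw [hq]
    intro i j
    fin_cases i <;> fin_cases j
    · exact ordGe_single (by omega) _
    · exact ordGe_single (by omega) _
    · exact OrdGe.zero _
    · exact ordGe_single (by omega) _
  refine ⟨?_, ?_, ?_, ?_, ?_⟩
  · have := entry_rel hY hc hoY 1 1
    have := le_of_ordGe_one this
    omega
  · have := entry_rel hX hc hoX 1 1
    rw [repX_val] at this
    exact le_of_ordGe_single this
  · have := ((ordGeM_ofPowerSeries k₀⁻¹.val).mul hoq).mul (ordGeM_ofPowerSeries k₁.val)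
    have h2 := quot_rel hX hY
    have h3 : OrdGe (0 + -a + 0) (((repX R n' a' b')⁻¹.val * (repY R n' r').val) 0 1) := by
      rw [h2]
      exact this 0 1
    rw [hq] at h3
    have := le_of_ordGe_single h3
    omega
  · have := det_rel hX hc (s := n + a + b) (by rw [hdX]; exact ordGe_single le_rfl _)
    rw [hdX] at this
    exact le_of_ordGe_single this
  · have := det_rel hY hc (s := n + r) (by rw [hdY]; exact ordGe_single le_rfl _)
    rw [hdY] at this
    exact le_of_ordGe_single this

end Uniqueness

lemma coordinates_unique {n a b r n' a' b' r' : ℤ} (hn : 0 ≤ n) (hr : 0 ≤ r) (hab : b ≤ a)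
    (hn' : 0 ≤ n') (hr' : 0 ≤ r') (hab' : b' ≤ a') {h : PSp ℂ⸨X⸩} (hh : h ∈ H ℂ)
    (he : h • Gr.mk (leviPair _ (repPair ℂ n a b r)) = Gr.mk (leviPair _ (repPair ℂ n' a' b' r'))) :
    n = n' ∧ a = a' ∧ b = b' ∧ r = r' := by
  obtain ⟨A, u, hu, rfl⟩ := mem_H_iff.1 hh
  obtain ⟨c, k₀, k₁, E, -, hX, hY, -⟩ := blocks_of_mk_eq hu he
  obtain ⟨γ, hγ, hγ'⟩ := exists_ordGe_units c
  -- The two directions give `γ ≤ 0` and `-γ ≤ 0`, so `γ = 0` and all the inequalities become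
  -- equalities.
  have h1 := coordinates_le hn hr hab hγ hX hY
  have h2 := coordinates_le hn' hr' hab' hγ' (inv_rel hX) (inv_rel hY)
  omega

/-! ### Existence of the representatives: the Levi subgroup -/

section LeviOrbits

/-- The orbit of the point given by a pair of matrices. -/
def pairOrbit (X Y : GL (Fin 2) ℂ⸨X⸩) : Set (Gr ℂ) :=
  MulAction.orbit (H ℂ) (Gr.mk (leviPair _ (X, Y)))

lemma orbit_smul_mk (h : PSp ℂ⸨X⸩) (hh : h ∈ H ℂ) (y : Gr ℂ) :
    MulAction.orbit (H ℂ) (h • y) = MulAction.orbit (H ℂ) y :=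
  MulAction.orbit_eq_iff.2 ⟨⟨h, hh⟩, rfl⟩

lemma pairOrbit_left (A : GL (Fin 2) ℂ⟦X⟧) (X Y : GL (Fin 2) ℂ⸨X⸩) :
    pairOrbit (glInt ℂ A * X) (glInt ℂ A * Y) = pairOrbit X Y := by
  rw [pairOrbit, pairOrbit, ← orbit_smul_mk (PSp.mk (leviUnip A 1))
    (mk_leviUnip_mem A (one_mem _)) (Gr.mk (leviPair _ (X, Y))), Gr.smul_mk, leviUnip, mul_one,
    ← leviPair_self, ← map_mul (leviPair ℂ⸨X⸩)]
  rfl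

lemma pairOrbit_right (k₀ k₁ : GL (Fin 2) ℂ⟦X⟧) (X Y : GL (Fin 2) ℂ⸨X⸩) :
    pairOrbit (X * glInt ℂ k₀) (Y * glInt ℂ k₁) = pairOrbit X Y := by
  have h : Gr.mk (leviPair _ (X, Y)) =
      Gr.mk (leviPair _ (X * glInt ℂ k₀, Y * glInt ℂ k₁)) := by
    refine Gr.mk_eq_mk.2 ⟨1, leviPair _ (k₀, k₁), ?_⟩
    rw [Units.val_one, one_smul, map_leviPair, ← GSp.coe_mul, ← map_mul (leviPair ℂ⸨X⸩)]
    rfl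
  rw [pairOrbit, pairOrbit, h]

/-- Scalar matrices. -/
def scalarGL {B : Type*} [CommRing B] (c : Bˣ) : GL (Fin 2) B := diagUnit fun _ => c

/-- The third block involves the quotient `det Y / det X`, in which the factor `c²` cancels; hence
all three blocks scale by `c`. -/
lemma leviPair_scalarGL_mul {B : Type*} [CommRing B] (c : Bˣ) (X Y : GL (Fin 2) B) :
    (leviPair B (scalarGL c * X, scalarGL c * Y)).1.1 = (c : B) • (leviPair B (X, Y)).1.1 := by
  have hdet : GeneralLinearGroup.det (scalarGL c : GL (Fin 2) B) = c * c := by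
    refine Units.ext ?_
    simp [scalarGL, diagUnit, pow_two]
  rw [leviPair_val, leviPair_val, map_mul, map_mul, hdet]
  have h2 : c * c * GeneralLinearGroup.det Y * (c * c * GeneralLinearGroup.det X)⁻¹ =
      GeneralLinearGroup.det Y * (GeneralLinearGroup.det X)⁻¹ := by
    rw [_root_.mul_inv, mul_mul_mul_comm, mul_inv_cancel, one_mul]
  rw [h2]
  generalize GeneralLinearGroup.det Y * (GeneralLinearGroup.det X)⁻¹ = z
  refine Matrix.ext fun i j => ?_
  fin_cases i <;> fin_cases j <;>
    (simp [blockDiag, signTwist, scalarGL, diagUnit]; try ring_nf)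

lemma pairOrbit_scalar (c : ℂ⸨X⸩ˣ) (X Y : GL (Fin 2) ℂ⸨X⸩) :
    pairOrbit (scalarGL c * X) (scalarGL c * Y) = pairOrbit X Y := by
  have h : Gr.mk (leviPair _ (X, Y)) = Gr.mk (leviPair _ (scalarGL c * X, scalarGL c * Y)) := by
    refine Gr.mk_eq_mk.2 ⟨c, 1, ?_⟩
    rw [map_one, leviPair_scalarGL_mul]
    change _ = (c : ℂ⸨X⸩) • ((leviPair _ (X, Y)).1.1 * 1)
    rw [Matrix.mul_one]
  rw [pairOrbit, pairOrbit, h]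

/-- A nonzero Laurent series is a power of `t` times an invertible power series. -/
lemma exists_eq_single_mul_unit {K : Type*} [Field K] {x : K⸨X⸩} (hx : x ≠ 0) :
    ∃ w : K⟦X⟧ˣ, x = HahnSeries.single x.order (1 : K) *
      HahnSeries.ofPowerSeries ℤ K w := by
  obtain ⟨p, hp⟩ := ordGe_iff.1
    (show OrdGe x.order x from fun n hn => HahnSeries.coeff_eq_zero_of_lt_order hn)
  have hu : IsUnit p := by
    rw [PowerSeries.isUnit_iff_constantCoeff, isUnit_iff_ne_zero]
    intro h
    apply HahnSeries.coeff_order_eq_zero.not.2 hx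
    rw [hp, coeff_single_one_mul, ← hp, sub_self]
    have := HahnSeries.ofPowerSeries_apply_coeff (Γ := ℤ) p 0
    simpa [h] using this
  obtain ⟨w, rfl⟩ := hu
  exact ⟨w, hp⟩

/-- The common denominator of a finite family of Laurent series. -/
lemma exists_pivot {K ι : Type*} [Field K] [Finite ι] (f : ι → K⸨X⸩) (hf : ∃ i, f i ≠ 0) :
    ∃ (q : ℤ) (p : ι → K⟦X⟧) (i : ι), IsUnit (p i) ∧
      ∀ j, f j = HahnSeries.single q (1 : K) * HahnSeries.ofPowerSeries ℤ K (p j) := by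
  cases nonempty_fintype ι
  classical
  -- The pivot is a nonzero member of least order; after division by its power of `t` all members
  -- are integral and the pivot is a unit.
  obtain ⟨i, hi, hmin⟩ := Finset.exists_min_image (Finset.univ.filter fun i => f i ≠ 0)
    (fun i => (f i).order) (by obtain ⟨i, hi⟩ := hf; exact ⟨i, by simpa using hi⟩)
  have hi' : f i ≠ 0 := by simpa using hi
  have h : ∀ j, OrdGe (f i).order (f j) := by
    intro j
    by_cases hj : f j = 0
    · rw [hj]
      exact OrdGe.zero _
    · have := hmin j (by simpa using hj)
      exact fun n hn => HahnSeries.coeff_eq_zero_of_lt_order (by omega)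
  choose p hp using fun j => ordGe_iff.1 (h j)
  refine ⟨(f i).order, p, i, ?_, hp⟩
  obtain ⟨w, hw⟩ := exists_eq_single_mul_unit hi'
  have h1 := (hp i).symm.trans hw
  have h2 : HahnSeries.ofPowerSeries ℤ K (p i) = HahnSeries.ofPowerSeries ℤ K w := by
    refine mul_left_cancel₀ ?_ h1
    exact HahnSeries.single_ne_zero one_ne_zero
  rw [HahnSeries.ofPowerSeries_injective h2]
  exact w.isUnit

/-- Lower triangular unipotent matrices. -/
def lowerGL {B : Type*} [CommRing B] (x : B) : GL (Fin 2) B where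
  val := !![1, 0; x, 1]
  inv := !![1, 0; -x, 1]
  val_inv := by
    ext i j
    fin_cases i <;> fin_cases j <;> simp
  inv_val := by
    ext i j
    fin_cases i <;> fin_cases j <;> simp

/-- The permutation matrix of order two. -/
def swapGL (B : Type*) [CommRing B] : GL (Fin 2) B where
  val := !![0, 1; 1, 0]
  inv := !![0, 1; 1, 0]
  val_inv := by
    ext i j
    fin_cases i <;> fin_cases j <;> simp
  inv_val := by
    ext i j
    fin_cases i <;> fin_cases j <;> simp

local notation "ps" => HahnSeries.ofPowerSeries ℤ ℂ
local notation "tt" n => (HahnSeries.single (n : ℤ) (1 : ℂ) : ℂ⸨X⸩)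

lemma glInt_val (A : GL (Fin 2) ℂ⟦X⟧) (i j : Fin 2) : (glInt ℂ A).val i j = ps (A.val i j) := rfl

/-- Elementary divisors of a `2 × 2` matrix. -/
lemma exists_elementary_divisors (M : GL (Fin 2) ℂ⸨X⸩) :
    ∃ (A k : GL (Fin 2) ℂ⟦X⟧) (p q : ℤ), q ≤ p ∧
      glInt ℂ A * M * glInt ℂ k = diagUnit ![tpow p, tpow q] := by
  obtain ⟨q, f, ⟨i, j⟩, hf, hM⟩ := exists_pivot (fun x : Fin 2 × Fin 2 => M.val x.1 x.2) (by
    by_contra! h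
    have : M.val = 0 := by exact Matrix.ext fun i j => h (i, j)
    exact M.ne_zero this)
  -- move the pivot to the last place
  obtain ⟨A₁, hA₁⟩ : ∃ A : GL (Fin 2) ℂ⟦X⟧, ∀ N : Matrix (Fin 2) (Fin 2) ℂ⸨X⸩,
      ∀ l, ((glInt ℂ A).val * N) 1 l = N i l := by
    fin_cases i
    · exact ⟨swapGL _, fun N l => by simp [Matrix.mul_apply, swapGL]⟩
    · exact ⟨1, fun N l => by rw [map_one, Units.val_one, Matrix.one_mul]; rfl⟩
  obtain ⟨k₁, hk₁⟩ : ∃ k : GL (Fin 2) ℂ⟦X⟧, ∀ N : Matrix (Fin 2) (Fin 2) ℂ⸨X⸩,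
      ∀ l, (N * (glInt ℂ k).val) l 1 = N l j := by
    fin_cases j
    · exact ⟨swapGL _, fun N l => by simp [Matrix.mul_apply, swapGL]⟩
    · exact ⟨1, fun N l => by rw [map_one, Units.val_one, Matrix.mul_one]; rfl⟩
  have hMq : OrdGeM q M.val := fun a b => ordGe_iff.2 ⟨_, hM (a, b)⟩
  have hM₁ : OrdGeM q (glInt ℂ A₁ * M * glInt ℂ k₁).val := by
    have := ((ordGeM_ofPowerSeries A₁.val).mul hMq).mul (ordGeM_ofPowerSeries k₁.val)
    exact this.mono (by omega)
  have h11 : (glInt ℂ A₁ * M * glInt ℂ k₁).val 1 1 = (tt q) * ps (f (i, j)) := by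
    change ((glInt ℂ A₁).val * M.val * (glInt ℂ k₁).val) 1 1 = _
    rw [hk₁, hA₁, ← hM]
  generalize hM' : glInt ℂ A₁ * M * glInt ℂ k₁ = M' at *
  obtain ⟨w, hw⟩ := hf.exists_right_inv
  obtain ⟨x, hx⟩ := ordGe_iff.1 (hM₁ 0 0)
  obtain ⟨y, hy⟩ := ordGe_iff.1 (hM₁ 0 1)
  obtain ⟨z, hz⟩ := ordGe_iff.1 (hM₁ 1 0)
  have hw1 : ps (f (i, j)) * ps w = 1 := by rw [← map_mul, hw, map_one]
  -- The unit pivot, with inverse `w`, clears its row and column; what remains in the other corner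
  -- is the Schur complement `x - y w z`.
  have hM2 : (glInt ℂ (upperGL (-(y * w))) * M' * glInt ℂ (lowerGL (-(z * w)))).val =
      !![(tt q) * ps (x - y * w * z), 0; 0, (tt q) * ps (f (i, j))] := by
    refine Matrix.ext fun a b => ?_
    have e : M'.val = !![M'.val 0 0, M'.val 0 1; M'.val 1 0, M'.val 1 1] := by
      refine Matrix.ext fun a b => ?_
      fin_cases a <;> fin_cases b <;> rfl
    change ((glInt ℂ (upperGL (-(y * w)))).val * M'.val *
      (glInt ℂ (lowerGL (-(z * w)))).val) a b = _
    rw [e, hx, hy, hz, h11]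
    fin_cases a <;> fin_cases b <;>
      simp [Matrix.mul_apply, upperGL, lowerGL]
    · linear_combination ((tt q) * ps y * ps w * ps z) * hw1
    · linear_combination (-(tt q) * ps y) * hw1
    · linear_combination (-(tt q) * ps z) * hw1
  generalize upperGL (-(y * w)) = A₂ at *
  generalize lowerGL (-(z * w)) = k₂ at *
  generalize x - y * w * z = d at *
  have hd : ps d ≠ 0 := by
    intro h
    have h1 := congrArg Units.val (mul_inv_cancel (glInt ℂ A₂ * M' * glInt ℂ k₂))
    have h2 := congrFun (congrFun h1 0) 0
    rw [Units.val_mul, hM2, h, Matrix.mul_apply, Fin.sum_univ_two] at h2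
    simp at h2
  obtain ⟨w', hw'⟩ := exists_eq_single_mul_unit hd
  have hm : 0 ≤ (ps d).order := by
    by_contra hc
    exact HahnSeries.coeff_order_eq_zero.not.2 hd (coeff_ofPowerSeries_neg d (by omega))
  generalize (ps d).order = m at *
  -- Column scaling removes the unit parts of the two diagonal entries. The exponents differ by `m`,
  -- the order of an integral series, whence the required inequality.
  refine ⟨A₂ * A₁, k₁ * k₂ * diagUnit ![w'⁻¹, (Units.mkOfMulEqOne _ _ hw)⁻¹], q + m, q,
    by omega, ?_⟩
  have h3 : glInt ℂ (A₂ * A₁) * M * glInt ℂ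
      (k₁ * k₂ * diagUnit ![w'⁻¹, (Units.mkOfMulEqOne _ _ hw)⁻¹]) =
      glInt ℂ A₂ * M' * glInt ℂ k₂ *
        glInt ℂ (diagUnit ![w'⁻¹, (Units.mkOfMulEqOne _ _ hw)⁻¹]) := by
    rw [← hM']
    simp only [map_mul, mul_assoc]
  refine h3.trans (Units.ext ?_)
  rw [Units.val_mul, hM2, hw']
  have hw2 : ps (w' : ℂ⟦X⟧) * ps ((w'⁻¹ : ℂ⟦X⟧ˣ) : ℂ⟦X⟧) = 1 := by
    rw [← map_mul, Units.mul_inv, map_one]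
  have e : (glInt ℂ (diagUnit ![w'⁻¹, (Units.mkOfMulEqOne _ _ hw)⁻¹])).val =
      !![ps ((w'⁻¹ : ℂ⟦X⟧ˣ) : ℂ⟦X⟧), 0; 0, ps w] := by
    refine Matrix.ext fun a b => ?_
    rw [glInt_val]
    fin_cases a <;> fin_cases b
    · rfl
    · exact map_zero _
    · exact map_zero _
    · rfl
  rw [e]
  generalize ps ((w'⁻¹ : ℂ⟦X⟧ˣ) : ℂ⟦X⟧) = v at *
  have e2 : (diagUnit ![tpow (q + m), tpow q] : GL (Fin 2) ℂ⸨X⸩).val =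
      !![(tt q) * (tt m), 0; 0, tt q] := by
    refine Matrix.ext fun a b => ?_
    fin_cases a <;> fin_cases b <;> simp [diagUnit, tpow]
  rw [e2]
  refine Matrix.ext fun a b => ?_
  fin_cases a <;> fin_cases b <;> simp [Matrix.mul_apply, -HahnSeries.single_mul_single]
  · linear_combination ((tt q) * (tt m)) * hw2
  · linear_combination (tt q) * hw1

/-- Normal form of a matrix up to column operations and scalars. -/
lemma exists_hermite (Y : GL (Fin 2) ℂ⸨X⸩) : ∃ (s : ℤ) (w : ℂ⟦X⟧ˣ)
    (k : GL (Fin 2) ℂ⟦X⟧) (x v : ℤ), v ≤ x ∧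
      (scalarGL (tpow s) * Y * glInt ℂ k).val = !![tt x, (tt v) * ps w; 0, 1] := by
  obtain ⟨q, f, j, hf, hY⟩ := exists_pivot (fun j : Fin 2 => Y.val 1 j) (by
    by_contra! h
    have h1 := congrFun (congrFun (Units.mul_inv Y) 1) 1
    rw [Matrix.mul_apply, Fin.sum_univ_two, h, h] at h1
    simp at h1)
  obtain ⟨k₁, hk₁⟩ : ∃ k : GL (Fin 2) ℂ⟦X⟧, ∀ N : Matrix (Fin 2) (Fin 2) ℂ⸨X⸩,
      ∀ l, (N * (glInt ℂ k).val) l 1 = N l j := by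
    fin_cases j
    · exact ⟨swapGL _, fun N l => by simp [Matrix.mul_apply, swapGL]⟩
    · exact ⟨1, fun N l => by rw [map_one, Units.val_one, Matrix.mul_one]; rfl⟩
  obtain ⟨w, hw⟩ := hf.exists_right_inv
  have hw1 : ps (f j) * ps w = 1 := by rw [← map_mul, hw, map_one]
  have h11 : (Y * glInt ℂ k₁).val 1 1 = (tt q) * ps (f j) := by
    change (Y.val * (glInt ℂ k₁).val) 1 1 = _
    rw [hk₁]
    exact hY j
  obtain ⟨z, hz⟩ : ∃ z, (Y * glInt ℂ k₁).val 1 0 = (tt q) * ps z := by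
    refine ordGe_iff.1 ?_
    change OrdGe q ((Y.val * (glInt ℂ k₁).val) 1 0)
    rw [Matrix.mul_apply]
    refine OrdGe.sum fun l _ => ?_
    rw [show Y.val 1 l = _ from hY l, mul_assoc, glInt_val, ← map_mul]
    exact ordGe_iff.2 ⟨_, rfl⟩
  generalize hY' : Y * glInt ℂ k₁ = Y' at *
  have hdet := congrArg Matrix.det (congrArg Units.val (mul_inv_cancel Y'))
  rw [Units.val_mul, Matrix.det_mul, Units.val_one, Matrix.det_one, Matrix.det_fin_two,
    h11, hz] at hdet
  -- Otherwise the column operation would produce a zero first column and the determinant would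
  -- vanish.
  have hα : (tt (-q)) * (Y'.val 0 0 - Y'.val 0 1 * ps (z * w)) ≠ 0 := by
    intro h
    have h0 := (mul_eq_zero.1 h).resolve_left (HahnSeries.single_ne_zero one_ne_zero)
    have h1 : Y'.val 0 0 * ((tt q) * ps (f j)) - Y'.val 0 1 * ((tt q) * ps z) = 0 := by
      have h2 : ps z = ps (z * w) * ps (f j) := by
        rw [map_mul, mul_assoc, mul_comm (ps w), hw1, mul_one]
      rw [h2]
      linear_combination ((tt q) * ps (f j)) * h0
    rw [h1, zero_mul] at hdet
    exact zero_ne_one hdet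
  obtain ⟨w', hw'⟩ := exists_eq_single_mul_unit hα
  generalize ((tt (-q)) * (Y'.val 0 0 - Y'.val 0 1 * ps (z * w))).order = x at *
  have hw2 : ps (w' : ℂ⟦X⟧) * ps ((w'⁻¹ : ℂ⟦X⟧ˣ) : ℂ⟦X⟧) = 1 := by
    rw [← map_mul, Units.mul_inv, map_one]
  have e : (glInt ℂ (diagUnit ![w'⁻¹, (Units.mkOfMulEqOne _ _ hw)⁻¹])).val =
      !![ps ((w'⁻¹ : ℂ⟦X⟧ˣ) : ℂ⟦X⟧), 0; 0, ps w] := by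
    refine Matrix.ext fun a b => ?_
    rw [glInt_val]
    fin_cases a <;> fin_cases b
    · rfl
    · exact map_zero _
    · exact map_zero _
    · rfl
  have htq : (tt (-q)) * (tt q) = 1 := by simp
  have key : (scalarGL (tpow (-q)) * Y * glInt ℂ (k₁ * lowerGL (-(z * w)) *
      diagUnit ![w'⁻¹, (Units.mkOfMulEqOne _ _ hw)⁻¹])).val =
      !![tt x, (tt (-q)) * Y'.val 0 1 * ps w; 0, 1] := by
    have h3 : scalarGL (tpow (-q)) * Y * glInt ℂ (k₁ * lowerGL (-(z * w)) *
      diagUnit ![w'⁻¹, (Units.mkOfMulEqOne _ _ hw)⁻¹]) = scalarGL (tpow (-q)) * (Y' *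
        glInt ℂ (lowerGL (-(z * w))) *
          glInt ℂ (diagUnit ![w'⁻¹, (Units.mkOfMulEqOne _ _ hw)⁻¹])) := by
      rw [← hY']
      simp only [map_mul, mul_assoc]
    rw [h3, Units.val_mul, Units.val_mul, Units.val_mul, e]
    have e1 : Y'.val = !![Y'.val 0 0, Y'.val 0 1; (tt q) * ps z, (tt q) * ps (f j)] := by
      rw [← h11, ← hz]
      refine Matrix.ext fun a b => ?_
      fin_cases a <;> fin_cases b <;> rfl
    have e2 : (scalarGL (tpow (-q)) : GL (Fin 2) ℂ⸨X⸩).val = !![tt (-q), 0; 0, tt (-q)] := by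
      refine Matrix.ext fun a b => ?_
      fin_cases a <;> fin_cases b <;> rfl
    have e3 : (glInt ℂ (lowerGL (-(z * w)))).val = !![1, 0; -(ps (z * w)), 1] := by
      refine Matrix.ext fun a b => ?_
      rw [glInt_val]
      fin_cases a <;> fin_cases b <;> simp [lowerGL]
    rw [e1, e2, e3]
    generalize Y'.val 0 0 = y₀ at *
    generalize Y'.val 0 1 = y₁ at *
    generalize ps ((w'⁻¹ : ℂ⟦X⟧ˣ) : ℂ⟦X⟧) = v at *
    rw [map_mul] at *
    generalize (tt q) = tq at *
    generalize (tt (-q)) = tq' at *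
    generalize (tt x) = tx at *
    refine Matrix.ext fun a b => ?_
    fin_cases a <;> fin_cases b <;> simp [Matrix.mul_apply]
    · linear_combination v * hw' + tx * hw2
    · ring
    · right
      left
      linear_combination (-tq * ps z) * hw1
    · linear_combination (tq' * tq) * hw1 + htq
  generalize k₁ * lowerGL (-(z * w)) *
      diagUnit ![w'⁻¹, (Units.mkOfMulEqOne _ _ hw)⁻¹] = k at *
  generalize (tt (-q)) * Y'.val 0 1 * ps w = β at *
  -- If `β` is divisible by `t^(x+1)`, adding the first column to the second turns it into `t^x`
  -- times a unit, so `v = x`; otherwise `v` is the order of `β`, which is at most `x`.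
  by_cases hβ : OrdGe (x + 1) β
  · obtain ⟨p, rfl⟩ := ordGe_iff.1 hβ
    have hu : IsUnit (1 + PowerSeries.X * p) := by
      rw [PowerSeries.isUnit_iff_constantCoeff]
      simp
    obtain ⟨u, hu⟩ := hu
    refine ⟨-q, u, k * upperGL 1, x, x, le_rfl, ?_⟩
    rw [map_mul, ← mul_assoc, Units.val_mul, key, hu]
    have e3 : (glInt ℂ (upperGL 1)).val = !![1, 1; 0, 1] := by
      refine Matrix.ext fun a b => ?_
      rw [glInt_val]
      fin_cases a <;> fin_cases b <;> simp [upperGL]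
    have e4 : (tt (x + 1)) = (tt x) * ps PowerSeries.X := by
      rw [HahnSeries.ofPowerSeries_X, HahnSeries.single_mul_single, mul_one]
    rw [e3, e4]
    refine Matrix.ext fun a b => ?_
    fin_cases a <;> fin_cases b <;> simp [Matrix.mul_apply, -HahnSeries.single_mul_single]
    ring
  · have hβ0 : β ≠ 0 := by
      rintro rfl
      exact hβ (OrdGe.zero _)
    obtain ⟨u, hu⟩ := exists_eq_single_mul_unit hβ0
    refine ⟨-q, u, k, x, β.order, ?_, ?_⟩
    · by_contra hc
      exact hβ fun n hn => HahnSeries.coeff_eq_zero_of_lt_order (by omega)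
    · rw [key, ← hu]

lemma pairOrbit_eq_of_val {X Y X' Y' : GL (Fin 2) ℂ⸨X⸩} (A k₀ k₁ : GL (Fin 2) ℂ⟦X⟧) (s : ℤ)
    (hX : (glInt ℂ A).val * X.val = (tt s) • (X'.val * (glInt ℂ k₀).val))
    (hY : (glInt ℂ A).val * Y.val = (tt s) • (Y'.val * (glInt ℂ k₁).val)) :
    pairOrbit X Y = pairOrbit X' Y' := by
  have hs : ∀ N : Matrix (Fin 2) (Fin 2) ℂ⸨X⸩, (scalarGL (tpow s)).val * N = (tt s) • N := by
    intro N
    rw [Matrix.smul_eq_diagonal_mul]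
    rfl
  rw [← pairOrbit_left A, ← pairOrbit_right k₀ k₁ X', ← pairOrbit_scalar (tpow s) (X' * _)]
  congr 1
  · exact Units.ext (by rw [Units.val_mul, Units.val_mul, Units.val_mul, hs, hX])
  · exact Units.ext (by rw [Units.val_mul, Units.val_mul, Units.val_mul, hs, hY])

/-- Every pair of matrices is equivalent to one of the representatives. -/
lemma exists_coordinates_pair (X Y : GL (Fin 2) ℂ⸨X⸩) : ∃ n a b r : ℤ, 0 ≤ n ∧ 0 ≤ r ∧ b ≤ a ∧
    pairOrbit X Y = pairOrbit (repX ℂ n a b) (repY ℂ n r) := by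
  -- Once `X` is diagonal, `Y` is normalized by column operations and a common scalar, which keep
  -- `X` diagonal.
  obtain ⟨A, k, p₀, q₀, hpq₀, hX⟩ := exists_elementary_divisors X
  obtain ⟨s, w, k', x, v, hvx, hY⟩ := exists_hermite (glInt ℂ A * Y)
  have h1 : pairOrbit X Y = pairOrbit (scalarGL (tpow s) * (glInt ℂ A * X * glInt ℂ k))
      (scalarGL (tpow s) * (glInt ℂ A * Y) * glInt ℂ k') := by
    rw [← pairOrbit_left A, ← pairOrbit_right k k', ← pairOrbit_scalar (tpow s)]
    simp only [mul_assoc]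
  have hX' : (scalarGL (tpow s) * (glInt ℂ A * X * glInt ℂ k)).val =
      !![tt (s + p₀), 0; 0, tt (s + q₀)] := by
    rw [hX]
    refine Matrix.ext fun a b => ?_
    fin_cases a <;> fin_cases b <;> simp [scalarGL, diagUnit, tpow]
  rw [h1]
  generalize scalarGL (tpow s) * (glInt ℂ A * X * glInt ℂ k) = X₁ at *
  generalize scalarGL (tpow s) * (glInt ℂ A * Y) * glInt ℂ k' = Y₁ at *
  obtain ⟨p, hp⟩ : ∃ p, p = s + p₀ := ⟨_, rfl⟩
  obtain ⟨q, hq⟩ : ∃ q, q = s + q₀ := ⟨_, rfl⟩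
  rw [← hp, ← hq] at hX'
  have hpq : q ≤ p := by omega
  clear hp hq h1 hX
  -- make the upper right entry a power of `t`
  have hw2 : ps (w : ℂ⟦X⟧) * ps ((w⁻¹ : ℂ⟦X⟧ˣ) : ℂ⟦X⟧) = 1 := by
    rw [← map_mul, Units.mul_inv, map_one]
  have e : ∀ z : ℂ⟦X⟧ˣ, (glInt ℂ (diagUnit ![z, 1])).val = !![ps (z : ℂ⟦X⟧), 0; 0, 1] := by
    intro z
    refine Matrix.ext fun a b => ?_
    rw [glInt_val]
    fin_cases a <;> fin_cases b
    · rfl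
    · exact map_zero _
    · exact map_zero _
    · exact map_one _
  obtain ⟨Y₂, hY₂⟩ : ∃ Y₂ : GL (Fin 2) ℂ⸨X⸩, Y₂.val = !![tt x, tt v; 0, 1] := by
    refine ⟨glInt ℂ (diagUnit ![w⁻¹, 1]) * Y₁ * glInt ℂ (diagUnit ![w, 1]), ?_⟩
    rw [Units.val_mul, Units.val_mul, hY, e, e]
    generalize ps ((w⁻¹ : ℂ⟦X⟧ˣ) : ℂ⟦X⟧) = z at *
    refine Matrix.ext fun a b => ?_
    fin_cases a <;> fin_cases b <;> simp [Matrix.mul_apply]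
    · linear_combination (tt x) * hw2
    · linear_combination (tt v) * hw2
  -- The common left factor `diag(w⁻¹, 1)` commutes with the diagonal `X₁` and is absorbed on the
  -- right.
  have h2 : pairOrbit X₁ Y₁ = pairOrbit X₁ Y₂ := by
    refine pairOrbit_eq_of_val (diagUnit ![w⁻¹, 1]) (diagUnit ![w⁻¹, 1]) (diagUnit ![w⁻¹, 1]) 0
      ?_ ?_
    · rw [hX', e]
      refine Matrix.ext fun a b => ?_
      fin_cases a <;> fin_cases b <;> simp [Matrix.mul_apply]
      ring
    · rw [hY, hY₂, e]
      generalize ps ((w⁻¹ : ℂ⟦X⟧ˣ) : ℂ⟦X⟧) = z at *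
      refine Matrix.ext fun a b => ?_
      fin_cases a <;> fin_cases b <;> simp [Matrix.mul_apply]
      · ring
      · linear_combination (tt v) * hw2
  rw [h2]
  clear h2 hY Y₁ e hw2
  have eU : ∀ {z : ℂ⟦X⟧}, (glInt ℂ (upperGL z)).val = !![1, ps z; 0, 1] := by
    intro z
    refine Matrix.ext fun a b => ?_
    rw [glInt_val]
    fin_cases a <;> fin_cases b <;> simp [upperGL]
  have eL : ∀ {z : ℂ⟦X⟧}, (glInt ℂ (lowerGL z)).val = !![1, 0; ps z, 1] := by
    intro z
    refine Matrix.ext fun a b => ?_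
    rw [glInt_val]
    fin_cases a <;> fin_cases b <;> simp [lowerGL]
  have e1 : (glInt ℂ 1).val = 1 := by rw [map_one]; rfl
  have int : ∀ {n : ℤ}, 0 ≤ n → ∃ z : ℂ⟦X⟧, (tt n) = ps z := fun {n} hn =>
    ordGe_zero_iff.1 (ordGe_single hn 1)
  rcases le_or_gt 0 v with hv | hv
  · rcases le_or_gt v (p - q) with hvm | hvm
    -- For `0 ≤ v ≤ p - q` the pair is a representative as it stands.
    · refine ⟨v, p - v, q, x - v, hv, by omega, by omega, pairOrbit_eq_of_val 1 1 1 0 ?_ ?_⟩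
      · rw [hX', e1, repX_val]
        simp
      · rw [hY₂, e1, repY_val]
        simp
    -- For `v > p - q`, adding `t^(p-q) - t^v` times the second row to the first replaces `t^v` by
    -- `t^(p-q)`; in `X` the change is an integral multiple of `t^p`, undone by a column operation.
    · obtain ⟨z₁, hz₁⟩ := int (n := p - q) (by omega)
      obtain ⟨z₂, hz₂⟩ := int (n := v) (by omega)
      obtain ⟨z₃, hz₃⟩ := int (n := v - (p - q)) (by omega)
      refine ⟨p - q, q, q, x - (p - q), by omega, by omega, le_rfl, pairOrbit_eq_of_val
        (upperGL (z₁ - z₂)) (upperGL (1 - z₃)) 1 0 ?_ ?_⟩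
      · rw [hX', eU, eU, repX_val, map_sub, map_sub, ← hz₁, ← hz₂, ← hz₃]
        refine Matrix.ext fun a b => ?_
        fin_cases a <;> fin_cases b <;> simp [Matrix.mul_apply, sub_mul, mul_sub]
        ring_nf
      · rw [hY₂, eU, e1, repY_val, map_sub, ← hz₁, ← hz₂]
        refine Matrix.ext fun a b => ?_
        fin_cases a <;> fin_cases b <;> simp [Matrix.mul_apply]
  -- For `v < 0`, adding `1 - t^(-v)` times the first row to the second makes the second column of
  -- `Y` equal to `t^v (1, 1)`; the scalar `t^v` is divided out, so `n = 0`.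
  · obtain ⟨z₁, hz₁⟩ := int (n := -v) (by omega)
    obtain ⟨z₂, hz₂⟩ := int (n := x - v) (by omega)
    obtain ⟨z₃, hz₃⟩ := int (n := p - q) (by omega)
    refine ⟨0, p - v, q - v, x - 2 * v, le_rfl, by omega, by omega, pairOrbit_eq_of_val
      (lowerGL (1 - z₁)) (lowerGL ((1 - z₁) * z₃)) (lowerGL ((1 - z₁) * z₂)) v ?_ ?_⟩
    · rw [hX', eL, eL, repX_val, map_mul, map_sub, ← hz₁, ← hz₃, map_one]
      refine Matrix.ext fun a b => ?_
      fin_cases a <;> fin_cases b <;> simp [Matrix.mul_apply, sub_mul, mul_sub]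
      ring_nf
    · rw [hY₂, eL, eL, repY_val, map_mul, map_sub, ← hz₁, ← hz₂, map_one]
      refine Matrix.ext fun a b => ?_
      fin_cases a <;> fin_cases b <;> simp [Matrix.mul_apply, sub_mul, mul_sub, mul_add]
      all_goals ring_nf

end LeviOrbits

/-! ### Iwasawa decomposition -/

section Iwasawa

variable {B : Type*} [CommRing B]

lemma transpose_mul_gram_mul_apply (M : Matrix (Fin 6) (Fin 6) B) (i j : Fin 6) :
    (Mᵀ * gram B * M) i j = M 0 i * M 5 j + M 1 i * M 4 j + M 2 i * M 3 j - M 3 i * M 2 j -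
      M 4 i * M 1 j - M 5 i * M 0 j := by
  simp [Matrix.mul_apply, Fin.sum_univ_succ, gram]
  ring

lemma gram_mul_gram : gram B * gram B = -1 := by
  ext i j
  fin_cases i <;> fin_cases j <;> simp [Matrix.mul_apply, Fin.sum_univ_succ, gram]

lemma gram_transpose : (gram B)ᵀ = -gram B := by
  ext i j
  fin_cases i <;> fin_cases j <;> simp [gram]

lemma GSp.exists_multiplier (M : GSp B) :
    ∃ ν : Bˣ, M.1.1ᵀ * gram B * M.1.1 = (ν : B) • gram B := M.2

/-- The rows of a symplectic similitude. -/
lemma mul_gram_mul_transpose {M : GSp B} {ν : Bˣ}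
    (h : M.1.1ᵀ * gram B * M.1.1 = (ν : B) • gram B) :
    M.1.1 * gram B * M.1.1ᵀ = (ν : B) • gram B := by
  have h1 : (-((ν⁻¹ : Bˣ) : B) • (gram B * M.1.1ᵀ * gram B)) * M.1.1 = 1 := by
    rw [Matrix.smul_mul, Matrix.mul_assoc, Matrix.mul_assoc, ← Matrix.mul_assoc M.1.1ᵀ, h,
      Matrix.mul_smul, gram_mul_gram, smul_smul, neg_mul, Units.inv_mul, neg_smul, one_smul,
      neg_neg]
  have h2 := mul_eq_one_comm.1 h1
  have h3 : M.1.1 * (gram B * M.1.1ᵀ * gram B) = -(ν : B) • 1 := by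
    rw [← h2, Matrix.mul_smul, smul_smul, neg_mul_neg, Units.mul_inv, one_smul]
  have h4 : gram B * M.1.1ᵀ * gram B * gram B = -(gram B * M.1.1ᵀ) := by
    rw [Matrix.mul_assoc _ (gram B) (gram B), gram_mul_gram, Matrix.mul_neg, Matrix.mul_one]
  rw [Matrix.mul_assoc, ← neg_neg (gram B * M.1.1ᵀ), ← h4, Matrix.mul_neg, ← Matrix.mul_assoc, h3,
    Matrix.smul_mul, Matrix.one_mul, neg_smul, neg_neg]

lemma mul_gram_mul_transpose_apply (M : Matrix (Fin 6) (Fin 6) B) (i j : Fin 6) :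
    (M * gram B * Mᵀ) i j = M i 0 * M j 5 + M i 1 * M j 4 + M i 2 * M j 3 - M i 3 * M j 2 -
      M i 4 * M j 1 - M i 5 * M j 0 := by
  simp [Matrix.mul_apply, Fin.sum_univ_succ, gram]
  ring

/-- An element of `GSp(6)` which is block upper triangular lies in `U L`. -/
lemma exists_unip_mul_leviPair {M : GSp B} (hM : BlockUpper 0 M.1.1) :
    ∃ u ∈ unip B, ∃ x, M = u * leviPair B x := by
  -- block upper triangular elements whose first two diagonal blocks are trivial are unipotent
  have key : ∀ u : GSp B, BlockUpper 0 u.1.1 → block u.1.1 0 0 = 1 → block u.1.1 1 1 = 1 →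
      u ∈ unip B := by
    intro u hu h0 h1
    obtain ⟨ν, hν⟩ := GSp.exists_multiplier u
    have hp : ∀ i j, u.1.1 0 i * u.1.1 5 j + u.1.1 1 i * u.1.1 4 j + u.1.1 2 i * u.1.1 3 j -
        u.1.1 3 i * u.1.1 2 j - u.1.1 4 i * u.1.1 1 j - u.1.1 5 i * u.1.1 0 j =
          ν * gram B i j := fun i j => by
      rw [← transpose_mul_gram_mul_apply, hν]
      rfl
    have e00 : u.1.1 0 0 = 1 := congrFun (congrFun h0 0) 0
    have e01 : u.1.1 0 1 = 0 := congrFun (congrFun h0 0) 1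
    have e10 : u.1.1 1 0 = 0 := congrFun (congrFun h0 1) 0
    have e11 : u.1.1 1 1 = 1 := congrFun (congrFun h0 1) 1
    have e22 : u.1.1 2 2 = 1 := congrFun (congrFun h1 0) 0
    have e23 : u.1.1 2 3 = 0 := congrFun (congrFun h1 0) 1
    have e32 : u.1.1 3 2 = 0 := congrFun (congrFun h1 1) 0
    have e33 : u.1.1 3 3 = 1 := congrFun (congrFun h1 1) 1
    have z : ∀ i j : Fin 6, j.val / 2 < i.val / 2 → u.1.1 i j = 0 := hu
    have hν1 : (ν : B) = 1 := by
      have := hp 2 3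
      rw [e22, e33, e23, e32, z 4 2 (by decide), z 5 2 (by decide), z 4 3 (by decide),
        z 5 3 (by decide)] at this
      simpa [gram] using this.symm
    -- Column `0` of `u` is a basis vector, so pairing it with column `j` reads off the entry `(5,
    -- j)`; row `4` is obtained in the same way from column `1`.
    have e5 : ∀ j, u.1.1 5 j = gram B 0 j := by
      intro j
      have := hp 0 j
      rw [e00, e10, z 2 0 (by decide), z 3 0 (by decide), z 4 0 (by decide), z 5 0 (by decide),
        hν1] at this
      simpa using this
    have e4 : ∀ j, u.1.1 4 j = gram B 1 j := by
      intro j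
      have := hp 1 j
      rw [e01, e11, z 2 1 (by decide), z 3 1 (by decide), z 4 1 (by decide), z 5 1 (by decide),
        hν1] at this
      simpa using this
    rw [mem_unip_iff]
    refine blockUpper_of_block fun b b' h => ?_
    rcases (Nat.lt_succ_iff.1 h).lt_or_eq with h | h
    · exact (hu.add ((blockUpper_one).smul (-1))).block_eq_zero (b := b) (b' := b') h |>.symm ▸ by
        rw [neg_smul, one_smul, sub_eq_add_neg]
    · obtain rfl : b' = b := Fin.ext h
      refine Matrix.ext fun p q => ?_
      fin_cases b' <;> fin_cases p <;> fin_cases q <;>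
        simp [block, bidx, e00, e01, e10, e11, e22, e23, e32, e33, e4, e5, gram]
  obtain ⟨ν, hν⟩ := GSp.exists_multiplier M
  have hp : ∀ i j, M.1.1 0 i * M.1.1 5 j + M.1.1 1 i * M.1.1 4 j + M.1.1 2 i * M.1.1 3 j -
      M.1.1 3 i * M.1.1 2 j - M.1.1 4 i * M.1.1 1 j - M.1.1 5 i * M.1.1 0 j =
        ν * gram B i j := fun i j => by
    rw [← transpose_mul_gram_mul_apply, hν]
    rfl
  have z : ∀ i j : Fin 6, j.val / 2 < i.val / 2 → M.1.1 i j = 0 := hM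
  have hQ : IsUnit (block M.1.1 1 1).det := by
    have := hp 2 3
    rw [z 4 2 (by decide), z 5 2 (by decide), z 4 3 (by decide), z 5 3 (by decide)] at this
    have h2 : (block M.1.1 1 1).det = ν := by
      rw [Matrix.det_fin_two]
      change M.1.1 2 2 * M.1.1 3 3 - M.1.1 2 3 * M.1.1 3 2 = ν
      simp [gram] at this
      linear_combination this
    rw [h2]
    exact ν.isUnit
  have hP : IsUnit (block M.1.1 0 0).det := by
    have h : ∀ i j : Fin 6, i.val < 2 → M.1.1 0 i * M.1.1 5 j + M.1.1 1 i * M.1.1 4 j =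
        ν * gram B i j := by
      intro i j hi
      have := hp i j
      rw [z 2 i (by fin_cases i <;> simp_all), z 3 i (by fin_cases i <;> simp_all),
        z 4 i (by fin_cases i <;> simp_all), z 5 i (by fin_cases i <;> simp_all)] at this
      linear_combination this
    -- The form pairs the first block with the third one, with values `ν` times a permutation
    -- matrix, so the determinants multiply to `ν²`.
    have h2 : (block M.1.1 0 0).det * (block M.1.1 2 2).det = (ν : B) * ν := by
      have h05 := h 0 5 (by decide)
      have h04 := h 0 4 (by decide)
      have h15 := h 1 5 (by decide)
      have h14 := h 1 4 (by decide)
      rw [Matrix.det_fin_two, Matrix.det_fin_two]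
      change (M.1.1 0 0 * M.1.1 1 1 - M.1.1 0 1 * M.1.1 1 0) *
        (M.1.1 4 4 * M.1.1 5 5 - M.1.1 4 5 * M.1.1 5 4) = _
      have g05 : gram B 0 5 = 1 := rfl
      have g04 : gram B 0 4 = 0 := rfl
      have g15 : gram B 1 5 = 0 := rfl
      have g14 : gram B 1 4 = 1 := rfl
      rw [g05] at h05
      rw [g04] at h04
      rw [g15] at h15
      rw [g14] at h14
      linear_combination (M.1.1 0 1 * M.1.1 5 4 + M.1.1 1 1 * M.1.1 4 4) * h05 -
        (M.1.1 0 1 * M.1.1 5 5 + M.1.1 1 1 * M.1.1 4 5) * h04 + ν * h14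
    exact isUnit_of_mul_isUnit_left (h2 ▸ ν.isUnit.mul ν.isUnit)
  let x : GL (Fin 2) B × GL (Fin 2) B :=
    (Matrix.nonsingInvUnit _ hP, Matrix.nonsingInvUnit _ hQ)
  have hx0 : x.1.val = block M.1.1 0 0 := rfl
  have hx1 : x.2.val = block M.1.1 1 1 := rfl
  refine ⟨M * (leviPair B x)⁻¹, key _ ?_ ?_ ?_, x, by rw [inv_mul_cancel_right]⟩
  · rw [← map_inv]
    exact hM.mul (blockUpper_leviPair _)
  · rw [← map_inv, GSp.coe_mul, hM.block_mul_self (blockUpper_leviPair _), block_leviPair_zero,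
      ← hx0]
    exact Units.mul_inv _
  · rw [← map_inv, GSp.coe_mul, hM.block_mul_self (blockUpper_leviPair _), block_leviPair_one,
      ← hx1]
    exact Units.mul_inv _

/-- The symplectic form on row vectors. -/
def rowForm (x y : Fin 6 → B) : B :=
  x 0 * y 5 + x 1 * y 4 + x 2 * y 3 - x 3 * y 2 - x 4 * y 1 - x 5 * y 0

lemma rowForm_add_left (x x' y : Fin 6 → B) :
    rowForm (x + x') y = rowForm x y + rowForm x' y := by
  simp only [rowForm, Pi.add_apply]
  ring

lemma rowForm_smul_left (c : B) (x y : Fin 6 → B) : rowForm (c • x) y = c * rowForm x y := by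
  simp only [rowForm, Pi.smul_apply, smul_eq_mul]
  ring

lemma rowForm_self (x : Fin 6 → B) : rowForm x x = 0 := by
  simp only [rowForm]
  ring

lemma rowForm_sub_right (x y z : Fin 6 → B) :
    rowForm x (y - z) = rowForm x y - rowForm x z := by
  simp only [rowForm, Pi.sub_apply]
  ring

/-- The matrix of the symplectic transvection `x ↦ x + c ⟨x, v⟩ v` of row vectors. -/
def transvectionMatrix (c : B) (v : Fin 6 → B) : Matrix (Fin 6) (Fin 6) B :=
  1 + c • Matrix.vecMulVec (gram B *ᵥ v) v

lemma vecMul_transvectionMatrix (c : B) (x v : Fin 6 → B) :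
    x ᵥ* transvectionMatrix c v = x + (c * rowForm x v) • v := by
  rw [transvectionMatrix, Matrix.vecMul_add, Matrix.vecMul_one, Matrix.vecMul_smul,
    Matrix.vecMul_vecMulVec, smul_smul]
  congr 3
  simp [dotProduct, Matrix.mulVec, Fin.sum_univ_succ, gram, rowForm]
  ring

/-- Since `v` is isotropic, the first transvection does not change the pairing with `v`, so the
coefficients add. -/
lemma transvectionMatrix_mul (c d : B) (v : Fin 6 → B) :
    transvectionMatrix c v * transvectionMatrix d v = transvectionMatrix (c + d) v := by
  refine Matrix.ext fun i j => ?_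
  have h : ∀ M N : Matrix (Fin 6) (Fin 6) B, (∀ x : Fin 6 → B, x ᵥ* M = x ᵥ* N) → M = N :=
    fun M N h => Matrix.ext fun i j => by
      have := congrFun (h (Pi.single i 1)) j
      simpa using this
  refine congrFun (congrFun (h _ _ fun x => ?_) i) j
  rw [← Matrix.vecMul_vecMul, vecMul_transvectionMatrix, vecMul_transvectionMatrix,
    vecMul_transvectionMatrix, rowForm_add_left, rowForm_smul_left, rowForm_self]
  ext l
  simp only [Pi.add_apply, Pi.smul_apply, smul_eq_mul]
  ring

/-- A symplectic transvection. -/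
def transvection (c : B) (v : Fin 6 → B) : GSp B :=
  ⟨⟨transvectionMatrix c v, transvectionMatrix (-c) v, by
    rw [transvectionMatrix_mul, add_neg_cancel]
    simp [transvectionMatrix], by
    rw [transvectionMatrix_mul, neg_add_cancel]
    simp [transvectionMatrix]⟩, 1, by
    change (transvectionMatrix c v)ᵀ * gram B * transvectionMatrix c v = _
    have h1 : (gram B *ᵥ v) ᵥ* gram B = v := by
      rw [← Matrix.vecMul_transpose, gram_transpose, Matrix.vecMul_vecMul, Matrix.neg_mul,
        gram_mul_gram, neg_neg, Matrix.vecMul_one]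
    have h2 : v ⬝ᵥ gram B *ᵥ v = 0 := by
      simp [dotProduct, Matrix.mulVec, Fin.sum_univ_succ, gram]
      ring
    have h3 : (Matrix.vecMulVec (gram B *ᵥ v) v)ᵀ * gram B = Matrix.vecMulVec v v := by
      rw [Matrix.transpose_vecMulVec, Matrix.vecMulVec_mul, h1]
    have h4 : gram B * Matrix.vecMulVec (gram B *ᵥ v) v = -Matrix.vecMulVec v v := by
      rw [Matrix.mul_vecMulVec, Matrix.mulVec_mulVec, gram_mul_gram, Matrix.neg_mulVec,
        Matrix.one_mulVec, Matrix.neg_vecMulVec]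
    have h5 : Matrix.vecMulVec v v * Matrix.vecMulVec (gram B *ᵥ v) v = 0 := by
      rw [Matrix.vecMulVec_mul_vecMulVec, h2, zero_smul, Matrix.vecMulVec_zero]
    rw [transvectionMatrix, Matrix.transpose_add, Matrix.transpose_one, Matrix.transpose_smul,
      Units.val_one, one_smul, Matrix.add_mul, Matrix.one_mul, Matrix.smul_mul, h3,
      Matrix.mul_add, Matrix.mul_one, Matrix.add_mul, Matrix.mul_smul, Matrix.mul_smul, h4,
      Matrix.smul_mul, h5, smul_zero, smul_zero, smul_neg, add_zero, add_neg_cancel_right]⟩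

lemma vecMul_transvection (c : B) (x v : Fin 6 → B) :
    x ᵥ* (transvection c v).1.1 = x + (c * rowForm x v) • v :=
  vecMul_transvectionMatrix c x v

/-- A transvection moving `x` to `y`. -/
lemma exists_vecMul_eq {x y : Fin 6 → B} (h : IsUnit (rowForm x y)) :
    ∃ k : GSp B, x ᵥ* k.1.1 = y ∧
      (x 0 = y 0 → (Pi.single 5 1 : Fin 6 → B) ᵥ* k.1.1 = Pi.single 5 1) := by
  obtain ⟨d, hd⟩ := h.exists_left_inv
  -- With `d = ⟨x, y⟩⁻¹` the transvection along `y - x` sends `x` to `y`; it fixes the last basis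
  -- vector when that pairs trivially with `y - x`, that is, when `x₀ = y₀`.
  refine ⟨transvection d (y - x), ?_, fun h0 => ?_⟩
  · rw [vecMul_transvection, rowForm_sub_right, rowForm_self, sub_zero, hd, one_smul,
      add_sub_cancel]
  · rw [vecMul_transvection]
    have : rowForm (Pi.single 5 1 : Fin 6 → B) (y - x) = 0 := by
      simp [rowForm, h0]
    rw [this, mul_zero, zero_smul, add_zero]

/-- Over a local ring a primitive row vector can be moved to a basis vector. -/
lemma exists_vecMul_eq_single [IsLocalRing B] {x : Fin 6 → B} {i : Fin 6} (hi : IsUnit (x i))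
    (m : Fin 6) : ∃ k : GSp B, x ᵥ* k.1.1 = Pi.single m 1 ∧
      (m = 4 → x 0 = 0 → i ≠ 5 →
        (Pi.single 5 1 : Fin 6 → B) ᵥ* k.1.1 = Pi.single 5 1) := by
  -- An intermediate vector pairing to units with both `x` and `e_m` allows two transvections. It is
  -- the basis vector dual to `e_m`, to which the one dual to `e_i` is added if `x m` is not a unit.
  obtain ⟨z, hxz, hzm, hz0⟩ : ∃ z : Fin 6 → B, IsUnit (rowForm x z) ∧
      IsUnit (rowForm z (Pi.single m 1)) ∧ (m = 4 → i ≠ 5 → z 0 = 0) := by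
    have hs : ∀ j : Fin 6, ∀ x : Fin 6 → B, rowForm x (Pi.single (Fin.rev j) 1) = x j ∨
        rowForm x (Pi.single (Fin.rev j) 1) = -x j := by
      intro j x
      fin_cases j <;> simp [rowForm, Fin.rev]
    have hs' : ∀ j l : Fin 6, rowForm (Pi.single (Fin.rev j) 1 : Fin 6 → B) (Pi.single l 1) =
        if j = l then (if j.val < 3 then -1 else 1) else 0 := by
      intro j l
      fin_cases j <;> fin_cases l <;> simp [rowForm, Fin.rev]
    have hu : ∀ j : Fin 6, IsUnit (if j.val < 3 then (-1 : B) else 1) := by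
      intro j
      split_ifs
      · exact isUnit_one.neg
      · exact isUnit_one
    by_cases hm : IsUnit (x m)
    · refine ⟨Pi.single (Fin.rev m) 1, ?_, ?_, ?_⟩
      · rcases hs m x with h | h <;> rw [h]
        exacts [hm, hm.neg]
      · rw [hs', if_pos rfl]
        exact hu m
      · rintro rfl -
        rfl
    · have hne : i ≠ m := by
        rintro rfl
        exact hm hi
      refine ⟨Pi.single (Fin.rev m) 1 + Pi.single (Fin.rev i) 1, ?_, ?_, ?_⟩
      · have e : rowForm x (Pi.single (Fin.rev m) 1 + Pi.single (Fin.rev i) 1) =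
            rowForm x (Pi.single (Fin.rev m) 1) + rowForm x (Pi.single (Fin.rev i) 1) := by
          simp only [rowForm, Pi.add_apply]
          ring
        by_contra hc
        have h1 : ¬ IsUnit (rowForm x (Pi.single (Fin.rev m) 1)) := by
          rcases hs m x with h | h <;> rw [h]
          exacts [hm, fun h => hm (by simpa using h)]
        have h2 : rowForm x (Pi.single (Fin.rev i) 1) ∈ nonunits B := by
          have := IsLocalRing.nonunits_add (a := rowForm x (Pi.single (Fin.rev m) 1 +
            Pi.single (Fin.rev i) 1)) (b := -rowForm x (Pi.single (Fin.rev m) 1)) hc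
            (fun h => h1 (by simpa using h))
          rwa [e, add_neg_cancel_comm] at this
        apply h2
        rcases hs i x with h | h <;> rw [h]
        exacts [hi, hi.neg]
      · rw [rowForm_add_left, hs', hs', if_pos rfl, if_neg hne, add_zero]
        exact hu m
      · rintro rfl h5
        fin_cases i <;> simp_all [Fin.rev]
  obtain ⟨k₁, hk₁, hf₁⟩ := exists_vecMul_eq hxz
  obtain ⟨k₂, hk₂, hf₂⟩ := exists_vecMul_eq hzm
  refine ⟨k₁ * k₂, ?_, ?_⟩
  · rw [GSp.coe_mul, ← Matrix.vecMul_vecMul, hk₁, hk₂]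
  · intro hm hx0 h5
    have hz := hz0 hm h5
    rw [GSp.coe_mul, ← Matrix.vecMul_vecMul, hf₁ (by rw [hx0, hz]), hf₂]
    subst hm
    rw [hz]
    rfl

end Iwasawa

/-! ### Reduction of the last two rows over a field of Laurent series -/

section Iwasawa

variable {K : Type*} [Field K]

local notation "pk" => HahnSeries.ofPowerSeries ℤ K

lemma map_vecMul_ofInt (k : GSp K⟦X⟧) (x : Fin 6 → K⟦X⟧) :
    (fun j => pk (x j)) ᵥ* (GSp.ofInt K k).1.1 = fun j => pk ((x ᵥ* k.1.1) j) := by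
  funext j
  simp only [Matrix.vecMul, dotProduct, map_sum, map_mul]
  rfl

lemma mul_apply_eq_vecMul {B : Type*} [CommRing B] (M N : Matrix (Fin 6) (Fin 6) B) (i : Fin 6) :
    (M * N) i = M i ᵥ* N := by
  funext j
  rw [Matrix.mul_apply]
  rfl

/-- Iwasawa decomposition with respect to the stabilizer of `⟨v₁, v₂⟩`. -/
lemma exists_blockUpper_mul_ofInt (M : GSp K⸨X⸩) :
    ∃ k : GSp K⟦X⟧, BlockUpper 0 (M * GSp.ofInt K k).1.1 := by
  have hrow : ∀ (M : GSp K⸨X⸩) (i : Fin 6), ∃ j, M.1.1 i j ≠ 0 := by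
    intro M i
    by_contra! h
    have h1 := congrFun (congrFun (GSp.mul_inv_val M) i) i
    rw [Matrix.mul_apply, Finset.sum_eq_zero fun j _ => by rw [h j, zero_mul],
      Matrix.one_apply_eq] at h1
    exact zero_ne_one h1
  -- the last row
  obtain ⟨q, x, i, hi, hx⟩ := exists_pivot (M.1.1 5) (hrow M 5)
  obtain ⟨k₁, hk₁, -⟩ := exists_vecMul_eq_single hi 5
  have ht : HahnSeries.single q (1 : K) ≠ 0 := HahnSeries.single_ne_zero one_ne_zero
  have h5 : (M * GSp.ofInt K k₁).1.1 5 = HahnSeries.single q (1 : K) • Pi.single 5 1 := by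
    rw [GSp.coe_mul, mul_apply_eq_vecMul,
      show M.1.1 5 = HahnSeries.single q (1 : K) • fun j => pk (x j) from funext hx,
      Matrix.smul_vecMul, map_vecMul_ofInt, hk₁]
    congr 1
    funext j
    rw [Pi.single_apply, Pi.single_apply]
    split_ifs <;> simp
  generalize hN : M * GSp.ofInt K k₁ = N at *
  obtain ⟨ν, hν⟩ := GSp.exists_multiplier N
  -- The last two rows are orthogonal, and the last one is a multiple of a basis vector.
  have h40 : N.1.1 4 0 = 0 := by
    have h := mul_gram_mul_transpose_apply N.1.1 4 5
    rw [mul_gram_mul_transpose hν, h5] at h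
    simp [gram, ht] at h
    exact h
  -- the fifth row
  let r : Fin 6 → K⸨X⸩ := Function.update (N.1.1 4) 5 0
  -- The component along the last basis vector is set aside because the next factor fixes that
  -- vector. The rest is nonzero, as otherwise the last two rows would be proportional.
  obtain ⟨q', y, i', hi', hy⟩ := exists_pivot r (by
    by_contra! h
    have h' : ∀ j, j ≠ 5 → N.1.1 4 j = 0 := fun j hj => by
      simpa [r, hj] using h j
    have e1 := congrFun (congrFun (GSp.mul_inv_val N) 4) 4
    have e2 := congrFun (congrFun (GSp.mul_inv_val N) 5) 4
    rw [Matrix.mul_apply, h5, Finset.sum_eq_single 5 (fun j _ hj => by simp [hj]) (by simp)] at e2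
    rw [Matrix.mul_apply, Finset.sum_eq_single 5 (fun j _ hj => by rw [h' j hj, zero_mul])
      (by simp)] at e1
    generalize (N⁻¹).1.1 5 4 = z at *
    simp [ht] at e2
    rw [e2] at e1
    simp at e1)
  have ht' : HahnSeries.single q' (1 : K) ≠ 0 := HahnSeries.single_ne_zero one_ne_zero
  have hy0 : y 0 = 0 := by
    have h := hy 0
    rw [show r 0 = 0 from h40] at h
    refine HahnSeries.ofPowerSeries_injective (Γ := ℤ) ?_
    rw [map_zero]
    exact (mul_eq_zero.1 h.symm).resolve_left ht'
  have hi5 : i' ≠ 5 := by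
    rintro rfl
    have h := hy 5
    rw [show r 5 = 0 from Function.update_self _ _ _] at h
    have h0 : y 5 = 0 := by
      refine HahnSeries.ofPowerSeries_injective (Γ := ℤ) ?_
      rw [map_zero]
      exact (mul_eq_zero.1 h.symm).resolve_left ht'
    rw [h0] at hi'
    exact not_isUnit_zero hi'
  obtain ⟨k₂, hk₂, hf₂⟩ := exists_vecMul_eq_single hi' 4
  have hf := hf₂ rfl hy0 hi5
  have hfL : (Pi.single 5 1 : Fin 6 → K⸨X⸩) ᵥ* (GSp.ofInt K k₂).1.1 = Pi.single 5 1 := by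
    have e : (Pi.single 5 1 : Fin 6 → K⸨X⸩) = fun j => pk ((Pi.single 5 1 : Fin 6 → K⟦X⟧) j) := by
      funext j
      rw [Pi.single_apply, Pi.single_apply]
      split_ifs <;> simp
    rw [e, map_vecMul_ofInt, hf]
  refine ⟨k₁ * k₂, ?_⟩
  rw [map_mul, ← mul_assoc, hN]
  have g5 : (N * GSp.ofInt K k₂).1.1 5 = HahnSeries.single q (1 : K) • Pi.single 5 1 := by
    rw [GSp.coe_mul, mul_apply_eq_vecMul, h5, Matrix.smul_vecMul, hfL]
  have g4 : (N * GSp.ofInt K k₂).1.1 4 =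
      HahnSeries.single q' (1 : K) • Pi.single 4 1 + N.1.1 4 5 • Pi.single 5 1 := by
    have e : N.1.1 4 = (HahnSeries.single q' (1 : K) • fun j => pk (y j)) +
        N.1.1 4 5 • Pi.single 5 1 := by
      funext j
      rw [Pi.add_apply, Pi.smul_apply, smul_eq_mul, ← hy j]
      by_cases hj : j = 5
      · subst hj
        simp [r]
      · simp [r, hj]
    rw [GSp.coe_mul, mul_apply_eq_vecMul]
    conv_lhs => rw [e]
    rw [Matrix.add_vecMul, Matrix.smul_vecMul, Matrix.smul_vecMul, hfL, map_vecMul_ofInt, hk₂]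
    congr 2
    funext j
    rw [Pi.single_apply, Pi.single_apply]
    split_ifs <;> simp
  generalize N * GSp.ofInt K k₂ = P at *
  -- the rows three and four
  obtain ⟨μ, hμ⟩ := GSp.exists_multiplier P
  have z4 : ∀ j : Fin 6, j.val < 4 → P.1.1 4 j = 0 := by
    intro j hj
    rw [g4]
    fin_cases j <;> simp at hj ⊢
  have z5 : ∀ j : Fin 6, j.val < 4 → P.1.1 5 j = 0 := by
    intro j hj
    rw [g5]
    fin_cases j <;> simp at hj ⊢
  have hp : ∀ i j : Fin 6, i.val < 4 → j.val < 4 →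
      P.1.1 2 i * P.1.1 3 j - P.1.1 3 i * P.1.1 2 j = μ * gram K⸨X⸩ i j := by
    intro i j hi hj
    have h := transpose_mul_gram_mul_apply P.1.1 i j
    rw [hμ, z4 i hi, z5 i hi, z4 j hj, z5 j hj] at h
    rw [Matrix.smul_apply, smul_eq_mul] at h
    linear_combination -h
  have h23 := hp 2 3 (by decide) (by decide)
  have hg : gram K⸨X⸩ 2 3 = 1 := rfl
  -- On columns `0` to `3` only rows `2` and `3` contribute to the form. There columns `2` and `3`
  -- have determinant `μ`, so a column orthogonal to both vanishes in these rows.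
  have hz : ∀ j : Fin 6, j.val < 2 → P.1.1 2 j = 0 ∧ P.1.1 3 j = 0 := by
    intro j hj
    have h2 := hp j 2 (by omega) (by decide)
    have h3 := hp j 3 (by omega) (by decide)
    have g2 : gram K⸨X⸩ j 2 = 0 := by fin_cases j <;> simp [gram] at hj ⊢
    have g3 : gram K⸨X⸩ j 3 = 0 := by fin_cases j <;> simp [gram] at hj ⊢
    rw [g2] at h2
    rw [g3] at h3
    rw [hg] at h23
    constructor
    · have : (μ : K⸨X⸩) * P.1.1 2 j = 0 := by
        linear_combination P.1.1 2 2 * h3 - P.1.1 2 3 * h2 - P.1.1 2 j * h23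
      exact (mul_eq_zero.1 this).resolve_left μ.ne_zero
    · have : (μ : K⸨X⸩) * P.1.1 3 j = 0 := by
        linear_combination P.1.1 3 2 * h3 - P.1.1 3 3 * h2 - P.1.1 3 j * h23
      exact (mul_eq_zero.1 this).resolve_left μ.ne_zero
  intro i j hij
  fin_cases i
  · simp at hij
  · simp at hij
  · exact (hz j (by simp at hij; omega)).1
  · exact (hz j (by simp at hij; omega)).2
  · exact z4 j (by simp at hij; omega)
  · exact z5 j (by simp at hij; omega)

end Iwasawa

lemma exists_coordinates (y : Gr ℂ) : ∃ n a b r : ℤ, 0 ≤ n ∧ 0 ≤ r ∧ b ≤ a ∧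
    ∃ h ∈ H ℂ, h • Gr.mk (leviPair _ (repPair ℂ n a b r)) = y := by
  obtain ⟨M, rfl⟩ := exists_gr_mk y
  obtain ⟨k, hk⟩ := exists_blockUpper_mul_ofInt M
  obtain ⟨u, hu, ⟨X, Y⟩, hM⟩ := exists_unip_mul_leviPair hk
  obtain ⟨n, a, b, r, hn, hr, hab, h⟩ := exists_coordinates_pair X Y
  refine ⟨n, a, b, r, hn, hr, hab, ?_⟩
  have h1 : Gr.mk M = Gr.mk (u * leviPair _ (X, Y)) := by
    refine Gr.mk_eq_mk.2 ⟨1, k, ?_⟩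
    rw [← hM, Units.val_one, one_smul]
    rfl
  have hu' : PSp.mk u ∈ H ℂ := Subgroup.mem_sup_right ⟨u, hu, rfl⟩
  have h2 : Gr.mk M ∈ MulAction.orbit (H ℂ) (Gr.mk (leviPair _ (repPair ℂ n a b r))) := by
    change _ ∈ pairOrbit _ _
    rw [← h, pairOrbit, h1, ← Gr.smul_mk]
    exact ⟨⟨_, hu'⟩, rfl⟩
  obtain ⟨g, hg⟩ := h2
  exact ⟨g.1, g.2, hg⟩

theorem isFullSetOfRepresentatives_lDominant :
    IsFullSetOfRepresentatives {l | LDominant l} (fun _ => True) := by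
  refine ⟨fun _ _ => trivial, fun y _ => ?_⟩
  obtain ⟨n, a, b, r, hn, hr, hab, h, hh, hy⟩ := exists_coordinates y
  refine ⟨coweight n a b r, ⟨lDominant_iff.2 ⟨n, a, b, r, hn, hr, hab, rfl⟩, h, hh, ?_⟩, ?_⟩
  · rw [pt_coweight, hy]
  · rintro l ⟨hl, h', hh', hy'⟩
    obtain ⟨n', a', b', r', hn', hr', hab', rfl⟩ := lDominant_iff.1 hl
    rw [pt_coweight, ← hy] at hy'
    have h3 : (h⁻¹ * h') • Gr.mk (leviPair _ (repPair ℂ n' a' b' r')) =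
        Gr.mk (leviPair _ (repPair ℂ n a b r)) := by
      rw [mul_smul, hy', inv_smul_smul]
    obtain ⟨rfl, rfl, rfl, rfl⟩ := coordinates_unique hn' hr' hab' hn hr hab
      (mul_mem (inv_mem hh) hh') h3
    rfl

/-- A full set of representatives of the orbits with a given property. -/
lemma isFullSetOfRepresentatives_of_forall {Λ : Set (Fin 4 → ℚ)} {P : Gr ℂ → Prop}
    (hΛ : ∀ l ∈ Λ, LDominant l) (h1 : ∀ l ∈ Λ, P (pt l))
    (h2 : ∀ l, LDominant l → ∀ h ∈ H ℂ, P (h • pt l) → l ∈ Λ) :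
    IsFullSetOfRepresentatives Λ P := by
  refine ⟨h1, fun y hy => ?_⟩
  obtain ⟨l, ⟨hl, h, hh, rfl⟩, huniq⟩ := isFullSetOfRepresentatives_lDominant.2 y trivial
  exact ⟨l, ⟨h2 l hl h hh hy, h, hh, rfl⟩, fun l' hl' => huniq l' ⟨hΛ l' hl'.1, hl'.2⟩⟩

/-! ### Exponentials and powers of nilpotent elements -/

section Nilpotent

variable {R S : Type*} [CommRing R] [Algebra ℂ R] [CommRing S] [Algebra ℂ S]

/-- Any exponent killing `n` may replace the nilpotency class. This makes the truncated series
compatible with homomorphisms, which can lower the class. -/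
lemma sum_range_nilpotencyClass {n : R} {k : ℕ} (h : n ^ k = 0) (a : ℕ → ℂ) :
    ∑ i ∈ Finset.range (nilpotencyClass n), a i • n ^ i = ∑ i ∈ Finset.range k, a i • n ^ i := by
  refine Finset.sum_subset (Finset.range_subset_range.2 (csInf_le' h)) fun i _ hi => ?_
  rw [pow_eq_zero_of_le (by simpa using hi) (pow_nilpotencyClass ⟨k, h⟩), smul_zero]

lemma nilExp_eq_sum {n : R} {k : ℕ} (h : n ^ k = 0) :
    nilExp n = ∑ i ∈ Finset.range k, ((i.factorial : ℂ)⁻¹) • n ^ i :=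
  sum_range_nilpotencyClass h _

lemma nilExp_zero : nilExp (0 : R) = 1 := by
  rw [nilExp_eq_sum (k := 1) (by simp)]
  simp

lemma nilExp_eq_one_add {n : R} (h : n ^ 2 = 0) : nilExp n = 1 + n := by
  rw [nilExp_eq_sum h]
  simp [Finset.sum_range_succ]

lemma nilExp_add {a b : R} (ha : IsNilpotent a) (hb : IsNilpotent b) :
    nilExp (a + b) = nilExp a * nilExp b := by
  -- Through `ℂ` the ring becomes a `ℚ`-algebra, for which `nilExp` is the usual exponential of
  -- nilpotent elements.
  let _ : Algebra ℚ R := ((algebraMap ℂ R).comp (algebraMap ℚ ℂ)).toAlgebra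
  have key : ∀ x : R, nilExp x = IsNilpotent.exp x := by
    intro x
    refine Finset.sum_congr rfl fun i _ => ?_
    rw [Algebra.smul_def, Algebra.smul_def]
    congr 1
    change _ = algebraMap ℂ R (algebraMap ℚ ℂ _)
    simp
  rw [key, key, key, IsNilpotent.exp_add_of_commute (Commute.all a b) ha hb]

lemma map_nilExp (f : R →ₐ[ℂ] S) {n : R} (hn : IsNilpotent n) : f (nilExp n) = nilExp (f n) := by
  obtain ⟨k, hk⟩ := hn
  rw [nilExp_eq_sum hk, nilExp_eq_sum (k := k) (by rw [← map_pow, hk, map_zero]), map_sum]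
  simp

/-- The generalized binomial coefficient. -/
def binomialCoeff (κ : ℂ) (k : ℕ) : ℂ := (∏ i ∈ Finset.range k, (κ - i)) / (k.factorial : ℂ)

lemma binomialCoeff_eq_eval (κ : ℂ) (k : ℕ) : binomialCoeff κ k =
    (Polynomial.C ((k.factorial : ℂ)⁻¹) * descPochhammer ℂ k).eval κ := by
  rw [Polynomial.eval_mul, Polynomial.eval_C, descPochhammer_eval_eq_prod_range, binomialCoeff,
    div_eq_inv_mul]

lemma binomialCoeff_natCast (m k : ℕ) : binomialCoeff m k = m.choose k := by
  rw [binomialCoeff_eq_eval, Polynomial.eval_mul, Polynomial.eval_C,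
    descPochhammer_eval_eq_descFactorial, Nat.descFactorial_eq_factorial_mul_choose,
    Nat.cast_mul, inv_mul_cancel_left₀ (Nat.cast_ne_zero.2 (Nat.factorial_ne_zero k))]

lemma onePlusPow_eq_sum (κ : ℂ) {n : R} {k : ℕ} (h : n ^ k = 0) :
    onePlusPow κ n = ∑ i ∈ Finset.range k, binomialCoeff κ i • n ^ i :=
  sum_range_nilpotencyClass h _

lemma onePlusPow_zero (κ : ℂ) : onePlusPow κ (0 : R) = 1 := by
  rw [onePlusPow_eq_sum (k := 1) κ (by simp)]
  simp [binomialCoeff]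

lemma onePlusPow_eq_one_add (κ : ℂ) {n : R} (h : n ^ 2 = 0) : onePlusPow κ n = 1 + κ • n := by
  rw [onePlusPow_eq_sum κ h]
  simp [Finset.sum_range_succ, binomialCoeff]

lemma onePlusPow_natCast (m : ℕ) {n : R} (hn : IsNilpotent n) :
    onePlusPow (m : ℂ) n = (1 + n) ^ m := by
  obtain ⟨k, hk⟩ := hn
  have h1 : n ^ (k + m + 1) = 0 := pow_eq_zero_of_le (by omega) hk
  rw [onePlusPow_eq_sum _ h1, add_comm 1 n, add_pow]
  symm
  refine Finset.sum_subset_zero_on_sdiff (Finset.range_subset_range.2 (by omega)) ?_ ?_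
  · intro i hi
    rw [binomialCoeff_natCast, Nat.choose_eq_zero_of_lt (by simp at hi; omega), Nat.cast_zero,
      zero_smul]
  · intro i _
    rw [binomialCoeff_natCast, one_pow, mul_one, mul_comm, Nat.cast_smul_eq_nsmul, nsmul_eq_mul]

lemma map_onePlusPow (f : R →ₐ[ℂ] S) (κ : ℂ) {n : R} (hn : IsNilpotent n) :
    f (onePlusPow κ n) = onePlusPow κ (f n) := by
  obtain ⟨k, hk⟩ := hn
  rw [onePlusPow_eq_sum κ hk, onePlusPow_eq_sum κ (k := k) (by rw [← map_pow, hk, map_zero]),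
    map_sum]
  simp

/-- `onePlusPow κ n` is a polynomial function of `κ`. -/
lemma exists_polynomial_onePlusPow {n : R} (hn : IsNilpotent n) : ∃ P : Polynomial R,
    ∀ κ : ℂ, P.eval (algebraMap ℂ R κ) = onePlusPow κ n := by
  obtain ⟨k, hk⟩ := hn
  refine ⟨∑ i ∈ Finset.range k, (Polynomial.C ((i.factorial : ℂ)⁻¹) *
    descPochhammer ℂ i).map (algebraMap ℂ R) * Polynomial.C (n ^ i), fun κ => ?_⟩
  rw [onePlusPow_eq_sum κ hk, Polynomial.eval_finsetSum]
  refine Finset.sum_congr rfl fun i _ => ?_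
  rw [Polynomial.eval_mul, Polynomial.eval_C, Polynomial.eval_map_algebraMap,
    Polynomial.aeval_algebraMap_apply, Polynomial.coe_aeval_eq_eval, ← binomialCoeff_eq_eval,
    Algebra.smul_def]

/-- Linear functionals `R → ℂ` separate the coefficients, and each of them turns `P` into a complex
polynomial with all natural numbers as roots. -/
lemma polynomial_eq_zero_of_eval_natCast {P : Polynomial R} (h : ∀ m : ℕ, P.eval (m : R) = 0) :
    P = 0 := by
  ext i
  rw [Polynomial.coeff_zero, ← Module.forall_dual_apply_eq_zero_iff ℂ]
  intro φ
  have hq : (∑ j ∈ Finset.range (P.natDegree + 1), Polynomial.monomial j (φ (P.coeff j)) :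
      Polynomial ℂ) = 0 := by
    refine Polynomial.eq_zero_of_infinite_isRoot _
      ((Set.infinite_range_of_injective (Nat.cast_injective (R := ℂ))).mono ?_)
    rintro _ ⟨m, rfl⟩
    rw [Set.mem_ofPred_eq, Polynomial.IsRoot.def, Polynomial.eval_finsetSum]
    have := congrArg φ (h m)
    rw [Polynomial.eval_eq_sum_range, map_sum, map_zero] at this
    rw [← this]
    refine Finset.sum_congr rfl fun j _ => ?_
    rw [Polynomial.eval_monomial, mul_comm, ← smul_eq_mul, ← map_smul, Algebra.smul_def]
    simp [mul_comm]
  have h2 := congrArg (fun q => Polynomial.coeff q i) hq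
  simp only [Polynomial.finsetSum_coeff, Polynomial.coeff_monomial, Polynomial.coeff_zero] at h2
  by_cases hi : i ∈ Finset.range (P.natDegree + 1)
  · rwa [Finset.sum_ite_eq' _ i, if_pos hi] at h2
  · rw [Polynomial.coeff_eq_zero_of_natDegree_lt (by simpa using hi), map_zero]

/-- For natural exponents this is multiplicativity of powers. Both sides are polynomial in `κ`, and
an identity of polynomials valid at all natural numbers is valid at every `κ`. -/
lemma onePlusPow_mul (κ : ℂ) {a b : R} (ha : IsNilpotent a) (hb : IsNilpotent b) :
    onePlusPow κ (a + b + a * b) = onePlusPow κ a * onePlusPow κ b := by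
  have hab : IsNilpotent (a + b + a * b) :=
    (Commute.all _ _).isNilpotent_add ((Commute.all _ _).isNilpotent_add ha hb)
      ((Commute.all _ _).isNilpotent_mul_right ha)
  obtain ⟨P, hP⟩ := exists_polynomial_onePlusPow ha
  obtain ⟨Q, hQ⟩ := exists_polynomial_onePlusPow hb
  obtain ⟨W, hW⟩ := exists_polynomial_onePlusPow hab
  have h : W - P * Q = 0 := by
    refine polynomial_eq_zero_of_eval_natCast fun m => ?_
    have e : (m : R) = algebraMap ℂ R m := by simp
    rw [Polynomial.eval_sub, Polynomial.eval_mul, e, hP, hQ, hW, onePlusPow_natCast m ha,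
      onePlusPow_natCast m hb, onePlusPow_natCast m hab, ← mul_pow, sub_eq_zero]
    congr 1
    ring
  have h2 := congrArg (Polynomial.eval (algebraMap ℂ R κ)) h
  rwa [Polynomial.eval_sub, Polynomial.eval_mul, hP, hQ, hW, Polynomial.eval_zero,
    sub_eq_zero] at h2

/-- The comparison of the generators of the fibres of the D-modules `exp` and `m^κ`. -/
def transition (κ : ℂ) (d : R) (u : Rˣ) : R := nilExp d * onePlusPow κ ((u : R) - 1)

lemma transition_zero_one (κ : ℂ) : transition κ (0 : R) 1 = 1 := by
  rw [transition, Units.val_one, sub_self, nilExp_zero, onePlusPow_zero, one_mul]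

lemma transition_mul (κ : ℂ) {d d' : R} {u u' : Rˣ} (hd : IsNilpotent d) (hd' : IsNilpotent d')
    (hu : IsNilpotent ((u : R) - 1)) (hu' : IsNilpotent ((u' : R) - 1)) :
    transition κ (d + d') (u * u') = transition κ d u * transition κ d' u' := by
  have h : ((u * u' : Rˣ) : R) - 1 =
      ((u : R) - 1) + ((u' : R) - 1) + ((u : R) - 1) * ((u' : R) - 1) := by
    rw [Units.val_mul]
    ring
  rw [transition, h, nilExp_add hd hd', onePlusPow_mul κ hu hu', transition, transition,
    mul_mul_mul_comm]

lemma map_transition (f : R →ₐ[ℂ] S) (κ : ℂ) {d : R} {u : Rˣ} (hd : IsNilpotent d)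
    (hu : IsNilpotent ((u : R) - 1)) :
    f (transition κ d u) = transition κ (f d) (Units.map f.toRingHom.toMonoidHom u) := by
  rw [transition, transition, map_mul, map_nilExp f hd, map_onePlusPow f κ hu, map_sub, map_one]
  rfl

end Nilpotent

/-! ### Equivariant D-modules from equivariant functions -/

section Existence

lemma isNilpotent_iff_mk_eq_zero {R : Type} [CommRing R] {a : R} :
    IsNilpotent a ↔ Ideal.Quotient.mk (nilradical R) a = 0 := by
  rw [Ideal.Quotient.eq_zero_iff_mem, mem_nilradical]

/-- Crystals are evaluated at points over `Red R`, so equivariance of a function has to be required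
only over reduced rings. -/
instance {R : Type} [CommRing R] : IsReduced (Red R) := by
  refine ⟨fun x hx => ?_⟩
  obtain ⟨a, rfl⟩ := Ideal.Quotient.mk_surjective x
  obtain ⟨n, hn⟩ := hx
  rw [← map_pow, ← isNilpotent_iff_mk_eq_zero] at hn
  exact isNilpotent_iff_mk_eq_zero.1 (IsNilpotent.of_pow hn)

/-- The homomorphism from the units of `R` to those of its reduced quotient. -/
abbrev redUnits (R : Type) [CommRing R] : Rˣ →* (Red R)ˣ :=
  Units.map (Ideal.Quotient.mk (nilradical R)).toMonoidHom

lemma redUnits_eq_one_iff {R : Type} [CommRing R] {u : Rˣ} :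
    redUnits R u = 1 ↔ IsNilpotent ((u : R) - 1) := by
  rw [isNilpotent_iff_mk_eq_zero, map_sub, map_one, sub_eq_zero, Units.ext_iff]
  rfl

/-- If `a` and `b` lift inverse units, then `a b` is `1` plus a nilpotent element, hence `a` is
invertible. -/
lemma redUnits_surjective (R : Type) [CommRing R] : Function.Surjective (redUnits R) := by
  intro u
  obtain ⟨a, ha⟩ := Ideal.Quotient.mk_surjective (u : Red R)
  obtain ⟨b, hb⟩ := Ideal.Quotient.mk_surjective ((u⁻¹ : (Red R)ˣ) : Red R)
  have h : IsNilpotent (a * b - 1) := by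
    rw [isNilpotent_iff_mk_eq_zero, map_sub, map_mul, ha, hb, Units.mul_inv, map_one, sub_self]
  have h2 : IsUnit a := by
    have := h.isUnit_add_one
    rw [sub_add_cancel] at this
    exact isUnit_of_mul_isUnit_left this
  exact ⟨h2.unit, Units.ext ha⟩

lemma transition_inv_mul {R : Type} [CommRing R] [Algebra ℂ R] (κ : ℂ) {d : R} {u : Rˣ}
    (hd : IsNilpotent d) (hu : redUnits R u = 1) :
    transition κ (-d) u⁻¹ * transition κ d u = 1 := by
  rw [← transition_mul κ hd.neg hd (redUnits_eq_one_iff.1 (by rw [map_inv, hu, inv_one]))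
    (redUnits_eq_one_iff.1 hu), neg_add_cancel, inv_mul_cancel, transition_zero_one]

lemma mul_mul_mul_inv_mul {G : Type*} [CommGroup G] (m m' x x' x'' : G) :
    m' * m * x * x''⁻¹ = m' * x' * x''⁻¹ * (m * x * x'⁻¹) := by
  have h : ∀ m m' x x' x'' : Additive G,
    m' + m + x + -x'' = m' + x' + -x'' + (m + x + -x') := by intros; abel
  exact h m m' x x' x''

lemma mul_mul_inv_mul_mul_inv {G : Type*} [CommGroup G] (m x y x' y' : G) :
    m * x' * y'⁻¹ * (x * x'⁻¹) = m * x * y⁻¹ * (y * y'⁻¹) := by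
  have h : ∀ m x y x' y' : Additive G,
    m + x' + -y' + (x + -x') = m + x + -y + (y + -y') := by intros; abel
  exact h m x y x' y'

variable {𝒳 : Space} (κ : ℂ) (c : ∀ {S : Type} [CommRing S] [Algebra ℂ S], 𝒳.Pt S → S)
  (μ : ∀ {S : Type} [CommRing S] [Algebra ℂ S], 𝒳.Pt S → Sˣ)

/-- A lift of the value of `c` to `R`. -/
def liftAdd {R : Type} [CommRing R] [Algebra ℂ R] (x : 𝒳.Pt (Red R)) : R :=
  (Ideal.Quotient.mk_surjective (c x)).choose

/-- A lift of the value of `μ` to `Rˣ`. -/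
def liftMul {R : Type} [CommRing R] [Algebra ℂ R] (x : 𝒳.Pt (Red R)) : Rˣ :=
  (redUnits_surjective R (μ x)).choose

lemma mk_liftAdd {R : Type} [CommRing R] [Algebra ℂ R] (x : 𝒳.Pt (Red R)) :
    Ideal.Quotient.mk (nilradical R) (liftAdd c x) = c x :=
  (Ideal.Quotient.mk_surjective (c x)).choose_spec

lemma redUnits_liftMul {R : Type} [CommRing R] [Algebra ℂ R] (x : 𝒳.Pt (Red R)) :
    redUnits R (liftMul μ x) = μ x :=
  (redUnits_surjective R (μ x)).choose_spec

lemma Red.map_mk {R R' : Type} [CommRing R] [Algebra ℂ R] [CommRing R'] [Algebra ℂ R']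
    (f : R →ₐ[ℂ] R') (a : R) : Red.map f (Ideal.Quotient.mk (nilradical R) a) =
      Ideal.Quotient.mk (nilradical R') (f a) := rfl

/-- Functoriality of the units. -/
abbrev mapUnits {R R' : Type} [CommRing R] [Algebra ℂ R] [CommRing R'] [Algebra ℂ R']
    (f : R →ₐ[ℂ] R') : Rˣ →* R'ˣ := Units.map f.toRingHom.toMonoidHom

lemma redUnits_mapUnits {R R' : Type} [CommRing R] [Algebra ℂ R] [CommRing R'] [Algebra ℂ R']
    (f : R →ₐ[ℂ] R') (u : Rˣ) :
    redUnits R' (mapUnits f u) = mapUnits (Red.map f) (redUnits R u) := rfl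

variable (hc : ∀ {S S' : Type} [CommRing S] [Algebra ℂ S] [CommRing S'] [Algebra ℂ S']
    (f : S →ₐ[ℂ] S') (x : 𝒳.Pt S), c (𝒳.map f x) = f (c x))
  (hμ : ∀ {S S' : Type} [CommRing S] [Algebra ℂ S] [CommRing S'] [Algebra ℂ S']
    (f : S →ₐ[ℂ] S') (x : 𝒳.Pt S), μ (𝒳.map f x) = mapUnits f (μ x))
  (hrel : ∀ {S : Type} [CommRing S] [Algebra ℂ S] [IsReduced S] (k : H S) (m : Sˣ)
    (x x' : 𝒳.Pt S), 𝒳.Rel k m x x' → chi k + c x = c x' ∧ m * μ x = μ x')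

/-- The D-module `c^*(exp) ⊗ μ^κ` given by an equivariant function `(c, μ)`. -/
def functionDModule : EquivariantDModule 𝒳 κ where
  fib R _ _ _ := ModuleCat.of R R
  -- The generator of a fibre depends on the chosen lifts of `c` and `μ`; the factor `transition`
  -- compares the images of the lifts at `x` with the lifts at `x'`.
  bc {R R'} _ _ _ _ f x x' _ :=
    { toFun := fun a => f a * transition κ (f (liftAdd c x) - liftAdd c x')
        (mapUnits f (liftMul μ x) * (liftMul μ x')⁻¹)
      map_add' := fun a b => by rw [map_add, add_mul]
      map_smul' := fun a b => by
        change f (a * b) * _ = f a * (f b * _)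
        rw [map_mul, mul_assoc] }
  bc_universal {R R'} _ _ _ _ f x x' h N φ := by
    have hd : IsNilpotent (f (liftAdd c x) - liftAdd c x') := by
      rw [isNilpotent_iff_mk_eq_zero, map_sub, ← Red.map_mk, mk_liftAdd, mk_liftAdd, ← hc, h,
        sub_self]
    have hu : redUnits R' (mapUnits f (liftMul μ x) * (liftMul μ x')⁻¹) = 1 := by
      rw [map_mul, map_inv, redUnits_mapUnits, redUnits_liftMul, redUnits_liftMul, ← hμ, h,
        mul_inv_cancel]
    have hi := transition_inv_mul κ hd hu
    set τ := transition κ (f (liftAdd c x) - liftAdd c x')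
        (mapUnits f (liftMul μ x) * (liftMul μ x')⁻¹)
    set τ' := transition κ (-(f (liftAdd c x) - liftAdd c x'))
        (mapUnits f (liftMul μ x) * (liftMul μ x')⁻¹)⁻¹
    let v : R := 1
    have hφ : ∀ a : R, φ a = f a • φ v := fun a => by
      have := map_smulₛₗ φ a v
      rw [show a • v = a from mul_one a] at this
      exact this
    -- The inverse `τ'` of the transition factor corrects the image of the generator.
    refine ⟨LinearMap.toSpanSingleton R' N (τ' • φ v), fun a => ?_, fun ψ hψ => ?_⟩
    · change (f a * τ) • τ' • φ v = φ a
      rw [hφ a, smul_smul, mul_assoc, mul_comm τ, hi, mul_one]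
    · refine LinearMap.ext_ring ?_
      rw [LinearMap.toSpanSingleton_apply, one_smul, ← hψ, ← map_smul]
      refine congrArg ψ ?_
      change 1 = τ' * (f 1 * τ)
      rw [map_one f, one_mul, hi]
  bc_id {R} _ _ x h v := by
    change v * transition κ (liftAdd c x - liftAdd c x) (mapUnits (AlgHom.id ℂ R) (liftMul μ x) *
      (liftMul μ x)⁻¹) = v
    have : mapUnits (AlgHom.id ℂ R) (liftMul μ x) = liftMul μ x := Units.ext rfl
    rw [this, sub_self, mul_inv_cancel, transition_zero_one, mul_one]
  bc_comp {R R' R''} _ _ _ _ _ _ f g x x' x'' h h' h'' v := by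
    have hd : IsNilpotent (f (liftAdd c x) - liftAdd c x') := by
      rw [isNilpotent_iff_mk_eq_zero, map_sub, ← Red.map_mk, mk_liftAdd, mk_liftAdd, ← hc, h,
        sub_self]
    have hu : redUnits R' (mapUnits f (liftMul μ x) * (liftMul μ x')⁻¹) = 1 := by
      rw [map_mul, map_inv, redUnits_mapUnits, redUnits_liftMul, redUnits_liftMul, ← hμ, h,
        mul_inv_cancel]
    have hd' : IsNilpotent (g (liftAdd c x') - liftAdd c x'') := by
      rw [isNilpotent_iff_mk_eq_zero, map_sub, ← Red.map_mk, mk_liftAdd, mk_liftAdd, ← hc, h',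
        sub_self]
    have hu' : redUnits R'' (mapUnits g (liftMul μ x') * (liftMul μ x'')⁻¹) = 1 := by
      rw [map_mul, map_inv, redUnits_mapUnits, redUnits_liftMul, redUnits_liftMul, ← hμ, h',
        mul_inv_cancel]
    have hgu : redUnits R'' (mapUnits g (mapUnits f (liftMul μ x) * (liftMul μ x')⁻¹)) = 1 := by
      rw [redUnits_mapUnits, hu, map_one]
    change g (f v) * transition κ _ _ = g (f v * transition κ _ _) * transition κ _ _
    rw [map_mul, map_transition g κ hd (redUnits_eq_one_iff.1 hu), mul_assoc]
    congr 1
    refine Eq.trans ?_ (transition_mul κ (hd.map g) hd' (redUnits_eq_one_iff.1 hgu)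
      (redUnits_eq_one_iff.1 hu'))
    congr 1
    · change g (f _) - _ = _
      rw [map_sub]
      ring
    · rw [map_mul, map_inv]
      refine Units.ext ?_
      rw [← mul_assoc, inv_mul_cancel_right]
      rfl
  act {R} _ _ k a m x x' _ _ := transition κ (a + liftAdd c x - liftAdd c x')
    (m * liftMul μ x * (liftMul μ x')⁻¹) • LinearMap.id
  act_one {R} _ _ x _ _ v := by
    change transition κ (0 + _ - _) (1 * _ * _) * v = v
    rw [zero_add, sub_self, one_mul, mul_inv_cancel, transition_zero_one, one_mul]
  act_mul {R} _ _ k k' a a' m m' x x' x'' hχ hx hχ' hx' hχ'' hx'' v := by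
    obtain ⟨e1, e2⟩ := hrel _ _ _ _ hx
    obtain ⟨e1', e2'⟩ := hrel _ _ _ _ hx'
    rw [chi_eq hχ] at e1
    rw [chi_eq hχ'] at e1'
    have hd : IsNilpotent (a + liftAdd c x - liftAdd c x') := by
      rw [isNilpotent_iff_mk_eq_zero, map_sub, map_add, mk_liftAdd, mk_liftAdd, e1, sub_self]
    have hd' : IsNilpotent (a' + liftAdd c x' - liftAdd c x'') := by
      rw [isNilpotent_iff_mk_eq_zero, map_sub, map_add, mk_liftAdd, mk_liftAdd, e1', sub_self]
    have hu : redUnits R (m * liftMul μ x * (liftMul μ x')⁻¹) = 1 := by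
      rw [map_mul, map_mul, map_inv, redUnits_liftMul, redUnits_liftMul, e2, mul_inv_cancel]
    have hu' : redUnits R (m' * liftMul μ x' * (liftMul μ x'')⁻¹) = 1 := by
      rw [map_mul, map_mul, map_inv, redUnits_liftMul, redUnits_liftMul, e2', mul_inv_cancel]
    change transition κ _ _ * v = transition κ _ _ * (transition κ _ _ * v)
    rw [← mul_assoc, ← transition_mul κ hd' hd (redUnits_eq_one_iff.1 hu')
      (redUnits_eq_one_iff.1 hu)]
    congr 2
    · ring
    · exact mul_mul_mul_inv_mul _ _ _ _ _
  act_lift {R} _ _ k a n m m' n' x x' hχ hx hχ' hx' v hn hn' hm := by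
    obtain ⟨e1, e2⟩ := hrel _ _ _ _ hx
    rw [chi_eq hχ] at e1
    have hd : IsNilpotent (a + liftAdd c x - liftAdd c x') := by
      rw [isNilpotent_iff_mk_eq_zero, map_sub, map_add, mk_liftAdd, mk_liftAdd, e1, sub_self]
    have hu : redUnits R (m * liftMul μ x * (liftMul μ x')⁻¹) = 1 := by
      rw [map_mul, map_mul, map_inv, redUnits_liftMul, redUnits_liftMul, e2, mul_inv_cancel]
    have hm' : ((m' * m⁻¹ : Rˣ) : R) - 1 = n' := by
      rw [Units.val_mul, hm, mul_right_comm, Units.mul_inv]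
      ring
    change transition κ _ _ * v = (nilExp n * onePlusPow κ n') * (transition κ _ _ * v)
    rw [← mul_assoc]
    congr 1
    rw [← hm']
    refine Eq.trans ?_ (transition_mul κ hn hd (by rwa [hm']) (redUnits_eq_one_iff.1 hu))
    congr 1
    · ring
    · simp only [mul_assoc, inv_mul_cancel_left]
  act_bc {R R'} _ _ _ _ f k a m x₁ x₂ x₁' x₂' h₁ h₂ hχ hx hχ' hx' v := by
    obtain ⟨e1, e2⟩ := hrel _ _ _ _ hx
    obtain ⟨e1', e2'⟩ := hrel _ _ _ _ hx'
    rw [chi_eq hχ] at e1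
    rw [chi_eq hχ'] at e1'
    have hd : IsNilpotent (a + liftAdd c x₁ - liftAdd c x₂) := by
      rw [isNilpotent_iff_mk_eq_zero, map_sub, map_add, mk_liftAdd, mk_liftAdd, e1, sub_self]
    have hu : redUnits R (m * liftMul μ x₁ * (liftMul μ x₂)⁻¹) = 1 := by
      rw [map_mul, map_mul, map_inv, redUnits_liftMul, redUnits_liftMul, e2, mul_inv_cancel]
    have hd' : IsNilpotent (f a + liftAdd c x₁' - liftAdd c x₂') := by
      rw [isNilpotent_iff_mk_eq_zero, map_sub, map_add, mk_liftAdd, mk_liftAdd, e1', sub_self]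
    have hu' : redUnits R' (mapUnits f m * liftMul μ x₁' * (liftMul μ x₂')⁻¹) = 1 := by
      rw [map_mul, map_mul, map_inv, redUnits_liftMul, redUnits_liftMul]
      exact mul_inv_eq_one.2 e2'
    have hb : ∀ (x : 𝒳.Pt (Red R)) (x' : 𝒳.Pt (Red R')), 𝒳.map (Red.map f) x = x' →
        IsNilpotent (f (liftAdd c x) - liftAdd c x') ∧
        IsNilpotent (((mapUnits f (liftMul μ x) * (liftMul μ x')⁻¹ : R'ˣ) : R') - 1) := by
      intro x x' h
      constructor
      · rw [isNilpotent_iff_mk_eq_zero, map_sub, ← Red.map_mk, mk_liftAdd, mk_liftAdd, ← hc, h,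
          sub_self]
      · rw [← redUnits_eq_one_iff, map_mul, map_inv, redUnits_mapUnits, redUnits_liftMul,
          redUnits_liftMul, ← hμ, h, mul_inv_cancel]
    have hfu : redUnits R' (mapUnits f (m * liftMul μ x₁ * (liftMul μ x₂)⁻¹)) = 1 := by
      rw [redUnits_mapUnits, hu, map_one]
    change transition κ _ _ * (f v * transition κ _ _) = f (transition κ _ _ * v) *
      transition κ _ _
    rw [map_mul, map_transition f κ hd (redUnits_eq_one_iff.1 hu)]
    refine (mul_left_comm _ _ _).trans (Eq.trans (congrArg (f v * ·) ?_)
      ((mul_left_comm _ _ _).trans (mul_assoc _ _ _).symm))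
    refine (transition_mul κ hd' (hb _ _ h₁).1 (redUnits_eq_one_iff.1 hu')
      (hb _ _ h₁).2).symm.trans ?_
    refine Eq.trans ?_ (transition_mul κ (hd.map f) (hb _ _ h₂).1
      (redUnits_eq_one_iff.1 hfu) (hb _ _ h₂).2)
    congr 1
    · rw [map_sub, map_add]
      ring
    · change mapUnits f m * _ * _ * _ = mapUnits f _ * _
      rw [map_mul, map_mul, map_inv]
      exact mul_mul_inv_mul_mul_inv _ _ _ _ _

lemma exists_nonzero_equivariantDModule (y : 𝒳.Pt (Red ℂ))
    (hc : ∀ {S S' : Type} [CommRing S] [Algebra ℂ S] [CommRing S'] [Algebra ℂ S']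
      (f : S →ₐ[ℂ] S') (x : 𝒳.Pt S), c (𝒳.map f x) = f (c x))
    (hμ : ∀ {S S' : Type} [CommRing S] [Algebra ℂ S] [CommRing S'] [Algebra ℂ S']
      (f : S →ₐ[ℂ] S') (x : 𝒳.Pt S), μ (𝒳.map f x) = mapUnits f (μ x))
    (hrel : ∀ {S : Type} [CommRing S] [Algebra ℂ S] [IsReduced S] (k : H S) (m : Sˣ)
      (x x' : 𝒳.Pt S), 𝒳.Rel k m x x' → chi k + c x = c x' ∧ m * μ x = μ x') :
    ∃ F : EquivariantDModule 𝒳 κ, F.Nonzero :=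
  ⟨functionDModule κ c μ hc hμ hrel, ℂ, inferInstance, inferInstance, y,
    inferInstanceAs (Nontrivial ℂ)⟩

end Existence

/-! ### Vanishing of equivariant D-modules -/

section Vanishing

/-- The ring of functions of the test family. -/
local notation "𝒢" => LaurentPolynomial ℂ

/-- The dual numbers over the ring of functions of the test family. -/
local notation "𝒟" => TrivSqZeroExt (LaurentPolynomial ℂ) (LaurentPolynomial ℂ)

/-- The derivation `T d/dT` of the ring of Laurent polynomials, as a homomorphism to the dual
numbers. -/
def eulerHom : 𝒢 →ₐ[ℂ] 𝒟 :=
  AddMonoidAlgebra.lift ℂ _ ℤ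
    { toFun := fun n => TrivSqZeroExt.inl (LaurentPolynomial.T n.toAdd) +
        TrivSqZeroExt.inr ((n.toAdd : ℂ) • LaurentPolynomial.T n.toAdd)
      map_one' := by
        ext1 <;> simp [LaurentPolynomial.T_zero]
      map_mul' := fun m n => by
        rw [toAdd_mul, LaurentPolynomial.T_add]
        refine TrivSqZeroExt.ext ?_ ?_
        · simp [-LaurentPolynomial.T_mul]
        · simp [-LaurentPolynomial.T_mul, add_smul, mul_comm, add_comm] }

lemma eulerHom_T (n : ℤ) : eulerHom (LaurentPolynomial.T n) =
    TrivSqZeroExt.inl (LaurentPolynomial.T n) +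
      TrivSqZeroExt.inr ((n : ℂ) • LaurentPolynomial.T n) := by
  rw [eulerHom, LaurentPolynomial.T, AddMonoidAlgebra.lift_single, one_smul]
  rfl

/-- The derivation `T d/dT`. -/
def euler (p : 𝒢) : 𝒢 := (eulerHom p).snd

lemma euler_T (n : ℤ) : euler (LaurentPolynomial.T n) = (n : ℂ) • LaurentPolynomial.T n := by
  rw [euler, eulerHom_T]
  simp

lemma fst_eulerHom (p : 𝒢) : (eulerHom p).fst = p := by
  induction p using LaurentPolynomial.induction_on' with
  | add p q hp hq => rw [map_add, TrivSqZeroExt.fst_add, hp, hq]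
  | C_mul_T n a =>
    rw [← LaurentPolynomial.smul_eq_C_mul, map_smul, eulerHom_T]
    simp

lemma eulerHom_eq (p : 𝒢) :
    eulerHom p = TrivSqZeroExt.inl p + TrivSqZeroExt.inr (euler p) := by
  ext1
  · simp [fst_eulerHom]
  · simp [euler]

lemma coeff_euler (p : 𝒢) (n : ℤ) : (euler p).coeff n = n * p.coeff n := by
  induction p using LaurentPolynomial.induction_on' with
  | add p q hp hq =>
    have : euler (p + q) = euler p + euler q := by simp [euler]
    rw [this, AddMonoidAlgebra.coeff_add, AddMonoidAlgebra.coeff_add, Finsupp.add_apply,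
      Finsupp.add_apply, hp, hq, mul_add]
  | C_mul_T m a =>
    have : euler (LaurentPolynomial.C a * LaurentPolynomial.T m) =
        a • (m : ℂ) • LaurentPolynomial.T m := by
      rw [← LaurentPolynomial.smul_eq_C_mul, euler, map_smul, TrivSqZeroExt.snd_smul]
      exact congrArg (a • ·) (euler_T m)
    rw [this, ← LaurentPolynomial.smul_eq_C_mul,
      show (LaurentPolynomial.T m : 𝒢) = AddMonoidAlgebra.single m 1 from rfl]
    simp only [AddMonoidAlgebra.coeff_smul, AddMonoidAlgebra.coeff_single, Finsupp.smul_apply,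
      smul_eq_mul]
    by_cases h : m = n
    · subst h
      ring1
    · rw [Finsupp.single_eq_of_ne (Ne.symm h)]
      ring1

/-- The Euler operator multiplies the coefficient of `T^n` by `n`, so a solution could only be
supported at an integer equal to `κ`. -/
lemma eq_zero_of_euler_eq_smul {p : 𝒢} {κ : ℂ} (hκ : ∀ n : ℤ, (n : ℂ) ≠ κ)
    (h : euler p = κ • p) : p = 0 := by
  refine LaurentPolynomial.ext fun n => ?_
  have h1 := congrArg (fun q : 𝒢 => q.coeff n) h
  simp only [coeff_euler, AddMonoidAlgebra.coeff_smul, Finsupp.smul_apply, smul_eq_mul] at h1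
  have h2 : ((n : ℂ) - κ) * p.coeff n = 0 := by linear_combination h1
  exact (mul_eq_zero.1 h2).resolve_left (sub_ne_zero.2 (hκ n))

/-- The formal solution is `exp T`. For a nonzero Laurent polynomial, multiplication by `T` raises
the top degree while the Euler operator does not. -/
lemma eq_zero_of_euler_eq_T_mul {p : 𝒢}
    (h : euler p = LaurentPolynomial.T 1 * p) : p = 0 := by
  by_contra hp
  have hs : p.coeff.support.Nonempty := by
    rw [Finsupp.support_nonempty_iff]
    exact fun h0 => hp (AddMonoidAlgebra.coeff_injective h0)
  have hm := p.coeff.support.max'_mem hs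
  set m := p.coeff.support.max' hs with hmdef
  have h1 := congrArg (fun q : 𝒢 => q.coeff (m + 1)) h
  have h2 : p.coeff (m + 1) = 0 := by
    by_contra h3
    have := p.coeff.support.le_max' (m + 1) (Finsupp.mem_support_iff.2 h3)
    omega
  have h3 : (LaurentPolynomial.T 1 * p).coeff (m + 1) = p.coeff m := by
    have := AddMonoidAlgebra.coeff_single_mul_add p (1 : ℂ) 1 m
    rw [add_comm m 1]
    exact this.trans (one_mul _)
  simp only [coeff_euler, h2, h3, mul_zero] at h1
  exact Finsupp.mem_support_iff.1 hm h1.symm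

variable {𝒳 : Space} {κ : ℂ} (F : EquivariantDModule 𝒳 κ)

/-- The projection modulo the span and the zero map both restrict to zero along `bc`, so uniqueness
in the universal property identifies them. -/
lemma EquivariantDModule.span_range_bc {R R' : Type} [CommRing R] [Algebra ℂ R] [CommRing R']
    [Algebra ℂ R'] (f : R →ₐ[ℂ] R') (x : 𝒳.Pt (Red R)) (x' : 𝒳.Pt (Red R'))
    (h : 𝒳.map (Red.map f) x = x') : Submodule.span R' (Set.range (F.bc f x x' h)) = ⊤ := by
  set W := Submodule.span R' (Set.range (F.bc f x x' h))
  obtain ⟨ψ, -, hψ⟩ := F.bc_universal f x x' h (ModuleCat.of R' (F.fib R' x' ⧸ W)) 0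
  have h1 : W.mkQ = 0 := (hψ W.mkQ fun v => (Submodule.Quotient.mk_eq_zero W).2
    (Submodule.subset_span ⟨v, rfl⟩)).trans (hψ 0 fun v => rfl).symm
  rw [← Submodule.ker_mkQ W, h1, LinearMap.ker_zero]

lemma EquivariantDModule.bc_congr {R R' : Type} [CommRing R] [Algebra ℂ R] [CommRing R']
    [Algebra ℂ R'] {f g : R →ₐ[ℂ] R'} (hfg : f = g) {x : 𝒳.Pt (Red R)} {x' : 𝒳.Pt (Red R')}
    (h : 𝒳.map (Red.map f) x = x') (h' : 𝒳.map (Red.map g) x = x') (v : F.fib R x) :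
    F.bc f x x' h v = F.bc g x x' h' v := by
  subst hfg
  rfl

lemma EquivariantDModule.act_congr {R : Type} [CommRing R] [Algebra ℂ R] {k k' : H (Red R)}
    (hk : k = k') {c c' : R} (hc : c = c') {m m' : Rˣ} (hm : m = m') {x x' : 𝒳.Pt (Red R)} (hχ) (hx)
    (hχ') (hx') (v : F.fib R x) :
    F.act k c m x x' hχ hx v = F.act k' c' m' x x' hχ' hx' v := by
  subst hk hc hm
  rfl

lemma EquivariantDModule.act_of_sq_eq_zero {R : Type} [CommRing R] [Algebra ℂ R]
    {k k' : H (Red R)} (hk : k' = k) {c c' n n' : R} (hc : c' = c + n) {m m' : Rˣ}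
    (hm : (m' : R) = m * (1 + n')) (hn : n ^ 2 = 0) (hn' : n' ^ 2 = 0) {x x' : 𝒳.Pt (Red R)} (hχ)
    (hx) (hχ') (hx') (v : F.fib R x) :
    F.act k' c' m' x x' hχ' hx' v = ((1 + n) * (1 + κ • n')) • F.act k c m x x' hχ hx v := by
  subst hk hc
  rw [F.act_lift k' c n m m' n' x x' hχ hx hχ' hx' v ⟨2, hn⟩ ⟨2, hn'⟩ hm, nilExp_eq_one_add hn,
    onePlusPow_eq_one_add _ hn']

/-- Comparison of the infinitesimal components: the first-order terms of the exponential and of the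
`κ`-th power produce the coefficient `a + κ b`. -/
lemma euler_eq_of_eulerHom_eq {p a b : 𝒢} {κ : ℂ} (h : eulerHom p =
    (((1 + TrivSqZeroExt.inr a) * (1 + κ • TrivSqZeroExt.inr b) : 𝒟)) • (TrivSqZeroExt.inl p : 𝒟)) :
    euler p = (a + κ • b) * p := by
  have h2 := congrArg TrivSqZeroExt.snd h
  change euler p = _ at h2
  rw [h2]
  simp only [smul_eq_mul, TrivSqZeroExt.snd_mul, TrivSqZeroExt.fst_mul, TrivSqZeroExt.fst_add,
    TrivSqZeroExt.snd_add, TrivSqZeroExt.fst_one, TrivSqZeroExt.snd_one, TrivSqZeroExt.fst_inr,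
    TrivSqZeroExt.snd_inr, TrivSqZeroExt.fst_inl, TrivSqZeroExt.snd_inl, TrivSqZeroExt.fst_smul,
    TrivSqZeroExt.snd_smul, MulOpposite.smul_eq_mul_unop, MulOpposite.unop_op, add_zero, zero_add,
    smul_zero, one_mul, mul_one]
  ring1

lemma EquivariantDModule.act_act_inv {R : Type} [CommRing R] [Algebra ℂ R] (k : H (Red R)) (c : R)
    (m : Rˣ) (x x' : 𝒳.Pt (Red R)) (hχ) (hx) (hχ') (hx') (h1 : 𝒳.Rel 1 1 x' x')
    (v : F.fib R x') :
    F.act k c m x x' hχ hx (F.act k⁻¹ (-c) m⁻¹ x' x hχ' hx' v) = v := by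
  have e1 : k * k⁻¹ = 1 := mul_inv_cancel k
  have e2 : c + -c = 0 := add_neg_cancel c
  have e3 : m * m⁻¹ = 1 := mul_inv_cancel m
  have g1 : IsChi ((1 : H (Red R)) : PSp (Red R)⸨X⸩) (Ideal.Quotient.mk (nilradical R) 0) := by
    rw [map_zero]
    exact isChi_one
  have g2 : 𝒳.Rel 1 (redUnits R 1) x' x' := by
    rw [map_one]
    exact h1
  rw [← F.act_mul k⁻¹ k (-c) c m⁻¹ m x' x x' hχ' hx' hχ hx (by rw [e1, e2]; exact g1)
    (by rw [e1, e3]; exact g2), F.act_congr e1 e2 e3 _ _ g1 g2, F.act_one]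

/-- The two homomorphisms to the dual numbers differ by a square-zero term. Their agreement modulo
nilpotents is what lets a crystal compare its pullbacks along them. -/
lemma Red.map_inl_eq_map_eulerHom :
    Red.map (TrivSqZeroExt.inlAlgHom ℂ 𝒢 𝒢) = Red.map eulerHom := by
  refine AlgHom.ext fun x => ?_
  obtain ⟨p, rfl⟩ := Ideal.Quotient.mk_surjective x
  rw [Red.map_mk, Red.map_mk, eulerHom_eq, map_add]
  refine (left_eq_add.2 (isNilpotent_iff_mk_eq_zero.1 ?_)).trans rfl
  exact ⟨2, by rw [pow_two]; exact TrivSqZeroExt.inr_mul_inr _ _ _⟩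

/-- The inclusion of the Laurent polynomials in the dual numbers. -/
abbrev constHom : 𝒢 →ₐ[ℂ] 𝒟 := TrivSqZeroExt.inlAlgHom ℂ 𝒢 𝒢

lemma inr_sq (q : 𝒢) : (TrivSqZeroExt.inr q : 𝒟) ^ 2 = 0 := by
  rw [pow_two]
  exact TrivSqZeroExt.inr_mul_inr _ _ _

/-- Units contribute to the differential equation through their logarithmic derivative. -/
lemma val_mapUnits_eulerHom (m : (𝒢)ˣ) : ((mapUnits eulerHom m : (𝒟)ˣ) : 𝒟) =
    (mapUnits constHom m : (𝒟)ˣ) * (1 + TrivSqZeroExt.inr (m⁻¹.val * euler m.val) : 𝒟) := by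
  change eulerHom m.val = constHom m.val * _
  rw [eulerHom_eq, mul_add, mul_one]
  congr 1
  refine TrivSqZeroExt.ext ?_ ?_
  · simp
  · simp [mul_right_comm m⁻¹.val]

/-- Base change of `act` along the two homomorphisms to the dual numbers uses the same group element
but different lifts of its parameters. The ratio prescribed by `act_lift` becomes the differential
equation in `hE` for the matrix coefficient. -/
lemma EquivariantDModule.apply_act_eq_zero {x : 𝒳.Pt (Red 𝒢)} {x' : 𝒳.Pt (Red 𝒟)}
    {s : H (Red 𝒢)} {c : 𝒢} {m : (𝒢)ˣ}
    (hχ : IsChi (s : PSp (Red 𝒢)⸨X⸩) (Ideal.Quotient.mk (nilradical 𝒢) c))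
    (hs : 𝒳.Rel s (redUnits _ m) x x)
    (hsD : 𝒳.Rel (H.map (Red.map eulerHom).toRingHom s)
      (mapUnits (Red.map eulerHom) (redUnits _ m)) x' x')
    (hE : ∀ p : 𝒢, euler p = (euler c + κ • (m⁻¹.val * euler m.val)) * p → p = 0)
    (hi : 𝒳.map (Red.map constHom) x = x') (he : 𝒳.map (Red.map eulerHom) x = x')
    (ψ : F.fib 𝒢 x →ₗ[𝒢] 𝒢) (ψ' : F.fib 𝒟 x' →ₗ[𝒟] 𝒟)
    (hψi : ∀ w, ψ' (F.bc constHom x x' hi w) = constHom (ψ w))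
    (hψe : ∀ w, ψ' (F.bc eulerHom x x' he w) = eulerHom (ψ w)) {w : F.fib 𝒢 x}
    (hw : F.bc constHom x x' hi w = F.bc eulerHom x x' he w) :
    ψ (F.act s c m x x hχ hs w) = 0 := by
  have hχD : ∀ f : 𝒢 →ₐ[ℂ] 𝒟, IsChi (H.map (Red.map f).toRingHom s : PSp (Red 𝒟)⸨X⸩)
      (Ideal.Quotient.mk (nilradical 𝒟) (f c)) := fun f => isChi_map (Red.map f).toRingHom hχ
  have hr : Red.map constHom = Red.map eulerHom := Red.map_inl_eq_map_eulerHom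
  have hsi : 𝒳.Rel (H.map (Red.map constHom).toRingHom s) (redUnits 𝒟 (mapUnits constHom m))
      x' x' := by
    rw [redUnits_mapUnits, hr]
    exact hsD
  have hk : H.map (Red.map eulerHom).toRingHom s = H.map (Red.map constHom).toRingHom s := by
    rw [hr]
  have e1 := hψi (F.act s c m x x hχ hs w)
  rw [← F.act_bc constHom s c m x x x' x' hi hi hχ hs (hχD constHom) hsi] at e1
  have e2 := hψe (F.act s c m x x hχ hs w)
  rw [← F.act_bc eulerHom s c m x x x' x' he he hχ hs (hχD eulerHom) hsD] at e2
  have e3 := F.act_of_sq_eq_zero hk (eulerHom_eq c) (val_mapUnits_eulerHom m) (inr_sq _)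
    (inr_sq _) (hχD constHom) hsi (hχD eulerHom) hsD (F.bc eulerHom x x' he w)
  exact hE _ (euler_eq_of_eulerHom_eq (e2.symm.trans ((congrArg ψ' e3).trans
    ((ψ'.map_smul _ _).trans (congrArg _ ((congrArg _ (congrArg _ hw)).symm.trans e1))))))

/-- The homomorphism from the complex numbers. -/
abbrev unitHom (R : Type) [CommRing R] [Algebra ℂ R] : ℂ →ₐ[ℂ] R := Algebra.ofId ℂ R

/-- An equivariant D-module on a homogeneous space vanishes if the stabilizer of the base point
contains a one-parameter family on which the character D-module has no horizontal sections. -/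
theorem EquivariantDModule.not_nonzero (o : ∀ (S : Type) [CommRing S] [Algebra ℂ S], 𝒳.Pt S)
    (ho : ∀ {S S' : Type} [CommRing S] [Algebra ℂ S] [CommRing S'] [Algebra ℂ S']
      (f : S →ₐ[ℂ] S'), 𝒳.map f (o S) = o S')
    (hone : ∀ {S : Type} [CommRing S] [Algebra ℂ S] (x : 𝒳.Pt S), 𝒳.Rel 1 1 x x)
    (htrans : ∀ {S : Type} [CommRing S] [Algebra ℂ S] (x : 𝒳.Pt S), ∃ (k : H S) (m : Sˣ),
      𝒳.Rel k m (o S) x ∧ 𝒳.Rel k⁻¹ m⁻¹ x (o S))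
    (s : H (Red 𝒢)) (c : 𝒢) (m : (𝒢)ˣ)
    (hχ : IsChi (s : PSp (Red 𝒢)⸨X⸩) (Ideal.Quotient.mk (nilradical 𝒢) c))
    (hs : 𝒳.Rel s (redUnits _ m) (o _) (o _))
    (hs' : 𝒳.Rel s⁻¹ (redUnits _ m)⁻¹ (o _) (o _))
    (hsD : 𝒳.Rel (H.map (Red.map eulerHom).toRingHom s)
      (mapUnits (Red.map eulerHom) (redUnits _ m)) (o _) (o _))
    (hE : ∀ p : 𝒢, euler p = (euler c + κ • (m⁻¹.val * euler m.val)) * p → p = 0) :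
    ¬ F.Nonzero := by
  rintro ⟨R, _, _, x, hx⟩
  -- By transitivity the nonzero fibre at `x` is the image of the fibre at the base point.
  have hoR : Nontrivial (F.fib R (o _)) := by
    obtain ⟨k, m, h1, h2⟩ := htrans x
    obtain ⟨c, hc⟩ := Ideal.Quotient.mk_surjective (chi k)
    obtain ⟨m, rfl⟩ := redUnits_surjective R m
    have hk : IsChi (k : PSp (Red R)⸨X⸩) (Ideal.Quotient.mk (nilradical R) c) := by
      rw [hc]
      exact isChi_chi k
    have hk' : IsChi ((k⁻¹ : H (Red R)) : PSp (Red R)⸨X⸩)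
        (Ideal.Quotient.mk (nilradical R) (-c)) := by
      rw [map_neg, hc, ← chi_inv]
      exact isChi_chi k⁻¹
    exact Function.Surjective.nontrivial (f := F.act k c m (o _) x hk h1)
      fun v => ⟨_, F.act_act_inv k c m (o _) x hk h1 hk' h2 (hone _) v⟩
  -- The base point is defined over `ℂ`, so its fibre over `R` is generated by the fibre over `ℂ`.
  have hoC : ∃ v : F.fib ℂ (o _), v ≠ 0 := by
    by_contra! h
    have h1 := F.span_range_bc (unitHom R) (o _) (o _) (ho _)
    have h2 : Submodule.span R (Set.range (F.bc (unitHom R) (o _) (o _) (ho _))) = ⊥ := by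
      rw [Submodule.span_eq_bot]
      rintro _ ⟨v, rfl⟩
      rw [h v, map_zero]
    obtain ⟨v, hv⟩ := exists_ne (0 : F.fib R (o _))
    have : v ∈ (⊤ : Submodule R (F.fib R (o _))) := trivial
    rw [← h1, h2] at this
    exact hv this
  obtain ⟨v₀, hv₀⟩ := hoC
  obtain ⟨l, hl⟩ : ∃ l : Module.Dual ℂ (F.fib ℂ (o _)), l v₀ ≠ 0 := by
    by_contra! h
    exact hv₀ ((Module.forall_dual_apply_eq_zero_iff ℂ v₀).1 h)
  -- The functional `l` extends to all base changes of the constant fibre, compatibly with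
  -- homomorphisms.
  have hψ : ∀ (S : Type) [CommRing S] [Algebra ℂ S], ∃ ψ : F.fib S (o _) →ₗ[S] S,
      ∀ v, ψ (F.bc (unitHom S) (o _) (o _) (ho _) v) = unitHom S (l v) := by
    intro S _ _
    obtain ⟨ψ, h, -⟩ := F.bc_universal (unitHom S) (o _) (o _) (ho _) (ModuleCat.of S S)
      { toFun := fun v => unitHom S (l v)
        map_add' := fun v w => by
          rw [map_add]
          exact map_add (unitHom S) _ _
        map_smul' := fun a v => by
          rw [map_smul]
          exact map_mul (unitHom S) _ _ }
    exact ⟨ψ, h⟩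
  choose ψ hψ using hψ
  have hbc : ∀ {S S' : Type} [CommRing S] [Algebra ℂ S] [CommRing S'] [Algebra ℂ S']
      (f : S →ₐ[ℂ] S') (v : F.fib ℂ (o _)), F.bc f (o _) (o _) (ho _)
        (F.bc (unitHom S) (o _) (o _) (ho _) v) = F.bc (unitHom S') (o _) (o _) (ho _) v := by
    intro S S' _ _ _ _ f v
    rw [← F.bc_comp (unitHom S) f (o _) (o _) (o _) (ho _) (ho _) (ho _)]
    exact F.bc_congr (Subsingleton.elim _ _) _ _ v
  have hnat : ∀ {S S' : Type} [CommRing S] [Algebra ℂ S] [CommRing S'] [Algebra ℂ S']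
      (f : S →ₐ[ℂ] S') (w : F.fib S (o _)), ψ S' (F.bc f (o _) (o _) (ho _) w) = f (ψ S w) := by
    intro S S' _ _ _ _ f w
    have hw : w ∈ Submodule.span S (Set.range (F.bc (unitHom S) (o _) (o _) (ho _))) := by
      rw [F.span_range_bc]
      trivial
    induction hw using Submodule.span_induction with
    | mem w hw =>
      obtain ⟨v, rfl⟩ := hw
      rw [hbc, hψ, hψ]
      exact (f.commutes _).symm
    | zero => simp only [map_zero]
    | add w w' _ _ h h' => rw [map_add, map_add, map_add, map_add, h, h']
    | smul a w _ h =>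
      rw [map_smulₛₗ, map_smul, map_smul, h]
      exact (map_mul f _ _).symm
  have key : ∀ v, ψ 𝒢 (F.act s c m (o _) (o _) hχ hs
      (F.bc (unitHom 𝒢) (o _) (o _) (ho _) v)) = 0 := by
    intro v
    exact F.apply_act_eq_zero hχ hs hsD hE (ho _) (ho _) (ψ 𝒢) (ψ 𝒟) (hnat _) (hnat _)
      ((hbc _ v).trans (hbc _ v).symm)
  have hzero : ∀ w, ψ 𝒢 (F.act s c m (o _) (o _) hχ hs w) = 0 := by
    intro w
    have hw : w ∈ Submodule.span 𝒢 (Set.range (F.bc (unitHom 𝒢) (o _) (o _) (ho _))) := by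
      rw [F.span_range_bc]
      trivial
    induction hw using Submodule.span_induction with
    | mem w hw =>
      obtain ⟨v, rfl⟩ := hw
      exact key v
    | zero => rw [map_zero, map_zero]
    | add w w' _ _ h h' => rw [map_add, map_add, h, h', add_zero]
    | smul a w _ h => rw [map_smul, map_smul, h, smul_zero]
  have hχ' : IsChi ((s⁻¹ : H (Red 𝒢)) : PSp (Red 𝒢)⸨X⸩)
      (Ideal.Quotient.mk (nilradical 𝒢) (-c)) := by
    rw [map_neg, ← chi_eq hχ, ← chi_inv]
    exact isChi_chi s⁻¹
  -- The matrix coefficients of the action of `s` vanish although it is invertible: applied to the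
  -- image of `v₀` under the inverse, this gives `l v₀ = 0`.
  have h0 := hzero (F.act s⁻¹ (-c) m⁻¹ (o _) (o _) hχ' hs'
    (F.bc (unitHom 𝒢) (o _) (o _) (ho _) v₀))
  rw [F.act_act_inv s c m (o _) (o _) hχ hs hχ' hs' (hone _), hψ] at h0
  exact hl ((map_eq_zero_iff _ (algebraMap ℂ 𝒢).injective).1 h0)

end Vanishing

/-! ### Equivariant D-modules on orbits -/

section Orbits

/-- The ring of functions of the test family. -/
local notation "𝒢" => LaurentPolynomial ℂ

variable {y : Gr ℂ}

/-- The base point of the orbit of `y` over a `ℂ`-algebra. -/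
abbrev basePoint (y : Gr ℂ) (S : Type) [CommRing S] [Algebra ℂ S] : Gr S :=
  Gr.map (algebraMap ℂ S) y

lemma GSp.map_comp {B C D : Type*} [CommRing B] [CommRing C] [CommRing D] (f : B →+* C)
    (g : C →+* D) (M : GSp B) : GSp.map g (GSp.map f M) = GSp.map (g.comp f) M := rfl

lemma GSp.laurent_algebraMap {S S' : Type} [CommRing S] [Algebra ℂ S] [CommRing S']
    [Algebra ℂ S'] (f : S →ₐ[ℂ] S') (M : GSp ℂ⸨X⸩) :
    GSp.laurent f.toRingHom (GSp.laurent (algebraMap ℂ S) M) =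
      GSp.laurent (algebraMap ℂ S') M := by
  rw [GSp.map_comp]
  refine congrArg (fun g => GSp.map g M) ?_
  refine RingHom.ext fun x => HahnSeries.ext (funext fun n => ?_)
  exact f.commutes _

lemma map_basePoint {S S' : Type} [CommRing S] [Algebra ℂ S] [CommRing S'] [Algebra ℂ S']
    (f : S →ₐ[ℂ] S') : Gr.map f.toRingHom (basePoint y S) = basePoint y S' := by
  obtain ⟨M, rfl⟩ := exists_gr_mk y
  rw [basePoint, basePoint, Gr.map_mk, Gr.map_mk, Gr.map_mk, GSp.laurent_algebraMap]

/-- `s` stabilizes the base point. -/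
def Stabilizes (y : Gr ℂ) {S : Type} [CommRing S] [Algebra ℂ S] (s : H S) : Prop :=
  (s : PSp S⸨X⸩) • basePoint y S = basePoint y S

lemma Stabilizes.one {S : Type} [CommRing S] [Algebra ℂ S] : Stabilizes y (1 : H S) :=
  one_smul _ _

lemma Stabilizes.inv {S : Type} [CommRing S] [Algebra ℂ S] {s : H S} (hs : Stabilizes y s) :
    Stabilizes y s⁻¹ := inv_smul_eq_iff.2 hs.symm

lemma Stabilizes.map {S S' : Type} [CommRing S] [Algebra ℂ S] [CommRing S'] [Algebra ℂ S']
    (f : S →ₐ[ℂ] S') {s : H S} (hs : Stabilizes y s) : Stabilizes y (H.map f.toRingHom s) := by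
  have h := congrArg (Gr.map f.toRingHom) hs
  rw [Gr.map_smul, map_basePoint] at h
  exact h

/-- If the character is trivial on stabilizers, its value at `h` depends only on the point `h y`,
and `exp` can be pulled back along this function. -/
lemma supportsChi_of_forall (h : ∀ (S : Type) [CommRing S] [Algebra ℂ S] [IsReduced S] (s : H S),
    Stabilizes y s → chi s = 0) : SupportsChi y := by
  refine exists_nonzero_equivariantDModule (𝒳 := orbitSpace y) 0 (fun x => chi x) (fun _ => 1)
    (1 : H (Red ℂ)) ?_ ?_ ?_
  · intro S S' _ _ _ _ f x
    exact chi_map f.toRingHom x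
  · intros
    rw [map_one]
  · rintro S _ _ _ k m (x : H S) (x' : H S) ⟨rfl, hx⟩
    refine ⟨?_, one_mul 1⟩
    have hs := h S (x'⁻¹ * (k * x)) (by
      rw [Stabilizes, Subgroup.coe_mul, mul_smul]
      exact inv_smul_eq_iff.2 hx)
    rw [chi_mul, chi_mul, chi_inv] at hs
    linear_combination hs

/-- Trivial weights make the scalar coordinate of the total space a well-defined invertible
function, whose power `κ` is tensored with the pullback of `exp` along the character. -/
lemma supportsChiTwisted_of_forall {κ : ℂ} (h : ∀ (S : Type) [CommRing S] [Algebra ℂ S]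
    [IsReduced S] (s : H S), Stabilizes y s → chi s = 0)
    (hw : ∀ (S : Type) [CommRing S] [Algebra ℂ S] [IsReduced S] (s : PSp S⸨X⸩) (w : Sˣ),
      IsFibreWeight y s w → w = 1) : SupportsChiTwisted κ y := by
  refine exists_nonzero_equivariantDModule (𝒳 := detSpace y) κ (fun x => chi x.1)
    (fun x => x.2) ((1, 1) : H (Red ℂ) × (Red ℂ)ˣ) ?_ ?_ ?_
  · intro S S' _ _ _ _ f x
    exact chi_map f.toRingHom x.1
  · intros
    rfl
  · rintro S _ _ _ k m ⟨x, μ⟩ ⟨x', μ'⟩ ⟨s, w, hs, hsw, h1, h2⟩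
    dsimp only at h1 h2 ⊢
    rw [hw S _ w hsw, mul_one] at h2
    refine ⟨?_, h2⟩
    have h3 := congrArg chi h1
    rw [chi_mul, chi_mul, h S s hs, add_zero] at h3
    exact h3

/-- A stabilizing element with character `T` imposes the equation of `exp T` on matrix coefficients.
-/
lemma not_supportsChi (s : H (Red 𝒢)) (hs : Stabilizes y s)
    (hχ : chi s = Ideal.Quotient.mk (nilradical 𝒢) (LaurentPolynomial.T 1)) :
    ¬ SupportsChi y := by
  rintro ⟨F, hF⟩
  have hrel : ∀ {S : Type} [CommRing S] [Algebra ℂ S] (s : H S) (m : Sˣ), m = 1 →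
      Stabilizes y s → (orbitSpace y).Rel s m (1 : H S) (1 : H S) := by
    intro S _ _ s m hm hs
    refine ⟨hm, ?_⟩
    rw [mul_one, Subgroup.coe_one, one_smul]
    exact hs
  refine F.not_nonzero (fun S _ _ => (1 : H S)) (fun f => map_one (H.map f.toRingHom)) ?_ ?_ s
    (LaurentPolynomial.T 1) 1 (by rw [← hχ]; exact isChi_chi s) (hrel _ _ (map_one _) hs)
    (hrel _ _ (by rw [map_one, inv_one]) hs.inv)
    (hrel _ _ (by rw [map_one, map_one]) (hs.map _)) ?_ hF
  · intro S _ _ (x : H S)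
    exact ⟨rfl, congrArg (fun z : H S => (z : PSp S⸨X⸩) • basePoint y S) (one_mul x)⟩
  · intro S _ _ (x : H S)
    exact ⟨x, 1, ⟨rfl, congrArg (fun z : H S => (z : PSp S⸨X⸩) • basePoint y S)
      (mul_one x)⟩, ⟨inv_one, congrArg (fun z : H S => (z : PSp S⸨X⸩) •
      basePoint y S) (inv_mul_cancel x)⟩⟩
  · intro p hp
    refine eq_zero_of_euler_eq_T_mul ?_
    rw [hp, euler_T, zero_smul, add_zero]
    simp

/-- An element of weight `m⁻¹` together with the scaling by `m` stabilizes a point of the total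
space. Weights are given by a relation, so those of the inverse and over the dual numbers are
requested separately. -/
lemma not_supportsChiTwisted {κ : ℂ} (h1 : ∀ (S : Type) [CommRing S] [Algebra ℂ S],
      IsFibreWeight y (1 : PSp S⸨X⸩) 1)
    (s : H (Red 𝒢)) (c : 𝒢) (m : (𝒢)ˣ) (hs : Stabilizes y s)
    (hχ : chi s = Ideal.Quotient.mk (nilradical 𝒢) c)
    (hw : IsFibreWeight y (s : PSp (Red 𝒢)⸨X⸩) (redUnits 𝒢 m)⁻¹)
    (hw' : IsFibreWeight y ((s⁻¹ : H (Red 𝒢)) : PSp (Red 𝒢)⸨X⸩) (redUnits 𝒢 m))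
    (hwD : IsFibreWeight y (H.map (Red.map eulerHom).toRingHom s : PSp _⸨X⸩)
      (mapUnits (Red.map eulerHom) (redUnits 𝒢 m))⁻¹)
    (hE : ∀ p : 𝒢, euler p = (euler c + κ • (m⁻¹.val * euler m.val)) * p → p = 0) :
    ¬ SupportsChiTwisted κ y := by
  rintro ⟨F, hF⟩
  have hrel : ∀ {S : Type} [CommRing S] [Algebra ℂ S] (s : H S) (m : Sˣ),
      IsFibreWeight y (s : PSp S⸨X⸩) m⁻¹ →
      Stabilizes y s → (detSpace y).Rel s m ((1, 1) : H S × Sˣ) ((1, 1) : H S × Sˣ) := by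
    intro S _ _ s m hm hs
    exact ⟨s, m⁻¹, hs, hm, by rw [mul_one, one_mul], by rw [mul_one, mul_inv_cancel]⟩
  refine F.not_nonzero (fun S _ _ => ((1, 1) : H S × Sˣ))
    (fun f => Prod.ext (map_one (H.map f.toRingHom)) (map_one (mapUnits f))) ?_ ?_ s c m
    (by rw [← hχ]; exact isChi_chi s) (hrel _ _ hw hs) (hrel _ _ (by rwa [inv_inv]) hs.inv)
    (hrel _ _ hwD (hs.map _)) hE hF
  · intro S _ _ x
    exact ⟨1, 1, Stabilizes.one, h1 S, by rw [one_mul, mul_one], by rw [one_mul, mul_one]⟩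
  · rintro S _ _ ⟨x, μ⟩
    exact ⟨x, μ, ⟨1, 1, Stabilizes.one, h1 S, rfl, by rw [mul_one, mul_one]⟩,
      ⟨1, 1, Stabilizes.one, h1 S, by rw [inv_mul_cancel, one_mul],
        by rw [mul_one, inv_mul_cancel]⟩⟩

end Orbits

/-! ### The orbits supporting equivariant D-modules -/

section Character

lemma basePoint_pt_coweight (n a b r : ℤ) (S : Type) [CommRing S] [Algebra ℂ S] :
    basePoint (pt (coweight n a b r)) S = Gr.mk (leviPair _ (repPair S n a b r)) := by
  rw [basePoint, pt_coweight, Gr.map_mk, map_repPair]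

lemma chi_eq_zero_of_stabilizes {n a b r : ℤ} (hr : 0 ≤ r) (hb : r ≤ b) (ha : b ≤ a) {S : Type}
    [CommRing S] [Algebra ℂ S] (s : H S) (hs : Stabilizes (pt (coweight n a b r)) s) :
    chi s = 0 := by
  rw [Stabilizes, basePoint_pt_coweight] at hs
  have h := ordGeM_repY_inv_mul_repX (R := S) (n := n) hr hb ha
  exact isChi_eq_zero_of_smul_eq (x := repPair S n a b r) h (isChi_chi s) hs

variable {B C : Type*} [CommRing B] [CommRing C]

/-- The matrix `1 + x (E₂₃ - E₄₅)`. -/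
def shearMatrix (x : B) : Matrix (Fin 6) (Fin 6) B :=
  !![1, 0, 0, 0, 0, 0;
     0, 1, x, 0, 0, 0;
     0, 0, 1, 0, 0, 0;
     0, 0, 0, 1, -x, 0;
     0, 0, 0, 0, 1, 0;
     0, 0, 0, 0, 0, 1]

lemma shearMatrix_zero : shearMatrix (0 : B) = 1 := by
  refine Matrix.ext fun i j => ?_
  fin_cases i <;> fin_cases j <;> simp [shearMatrix]

lemma shearMatrix_mul (x z : B) : shearMatrix x * shearMatrix z = shearMatrix (x + z) := by
  refine Matrix.ext fun i j => ?_
  fin_cases i <;> fin_cases j <;>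
    simp [shearMatrix, Matrix.mul_apply, Fin.sum_univ_succ, add_comm]

/-- The matrix `1 + x (E₂₃ - E₄₅)` as a symplectic similitude. -/
def shearGSp (x : B) : GSp B :=
  ⟨⟨shearMatrix x, shearMatrix (-x), by rw [shearMatrix_mul, add_neg_cancel, shearMatrix_zero],
    by rw [shearMatrix_mul, neg_add_cancel, shearMatrix_zero]⟩, 1, by
    refine Matrix.ext fun i j => ?_
    fin_cases i <;> fin_cases j <;>
      simp [shearMatrix, gram, Matrix.mul_apply, Fin.sum_univ_succ]⟩

lemma shearGSp_val (x : B) : (shearGSp x).1.1 = shearMatrix x := rfl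

lemma shearGSp_mem_unip (x : B) : shearGSp x ∈ unip B := by
  intro i j
  rw [shearGSp_val]
  fin_cases i <;> fin_cases j <;> simp [shearMatrix]

lemma map_shearGSp (f : B →+* C) (x : B) : GSp.map f (shearGSp x) = shearGSp (f x) := by
  refine Subtype.ext (Units.ext (Matrix.ext fun i j => ?_))
  rw [GSp.map_val, Matrix.map_apply, shearGSp_val, shearGSp_val]
  fin_cases i <;> fin_cases j <;> simp [shearMatrix]

lemma shearGSp_neg (x : B) : shearGSp (-x) = (shearGSp x)⁻¹ := by
  refine eq_inv_of_mul_eq_one_left (Subtype.ext (Units.ext ?_))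
  rw [GSp.coe_mul, shearGSp_val, shearGSp_val, shearMatrix_mul, neg_add_cancel, shearMatrix_zero]
  rfl

lemma block_shearGSp (x : B) : block (shearGSp x).1.1 0 1 = !![0, 0; x, 0] := by
  rw [shearGSp_val]
  refine Matrix.ext fun i j => ?_
  fin_cases i <;> fin_cases j <;> rfl

lemma leviUnip_one_left {R : Type*} [CommRing R] (u : GSp R⸨X⸩) : leviUnip 1 u = u := by
  rw [leviUnip, map_one, map_one, one_mul]

/-- The element of `H R` given by a unipotent matrix. -/
def unipH {R : Type*} [CommRing R] (u : unip R⸨X⸩) : H R :=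
  ⟨PSp.mk u.1, mem_H_iff.2 ⟨1, u.1, u.2, by rw [leviUnip_one_left]⟩⟩

lemma chi_unipH {R : Type*} [CommRing R] (u : unip R⸨X⸩) :
    chi (unipH u) = residueTrace u.1.1.1 :=
  chi_eq (isChi_iff.2 ⟨1, u.1, u.2, by rw [leviUnip_one_left]; rfl, rfl⟩)

lemma smul_mk_conj_ofInt {R : Type*} [CommRing R] (M : GSp R⸨X⸩) (k : GSp R⟦X⟧) :
    PSp.mk (M * GSp.ofInt R k * M⁻¹) • Gr.mk M = Gr.mk M := by
  rw [Gr.smul_mk, inv_mul_cancel_right]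
  refine (Gr.mk_eq_mk.2 ⟨1, k, ?_⟩).symm
  rw [GSp.coe_mul, Units.val_one, one_smul]

lemma block_leviPair_conj (x : GL (Fin 2) B × GL (Fin 2) B) {u : GSp B} (hu : u ∈ unip B) :
    block (leviPair B x * u * (leviPair B x)⁻¹).1.1 0 1 =
      x.1.val * block u.1.1 0 1 * x.2⁻¹.val := by
  rw [← map_inv, GSp.coe_mul, (blockUpper_leviPair _).block_mul_zero_one, leviPair_block_zero_one,
    mul_zero, zero_add, block_leviPair_one, GSp.coe_mul,
    (blockUpper_of_mem_unip hu).block_mul_zero_one, leviPair_block_zero_one, zero_mul, add_zero,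
    block_leviPair_zero]
  rfl

/-- The conjugate of a shear by the representative of an orbit. -/
def shearConj {S : Type} [CommRing S] (n a b r : ℤ) (z : S) : unip S⸨X⸩ :=
  -- A shear with parameter `x` contributes `-t^(b-r) x` to the trace of `X E Y⁻¹`, so this exponent
  -- and this sign make the residue equal to `z`.
  ⟨leviPair _ (repPair S n a b r) * shearGSp (HahnSeries.single (r - b - 1) (-z)) *
    (leviPair _ (repPair S n a b r))⁻¹, leviPair_conj_mem_unip _ (shearGSp_mem_unip _)⟩

variable {S S' : Type} [CommRing S] [CommRing S']

lemma residueTrace_shearConj (n a b r : ℤ) (z : S) :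
    residueTrace (shearConj n a b r z).1.1.1 = z := by
  have h : block (shearConj n a b r z).1.1.1 0 1 = _ :=
    block_leviPair_conj (repPair S n a b r) (shearGSp_mem_unip _)
  rw [residueTrace, h, block_shearGSp, repX_val, repY_inv_val]
  have e : b + (r - b - 1) + -r = -1 := by ring
  simp [Matrix.trace_fin_two, e]

lemma map_shearConj (f : S →+* S') (n a b r : ℤ) (z : S) :
    GSp.laurent f (shearConj n a b r z).1 = (shearConj n a b r (f z)).1 := by
  change GSp.laurent f (_ * _ * _) = _ * _ * _
  rw [map_mul, map_mul, map_inv, map_repPair, map_shearGSp, laurentMap_single, map_neg]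

lemma shearConj_neg (n a b r : ℤ) (z : S) :
    (shearConj n a b r (-z)).1 = (shearConj n a b r z).1⁻¹ := by
  change _ * _ * _ = (_ * _ * _)⁻¹
  rw [HahnSeries.single_neg, shearGSp_neg]
  group

/-- For `b < r` the exponent `r - b - 1` is nonnegative, so the shear is integral, and its conjugate
by the representative stabilizes the point. -/
lemma exists_shearConj_eq {n a b r : ℤ} (h : b < r) (z : S) : ∃ k : GSp S⟦X⟧,
    (shearConj n a b r z).1 = leviPair _ (repPair S n a b r) * GSp.ofInt S k *
      (leviPair _ (repPair S n a b r))⁻¹ := by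
  obtain ⟨p, hp⟩ := ordGe_zero_iff.1
    (ordGe_single (show (0 : ℤ) ≤ r - b - 1 by omega) (-z))
  refine ⟨shearGSp p, ?_⟩
  rw [map_shearGSp, ← hp]
  rfl

/-- The conjugate of a shear by the representative of an orbit and an element of `H ℂ`. -/
def shearH [Algebra ℂ S] (h : H ℂ) (n a b r : ℤ) (z : S) : H S :=
  H.map (algebraMap ℂ S) h * unipH (shearConj n a b r z) * (H.map (algebraMap ℂ S) h)⁻¹

lemma chi_shearH [Algebra ℂ S] (h : H ℂ) (n a b r : ℤ) (z : S) : chi (shearH h n a b r z) = z := by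
  rw [shearH, chi_mul, chi_mul, chi_inv, chi_unipH, residueTrace_shearConj]
  ring

lemma Stabilizes.conj [Algebra ℂ S] {y : Gr ℂ} {s : H S} (hs : Stabilizes y s) (h : H ℂ) :
    Stabilizes ((h : PSp ℂ⸨X⸩) • y) (H.map (algebraMap ℂ S) h * s * (H.map (algebraMap ℂ S) h)⁻¹) := by
  have e : basePoint ((h : PSp ℂ⸨X⸩) • y) S =
      (H.map (algebraMap ℂ S) h : PSp S⸨X⸩) • basePoint y S := Gr.map_smul _ _ _
  rw [Stabilizes, e, smul_smul, ← Subgroup.coe_mul, inv_mul_cancel_right, Subgroup.coe_mul,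
    mul_smul]
  exact congrArg _ hs

lemma stabilizes_shearH [Algebra ℂ S] (h : H ℂ) {n a b r : ℤ} (hb : b < r) (z : S) :
    Stabilizes ((h : PSp ℂ⸨X⸩) • pt (coweight n a b r)) (shearH h n a b r z) := by
  refine Stabilizes.conj ?_ h
  obtain ⟨k, hk⟩ := exists_shearConj_eq (n := n) (a := a) hb z
  rw [Stabilizes, basePoint_pt_coweight]
  change PSp.mk (shearConj n a b r z).1 • _ = _
  rw [hk, smul_mk_conj_ofInt]

theorem isFullSetOfRepresentatives_dominant :
    IsFullSetOfRepresentatives {l | Dominant l} SupportsChi := by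
  refine isFullSetOfRepresentatives_of_forall (fun l hl => Dominant.lDominant hl) ?_ ?_
  · intro l hl
    obtain ⟨n, a, b, r, hn, hr, hab, rfl⟩ := lDominant_iff.1 (Dominant.lDominant hl)
    refine supportsChi_of_forall fun S _ _ _ s hs => ?_
    exact chi_eq_zero_of_stabilizes hr ((dominant_coweight_iff hn hr hab).1 hl) hab s hs
  · intro l hl h hh hP
    obtain ⟨n, a, b, r, hn, hr, hab, rfl⟩ := lDominant_iff.1 hl
    by_contra hd
    have hb : b < r := by
      by_contra hb
      exact hd ((dominant_coweight_iff hn hr hab).2 (by omega))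
    exact not_supportsChi (shearH ⟨h, hh⟩ n a b r _) (stabilizes_shearH ⟨h, hh⟩ hb _)
      (chi_shearH _ _ _ _ _ _) hP

end Character

/-! ### Determinants of endomorphisms of quotients of lattices -/

section Determinants

lemma isDetOn_unique {R E : Type*} [CommRing R] [AddCommGroup E] [Module R E] {T : E →ₗ[R] E}
    {L C : Submodule R E} {d d' : R} (h : IsDetOn T L C d) (h' : IsDetOn T L C d') : d = d' := by
  obtain ⟨_, _, _, _, _, rfl⟩ := h
  obtain ⟨_, _, _, _, _, rfl⟩ := h'
  rfl

/-- The determinant on a quotient with given coordinates. -/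
theorem isDetOn_of_coordinates {R E κ : Type*} [CommRing R] [AddCommGroup E] [Module R E]
    [Fintype κ] [DecidableEq κ] {T : E →ₗ[R] E} {L C : Submodule R E} (hCL : C ≤ L)
    (hL : ∀ v ∈ L, T v ∈ L) (hC : ∀ v ∈ C, T v ∈ C) (φ : E →ₗ[R] κ → R) (e : κ → E)
    (he : ∀ k, e k ∈ L) (hφe : ∀ k, φ (e k) = Pi.single k 1)
    (hker : ∀ v ∈ L, φ v = 0 ↔ v ∈ C) :
    IsDetOn T L C (Matrix.of fun k k' => φ (T (e k')) k).det := by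
  have hexp : ∀ w : κ → R, φ (∑ k, w k • e k) = w := fun w => by
    rw [map_sum]
    simp only [map_smul, hφe]
    exact (pi_eq_sum_univ' w).symm
  have hmem : ∀ w : κ → R, ∑ k, w k • e k ∈ L := fun w =>
    L.sum_mem fun k _ => L.smul_mem _ (he k)
  have hTφ : ∀ v ∈ L, φ (T v) = (Matrix.of fun k k' => φ (T (e k')) k) *ᵥ φ v := by
    intro v hv
    -- A vector of `L` differs from the combination of the `e k` with the same coordinates by an
    -- element of `C`, which `T` preserves.
    have h1 : φ (T (v - ∑ k, φ v k • e k)) = 0 := by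
      have hd : v - ∑ k, φ v k • e k ∈ L := L.sub_mem hv (hmem _)
      exact (hker _ (hL _ hd)).2 (hC _ ((hker _ hd).1 (by rw [map_sub, hexp, sub_self])))
    rw [map_sub, map_sub, sub_eq_zero] at h1
    rw [h1, map_sum, map_sum]
    funext k
    rw [Finset.sum_apply]
    refine Finset.sum_congr rfl fun k' _ => ?_
    rw [map_smul, map_smul, Pi.smul_apply, smul_eq_mul, mul_comm]
    rfl
  have hCm : C.submoduleOf L ≤ (C.submoduleOf L).comap (T.restrict hL) := fun v hv => hC _ hv
  have hk : C.submoduleOf L = (φ.domRestrict L).ker := by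
    ext v
    exact (hker v v.2).symm
  have hsurj : Function.Surjective (φ.domRestrict L) := fun w =>
    ⟨⟨_, hmem w⟩, hexp w⟩
  let q : (L ⧸ C.submoduleOf L) ≃ₗ[R] (κ → R) := (Submodule.quotEquivOfEq _ _ hk).trans
    (LinearMap.quotKerEquivOfSurjective _ hsurj)
  refine ⟨hL, hCm, hCL, Module.Free.of_equiv q.symm, Module.Finite.equiv q.symm, ?_⟩
  rw [← LinearMap.det_conj _ q, ← LinearMap.det_toLin']
  congr 1
  refine LinearMap.ext fun w => ?_
  obtain ⟨v, rfl⟩ := q.surjective w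
  obtain ⟨v, rfl⟩ := Submodule.Quotient.mk_surjective _ v
  rw [LinearMap.comp_apply, LinearMap.comp_apply, LinearEquiv.coe_coe, LinearEquiv.coe_coe,
    LinearEquiv.symm_apply_apply]
  exact hTφ v v.2

lemma det_of_blockTriangular {K p α R : Type*} [CommRing R] [Fintype K] [DecidableEq K] [Fintype p]
    [DecidableEq p] [LinearOrder α] {M : Matrix (K × p) (K × p) R} {b : K → α}
    (hb : Function.Injective b) (hM : M.BlockTriangular fun x => b x.1) :
    M.det = ∏ k, (Matrix.of fun x y => M (k, x) (k, y)).det := by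
  cases isEmpty_or_nonempty p
  · rw [Matrix.det_isEmpty]
    simp
  rw [hM.det]
  have h : (Finset.univ.image fun x : K × p => b x.1) = Finset.univ.image b := by
    ext a
    simp
  rw [h, Finset.prod_image fun _ _ _ _ hk => hb hk]
  refine Finset.prod_congr rfl fun k _ => ?_
  let f : p ≃ {x : K × p // b x.1 = b k} :=
    { toFun := fun x => ⟨(k, x), rfl⟩
      invFun := fun x => x.1.2
      left_inv := fun _ => rfl
      right_inv := fun ⟨⟨k', x⟩, hx⟩ => Subtype.ext (Prod.ext (hb hx).symm rfl) }
  rw [← Matrix.det_submatrix_equiv_self f]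
  rfl

lemma det_of_triangular {K α R : Type*} [CommRing R] [Fintype K] [DecidableEq K]
    [LinearOrder α] {M : Matrix K K R} {b : K → α}
    (hb : Function.Injective b) (hM : M.BlockTriangular b) : M.det = ∏ k, M k k := by
  have h := det_of_blockTriangular (p := Unit)
    (M := M.submatrix (fun x : K × Unit => x.1) fun x : K × Unit => x.1) hb
    (fun i j hij => hM hij)
  rw [show (M.submatrix (fun x : K × Unit => x.1) fun x : K × Unit => x.1) =
    M.submatrix (Equiv.prodPUnit K) (Equiv.prodPUnit K) from rfl,
    Matrix.det_submatrix_equiv_self] at h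
  rw [h]
  refine Finset.prod_congr rfl fun k _ => ?_
  rw [Matrix.det_unique]
  rfl

end Determinants

/-! ### Lattices in coordinates -/

section Lattices

variable {ι : Type*} {S : Type*} [CommRing S]

/-- The vector `v` is in the lattice `diag(t^l) S[[t]]^ι`. -/
def InLat (l : ι → ℤ) (v : ι → S⸨X⸩) : Prop := ∀ i, OrdGe (l i) (v i)

/-- The matrix `T` preserves the lattice `diag(t^l) S[[t]]^ι`. -/
def Stable (l : ι → ℤ) (T : Matrix ι ι S⸨X⸩) : Prop := ∀ i j, OrdGe (l i - l j) (T i j)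

lemma inLat_single [DecidableEq ι] {l : ι → ℤ} (i : ι) {s : ℤ} (h : l i ≤ s) :
    InLat l (Pi.single i (HahnSeries.single s 1) : ι → S⸨X⸩) := by
  intro j
  by_cases hj : j = i
  · subst hj
    rw [Pi.single_eq_same]
    exact ordGe_single h 1
  · rw [Pi.single_eq_of_ne hj]
    exact OrdGe.zero _

variable [Fintype ι]

lemma InLat.mulVec {l : ι → ℤ} {T : Matrix ι ι S⸨X⸩} {v : ι → S⸨X⸩} (hT : Stable l T)
    (hv : InLat l v) : InLat l (T *ᵥ v) := fun i =>
  OrdGe.sum fun j _ => ((hT i j).mul (hv j)).mono (by omega)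

/-- The submodule `L` is the lattice with the given exponents in the coordinates `ψ`. -/
def IsCoord (ψ : Matrix ι ι S⸨X⸩) (l : ι → ℤ) (L : Submodule S (ι → S⸨X⸩)) : Prop :=
  ∀ v, v ∈ L ↔ InLat l (ψ *ᵥ v)

variable [DecidableEq ι] {φ ψ T : Matrix ι ι S⸨X⸩} {l c : ι → ℤ} {L C : Submodule S (ι → S⸨X⸩)}

lemma mulVec_single_apply (M : Matrix ι ι S⸨X⸩) (i j : ι) (s n : ℤ) :
    ((M *ᵥ Pi.single j (HahnSeries.single s 1)) i).coeff n = (M i j).coeff (n - s) := by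
  rw [Matrix.mulVec_single]
  change (M i j * HahnSeries.single s 1).coeff n = _
  rw [mul_comm, coeff_single_one_mul]

lemma IsCoord.mulVec_single_mem (h : ψ * φ = 1) (hL : IsCoord ψ l L) (i : ι) {s : ℤ}
    (hs : l i ≤ s) : φ *ᵥ Pi.single i (HahnSeries.single s 1) ∈ L := by
  rw [hL, Matrix.mulVec_mulVec, h, Matrix.one_mulVec]
  exact inLat_single i hs

/-- The basis vector `t^(l j) e_j` is mapped into the lattice, which bounds the orders in column
`j`. -/
lemma IsCoord.stable (h : ψ * φ = 1) (hL : IsCoord ψ l L) (hT : ∀ v ∈ L, mulVecLin T v ∈ L) :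
    Stable l (ψ * T * φ) := by
  intro i j n hn
  have h1 := (hL _).1 (hT _ (hL.mulVec_single_mem h j le_rfl)) i (n + l j) (by omega)
  change ((ψ *ᵥ T *ᵥ φ *ᵥ _) i).coeff _ = 0 at h1
  rw [Matrix.mulVec_mulVec, Matrix.mulVec_mulVec, mulVec_single_apply] at h1
  rw [← h1, add_sub_cancel_right]

lemma IsCoord.mulVec_mem (h : φ * ψ = 1) (hL : IsCoord ψ l L) (hT : Stable l (ψ * T * φ))
    {v : ι → S⸨X⸩} (hv : v ∈ L) : mulVecLin T v ∈ L := by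
  rw [hL] at hv ⊢
  have h1 := hv.mulVec hT
  rw [Matrix.mulVec_mulVec, Matrix.mul_assoc, h, Matrix.mul_one, ← Matrix.mulVec_mulVec] at h1
  exact h1

/-- The coefficients of a vector in the coordinates `ψ`. -/
def coeffMap {κ : Type*} (ψ : Matrix ι ι S⸨X⸩) (i : κ → ι) (σ : κ → ℤ) :
    (ι → S⸨X⸩) →ₗ[S] κ → S where
  toFun v k := (mulVecLin ψ v (i k)).coeff (σ k)
  map_add' v w := by
    rw [map_add]
    rfl
  map_smul' a v := by
    rw [map_smul]
    rfl

/-- The quotient has the basis `t^s e_j` with `l j ≤ s < c j`, enumerated by the pairs `(i k, σ k)`;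
matrix entries are single coefficients of Laurent series. -/
theorem isDetOn_of_isCoord {κ : Type*} [Fintype κ] [DecidableEq κ] (h' : ψ * φ = 1) (hL : IsCoord ψ l L) (hC : IsCoord ψ c C) (hlc : ∀ i, l i ≤ c i)
    (hTL : ∀ v ∈ L, mulVecLin T v ∈ L) (hTC : ∀ v ∈ C, mulVecLin T v ∈ C) (i : κ → ι)
    (σ : κ → ℤ) (hinj : ∀ k k', i k = i k' → σ k = σ k' → k = k')
    (hrange : ∀ j s, (l j ≤ s ∧ s < c j) ↔ ∃ k, i k = j ∧ σ k = s) :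
    IsDetOn (mulVecLin T) L C
      (Matrix.of fun k k' => ((ψ * T * φ) (i k) (i k')).coeff (σ k - σ k')).det := by
  have hm : ∀ (M : Matrix ι ι S⸨X⸩) (k : κ) (j : ι) (s : ℤ),
      coeffMap ψ i σ (M *ᵥ Pi.single j (HahnSeries.single s 1)) k =
        ((ψ * M) (i k) j).coeff (σ k - s) := by
    intro M k j s
    change ((ψ *ᵥ M *ᵥ _) _).coeff _ = _
    rw [Matrix.mulVec_mulVec, mulVec_single_apply]
  have key := isDetOn_of_coordinates (T := mulVecLin T) (L := L) (C := C) ?_ hTL hTC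
    (coeffMap ψ i σ)
    (fun k => φ *ᵥ Pi.single (i k) (HahnSeries.single (σ k) 1)) ?_ ?_ ?_
  · convert key using 3
    funext k k'
    change _ = coeffMap ψ i σ (T *ᵥ φ *ᵥ _) k
    rw [Matrix.mulVec_mulVec, hm, Matrix.mul_assoc]
  · intro v hv
    rw [hC] at hv
    rw [hL]
    exact fun j => (hv j).mono (hlc j)
  · intro k
    exact hL.mulVec_single_mem h' _ ((hrange _ _).2 ⟨k, rfl, rfl⟩).1
  · intro k
    funext k'
    rw [hm, h', Matrix.one_apply, Pi.single_apply]
    by_cases hk : k' = k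
    · subst hk
      rw [if_pos rfl, if_pos rfl, sub_self]
      exact HahnSeries.coeff_single_same 0 1
    · rw [if_neg hk]
      by_cases hi : i k' = i k
      · rw [if_pos hi]
        exact HahnSeries.coeff_single_of_ne (by
          intro h0
          exact hk (hinj _ _ hi (by omega)))
      · rw [if_neg hi]
        rfl
  · intro v hv
    rw [hL] at hv
    rw [hC]
    constructor
    · intro h0 j n hn
      by_cases hjn : l j ≤ n
      · obtain ⟨k, rfl, rfl⟩ := (hrange j n).1 ⟨hjn, hn⟩
        exact congrFun h0 k
      · exact hv j n (by omega)
    · intro h0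
      funext k
      exact h0 (i k) (σ k) ((hrange _ _).2 ⟨k, rfl, rfl⟩).2

/-- The determinant of an endomorphism which is triangular with respect to suitable bases. -/
theorem isDetOn_of_triangular (h' : ψ * φ = 1) (hL : IsCoord ψ l L) (hC : IsCoord ψ c C) (hlc : ∀ i, l i ≤ c i)
    (hTL : ∀ v ∈ L, mulVecLin T v ∈ L) (hTC : ∀ v ∈ C, mulVecLin T v ∈ C)
    {ρ : ι → ℤ} (hρ : Function.Injective ρ)
    (htri : ∀ i j, ρ j < ρ i → ((ψ * T * φ) i j).coeff (c i - c j) = 0) :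
    IsDetOn (mulVecLin T) L C (∏ i, ((ψ * T * φ) i i).coeff 0 ^ (c i - l i).toNat) := by
  have hs := hC.stable h' hTC
  have key := isDetOn_of_isCoord h' hL hC hlc hTL hTC
    (κ := Σ i, Fin (c i - l i).toNat) (fun k => k.1) (fun k => l k.1 + k.2.val) ?_ ?_
  · convert key using 1
    -- The basis is ordered by the distance `c - σ` to `C`: entries against this order vanish
    -- because `C` is stable. Ties are broken by `ρ` and handled by `htri`.
    rw [det_of_triangular (b := fun k : Σ i, Fin (c i - l i).toNat =>
      toLex (c k.1 - (l k.1 + (k.2.val : ℤ)), ρ k.1))]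
    · rw [Fintype.prod_sigma]
      refine Finset.prod_congr rfl fun i _ => ?_
      simp
    · rintro ⟨i, s⟩ ⟨j, s'⟩ hk
      have hk1 := congrArg (fun x => (ofLex x).1) hk
      have hk2 := congrArg (fun x => (ofLex x).2) hk
      obtain rfl : i = j := hρ hk2
      have : s = s' := Fin.ext (by simpa using hk1)
      rw [this]
    · rintro ⟨i, s⟩ ⟨j, s'⟩ hk
      rw [Prod.Lex.toLex_lt_toLex] at hk
      rcases hk with hk | ⟨hk, hk2⟩
      · exact hs i j _ (by dsimp only at hk ⊢; omega)
      · rw [Matrix.of_apply, ← htri i j hk2]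
        congr 1
        dsimp only at hk ⊢
        omega
  · rintro ⟨i, s⟩ ⟨j, s'⟩ hij hk
    obtain rfl : i = j := hij
    have : s = s' := Fin.ext (by simpa using hk)
    rw [this]
  · intro j s
    constructor
    · rintro ⟨h1, h2⟩
      exact ⟨⟨j, ⟨(s - l j).toNat, by omega⟩⟩, rfl, by dsimp only; omega⟩
    · rintro ⟨⟨i, k⟩, rfl, rfl⟩
      have := k.2
      dsimp only
      omega

lemma exists_bidx_eq (i : Fin 6) : ∃ b p, bidx b p = i :=
  ⟨⟨i.val / 2, by omega⟩, ⟨i.val % 2, by omega⟩, Fin.ext (by simp only [bidx]; omega)⟩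

lemma bidx_inj {b b' : Fin 3} {p p' : Fin 2} (h : bidx b p = bidx b' p') : b = b' ∧ p = p' := by
  have := congrArg Fin.val h
  simp only [bidx] at this
  exact ⟨Fin.ext (by omega), Fin.ext (by omega)⟩

/-- The determinant of an endomorphism which is block triangular with respect to suitable
bases. -/
theorem isDetOn_of_blockTriangular {φ ψ T : Matrix (Fin 6) (Fin 6) S⸨X⸩} {l c : Fin 6 → ℤ}
    {l' c' : Fin 3 → ℤ} (hl : ∀ b p, l (bidx b p) = l' b) (hc : ∀ b p, c (bidx b p) = c' b)
    {L C : Submodule S (Fin 6 → S⸨X⸩)} (h' : ψ * φ = 1) (hL : IsCoord ψ l L)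
    (hC : IsCoord ψ c C) (hlc : ∀ i, l i ≤ c i)
    (hTL : ∀ v ∈ L, mulVecLin T v ∈ L) (hTC : ∀ v ∈ C, mulVecLin T v ∈ C)
    (htri : BlockUpper 0 (ψ * T * φ)) :
    IsDetOn (mulVecLin T) L C (∏ b, (Matrix.of fun p q =>
      (block (ψ * T * φ) b b p q).coeff 0).det ^ (c' b - l' b).toNat) := by
  have hs := hC.stable h' hTC
  have key := isDetOn_of_isCoord h' hL hC hlc hTL hTC
    (κ := (Σ b, Fin (c' b - l' b).toNat) × Fin 2) (fun k => bidx k.1.1 k.2)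
    (fun k => l' k.1.1 + k.1.2.val) ?_ ?_
  · convert key using 1
    -- Ties are now broken by the block number only, which leaves `2 × 2` matrices of constant terms
    -- on the diagonal.
    rw [det_of_blockTriangular (b := fun k : Σ b, Fin (c' b - l' b).toNat =>
      toLex (c' k.1 - (l' k.1 + (k.2.val : ℤ)), k.1))]
    · rw [Fintype.prod_sigma]
      refine Finset.prod_congr rfl fun i _ => ?_
      simp [block]
    · rintro ⟨i, s⟩ ⟨j, s'⟩ hk
      have hk1 := congrArg (fun x => (ofLex x).1) hk
      have hk2 := congrArg (fun x => (ofLex x).2) hk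
      obtain rfl : i = j := hk2
      have : s = s' := Fin.ext (by simpa using hk1)
      rw [this]
    · rintro ⟨⟨i, s⟩, p⟩ ⟨⟨j, s'⟩, q⟩ hk
      rw [Prod.Lex.toLex_lt_toLex] at hk
      rcases hk with hk | ⟨hk, hk2⟩
      · refine hs _ _ _ ?_
        rw [hc, hc]
        dsimp only at hk ⊢
        omega
      · rw [Matrix.of_apply, htri _ _ (by
          simp only [bidx]
          have : j.val < i.val := hk2
          omega)]
        rfl
  · rintro ⟨⟨i, s⟩, p⟩ ⟨⟨j, s'⟩, q⟩ hij hk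
    obtain ⟨rfl, rfl⟩ := bidx_inj hij
    have : s = s' := Fin.ext (by simpa using hk)
    rw [this]
  · intro j s
    obtain ⟨b, p, rfl⟩ := exists_bidx_eq j
    rw [hl, hc]
    constructor
    · rintro ⟨h1, h2⟩
      exact ⟨⟨⟨b, ⟨(s - l' b).toNat, by omega⟩⟩, p⟩, rfl, by dsimp only; omega⟩
    · rintro ⟨⟨⟨i, k⟩, q⟩, h1, rfl⟩
      obtain ⟨rfl, rfl⟩ := bidx_inj h1
      have := k.2
      dsimp only
      omega

end Lattices

/-! ### Relative determinants -/

section RelativeDeterminants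

variable {ι : Type*} [Fintype ι] {S : Type*} [CommRing S]

lemma stable_add_iff {ι : Type*} {T : Matrix ι ι S⸨X⸩} {b : ι → ℤ} {N : ℤ} :
    Stable (fun i => N + b i) T ↔ Stable b T := by
  refine forall₂_congr fun i j => ?_
  rw [add_sub_add_left_eq_sub]

lemma lattice_single_smul (N : ℤ) (B : Matrix ι ι S⸨X⸩) (v : ι → S⸨X⸩) :
    v ∈ lattice ((HahnSeries.single N (1 : S) : S⸨X⸩) • B) ↔
      (HahnSeries.single (-N) (1 : S) : S⸨X⸩) • v ∈ lattice B := by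
  have h1 : (HahnSeries.single (-N) (1 : S) : S⸨X⸩) * HahnSeries.single N 1 = 1 := by simp
  have h2 : (HahnSeries.single N (1 : S) : S⸨X⸩) * HahnSeries.single (-N) 1 = 1 := by simp
  constructor
  · rintro ⟨w, rfl⟩
    exact ⟨w, by rw [Matrix.smul_mulVec, smul_smul, h1, one_smul]⟩
  · rintro ⟨w, hw⟩
    exact ⟨w, by rw [Matrix.smul_mulVec, ← hw, smul_smul, h2, one_smul]⟩

variable {φ ψ T T' M B : Matrix ι ι S⸨X⸩} {l b : ι → ℤ}

lemma mem_of_map_eq {L : Submodule S (ι → S⸨X⸩)} (h : L.map (mulVecLin T) = L) :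
    ∀ v ∈ L, mulVecLin T v ∈ L := fun _ hv => h ▸ Submodule.mem_map_of_mem hv


lemma IsCoord.single_smul (h : IsCoord ψ b (lattice B)) (N : ℤ) :
    IsCoord ψ (fun i => N + b i) (lattice ((HahnSeries.single N (1 : S) : S⸨X⸩) • B)) := by
  intro v
  rw [lattice_single_smul, h, Matrix.mulVec_smul]
  refine forall_congr' fun i => ?_
  change OrdGe _ (HahnSeries.single (-N) (1 : S) * _) ↔ OrdGe (N + b i) _
  constructor
  · intro hi n hn
    rw [← hi (n - N) (by omega), coeff_single_one_mul]
    congr 1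
    omega
  · intro hi n hn
    rw [coeff_single_one_mul]
    exact hi _ (by omega)

variable [DecidableEq ι]

/-- The lattice of a matrix in coordinates. -/
lemma isCoord_lattice {E E' : Matrix ι ι S⸨X⸩} (h : φ * ψ = 1) (h' : ψ * φ = 1) (hM : M = φ * E)
    (hE : E * E' = 1) (h1 : ∀ i j, OrdGe (l i) (E i j)) (h2 : ∀ i j, OrdGe (-l j) (E' i j)) :
    IsCoord ψ l (lattice M) := by
  intro v
  constructor
  · rintro ⟨w, rfl⟩
    rw [hM, Matrix.mulVec_mulVec, ← Matrix.mul_assoc, h', Matrix.one_mul]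
    exact fun i => OrdGe.sum fun j _ =>
      ((h1 i j).mul (ordGe_ofPowerSeries (w j))).mono (by omega)
  · intro hv
    have h3 : ∀ i, OrdGe 0 ((E' *ᵥ ψ *ᵥ v) i) := fun i => OrdGe.sum fun j _ =>
      ((h2 i j).mul (hv j)).mono (by omega)
    choose w hw using fun i => ordGe_zero_iff.1 (h3 i)
    refine ⟨w, ?_⟩
    rw [← funext hw, hM, Matrix.mulVec_mulVec, Matrix.mulVec_mulVec, Matrix.mul_assoc φ, hE, Matrix.mul_one, h, Matrix.one_mulVec]

lemma IsCoord.map_eq (h : φ * ψ = 1) (hL : IsCoord ψ l (lattice M)) (hTT : T * T' = 1)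
    (hT : Stable l (ψ * T * φ)) (hT' : Stable l (ψ * T' * φ)) :
    (lattice M).map (mulVecLin T) = lattice M := by
  refine le_antisymm ?_ fun v hv => ?_
  · rintro _ ⟨v, hv, rfl⟩
    exact hL.mulVec_mem h hT hv
  · refine ⟨_, hL.mulVec_mem h hT' hv, ?_⟩
    change T *ᵥ T' *ᵥ v = v
    rw [Matrix.mulVec_mulVec, hTT, Matrix.one_mulVec]

/-- Determinants on quotients `L / C` of lattices in the coordinates `ψ` are given by `δ`, where
the exponents of the lattices are constant on the fibres of `π`. -/
def DetBy {κ : Type*} [Fintype κ] (ψ T : Matrix ι ι S⸨X⸩) (π : ι → κ) (b : κ → ℤ) (δ : κ → Sˣ) :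
    Prop :=
  ∀ (L C : Submodule S (ι → S⸨X⸩)) (l : κ → ℤ) (N : ℤ), IsCoord ψ (fun i => l (π i)) L →
    IsCoord ψ (fun i => N + b (π i)) C → (∀ k, l k ≤ N + b k) →
    (∀ v ∈ L, mulVecLin T v ∈ L) → (∀ v ∈ C, mulVecLin T v ∈ C) →
    IsDetOn (mulVecLin T) L C ((∏ k, δ k ^ (N + b k - l k).toNat : Sˣ) : S)

variable {κ : Type*} [Fintype κ] {π : ι → κ} {l' b' : κ → ℤ} {δ : κ → Sˣ} {r : Sˣ}

/-- The auxiliary shift `N` cancels in the ratio of the two determinants and leaves the exponents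
`b' - l'`. -/
lemma prod_zpow_toNat {N : ℤ} (hl : ∀ k, l' k ≤ N + b' k) (hN : 0 ≤ N) :
    ∏ k, δ k ^ (N + b' k - l' k).toNat =
      (∏ k, δ k ^ (b' k - l' k)) * ∏ k, δ k ^ (N + b' k - b' k).toNat := by
  rw [← Finset.prod_mul_distrib]
  refine Finset.prod_congr rfl fun k _ => ?_
  have h := hl k
  rw [← zpow_natCast, ← zpow_natCast, ← _root_.zpow_add]
  congr 1
  omega

theorem DetBy.eq_of_isRelDet (hπ : Function.Surjective π) (hd : DetBy ψ T π b' δ)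
    (h : φ * ψ = 1) (h' : ψ * φ = 1) (hL : IsCoord ψ (fun i => l' (π i)) (lattice M))
    (hB : IsCoord ψ (fun i => b' (π i)) (lattice B)) (hr : IsRelDet T M B r) :
    r = ∏ k, δ k ^ (b' k - l' k) := by
  obtain ⟨hTM, hTB, N, d, d₀, h1, h2, h3⟩ := hr
  -- Over the zero ring orders carry no information, but there is only one unit.
  cases subsingleton_or_nontrivial S
  · exact Subsingleton.elim _ _
  have hC := hB.single_smul N
  have hsB := hB.stable h' (mem_of_map_eq hTB)
  have hTC : ∀ v ∈ lattice ((HahnSeries.single (N : ℤ) (1 : S) : S⸨X⸩) • B),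
      mulVecLin T v ∈ lattice ((HahnSeries.single (N : ℤ) (1 : S) : S⸨X⸩) • B) :=
    fun v hv => hC.mulVec_mem h (stable_add_iff.2 hsB) hv
  have hl : ∀ k, l' k ≤ N + b' k := by
    intro k
    obtain ⟨i, rfl⟩ := hπ k
    obtain ⟨_, _, hCL, _⟩ := h1
    have hi := (hL _).1 (hCL (hC.mulVec_single_mem h' i le_rfl)) i
    rw [Matrix.mulVec_mulVec, h', Matrix.one_mulVec, Pi.single_eq_same] at hi
    exact le_of_ordGe_single hi
  have e1 := isDetOn_unique h1 (hd _ _ _ _ hL hC hl (mem_of_map_eq hTM) hTC)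
  have e2 := isDetOn_unique h2 (hd _ _ _ _ hB hC (fun k => by omega) (mem_of_map_eq hTB) hTC)
  rw [e1, e2, prod_zpow_toNat hl (Int.natCast_nonneg N)] at h3
  exact (mul_right_cancel (Units.ext h3)).symm

theorem DetBy.isRelDet (hd : DetBy ψ T π b' δ)
    (h : φ * ψ = 1) (hL : IsCoord ψ (fun i => l' (π i)) (lattice M))
    (hB : IsCoord ψ (fun i => b' (π i)) (lattice B)) (hTT : T * T' = 1)
    (h1 : Stable (fun i => l' (π i)) (ψ * T * φ)) (h2 : Stable (fun i => l' (π i)) (ψ * T' * φ))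
    (h3 : Stable (fun i => b' (π i)) (ψ * T * φ)) (h4 : Stable (fun i => b' (π i)) (ψ * T' * φ)) :
    IsRelDet T M B (∏ k, δ k ^ (b' k - l' k)) := by
  have hTM := hL.map_eq h hTT h1 h2
  have hTB := hB.map_eq h hTT h3 h4
  obtain ⟨N, hN⟩ : ∃ N : ℕ, ∀ k, l' k ≤ N + b' k := by
    refine ⟨∑ k, (l' k - b' k).toNat, fun k => ?_⟩
    have := Finset.single_le_sum (f := fun k => (l' k - b' k).toNat) (fun _ _ => Nat.zero_le _)
      (Finset.mem_univ k)
    omega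
  have hC := hB.single_smul N
  have hTC : ∀ v ∈ lattice ((HahnSeries.single (N : ℤ) (1 : S) : S⸨X⸩) • B),
      mulVecLin T v ∈ lattice ((HahnSeries.single (N : ℤ) (1 : S) : S⸨X⸩) • B) :=
    fun v hv => hC.mulVec_mem h (stable_add_iff.2 h3) hv
  refine ⟨hTM, hTB, N, _, _, hd _ _ _ _ hL hC hN (mem_of_map_eq hTM) hTC,
    hd _ _ _ _ hB hC (fun k => by omega) (mem_of_map_eq hTB) hTC, ?_⟩
  rw [prod_zpow_toNat hN (Int.natCast_nonneg N), Units.val_mul]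

theorem detBy_of_triangular {τ : ι → Sˣ} (h' : ψ * φ = 1) {ρ : ι → ℤ} (hρ : Function.Injective ρ)
    (htri : ∀ i j, ρ j < ρ i → ((ψ * T * φ) i j).coeff (b i - b j) = 0)
    (hτ : ∀ i, ((ψ * T * φ) i i).coeff 0 = τ i) : DetBy ψ T id b τ := by
  intro L C l N hL hC hl hTL hTC
  have := isDetOn_of_triangular h' hL hC hl hTL hTC hρ fun i j hij => by
    rw [add_sub_add_left_eq_sub]
    exact htri i j hij
  simp only [hτ] at this
  rw [Units.coe_prod]
  exact this

/-- The number of the block of an index. -/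
def bnum (i : Fin 6) : Fin 3 := ⟨i.val / 2, by omega⟩

lemma bnum_bidx (b : Fin 3) (p : Fin 2) : bnum (bidx b p) = b :=
  Fin.ext (by simp only [bnum, bidx]; omega)

lemma bnum_surjective : Function.Surjective bnum := fun b => ⟨bidx b 0, bnum_bidx b 0⟩

theorem detBy_of_blockTriangular {φ ψ T : Matrix (Fin 6) (Fin 6) S⸨X⸩} {b : Fin 3 → ℤ}
    {δ : Fin 3 → Sˣ} (h' : ψ * φ = 1) (htri : BlockUpper 0 (ψ * T * φ))
    (hδ : ∀ k, (Matrix.of fun p q => (block (ψ * T * φ) k k p q).coeff 0).det = δ k) :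
    DetBy ψ T bnum b δ := by
  intro L C l N hL hC hl hTL hTC
  have := isDetOn_of_blockTriangular (l' := l) (c' := fun k => N + b k)
    (fun k p => by rw [bnum_bidx]) (fun k p => by rw [bnum_bidx]) h' hL hC (fun i => hl _) hTL hTC
    htri
  simp only [hδ] at this
  rw [Units.coe_prod]
  exact this

end RelativeDeterminants

/-! ### Multipliers -/

section Multipliers

variable {B C : Type*} [CommRing B] [CommRing C]

/-- The matrix `M` multiplies the symplectic form by `ν`. -/
def IsMult (M : Matrix (Fin 6) (Fin 6) B) (ν : B) : Prop := Mᵀ * gram B * M = ν • gram B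

lemma IsMult.mul {M N : Matrix (Fin 6) (Fin 6) B} {μ ν : B} (hM : IsMult M μ) (hN : IsMult N ν) :
    IsMult (M * N) (μ * ν) := by
  have h : (M * N)ᵀ * gram B * (M * N) = Nᵀ * (Mᵀ * gram B * M) * N := by
    simp only [Matrix.transpose_mul, Matrix.mul_assoc]
  rw [IsMult, h, hM, Matrix.mul_smul, Matrix.smul_mul, hN, smul_smul]

lemma IsMult.smul {M : Matrix (Fin 6) (Fin 6) B} {ν : B} (hM : IsMult M ν) (c : B) :
    IsMult (c • M) (c * c * ν) := by
  rw [IsMult, Matrix.transpose_smul, Matrix.smul_mul, Matrix.smul_mul, Matrix.mul_smul, hM,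
    smul_smul, smul_smul, mul_assoc]

lemma IsMult.map {M : Matrix (Fin 6) (Fin 6) B} {ν : B} (hM : IsMult M ν) (f : B →+* C) :
    IsMult (M.map f) (f ν) := by
  have h := congrArg f.mapMatrix hM
  rw [map_mul, map_mul, gram_map] at h
  rw [IsMult, ← Matrix.transpose_map]
  refine h.trans (Matrix.ext fun i j => ?_)
  have := congrFun (congrFun (gram_map f) i) j
  rw [RingHom.mapMatrix_apply, Matrix.map_apply] at this
  rw [RingHom.mapMatrix_apply, Matrix.map_apply, Matrix.smul_apply, Matrix.smul_apply, smul_eq_mul,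
    map_mul, this]
  rfl

lemma IsMult.unique {M : Matrix (Fin 6) (Fin 6) B} {μ ν : B} (h : IsMult M μ) (h' : IsMult M ν) :
    μ = ν := by
  have := congrFun (congrFun (h.symm.trans h') 0) 5
  simpa [gram] using this

lemma isMult_leviPair (x : GL (Fin 2) B × GL (Fin 2) B) :
    IsMult (leviPair B x).1.1 (GeneralLinearGroup.det x.2 : Bˣ) := by
  obtain ⟨P, Q⟩ := x
  obtain ⟨ν, hν⟩ := GSp.exists_multiplier (leviPair B (P, Q))
  have h : (ν : B) = (GeneralLinearGroup.det Q : Bˣ) := by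
    have := congrFun (congrFun hν 2) 3
    rw [transpose_mul_gram_mul_apply, leviPair_val] at this
    rw [GeneralLinearGroup.val_det_apply, Matrix.det_fin_two]
    simp [blockDiag, gram] at this
    rw [← this, mul_comm (Q.val 1 0)]
  rw [← h]
  exact hν

lemma isMult_of_mem_unip {u : GSp B} (hu : u ∈ unip B) : IsMult u.1.1 1 := by
  obtain ⟨ν, hν⟩ := GSp.exists_multiplier u
  have h : (ν : B) = 1 := by
    have := congrFun (congrFun hν 2) 3
    rw [transpose_mul_gram_mul_apply] at this
    have e : ∀ i j : Fin 6, j.val / 2 ≤ i.val / 2 → u.1.1 i j = (1 : Matrix (Fin 6) (Fin 6) B) i j :=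
      hu
    rw [e 2 2 (by decide), e 3 3 (by decide), e 3 2 (by decide), e 4 2 (by decide),
      e 5 2 (by decide), e 2 3 (by decide), e 4 3 (by decide), e 5 3 (by decide)] at this
    simpa [gram] using this.symm
  rw [← h]
  exact hν

end Multipliers

/-! ### Diagonal matrices -/

section Diagonal

variable (R : Type*) [CommRing R]

/-- The diagonal matrix whose first diagonal entries have the given exponents. -/
def diagPair (l : Fin 4 → ℤ) : GSp R⸨X⸩ :=
  leviPair _ (diagUnit ![tpowR R (l 0), tpowR R (l 1)], diagUnit ![tpowR R (l 2), tpowR R (l 3)])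

/-- The exponents of `diagPair`. -/
def expo (l : Fin 4 → ℤ) : Fin 6 → ℤ :=
  ![l 0, l 1, l 2, l 3, l 2 + l 3 - l 1, l 2 + l 3 - l 0]

lemma diagPair_val (l : Fin 4 → ℤ) : (diagPair R l).1.1 =
    Matrix.diagonal fun i => HahnSeries.single (expo l i) 1 := by
  have h : ((GeneralLinearGroup.det (diagUnit ![tpowR R (l 2), tpowR R (l 3)]) *
      (GeneralLinearGroup.det (diagUnit ![tpowR R (l 0), tpowR R (l 1)]))⁻¹ : R⸨X⸩ˣ) : R⸨X⸩) =
      HahnSeries.single (l 2 + l 3 - l 1 - l 0) 1 := by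
    have h1 : ∀ m n : ℤ, GeneralLinearGroup.det (diagUnit ![tpowR R m, tpowR R n]) =
        tpowR R (m + n) := fun m n => by
      refine Units.ext ?_
      rw [GeneralLinearGroup.val_det_apply]
      simp [diagUnit, tpowR]
    rw [h1, h1]
    change HahnSeries.single (l 2 + l 3) (1 : R) * HahnSeries.single (-(l 0 + l 1)) 1 = _
    rw [HahnSeries.single_mul_single, mul_one]
    congr 1
    ring_nf
  rw [diagPair, leviPair_val, h]
  refine Matrix.ext fun i j => ?_
  have e1 : l 2 + l 3 - l 1 - l 0 + l 0 = l 2 + l 3 - l 1 := by ring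
  have e2 : l 2 + l 3 - l 1 - l 0 + l 1 = l 2 + l 3 - l 0 := by ring
  fin_cases i <;> fin_cases j <;>
    simp [blockDiag, signTwist, diagUnit, tpowR, expo, e1, e2]

lemma diagPair_inv_val (l : Fin 4 → ℤ) : ((diagPair R l)⁻¹).1.1 =
    Matrix.diagonal fun i => HahnSeries.single (-expo l i) 1 := by
  have h : (Matrix.diagonal fun i => HahnSeries.single (-expo l i) (1 : R)) * (diagPair R l).1.1 =
      1 := by
    rw [diagPair_val, Matrix.diagonal_mul_diagonal, ← Matrix.diagonal_one]
    congr 1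
    funext i
    simp
  have h2 := GSp.mul_inv_val (diagPair R l)
  calc _ = (Matrix.diagonal fun i => HahnSeries.single (-expo l i) (1 : R)) *
        (diagPair R l).1.1 * ((diagPair R l)⁻¹).1.1 := by rw [h, Matrix.one_mul]
    _ = _ := by rw [Matrix.mul_assoc, h2, Matrix.mul_one]

lemma isMult_diagPair (l : Fin 4 → ℤ) :
    IsMult (diagPair R l).1.1 (tpowR R (l 2 + l 3) : R⸨X⸩ˣ) := by
  have h : GeneralLinearGroup.det (diagUnit ![tpowR R (l 2), tpowR R (l 3)]) =
      tpowR R (l 2 + l 3) := by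
    refine Units.ext ?_
    rw [GeneralLinearGroup.val_det_apply]
    simp [diagUnit, tpowR]
  rw [← h]
  exact isMult_leviPair _

/-- The exponents of `balanced`. -/
def bal (a : ℕ) : Fin 3 → ℤ := fun b => a * ![-1, 0, 1] b

variable {R}

lemma bal_bnum (a : ℕ) (i : Fin 6) : bal a (bnum i) = (a : ℤ) * ![-1, -1, 0, 0, 1, 1] i := by
  fin_cases i <;> rfl

/-- Coordinates of the balanced lattice. -/
lemma isCoord_balanced {a : ℕ} {φ ψ : Matrix (Fin 6) (Fin 6) R⸨X⸩} (h : φ * ψ = 1) (h' : ψ * φ = 1)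
    (hφ : Stable (fun i => bal a (bnum i)) φ) (hψ : Stable (fun i => bal a (bnum i)) ψ) :
    IsCoord ψ (fun i => bal a (bnum i)) (lattice (balanced R a)) := by
  have hb : balanced R a = Matrix.diagonal fun i => HahnSeries.single (bal a (bnum i)) (1 : R) := by
    rw [balanced]
    congr 1
    funext i
    rw [bal_bnum]
  have hbb : balanced R a *
      (Matrix.diagonal fun i => HahnSeries.single (-bal a (bnum i)) (1 : R)) = 1 := by
    rw [hb, Matrix.diagonal_mul_diagonal, ← Matrix.diagonal_one]
    congr 1
    funext i
    simp
  refine isCoord_lattice h h' (E := ψ * balanced R a)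
    (E' := (Matrix.diagonal fun i => HahnSeries.single (-bal a (bnum i)) (1 : R)) * φ) ?_ ?_ ?_ ?_
  · rw [← Matrix.mul_assoc, h, Matrix.one_mul]
  · rw [Matrix.mul_assoc, ← Matrix.mul_assoc (balanced R a), hbb, Matrix.one_mul, h']
  · intro i j
    rw [hb, Matrix.mul_diagonal]
    exact ((hψ i j).mul (ordGe_single le_rfl 1)).mono (by dsimp only; omega)
  · intro i j
    rw [Matrix.diagonal_mul]
    exact ((ordGe_single le_rfl 1).mul (hφ i j)).mono (by dsimp only; omega)

end Diagonal

/-! ### Coordinates of points of the affine Grassmannian -/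

section Coordinates

/-- The unit `c` is a power of the variable times a unit of the ring of power series. -/
def UnitOrd {R : Type*} [CommRing R] (γ : ℤ) (c : R⸨X⸩ˣ) : Prop :=
  OrdGe γ (c : R⸨X⸩) ∧ OrdGe (-γ) ((c⁻¹ : R⸨X⸩ˣ) : R⸨X⸩)

lemma UnitOrd.mul {R : Type*} [CommRing R] {γ γ' : ℤ} {c c' : R⸨X⸩ˣ} (h : UnitOrd γ c)
    (h' : UnitOrd γ' c') : UnitOrd (γ + γ') (c * c') := by
  refine ⟨h.1.mul h'.1, ?_⟩
  rw [_root_.mul_inv_rev, Units.val_mul]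
  exact (h'.2.mul h.2).mono (by omega)

lemma unitOrd_tpowR (R : Type*) [CommRing R] (n : ℤ) : UnitOrd n (tpowR R n) :=
  ⟨ordGe_single le_rfl 1, ordGe_single le_rfl 1⟩

lemma unitOrd_ofPowerSeries {R : Type*} [CommRing R] (η : R⟦X⟧ˣ) :
    UnitOrd 0 (Units.map (HahnSeries.ofPowerSeries ℤ R).toMonoidHom η) :=
  ⟨ordGe_ofPowerSeries η.val, ordGe_ofPowerSeries (η⁻¹).val⟩

lemma OrdGeM.mul_diagonal {R ι : Type*} [CommRing R] [Fintype ι] [DecidableEq ι] {s : ℤ}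
    {M : Matrix ι ι R⸨X⸩} (hM : OrdGeM s M) (l : ι → ℤ) (i j : ι) :
    OrdGe (s + l j) ((M * Matrix.diagonal fun i => HahnSeries.single (l i) (1 : R) : Matrix ι ι R⸨X⸩) i j) := by
  rw [Matrix.mul_diagonal]
  exact (hM i j).mul (ordGe_single le_rfl 1)

lemma OrdGeM.diagonal_mul {R ι : Type*} [CommRing R] [Fintype ι] [DecidableEq ι] {s : ℤ}
    {M : Matrix ι ι R⸨X⸩} (hM : OrdGeM s M) (l : ι → ℤ) (i j : ι) :
    OrdGe (l i + s) (((Matrix.diagonal fun i => HahnSeries.single (l i) (1 : R)) * M : Matrix ι ι R⸨X⸩) i j) := by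
  rw [Matrix.diagonal_mul]
  exact (ordGe_single le_rfl 1).mul (hM i j)

/-- The base change of a matrix with complex coefficients. -/
abbrev GSp.baseChange (S : Type*) [CommRing S] [Algebra ℂ S] : GSp ℂ⸨X⸩ →* GSp S⸨X⸩ :=
  GSp.laurent (algebraMap ℂ S)

lemma GSp.inv_mul_val_of_smul {B : Type*} [CommRing B] {p D k M : GSp B} {c : Bˣ}
    (h : M.1.1 = (c : B) • ((p * D).1.1 * k.1.1)) :
    (p⁻¹ * M).1.1 = (c : B) • (D.1.1 * k.1.1) ∧
      ((p⁻¹ * M)⁻¹).1.1 = ((c⁻¹ : Bˣ) : B) • ((k⁻¹).1.1 * (D⁻¹).1.1) := by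
  have h1 : (p⁻¹ * M).1.1 = (c : B) • (D.1.1 * k.1.1) := by
    rw [GSp.coe_mul, h, GSp.coe_mul, Matrix.mul_smul, Matrix.mul_assoc p.1.1, ← Matrix.mul_assoc,
      GSp.inv_mul_val, Matrix.one_mul]
  refine ⟨h1, ?_⟩
  have h2 : ((c⁻¹ : Bˣ) : B) • ((k⁻¹).1.1 * (D⁻¹).1.1) * (p⁻¹ * M).1.1 = 1 := by
    rw [h1, Matrix.smul_mul, Matrix.mul_smul, smul_smul, Units.inv_mul, one_smul,
      Matrix.mul_assoc, ← Matrix.mul_assoc (D⁻¹).1.1, GSp.inv_mul_val, Matrix.one_mul,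
      GSp.inv_mul_val]
  rw [← Matrix.one_mul ((p⁻¹ * M)⁻¹).1.1, ← h2, Matrix.mul_assoc, GSp.mul_inv_val, Matrix.mul_one]

/-- Another matrix of the same point differs by a scalar and an integral factor. Only the order `γ`
of the scalar matters: it shifts all six exponents by `γ` and the order of the multiplier by `2 γ`.
-/
lemma exists_isCoord_of_mk_eq {p M : GSp ℂ⸨X⸩} {l : Fin 4 → ℤ} {μ : ℂ⸨X⸩ˣ} (hμ : IsMult p.1.1 μ)
    (h0 : UnitOrd 0 μ)
    (h : Gr.mk M = Gr.mk (p * diagPair ℂ l)) : ∃ γ : ℤ,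
    (∀ (S : Type) [CommRing S] [Algebra ℂ S],
      IsCoord ((GSp.baseChange S p)⁻¹).1.1 (fun i => γ + expo l i)
        (lattice (GSp.baseChange S M).1.1)) ∧
    ∀ ν : ℂ⸨X⸩ˣ, IsMult M.1.1 ν → UnitOrd (2 * γ + (l 2 + l 3)) ν := by
  obtain ⟨c, k, hk⟩ := Gr.mk_eq_mk.1 h.symm
  obtain ⟨γ, hc, hc'⟩ := exists_ordGe_units c
  refine ⟨γ, fun S _ _ => ?_, fun ν hν => ?_⟩
  · obtain ⟨hE, hE'⟩ := GSp.inv_mul_val_of_smul hk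
    rw [← map_inv] at hE'
    refine isCoord_lattice (φ := (GSp.baseChange S p).1.1) (GSp.mul_inv_val _) (GSp.inv_mul_val _)
      (E := (GSp.baseChange S (p⁻¹ * M)).1.1) (E' := (GSp.baseChange S (p⁻¹ * M)⁻¹).1.1) ?_ ?_ ?_ ?_
    · rw [← GSp.coe_mul, ← map_mul, mul_inv_cancel_left]
    · rw [← GSp.coe_mul, ← map_mul, mul_inv_cancel, map_one]
      rfl
    · intro i j
      refine OrdGe.map (algebraMap ℂ S) ?_
      change OrdGe _ ((p⁻¹ * M).1.1 i j)
      rw [hE, diagPair_val]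
      exact (hc.mul ((ordGeM_ofPowerSeries k.1.1).diagonal_mul (expo l) i j)).mono (by omega)
    · intro i j
      refine OrdGe.map (algebraMap ℂ S) ?_
      change OrdGe _ (((p⁻¹ * M)⁻¹).1.1 i j)
      rw [hE', diagPair_inv_val]
      exact (hc'.mul ((ordGeM_ofPowerSeries (k⁻¹).1.1).mul_diagonal (fun i => -expo l i)
        i j)).mono (by omega)
  · obtain ⟨η, hη⟩ := GSp.exists_multiplier k
    have h1 := (((hμ.mul (isMult_diagPair ℂ l)).mul
      (IsMult.map (M := k.1.1) hη (HahnSeries.ofPowerSeries ℤ ℂ))).smul c)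
    have h2 : ν = c * c * (μ * tpowR ℂ (l 2 + l 3) *
        Units.map (HahnSeries.ofPowerSeries ℤ ℂ).toMonoidHom η) :=
      Units.ext (hν.unique (by rw [hk]; exact h1))
    have h3 := (UnitOrd.mul ⟨hc, hc'⟩ ⟨hc, hc'⟩).mul
      ((h0.mul (unitOrd_tpowR ℂ (l 2 + l 3))).mul (unitOrd_ofPowerSeries η))
    rw [h2, show 2 * γ + (l 2 + l 3) = γ + γ + (0 + (l 2 + l 3) + 0) by ring]
    exact h3

end Coordinates

/-! ### Weights of fibres -/

section Weights

variable {S : Type} [CommRing S]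

lemma coeff_zero_ofPowerSeries (x : S⟦X⟧) :
    (HahnSeries.ofPowerSeries ℤ S x).coeff 0 = PowerSeries.constantCoeff x := by
  have := HahnSeries.ofPowerSeries_apply_coeff (Γ := ℤ) x 0
  rw [Nat.cast_zero] at this
  rw [this, PowerSeries.coeff_zero_eq_constantCoeff_apply]

/-- The constant coefficient of the determinant. -/
def detUnit (A : GL (Fin 2) S⟦X⟧) : Sˣ :=
  Units.map (PowerSeries.constantCoeff (R := S)).toMonoidHom (GeneralLinearGroup.det A)

lemma isCoord_of_unit {ι : Type*} [Fintype ι] [DecidableEq ι] [Unique ι] {x y : S⸨X⸩} (hxy : x * y = 1)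
    {v : ℤ} (hx : OrdGe v x) (hy : OrdGe (-v) y) :
    IsCoord 1 (fun _ => v) (lattice (Matrix.of fun _ _ : ι => x)) := by
  refine isCoord_lattice (φ := 1) (E := Matrix.of fun _ _ : ι => x)
    (E' := Matrix.of fun _ _ : ι => y) (mul_one 1) (mul_one 1) (Matrix.one_mul _).symm ?_
    (fun _ _ => hx) fun _ _ => hy
  refine Matrix.ext fun i j => ?_
  rw [Matrix.mul_apply, Fintype.sum_unique, Subsingleton.elim i j, Matrix.one_apply_eq]
  exact hxy

lemma isCoord_one {ι : Type*} [Fintype ι] [DecidableEq ι] :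
    IsCoord 1 (fun _ => 0) (lattice (1 : Matrix ι ι S⸨X⸩)) := by
  have h : OrdGeM 0 (1 : Matrix ι ι S⸨X⸩) := by
    intro i j
    rw [Matrix.one_apply]
    split_ifs
    · exact ordGe_one
    · exact OrdGe.zero 0
  refine isCoord_lattice (φ := 1) (E := 1) (E' := 1) (mul_one 1) (mul_one 1) (mul_one 1).symm
    (mul_one 1) h h


lemma detBy_det (A : GL (Fin 2) S⟦X⟧) :
    DetBy 1 (Matrix.of fun _ _ : Fin 1 => HahnSeries.ofPowerSeries ℤ S A.1.det) id 0
      fun _ => detUnit A := by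
  refine detBy_of_triangular (φ := 1) (ρ := fun _ => 0) (mul_one 1) (fun i j _ => Subsingleton.elim i j) ?_ ?_
  · intro i j hij
    exact absurd hij (lt_irrefl _)
  · intro i
    rw [Matrix.one_mul, Matrix.mul_one, Matrix.of_apply, coeff_zero_ofPowerSeries]
    rfl

variable [Algebra ℂ S] variable {ν : ℂ⸨X⸩ˣ} {v : ℤ}

lemma isCoord_multiplier (h1 : UnitOrd v ν) :
    IsCoord 1 (fun _ => v)
      (lattice (Matrix.of fun _ _ : Fin 1 => laurentMap (algebraMap ℂ S) ν)) :=
  isCoord_of_unit (by rw [← map_mul, Units.mul_inv, map_one]) (h1.1.map (algebraMap ℂ S))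
    (h1.2.map (algebraMap ℂ S))

lemma eq_of_isRelDet_det {A : GL (Fin 2) S⟦X⟧} {e : Sˣ} (h1 : UnitOrd v ν)
    (h : IsRelDet (Matrix.of fun _ _ : Fin 1 => HahnSeries.ofPowerSeries ℤ S A.1.det)
      (Matrix.of fun _ _ : Fin 1 => laurentMap (algebraMap ℂ S) ν) 1 e) : e = detUnit A ^ (-v) := by
  rw [(detBy_det A).eq_of_isRelDet (φ := 1) (l' := fun _ => v) Function.surjective_id (mul_one 1) (mul_one 1)
    (isCoord_multiplier h1) isCoord_one h]
  simp

lemma isRelDet_det (A : GL (Fin 2) S⟦X⟧) (h1 : UnitOrd v ν) :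
    IsRelDet (Matrix.of fun _ _ : Fin 1 => HahnSeries.ofPowerSeries ℤ S A.1.det)
      (Matrix.of fun _ _ : Fin 1 => laurentMap (algebraMap ℂ S) ν) 1 (detUnit A ^ (-v)) := by
  have hs : ∀ (b : ℤ) (x : S⟦X⟧), Stable (fun _ => b)
      (1 * (Matrix.of fun _ _ : Fin 1 => HahnSeries.ofPowerSeries ℤ S x) * 1) := by
    intro b x i j
    rw [sub_self, Matrix.one_mul, Matrix.mul_one]
    exact ordGe_ofPowerSeries x
  have := (detBy_det A).isRelDet (φ := 1) (l' := fun _ => v) (mul_one 1)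
    (isCoord_multiplier h1) isCoord_one
    (T' := Matrix.of fun _ _ : Fin 1 => HahnSeries.ofPowerSeries ℤ S (A⁻¹).1.det) ?_
    (hs _ _) (hs _ _) (hs _ _) (hs _ _)
  · simpa using this
  · refine Matrix.ext fun i j => ?_
    rw [Matrix.mul_apply, Fintype.sum_unique, Subsingleton.elim i j, Matrix.one_apply_eq]
    change HahnSeries.ofPowerSeries ℤ S A.1.det * HahnSeries.ofPowerSeries ℤ S (A⁻¹).1.det = 1
    rw [← map_mul, ← Matrix.det_mul, Units.mul_inv, Matrix.det_one, map_one]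

/-- The matrix of the point hidden in `IsFibreWeight` is arbitrary, so the weight is expressed
through an unknown shift `γ`, which cancels in the later computations. -/
theorem exists_of_isFibreWeight {p : GSp ℂ⸨X⸩} {l : Fin 4 → ℤ} {μ : ℂ⸨X⸩ˣ} (hμ : IsMult p.1.1 μ)
    (h0 : UnitOrd 0 μ) {s : PSp S⸨X⸩} {w : Sˣ}
    (hw : IsFibreWeight (Gr.mk (p * diagPair ℂ l)) s w) :
    ∃ (M : GSp S⸨X⸩) (γ : ℤ) (A : GL (Fin 2) S⟦X⟧) (u : GSp S⸨X⸩) (a : ℕ) (d : Sˣ),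
      u ∈ unip S⸨X⸩ ∧
      IsCoord ((GSp.baseChange S p)⁻¹).1.1 (fun i => γ + expo l i) (lattice M.1.1) ∧
      IsRelDet (leviUnip A u).1.1 M.1.1 (balanced S a) d ∧
      w = d ^ (-4 : ℤ) * detUnit A ^ (-6 * (2 * γ + (l 2 + l 3))) := by
  obtain ⟨M, ν, A, u, a, d, e, hM, hν, hu, -, hd, he, rfl⟩ := hw
  obtain ⟨γ, h1, h2⟩ := exists_isCoord_of_mk_eq hμ h0 hM
  refine ⟨_, γ, A, u, a, d, hu, h1 S, hd, ?_⟩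
  rw [eq_of_isRelDet_det (h2 ν hν) he, ← _root_.zpow_mul]
  congr 2
  ring

/-- To exhibit a weight the given representative may be used, for which `γ = 0`. -/
theorem isFibreWeight_of {p : GSp ℂ⸨X⸩} {l : Fin 4 → ℤ} {μ : ℂ⸨X⸩ˣ} (hμ : IsMult p.1.1 μ)
    (h0 : UnitOrd 0 μ) {A : GL (Fin 2) S⟦X⟧}
    {u : GSp S⸨X⸩} (hu : u ∈ unip S⸨X⸩) {a : ℕ} {d : Sˣ}
    (hd : ∀ M : GSp S⸨X⸩, IsCoord ((GSp.baseChange S p)⁻¹).1.1 (expo l) (lattice M.1.1) →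
      IsRelDet (leviUnip A u).1.1 M.1.1 (balanced S a) d) :
    IsFibreWeight (Gr.mk (p * diagPair ℂ l)) (PSp.mk (leviUnip A u))
      (d ^ (-4 : ℤ) * detUnit A ^ (-6 * (l 2 + l 3))) := by
  have hm : IsMult (p * diagPair ℂ l).1.1 ((μ * tpowR ℂ (l 2 + l 3) : ℂ⸨X⸩ˣ) : ℂ⸨X⸩) :=
    hμ.mul (isMult_diagPair ℂ l)
  have h1 : UnitOrd (l 2 + l 3) (μ * tpowR ℂ (l 2 + l 3)) := by
    have := h0.mul (unitOrd_tpowR ℂ (l 2 + l 3))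
    rwa [zero_add] at this
  refine ⟨p * diagPair ℂ l, _, A, u, a, d, detUnit A ^ (-(l 2 + l 3)), rfl, hm, hu, rfl, ?_,
    isRelDet_det A h1, ?_⟩
  · refine hd (GSp.baseChange S (p * diagPair ℂ l)) ?_
    refine isCoord_lattice (φ := (GSp.baseChange S p).1.1) (GSp.mul_inv_val _) (GSp.inv_mul_val _)
      (E := (GSp.baseChange S (diagPair ℂ l)).1.1) (E' := (GSp.baseChange S (diagPair ℂ l)⁻¹).1.1)
      ?_ ?_ ?_ ?_
    · rw [← GSp.coe_mul, ← map_mul]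
    · rw [← GSp.coe_mul, ← map_mul, mul_inv_cancel, map_one]
      rfl
    · intro i j
      refine OrdGe.map (algebraMap ℂ S) ?_
      change OrdGe _ ((diagPair ℂ l).1.1 i j)
      rw [diagPair_val, Matrix.diagonal_apply]
      split_ifs
      · exact ordGe_single le_rfl 1
      · exact OrdGe.zero _
    · intro i j
      refine OrdGe.map (algebraMap ℂ S) ?_
      change OrdGe _ (((diagPair ℂ l)⁻¹).1.1 i j)
      rw [diagPair_inv_val, Matrix.diagonal_apply]
      split_ifs with h
      · exact ordGe_single (by rw [h]) 1
      · exact OrdGe.zero _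
  · rw [← _root_.zpow_mul]
    congr 2
    ring

end Weights

/-! ### Weights of stabilizers -/

section StabilizerWeights

variable {S : Type} [CommRing S]

lemma stable_bal_leviPair {a : ℕ} {x : GL (Fin 2) S⸨X⸩ × GL (Fin 2) S⸨X⸩}
    (hx : ∀ b, OrdGeM 0 (block (leviPair _ x).1.1 b b)) :
    Stable (fun i => bal a (bnum i)) (leviPair _ x).1.1 := by
  intro i j
  obtain ⟨b, p, rfl⟩ := exists_bidx_eq i
  obtain ⟨b', q, rfl⟩ := exists_bidx_eq j
  change OrdGe _ (block (leviPair _ x).1.1 b b' p q)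
  by_cases h : b = b'
  · subst h
    simp only [bnum_bidx, sub_self]
    exact hx b p q
  · rw [show block (leviPair _ x).1.1 b b' = 0 from block_blockDiag_of_ne _ _ _ h]
    exact OrdGe.zero _

lemma block_leviPair_of_det_eq {B : Type*} [CommRing B] {P Q : GL (Fin 2) B}
    (h : GeneralLinearGroup.det Q = GeneralLinearGroup.det P) (b : Fin 3) :
    block (leviPair B (P, Q)).1.1 b b = ![P.val, Q.val, signTwist B P.val] b := by
  rw [leviPair_val, h, mul_inv_cancel, Units.val_one, one_smul, block_blockDiag_self]

lemma levi₃_one_left_val {B : Type*} [CommRing B] (Q : GL (Fin 2) B) :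
    (levi₃ B (1, Q)).val = (GeneralLinearGroup.det Q : B) • 1 := by
  rw [levi₃_val, map_one, inv_one, mul_one, Units.val_one, map_one]

lemma ordGeM_one {n R : Type*} [CommRing R] [DecidableEq n] :
    OrdGeM 0 (1 : Matrix n n R⸨X⸩) := by
  intro i j
  rw [Matrix.one_apply]
  split_ifs
  · exact ordGe_one
  · exact OrdGe.zero 0

lemma ordGeM_block_leviPair_one_left (Q : GL (Fin 2) S⟦X⟧) (b : Fin 3) :
    OrdGeM 0 (block (leviPair _ (1, glInt S Q)).1.1 b b) := by
  have h : ∀ M ∈ [1, (glInt S Q).val, (levi₃ S⸨X⸩ (1, glInt S Q)).val], OrdGeM 0 M := by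
    intro M hM
    simp only [List.mem_cons, List.not_mem_nil, or_false] at hM
    have hQ : OrdGeM 0 (glInt S Q).val := ordGeM_ofPowerSeries Q.val
    rcases hM with rfl | rfl | rfl
    · exact ordGeM_one
    · exact hQ
    · rw [levi₃_one_left_val, GeneralLinearGroup.val_det_apply]
      exact OrdGeM.smul hQ.det ordGeM_one
  have e : block (leviPair _ (1, glInt S Q)).1.1 b b =
      ![1, (glInt S Q).val, (levi₃ S⸨X⸩ (1, glInt S Q)).val] b := block_blockDiag_self _ _ _ b
  rw [e]
  refine h _ ?_
  fin_cases b <;> simp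

lemma glInt_det_unit {R : Type*} [CommRing R] (Q : GL (Fin 2) R⟦X⟧) :
    GeneralLinearGroup.det (glInt R Q) =
      Units.map (HahnSeries.ofPowerSeries ℤ R).toMonoidHom (GeneralLinearGroup.det Q) := by
  refine Units.ext ?_
  exact ((HahnSeries.ofPowerSeries ℤ R).map_det Q.val).symm

/-- This is why the size `a` of the balanced lattice drops out of the weights. -/
lemma bal_sum (a : ℕ) : bal a 0 + bal a 1 + bal a 2 = 0 := by
  simp [bal]

lemma det_conj_eq {B : Type*} [CommRing B] (A Q : GL (Fin 2) B) :
    GeneralLinearGroup.det (Q⁻¹ * A * Q) = GeneralLinearGroup.det A := by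
  rw [map_mul, map_mul, map_inv, mul_comm, mul_inv_cancel_left]

lemma det_glInt_eq {R : Type*} [CommRing R] {A K : GL (Fin 2) R⟦X⟧}
    (h : GeneralLinearGroup.det K = GeneralLinearGroup.det A) :
    GeneralLinearGroup.det (glInt R K) = GeneralLinearGroup.det (glInt R A) := by
  rw [glInt_det_unit, glInt_det_unit, h]

/-- The diagonal blocks of the matrix in coordinates. -/
lemma block_leviPair_mul_unip {A K : GL (Fin 2) S⟦X⟧}
    (h : GeneralLinearGroup.det K = GeneralLinearGroup.det A) {u : GSp S⸨X⸩}
    (hu : u ∈ unip S⸨X⸩) (b : Fin 3) :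
    block (leviPair _ (glInt S A, glInt S K) * u).1.1 b b =
      ![(glInt S A).val, (glInt S K).val, signTwist _ (glInt S A).val] b := by
  rw [GSp.coe_mul, (blockUpper_leviPair _).block_mul_self (blockUpper_of_mem_unip hu),
    block_unip_self hu, mul_one, block_leviPair_of_det_eq (det_glInt_eq h)]

lemma blockUpper_leviPair_mul_unip {B : Type*} [CommRing B] (x : GL (Fin 2) B × GL (Fin 2) B)
    {u : GSp B} (hu : u ∈ unip B) : BlockUpper 0 (leviPair _ x * u).1.1 := by
  rw [GSp.coe_mul]
  exact (blockUpper_leviPair x).mul (blockUpper_of_mem_unip hu)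

lemma coeff_zero_glInt (A : GL (Fin 2) S⟦X⟧) (p q : Fin 2) :
    ((glInt S A).val p q).coeff 0 = PowerSeries.constantCoeff (A.val p q) :=
  coeff_zero_ofPowerSeries _

lemma detUnit_val (A : GL (Fin 2) S⟦X⟧) : (detUnit A : S) =
    PowerSeries.constantCoeff (A.val 0 0) * PowerSeries.constantCoeff (A.val 1 1) -
      PowerSeries.constantCoeff (A.val 0 1) * PowerSeries.constantCoeff (A.val 1 0) := by
  rw [← map_mul, ← map_mul, ← map_sub, ← Matrix.det_fin_two]
  rfl

lemma detUnit_eq {A K : GL (Fin 2) S⟦X⟧}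
    (h : GeneralLinearGroup.det K = GeneralLinearGroup.det A) : detUnit K = detUnit A := by
  rw [detUnit, detUnit, h]

lemma coeff_zero_block {A K : GL (Fin 2) S⟦X⟧}
    (h : GeneralLinearGroup.det K = GeneralLinearGroup.det A) {u : GSp S⸨X⸩}
    (hu : u ∈ unip S⸨X⸩) (b : Fin 3) (p q : Fin 2) :
    ((leviPair _ (glInt S A, glInt S K) * u).1.1 (bidx b p) (bidx b q)).coeff 0 =
      PowerSeries.constantCoeff (![A.val, K.val, signTwist _ A.val] b p q) := by
  have e := congrFun (congrFun (block_leviPair_mul_unip h hu b) p) q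
  rw [show (leviPair _ (glInt S A, glInt S K) * u).1.1 (bidx b p) (bidx b q) = _ from e]
  fin_cases b
  · exact coeff_zero_glInt _ _ _
  · exact coeff_zero_glInt _ _ _
  · have e' : (signTwist _ (glInt S A).val) p q =
        HahnSeries.ofPowerSeries ℤ S (signTwist _ A.val p q) := by
      fin_cases p <;> fin_cases q <;> simp [signTwist]
    exact (congrArg (fun x : S⸨X⸩ => x.coeff 0) e').trans (coeff_zero_ofPowerSeries _)

lemma constantCoeff_X_pow {n : ℕ} (hn : n ≠ 0) :
    PowerSeries.constantCoeff (PowerSeries.X ^ n : S⟦X⟧) = 0 := by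
  rw [map_pow, PowerSeries.constantCoeff_X, zero_pow hn]

lemma Stable.coeff_block_zero {l : Fin 4 → ℤ} {A K : GL (Fin 2) S⟦X⟧}
    (h : GeneralLinearGroup.det K = GeneralLinearGroup.det A) {u : GSp S⸨X⸩}
    (hu : u ∈ unip S⸨X⸩) (hs : Stable (expo l) (leviPair _ (glInt S A, glInt S K) * u).1.1)
    {m : ℕ} (hm : m < l 0 - l 1) : PowerSeries.coeff m (A.val 0 1) = 0 := by
  have h1 := hs (bidx 0 0) (bidx 0 1)
  have h2 : (leviPair _ (glInt S A, glInt S K) * u).1.1 (bidx 0 0) (bidx 0 1) =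
      HahnSeries.ofPowerSeries ℤ S (A.val 0 1) :=
    congrFun (congrFun (block_leviPair_mul_unip h hu 0) 0) 1
  rw [h2] at h1
  rw [← HahnSeries.ofPowerSeries_apply_coeff (Γ := ℤ)]
  exact h1 _ hm

lemma Stable.coeff_block_one {l : Fin 4 → ℤ} {A K : GL (Fin 2) S⟦X⟧}
    (h : GeneralLinearGroup.det K = GeneralLinearGroup.det A) {u : GSp S⸨X⸩}
    (hu : u ∈ unip S⸨X⸩) (hs : Stable (expo l) (leviPair _ (glInt S A, glInt S K) * u).1.1)
    {m : ℕ} (hm : m < l 2 - l 3) : PowerSeries.coeff m (K.val 0 1) = 0 := by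
  have h1 := hs (bidx 1 0) (bidx 1 1)
  have h2 : (leviPair _ (glInt S A, glInt S K) * u).1.1 (bidx 1 0) (bidx 1 1) =
      HahnSeries.ofPowerSeries ℤ S (K.val 0 1) :=
    congrFun (congrFun (block_leviPair_mul_unip h hu 1) 0) 1
  rw [h2] at h1
  rw [← HahnSeries.ofPowerSeries_apply_coeff (Γ := ℤ)]
  exact h1 _ hm

variable [Algebra ℂ S]

/-- The base change of an invertible matrix of power series. -/
abbrev glBaseChange (S : Type) [CommRing S] [Algebra ℂ S] :
    GL (Fin 2) ℂ⟦X⟧ →* GL (Fin 2) S⟦X⟧ :=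
  GeneralLinearGroup.map (PowerSeries.map (algebraMap ℂ S))

lemma baseChange_leviPair_one_left (Q : GL (Fin 2) ℂ⟦X⟧) :
    GSp.baseChange S (leviPair _ (1, glInt ℂ Q)) = leviPair _ (1, glInt S (glBaseChange S Q)) := by
  rw [map_leviPair, map_one]
  congr 2
  exact Units.ext (map_laurentMap_ofPowerSeries (algebraMap ℂ S) Q.val)

/-- The coordinates attached to an element acting on the fibre. -/
theorem exists_conj_of_isFibreWeight {Q : GL (Fin 2) ℂ⟦X⟧} {l : Fin 4 → ℤ} {s : PSp S⸨X⸩} {w : Sˣ}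
    (hw : IsFibreWeight (Gr.mk (leviPair _ (1, glInt ℂ Q) * diagPair ℂ l)) s w) :
    ∃ (A K : GL (Fin 2) S⟦X⟧) (u : GSp S⸨X⸩) (φ ψ T M : Matrix (Fin 6) (Fin 6) S⸨X⸩) (γ : ℤ)
      (a : ℕ) (d : Sˣ), u ∈ unip S⸨X⸩ ∧ K = (glBaseChange S Q)⁻¹ * A * glBaseChange S Q ∧
      φ * ψ = 1 ∧ ψ * φ = 1 ∧ ψ * T * φ = (leviPair _ (glInt S A, glInt S K) * u).1.1 ∧
      Stable (expo l) (ψ * T * φ) ∧ IsCoord ψ (fun i => γ + expo l i) (lattice M) ∧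
      IsCoord ψ (fun i => bal a (bnum i)) (lattice (balanced S a)) ∧
      IsRelDet T M (balanced S a) d ∧
      w = d ^ (-4 : ℤ) * detUnit A ^ (-6 * (2 * γ + (l 2 + l 3))) := by
  have hμ : IsMult (leviPair _ (1, glInt ℂ Q)).1.1 _ := isMult_leviPair _
  have h0 : UnitOrd 0 (GeneralLinearGroup.det (glInt ℂ Q)) := by
    rw [glInt_det_unit]
    exact unitOrd_ofPowerSeries _
  obtain ⟨M, γ, A, u, a, d, hu, hM, hd, rfl⟩ := exists_of_isFibreWeight hμ h0 hw
  rw [baseChange_leviPair_one_left] at hM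
  set Q' := glBaseChange S Q
  set q : GL (Fin 2) S⸨X⸩ × GL (Fin 2) S⸨X⸩ := (1, glInt S Q') with hq
  -- The change of coordinates is trivial in the first block, so conjugation keeps `A` there and
  -- turns it into `Q⁻¹ A Q` in the second one.
  have h1 : (leviPair _ q)⁻¹ * leviUnip A u * leviPair _ q =
      leviPair _ (glInt S A, glInt S (Q'⁻¹ * A * Q')) *
        (leviPair _ q⁻¹ * u * (leviPair _ q⁻¹)⁻¹) := by
    have h2 : (glInt S A, glInt S (Q'⁻¹ * A * Q')) = q⁻¹ * (glInt S A, glInt S A) * q := by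
      rw [hq]
      refine Prod.ext ?_ ?_
      · change _ = 1⁻¹ * _ * 1
        rw [inv_one, one_mul, mul_one]
      · rw [map_mul, map_mul, map_inv]
        rfl
    rw [h2, leviUnip, ← leviPair_self, map_mul, map_mul, map_inv]
    group
  have h3 := congrArg (fun g : GSp S⸨X⸩ => g.1.1) h1
  refine ⟨A, _, _, _, _, _, M.1.1, γ, a, d, leviPair_conj_mem_unip _ hu, rfl, GSp.mul_inv_val _,
    GSp.inv_mul_val _, h3, ?_, hM, ?_, hd, rfl⟩
  · have := hM.stable (GSp.inv_mul_val (leviPair _ q)) (mem_of_map_eq hd.1)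
    exact stable_add_iff.1 this
  · refine isCoord_balanced (GSp.mul_inv_val _) (GSp.inv_mul_val _)
      (stable_bal_leviPair (ordGeM_block_leviPair_one_left _)) ?_
    have : (leviPair _ q)⁻¹ = leviPair _ (1, glInt S Q'⁻¹) := by
      rw [← map_inv]
      exact congrArg _ (Prod.ext inv_one (map_inv (glInt S) Q').symm)
    rw [this]
    exact stable_bal_leviPair (ordGeM_block_leviPair_one_left _)

/-- The weights are trivial when the first two exponents agree. -/
theorem weight_eq_one_of_block {l : Fin 4 → ℤ} (h1 : l 0 = l 1) (h2 : l 2 = 0) (h3 : l 3 = 0)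
    {Q : GL (Fin 2) ℂ⟦X⟧} {s : PSp S⸨X⸩} {w : Sˣ}
    (hw : IsFibreWeight (Gr.mk (leviPair _ (1, glInt ℂ Q) * diagPair ℂ l)) s w) : w = 1 := by
  obtain ⟨A, K, u, φ, ψ, T, M, γ, a, d, hu, rfl, hφ, hψ, hT, -, hM, hB, hd, rfl⟩ :=
    exists_conj_of_isFibreWeight hw
  have hdet := det_conj_eq A (glBaseChange S Q)
  -- The exponents are constant on each block, so only determinants of `2 × 2` constant terms enter
  -- and no triangularity is needed.
  have hl : (fun i => γ + expo l i) = fun i => γ + ![l 0, 0, -l 0] (bnum i) := by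
    funext i
    fin_cases i <;> simp [expo, bnum, h2, h3, ← h1]
  rw [hl] at hM
  have hdb : DetBy ψ T bnum (bal a) fun _ => detUnit A := by
    refine detBy_of_blockTriangular hψ ?_ fun k => ?_
    · rw [hT]
      exact blockUpper_leviPair_mul_unip _ hu
    · rw [hT, block_leviPair_mul_unip hdet hu, Matrix.det_fin_two]
      fin_cases k
      · exact (detUnit_val A).symm ▸ (by
          simp only [Matrix.of_apply]
          change ((glInt S A).val 0 0).coeff 0 * ((glInt S A).val 1 1).coeff 0 -
            ((glInt S A).val 0 1).coeff 0 * ((glInt S A).val 1 0).coeff 0 = _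
          simp only [coeff_zero_glInt])
      · rw [← detUnit_eq hdet, detUnit_val]
        simp only [Matrix.of_apply]
        change ((glInt S _).val 0 0).coeff 0 * ((glInt S _).val 1 1).coeff 0 -
            ((glInt S _).val 0 1).coeff 0 * ((glInt S _).val 1 0).coeff 0 = _
        simp only [coeff_zero_glInt]
      · rw [detUnit_val]
        simp only [Matrix.of_apply]
        change ((glInt S A).val 0 0).coeff 0 * ((glInt S A).val 1 1).coeff 0 -
            (-(glInt S A).val 0 1).coeff 0 * (-(glInt S A).val 1 0).coeff 0 = _
        simp only [HahnSeries.coeff_neg, coeff_zero_glInt]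
        ring
  have := hdb.eq_of_isRelDet (l' := fun k => γ + ![l 0, 0, -l 0] k) bnum_surjective hφ hψ hM hB hd
  rw [this, Fin.prod_univ_three, ← _root_.zpow_add, ← _root_.zpow_add, ← _root_.zpow_mul,
    ← _root_.zpow_add, ← zpow_zero (detUnit A)]
  congr 1
  have := bal_sum a
  simp [h2, h3]
  linarith

/-- The weights are trivial when the matrix in coordinates is triangular. -/
theorem weight_eq_one_of_triangular {l : Fin 4 → ℤ} {Q : GL (Fin 2) ℂ⟦X⟧}
    (h : ∀ (A K : GL (Fin 2) S⟦X⟧) (u : GSp S⸨X⸩), u ∈ unip S⸨X⸩ →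
      K = (glBaseChange S Q)⁻¹ * A * glBaseChange S Q →
      Stable (expo l) (leviPair _ (glInt S A, glInt S K) * u).1.1 →
      PowerSeries.constantCoeff (A.val 0 1) = 0 ∧ PowerSeries.constantCoeff (K.val 0 1) = 0 ∧
      PowerSeries.constantCoeff (K.val 0 0) = PowerSeries.constantCoeff (A.val 0 0) ∧
      PowerSeries.constantCoeff (K.val 1 1) = PowerSeries.constantCoeff (A.val 1 1) ∧
      (2 * (l 0 - l 1) + l 2 - l 3 = 0 ∨
        PowerSeries.constantCoeff (A.val 0 0) = PowerSeries.constantCoeff (A.val 1 1)))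
    {s : PSp S⸨X⸩} {w : Sˣ}
    (hw : IsFibreWeight (Gr.mk (leviPair _ (1, glInt ℂ Q) * diagPair ℂ l)) s w) : w = 1 := by
  obtain ⟨A, K, u, φ, ψ, T, M, γ, a, d, hu, hK, hφ, hψ, hT, hs, hM, hB, hd, rfl⟩ :=
    exists_conj_of_isFibreWeight hw
  have hdet : GeneralLinearGroup.det K = GeneralLinearGroup.det A := by
    rw [hK]
    exact det_conj_eq _ _
  obtain ⟨hA1, hK1, hK0, hK2, hl⟩ := h A K u hu hK (hT ▸ hs)
  have hδ := detUnit_val A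
  rw [hA1, zero_mul, sub_zero] at hδ
  obtain ⟨α, hα⟩ : IsUnit (PowerSeries.constantCoeff (A.val 0 0)) :=
    isUnit_of_mul_isUnit_left (hδ ▸ (detUnit A).isUnit)
  obtain ⟨β, hβ⟩ : IsUnit (PowerSeries.constantCoeff (A.val 1 1)) :=
    isUnit_of_mul_isUnit_right (hδ ▸ (detUnit A).isUnit)
  have hαβ : detUnit A = α * β := Units.ext (by rw [hδ, Units.val_mul, hα, hβ])
  have hc := coeff_zero_block hdet hu
  have hdb : DetBy ψ T id (fun i => bal a (bnum i)) ![α, β, α, β, α, β] := by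
    -- Between blocks the matrix is upper triangular, but inside a block its constant term is lower
    -- triangular; hence the two indices of each block are swapped.
    refine detBy_of_triangular (ρ := ![1, 0, 3, 2, 5, 4]) hψ (by decide) ?_ ?_
    · intro i j hij
      rw [hT]
      by_cases hb : j.val / 2 < i.val / 2
      · rw [blockUpper_leviPair_mul_unip _ hu i j (by omega)]
        rfl
      · obtain ⟨b, p, rfl⟩ := exists_bidx_eq i
        obtain ⟨b', q, rfl⟩ := exists_bidx_eq j
        obtain ⟨rfl, rfl, rfl⟩ : b' = b ∧ p = 0 ∧ q = 1 := by
          revert hij hb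
          revert b b' p q
          decide
        rw [bnum_bidx, bnum_bidx, sub_self, hc]
        fin_cases b'
        · exact hA1
        · exact hK1
        · change PowerSeries.constantCoeff (-(A.val 0 1)) = 0
          rw [map_neg, hA1, neg_zero]
    · intro i
      rw [hT]
      obtain ⟨b, p, rfl⟩ := exists_bidx_eq i
      rw [hc]
      fin_cases b <;> fin_cases p
      · exact hα.symm
      · exact hβ.symm
      · exact hK0.trans hα.symm
      · exact hK2.trans hβ.symm
      · exact hα.symm
      · exact hβ.symm
  have hr := hdb.eq_of_isRelDet (l' := fun k => γ + expo l k) Function.surjective_id hφ hψ hM hB hd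
  have hd' : d = α ^ (-(3 * γ + l 0 + 2 * l 2 + l 3 - l 1)) *
      β ^ (-(3 * γ + l 1 + 2 * l 3 + l 2 - l 0)) := by
    have hb := bal_sum a
    have e : ∀ f : Fin 6 → ℤ, ∏ k, ![α, β, α, β, α, β] k ^ f k =
        α ^ (f 0 + f 2 + f 4) * β ^ (f 1 + f 3 + f 5) := by
      intro f
      simp only [Fin.prod_univ_six, _root_.zpow_add]
      simp
      ac_rfl
    rw [hr, e]
    congr 2
    · simp [expo, bnum] at hb ⊢
      linarith
    · simp [expo, bnum] at hb ⊢
      linarith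
  rw [hd', hαβ, mul_zpow, mul_zpow, ← _root_.zpow_mul, ← _root_.zpow_mul, mul_mul_mul_comm,
    ← _root_.zpow_add, ← _root_.zpow_add]
  -- Altogether the weight is `(α / β)` to the power `2 (2 (l 0 - l 1) + l 2 - l 3)`; either the
  -- exponent or the ratio is trivial.
  rcases hl with hl | hl
  · have e1 : -(3 * γ + l 0 + 2 * l 2 + l 3 - l 1) * -4 + -6 * (2 * γ + (l 2 + l 3)) = 0 := by
      linarith
    have e2 : -(3 * γ + l 1 + 2 * l 3 + l 2 - l 0) * -4 + -6 * (2 * γ + (l 2 + l 3)) = 0 := by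
      linarith
    rw [e1, e2, zpow_zero, zpow_zero, mul_one]
  · have hαβ : α = β := Units.ext (by rw [hα, hβ, hl])
    rw [hαβ, ← _root_.zpow_add, ← zpow_zero β]
    congr 1
    ring

/-! ### Factorizations of the representatives -/

lemma mk_leviPair_mul_glInt {R : Type*} [CommRing R] {X Y X' Y' : GL (Fin 2) R⸨X⸩}
    (k₀ k₁ : GL (Fin 2) R⟦X⟧) (hX : X = X' * glInt R k₀) (hY : Y = Y' * glInt R k₁) :
    Gr.mk (leviPair _ (X, Y)) = Gr.mk (leviPair _ (X', Y')) := by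
  refine (Gr.mk_eq_mk.2 ⟨1, leviPair _ (k₀, k₁), ?_⟩).symm
  rw [Units.val_one, one_smul, map_leviPair, ← GSp.coe_mul, ← map_mul, hX, hY]
  rfl

lemma diagUnit_tpowR (R : Type*) [CommRing R] (m n : ℤ) : (diagUnit ![tpowR R m, tpowR R n]).val =
    !![HahnSeries.single m 1, 0; 0, HahnSeries.single n 1] := by
  refine Matrix.ext fun i j => ?_
  fin_cases i <;> fin_cases j <;> simp [diagUnit, tpowR]

lemma repX_eq (R : Type*) [CommRing R] (n a b : ℤ) :
    repX R n a b = diagUnit ![tpowR R (n + a), tpowR R b] := rfl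

lemma leviPair_mul_diagPair {R : Type*} [CommRing R] (P Q : GL (Fin 2) R⸨X⸩) (l : Fin 4 → ℤ) :
    leviPair _ (P, Q) * diagPair R l = leviPair _ (P * diagUnit ![tpowR R (l 0), tpowR R (l 1)],
      Q * diagUnit ![tpowR R (l 2), tpowR R (l 3)]) := by
  rw [diagPair, ← map_mul]
  rfl

lemma repY_eq (R : Type*) [CommRing R] (n : ℕ) (r : ℤ) : repY R n r =
    glInt R (upperGL (PowerSeries.X ^ n)) * diagUnit ![tpowR R (n + r), tpowR R 0] := by
  refine Units.ext ?_
  rw [Units.val_mul, diagUnit_tpowR, repY_val]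
  refine Matrix.ext fun i j => ?_
  fin_cases i <;> fin_cases j <;> simp [Matrix.mul_apply, Fin.sum_univ_two, upperGL]

lemma pt_eq_upperGL (n : ℕ) (a b r : ℤ) : pt (coweight n a b r) =
    Gr.mk (leviPair _ (1, glInt ℂ (upperGL (PowerSeries.X ^ n))) *
      diagPair ℂ ![n + a, b, n + r, 0]) := by
  rw [pt_coweight, leviPair_mul_diagPair, one_mul, repPair, repY_eq, repX_eq]
  rfl

/-- The matrix with rows `(x, 1)` and `(-1, 0)`. -/
def rotGL {B : Type*} [CommRing B] (x : B) : GL (Fin 2) B where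
  val := !![x, 1; -1, 0]
  inv := !![0, -1; 1, x]
  val_inv := by
    ext i j
    fin_cases i <;> fin_cases j <;> simp [Matrix.mul_apply, Fin.sum_univ_two]
  inv_val := by
    ext i j
    fin_cases i <;> fin_cases j <;> simp [Matrix.mul_apply, Fin.sum_univ_two]

/-- The exponents `(0, r)` with a lower triangular change of basis suit the case `b < a`, where the
constant term of `A` is lower triangular and keeps its diagonal under this conjugation. -/
lemma repY_zero_eq (R : Type*) [CommRing R] (r : ℕ) : repY R 0 r =
    glInt R (lowerGL 1) * diagUnit ![tpowR R 0, tpowR R r] *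
      glInt R (rotGL (PowerSeries.X ^ r)) := by
  refine Units.ext ?_
  rw [Units.val_mul, Units.val_mul, diagUnit_tpowR, repY_val]
  refine Matrix.ext fun i j => ?_
  fin_cases i <;> fin_cases j <;> simp [Matrix.mul_apply, Fin.sum_univ_two, lowerGL, rotGL]

lemma pt_eq_lowerGL (a b : ℤ) (r : ℕ) : pt (coweight 0 a b r) =
    Gr.mk (leviPair _ (1, glInt ℂ (lowerGL 1)) * diagPair ℂ ![a, b, 0, r]) := by
  rw [pt_coweight, leviPair_mul_diagPair, one_mul]
  refine mk_leviPair_mul_glInt 1 _ ?_ (repY_zero_eq ℂ r)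
  rw [map_one, mul_one, repX_eq, zero_add]
  rfl

lemma upperGL_inv_val {B : Type*} [CommRing B] (x : B) :
    ((upperGL x)⁻¹ : GL (Fin 2) B).val = !![1, -x; 0, 1] := rfl

lemma lowerGL_inv_val {B : Type*} [CommRing B] (x : B) :
    ((lowerGL x)⁻¹ : GL (Fin 2) B).val = !![1, 0; -x, 1] := rfl

lemma glBaseChange_upperGL (n : ℕ) : glBaseChange S (upperGL (PowerSeries.X ^ n)) =
    upperGL (PowerSeries.X ^ n) := by
  refine Units.ext (Matrix.ext fun i j => ?_)
  fin_cases i <;> fin_cases j <;> simp [upperGL]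

lemma glBaseChange_lowerGL : glBaseChange S (lowerGL 1) = lowerGL 1 := by
  refine Units.ext (Matrix.ext fun i j => ?_)
  fin_cases i <;> fin_cases j <;> simp [lowerGL]

lemma upperGL_conj_val {B : Type*} [CommRing B] (x : B) (A : GL (Fin 2) B) :
    ((upperGL x)⁻¹ * A * upperGL x).val =
      !![A.val 0 0 - x * A.val 1 0,
        A.val 0 1 + x * (A.val 0 0 - A.val 1 1) - x * x * A.val 1 0;
        A.val 1 0, A.val 1 1 + x * A.val 1 0] := by
  rw [Units.val_mul, Units.val_mul, upperGL_inv_val, upperGL_val]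
  refine Matrix.ext fun i j => ?_
  fin_cases i <;> fin_cases j <;> simp [Matrix.mul_apply, Fin.sum_univ_two, Matrix.vecMul, dotProduct] <;> ring

lemma lowerGL_conj_val {B : Type*} [CommRing B] (x : B) (A : GL (Fin 2) B) :
    ((lowerGL x)⁻¹ * A * lowerGL x).val =
      !![A.val 0 0 + x * A.val 0 1, A.val 0 1;
        A.val 1 0 + x * (A.val 1 1 - A.val 0 0) - x * x * A.val 0 1,
        A.val 1 1 - x * A.val 0 1] := by
  rw [Units.val_mul, Units.val_mul, lowerGL_inv_val]
  refine Matrix.ext fun i j => ?_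
  fin_cases i <;> fin_cases j <;> simp [Matrix.mul_apply, Fin.sum_univ_two, lowerGL, Matrix.vecMul, dotProduct] <;> ring

/-- The stabilizers of the distinguished representatives act trivially on the fibres. -/
theorem weight_eq_one {n r : ℕ} {a b : ℤ} (h0 : n = 0 → 2 * (a - b) = r)
    (h1 : 0 < n → b < a ∧ r ≤ b ∧ 0 < r) {s : PSp S⸨X⸩} {w : Sˣ}
    (hw : IsFibreWeight (pt (coweight n a b r)) s w) : w = 1 := by
  rcases Nat.eq_zero_or_pos n with rfl | hn
  · have h0 := h0 rfl
    rcases Nat.eq_zero_or_pos r with rfl | hr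
    · rw [pt_eq_upperGL] at hw
      -- Here `n = r = 0`, hence `a = b`, and `A` is not forced to be triangular modulo `t`.
      refine weight_eq_one_of_block ?_ ?_ rfl hw
      · simp
        push_cast at h0
        omega
      · simp
    · rw [Nat.cast_zero, pt_eq_lowerGL] at hw
      refine weight_eq_one_of_triangular (fun A K u hu hK hs => ?_) hw
      rw [glBaseChange_lowerGL] at hK
      have hdet : GeneralLinearGroup.det K = GeneralLinearGroup.det A := hK ▸ det_conj_eq _ _
      have hA := hs.coeff_block_zero hdet hu (m := 0) (by
        change (0 : ℤ) < a - b
        omega)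
      rw [PowerSeries.coeff_zero_eq_constantCoeff_apply] at hA
      rw [hK, lowerGL_conj_val]
      refine ⟨hA, by simp [hA], by simp [hA], by simp [hA], Or.inl ?_⟩
      change 2 * (a - b) + 0 - (r : ℤ) = 0
      omega
  · obtain ⟨hab, hrb, hr⟩ := h1 hn
    rw [pt_eq_upperGL] at hw
    refine weight_eq_one_of_triangular (fun A K u hu hK hs => ?_) hw
    rw [glBaseChange_upperGL] at hK
    have hdet : GeneralLinearGroup.det K = GeneralLinearGroup.det A := hK ▸ det_conj_eq _ _
    have hA : ∀ m : ℕ, m ≤ n → PowerSeries.coeff m (A.val 0 1) = 0 := fun m hm =>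
      hs.coeff_block_zero hdet hu (by
        change (m : ℤ) < n + a - b
        omega)
    have hA0 := hA 0 (Nat.zero_le _)
    rw [PowerSeries.coeff_zero_eq_constantCoeff_apply] at hA0
    -- As `r > 0`, the coefficient of `t^n` in the corner of `K` vanishes. The corner of `A`
    -- vanishes up to this order as well, so what remains is the difference of the diagonal constant
    -- terms of `A`.
    have hK1 := hs.coeff_block_one hdet hu (m := n) (by
      change (n : ℤ) < n + r - 0
      omega)
    have hx := constantCoeff_X_pow (S := S) hn.ne'
    rw [hK, upperGL_conj_val] at hK1 ⊢
    refine ⟨hA0, by simp [hA0, hn.ne'], by simp [hn.ne'], by simp [hn.ne'], Or.inr ?_⟩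
    have e : PowerSeries.coeff n (A.val 0 1 + PowerSeries.X ^ n * (A.val 0 0 - A.val 1 1) -
        PowerSeries.X ^ n * PowerSeries.X ^ n * A.val 1 0) =
        PowerSeries.constantCoeff (A.val 0 0) - PowerSeries.constantCoeff (A.val 1 1) := by
      rw [mul_assoc, map_sub, map_add, hA n le_rfl, PowerSeries.coeff_X_pow_mul',
        PowerSeries.coeff_X_pow_mul', if_pos le_rfl, if_pos le_rfl, Nat.sub_self,
        PowerSeries.coeff_zero_eq_constantCoeff_apply,
        PowerSeries.coeff_zero_eq_constantCoeff_apply, map_sub, map_mul, hx]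
      ring
    exact sub_eq_zero.1 (e.symm.trans hK1)

end StabilizerWeights

/-! ### Integral elements of the parabolic subgroup -/

section Parabolic

variable {R S : Type*} [CommRing R] [CommRing S]

lemma exists_ordGe (x : R⸨X⸩) : ∃ s, OrdGe s x :=
  ⟨x.order, fun _ hn => HahnSeries.coeff_eq_zero_of_lt_order hn⟩

/-- The matrix is block upper triangular with integral diagonal blocks. -/
def ParInt (M : Matrix (Fin 6) (Fin 6) R⸨X⸩) : Prop :=
  BlockUpper 0 M ∧ ∀ b, OrdGeM 0 (block M b b)

lemma ParInt.mul {M N : Matrix (Fin 6) (Fin 6) R⸨X⸩} (hM : ParInt M) (hN : ParInt N) :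
    ParInt (M * N) :=
  ⟨hM.1.mul hN.1, fun b => by
    rw [hM.1.block_mul_self hN.1]
    exact (hM.2 b).mul (hN.2 b)⟩

lemma ParInt.map (f : R →+* S) {M : Matrix (Fin 6) (Fin 6) R⸨X⸩} (hM : ParInt M) :
    ParInt (M.map (laurentMap f)) :=
  ⟨hM.1.map _, fun b => (hM.2 b).map f⟩

lemma parInt_of_mem_unip {u : GSp R⸨X⸩} (hu : u ∈ unip R⸨X⸩) : ParInt u.1.1 :=
  ⟨blockUpper_of_mem_unip hu, fun b => by
    rw [block_unip_self hu]
    exact ordGeM_one⟩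

lemma ordGeM_signTwist {M : Matrix (Fin 2) (Fin 2) R⸨X⸩} (hM : OrdGeM 0 M) :
    OrdGeM 0 (signTwist _ M) := by
  intro i j
  fin_cases i <;> fin_cases j
  · exact hM 0 0
  · exact (hM 0 1).neg
  · exact (hM 1 0).neg
  · exact hM 1 1

lemma parInt_leviUnip (A : GL (Fin 2) R⟦X⟧) {u : GSp R⸨X⸩} (hu : u ∈ unip R⸨X⸩) :
    ParInt (leviUnip A u).1.1 := by
  refine ParInt.mul ⟨?_, fun b => ?_⟩ (parInt_of_mem_unip hu)
  · rw [← leviPair_self]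
    exact blockUpper_leviPair _
  · have h : OrdGeM 0 (glInt R A).val := ordGeM_ofPowerSeries A.val
    rw [← leviPair_self, block_leviPair_of_det_eq rfl]
    fin_cases b
    · exact h
    · exact h
    · exact ordGeM_signTwist h

lemma parInt_leviPair_one_left {R : Type} [CommRing R] (Q : GL (Fin 2) R⟦X⟧) :
    ParInt (leviPair _ (1, glInt R Q)).1.1 :=
  ⟨blockUpper_leviPair _, ordGeM_block_leviPair_one_left Q⟩

open Filter in
/-- Integral elements of the parabolic subgroup preserve almost all balanced lattices. -/
lemma ParInt.eventually_stable {M : Matrix (Fin 6) (Fin 6) R⸨X⸩} (hM : ParInt M) :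
    ∀ᶠ a : ℕ in atTop, Stable (fun i => bal a (bnum i)) M := by
  choose s hs using fun i j => exists_ordGe (M i j)
  rw [eventually_atTop]
  refine ⟨∑ i, ∑ j, (-s i j).toNat, fun a ha i j => ?_⟩
  have h1 : (-s i j).toNat ≤ a := by
    refine le_trans ?_ ha
    refine le_trans ?_ (Finset.single_le_sum (f := fun i => ∑ j, (-s i j).toNat)
      (fun _ _ => Nat.zero_le _) (Finset.mem_univ i))
    exact Finset.single_le_sum (f := fun j => (-s i j).toNat) (fun _ _ => Nat.zero_le _)
      (Finset.mem_univ j)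
  obtain ⟨b, p, rfl⟩ := exists_bidx_eq i
  obtain ⟨b', q, rfl⟩ := exists_bidx_eq j
  dsimp only
  rw [bnum_bidx, bnum_bidx]
  -- Above the diagonal blocks poles of order `a` are permitted, which covers all entries once `a`
  -- is large.
  rcases lt_trichotomy b b' with h | rfl | h
  · refine (hs _ _).mono ?_
    have h2 : bal a b + a ≤ bal a b' := by
      fin_cases b <;> fin_cases b' <;> simp [bal] at h ⊢
    omega
  · rw [sub_self]
    exact hM.2 b p q
  · rw [hM.1 _ _ (by simp only [bidx]; omega)]
    exact OrdGe.zero _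

end Parabolic

/-! ### Elements acting non-trivially on the fibres -/

section Elements

variable {S : Type} [CommRing S]

/-- The matrix `T` represents an element of `PGL(2, S[[t]]) ⋉ U(S((t)))` whose first factor has a
determinant with constant coefficient `δ`. -/
def HasDet (T : GSp S⸨X⸩) (δ : Sˣ) : Prop :=
  ∃ A u, u ∈ unip S⸨X⸩ ∧ T = leviUnip A u ∧ detUnit A = δ

lemma detUnit_mul (A A' : GL (Fin 2) S⟦X⟧) : detUnit (A * A') = detUnit A * detUnit A' := by
  rw [detUnit, map_mul, map_mul]
  rfl

lemma detUnit_one : detUnit (1 : GL (Fin 2) S⟦X⟧) = 1 := by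
  rw [detUnit, map_one, map_one]

lemma HasDet.mul {T T' : GSp S⸨X⸩} {δ δ' : Sˣ} (h : HasDet T δ) (h' : HasDet T' δ') :
    HasDet (T * T') (δ * δ') := by
  obtain ⟨A, u, hu, rfl, rfl⟩ := h
  obtain ⟨A', u', hu', rfl, rfl⟩ := h'
  exact ⟨_, _, mul_mem (levi_conj_mem_unip _ hu) hu', leviUnip_mul _ _ _ _, detUnit_mul _ _⟩

lemma HasDet.inv {T : GSp S⸨X⸩} {δ : Sˣ} (h : HasDet T δ) : HasDet T⁻¹ δ⁻¹ := by
  obtain ⟨A, u, hu, rfl, rfl⟩ := h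
  refine ⟨A⁻¹, levi S⸨X⸩ (glInt S A) * u⁻¹ * (levi S⸨X⸩ (glInt S A))⁻¹,
    levi_conj_mem_unip _ (inv_mem hu), ?_, ?_⟩
  · simp only [leviUnip, map_inv]
    group
  · rw [eq_inv_iff_mul_eq_one, ← detUnit_mul, inv_mul_cancel, detUnit_one]

lemma HasDet.conj {g T : GSp S⸨X⸩} {δ δ' : Sˣ} (hg : HasDet g δ') (h : HasDet T δ) :
    HasDet (g * T * g⁻¹) δ := by
  have := (hg.mul h).mul hg.inv
  rwa [mul_comm δ' δ, mul_inv_cancel_right] at this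

lemma HasDet.parInt {T : GSp S⸨X⸩} {δ : Sˣ} (h : HasDet T δ) : ParInt T.1.1 := by
  obtain ⟨A, u, hu, rfl, rfl⟩ := h
  exact parInt_leviUnip A hu

lemma hasDet_of_mem_unip {u : GSp S⸨X⸩} (hu : u ∈ unip S⸨X⸩) : HasDet u 1 :=
  ⟨1, u, hu, (leviUnip_one_left u).symm, detUnit_one⟩

lemma HasDet.exists_isMult {T : GSp S⸨X⸩} {δ : Sˣ} (h : HasDet T δ) :
    ∃ μ : S⸨X⸩ˣ, IsMult T.1.1 μ ∧ UnitOrd 0 μ := by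
  obtain ⟨A, u, hu, rfl, rfl⟩ := h
  refine ⟨GeneralLinearGroup.det (glInt S A), ?_, ?_⟩
  · have := (isMult_leviPair (glInt S A, glInt S A)).mul (isMult_of_mem_unip hu)
    rw [mul_one, leviPair_self] at this
    exact this
  · rw [glInt_det_unit]
    exact unitOrd_ofPowerSeries _

lemma exists_hasDet {h : PSp S⸨X⸩} (hh : h ∈ H S) : ∃ T δ, HasDet T δ ∧ h = PSp.mk T := by
  obtain ⟨A, u, hu, rfl⟩ := mem_H_iff.1 hh
  exact ⟨_, _, ⟨A, u, hu, rfl, rfl⟩, rfl⟩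

lemma GSp.inv_mul_conj_mul_val {B : Type*} [CommRing B] (g T : GSp B) :
    (g⁻¹).1.1 * (g * T * g⁻¹).1.1 * g.1.1 = T.1.1 := by
  have h : g⁻¹ * (g * T * g⁻¹) * g = T := by group
  exact congrArg (fun x : GSp B => x.1.1) h

lemma GSp.inv_mul_conj_inv_mul_val {B : Type*} [CommRing B] (g T : GSp B) :
    (g⁻¹).1.1 * ((g * T * g⁻¹)⁻¹).1.1 * g.1.1 = (T⁻¹).1.1 := by
  have h : g⁻¹ * (g * T * g⁻¹)⁻¹ * g = T⁻¹ := by group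
  exact congrArg (fun x : GSp B => x.1.1) h

lemma prod_zpow_bal_sub_expo (a : ℕ) (l : Fin 4 → ℤ) (α : Sˣ) :
    ∏ k : Fin 6, ![α, 1, α, 1, α, 1] k ^ (bal a (bnum k) - expo l k) =
      α ^ (-(l 0 + 2 * l 2 + l 3 - l 1)) := by
  have hb := bal_sum a
  have e : ∀ f : Fin 6 → ℤ, ∏ k, ![α, 1, α, 1, α, 1] k ^ f k = α ^ (f 0 + f 2 + f 4) := by
    intro f
    simp only [Fin.prod_univ_six, _root_.zpow_add]
    simp
  rw [e]
  congr 1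
  simp [expo, bnum] at hb ⊢
  linarith

lemma detBy_conj {g T : GSp S⸨X⸩} (a : ℕ) {α : Sˣ} (htri : ∀ i j, j < i → T.1.1 i j = 0)
    (hα : ∀ i, (T.1.1 i i).coeff 0 = (![α, 1, α, 1, α, 1] i : Sˣ)) :
    DetBy (g⁻¹).1.1 (g * T * g⁻¹).1.1 id (fun i => bal a (bnum i)) ![α, 1, α, 1, α, 1] := by
  refine detBy_of_triangular (ρ := fun i => ((i : ℕ) : ℤ)) (GSp.inv_mul_val g)
    (fun i j hij => Fin.ext (Int.ofNat_inj.1 hij)) ?_ ?_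
  · intro i j hij
    rw [GSp.inv_mul_conj_mul_val, htri i j (by exact_mod_cast hij)]
    rfl
  · intro i
    rw [GSp.inv_mul_conj_mul_val, hα]

/-- All four matrices involved preserve the balanced lattices for large `a`, so a common `a` exists;
the resulting determinant does not involve it. -/
lemma exists_isRelDet_of_triangular {g T : GSp S⸨X⸩} {l : Fin 4 → ℤ} (hg : ParInt g.1.1)
    (hg' : ParInt (g⁻¹).1.1) (hT : ParInt T.1.1) (hT' : ParInt (T⁻¹).1.1)
    (hs : Stable (expo l) T.1.1) (hs' : Stable (expo l) (T⁻¹).1.1) {α : Sˣ}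
    (htri : ∀ i j, j < i → T.1.1 i j = 0)
    (hα : ∀ i, (T.1.1 i i).coeff 0 = (![α, 1, α, 1, α, 1] i : Sˣ)) :
    ∃ a, ∀ M : GSp S⸨X⸩, IsCoord (g⁻¹).1.1 (expo l) (lattice M.1.1) →
      IsRelDet (g * T * g⁻¹).1.1 M.1.1 (balanced S a) (α ^ (-(l 0 + 2 * l 2 + l 3 - l 1))) := by
  obtain ⟨a, ha1, ha2, ha3, ha4⟩ := (hg.eventually_stable.and (hg'.eventually_stable.and
    (hT.eventually_stable.and hT'.eventually_stable))).exists
  refine ⟨a, fun M hM => ?_⟩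
  have hB := isCoord_balanced (GSp.mul_inv_val g) (GSp.inv_mul_val g) ha1 ha2
  rw [← prod_zpow_bal_sub_expo a]
  refine (detBy_conj a htri hα).isRelDet (l' := expo l) (GSp.mul_inv_val g) hM hB
    (T' := ((g * T * g⁻¹)⁻¹).1.1) (GSp.mul_inv_val _) ?_ ?_ ?_ ?_
  · rw [GSp.inv_mul_conj_mul_val]
    exact hs
  · rw [GSp.inv_mul_conj_inv_mul_val]
    exact hs'
  · rw [GSp.inv_mul_conj_mul_val]
    exact ha3
  · rw [GSp.inv_mul_conj_inv_mul_val]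
    exact ha4

variable [Algebra ℂ S]

lemma HasDet.baseChange {T : GSp ℂ⸨X⸩} {δ : ℂˣ} (h : HasDet T δ) :
    ∃ δ', HasDet (GSp.baseChange S T) δ' := by
  obtain ⟨A, u, hu, rfl, rfl⟩ := h
  exact ⟨_, _, _, laurent_mem_unip _ hu, laurent_leviUnip _ _ _, rfl⟩

/-- The weight of an element which is triangular in suitable coordinates. -/
theorem isFibreWeight_of_triangular {p : GSp ℂ⸨X⸩} {l : Fin 4 → ℤ} {μ : ℂ⸨X⸩ˣ}
    (hμ : IsMult p.1.1 μ) (h0 : UnitOrd 0 μ) (hp : ParInt p.1.1) (hp' : ParInt (p⁻¹).1.1)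
    {T : GSp S⸨X⸩} (hT : ParInt T.1.1) (hT' : ParInt (T⁻¹).1.1) (hs : Stable (expo l) T.1.1)
    (hs' : Stable (expo l) (T⁻¹).1.1) {α : Sˣ}
    (hA : HasDet (GSp.baseChange S p * T * (GSp.baseChange S p)⁻¹) α)
    (htri : ∀ i j, j < i → T.1.1 i j = 0)
    (hα : ∀ i, (T.1.1 i i).coeff 0 = (![α, 1, α, 1, α, 1] i : Sˣ)) :
    IsFibreWeight (Gr.mk (p * diagPair ℂ l))
      (PSp.mk (GSp.baseChange S p * T * (GSp.baseChange S p)⁻¹))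
      (α ^ (4 * (l 0 - l 1) + 2 * l 2 - 2 * l 3)) := by
  have hg2 : ParInt ((GSp.baseChange S p)⁻¹).1.1 := by
    rw [← map_inv]
    exact hp'.map (algebraMap ℂ S)
  obtain ⟨a, ha⟩ := exists_isRelDet_of_triangular (hp.map (algebraMap ℂ S)) hg2 hT hT' hs hs'
    htri hα
  obtain ⟨A, u, hu, hAu, rfl⟩ := hA
  have key := isFibreWeight_of (S := S) hμ h0 hu (A := A) fun M hM => hAu ▸ ha M hM
  rw [← hAu, ← _root_.zpow_mul, ← _root_.zpow_add] at key
  -- The exponent is `4 (l 0 + 2 l 2 + l 3 - l 1) - 6 (l 2 + l 3)`, from the powers `-4` and `6` in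
  -- the line bundle.
  convert key using 2
  ring

end Elements

/-! ### The orbits supporting equivariant twisted D-modules -/

section Twisted

local notation "𝒢" => LaurentPolynomial ℂ

/-! ### Transport of stabilizing elements along the orbit by complex points -/

section Conjugation

variable {S S' : Type} [CommRing S] [Algebra ℂ S] [CommRing S'] [Algebra ℂ S']

/-- The conjugate of an element of `H S` by an element of `H ℂ`. -/
def conjH (h : H ℂ) (k : H S) : H S :=
  H.map (algebraMap ℂ S) h * k * (H.map (algebraMap ℂ S) h)⁻¹

lemma conjH_one (h : H ℂ) : conjH h (1 : H S) = 1 := by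
  rw [conjH, mul_one, mul_inv_cancel]

lemma conjH_inv (h : H ℂ) (k : H S) : (conjH h k)⁻¹ = conjH h k⁻¹ := by
  simp only [conjH]
  group

lemma H.map_algebraMap (f : S →ₐ[ℂ] S') (h : H ℂ) :
    H.map f.toRingHom (H.map (algebraMap ℂ S) h) = H.map (algebraMap ℂ S') h := by
  obtain ⟨x, hx⟩ := h
  obtain ⟨T, rfl⟩ := QuotientGroup.mk_surjective x
  exact Subtype.ext (congrArg PSp.mk (GSp.laurent_algebraMap f T))

lemma map_conjH (f : S →ₐ[ℂ] S') (h : H ℂ) (k : H S) :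
    H.map f.toRingHom (conjH h k) = conjH h (H.map f.toRingHom k) := by
  rw [conjH, conjH, map_mul, map_mul, map_inv, H.map_algebraMap]

lemma conjH_val {h : H ℂ} {k : H S} {g : GSp ℂ⸨X⸩} {T : GSp S⸨X⸩} (hg : h = PSp.mk g)
    (hT : k = PSp.mk T) :
    (conjH h k : PSp S⸨X⸩) = PSp.mk (GSp.baseChange S g * T * (GSp.baseChange S g)⁻¹) := by
  obtain ⟨h, hh⟩ := h
  obtain ⟨k, hk⟩ := k
  obtain rfl : h = PSp.mk g := hg
  obtain rfl : k = PSp.mk T := hT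
  rfl

lemma chi_conjH (h : H ℂ) (k : H S) : chi (conjH h k) = chi k := by
  rw [conjH, chi_mul, chi_mul, chi_inv]
  ring

end Conjugation

/-! ### Tori -/

section Torus

variable {S S' : Type} [CommRing S] [CommRing S']

/-- The matrix `diag(z, 1)`. -/
def diagGL (S : Type) [CommRing S] : Sˣ →* GL (Fin 2) S⟦X⟧ where
  toFun z := diagUnit ![Units.map (PowerSeries.C (R := S)).toMonoidHom z, 1]
  map_one' := by
    refine Units.ext (Matrix.ext fun i j => ?_)
    fin_cases i <;> fin_cases j <;> simp [diagUnit]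
  map_mul' z z' := by
    refine Units.ext (Matrix.ext fun i j => ?_)
    fin_cases i <;> fin_cases j <;> simp [diagUnit]

/-- The matrix `diag(z, 1, z, 1, z, 1)`. -/
def torusGSp (S : Type) [CommRing S] : Sˣ →* GSp S⟦X⟧ := (levi S⟦X⟧).comp (diagGL S)

lemma torusGSp_val (z : Sˣ) : (torusGSp S z).1.1 =
    Matrix.diagonal fun i => PowerSeries.C (![z, 1, z, 1, z, 1] i : Sˣ).val := by
  refine Matrix.ext fun i j => ?_
  change leviMatrix (diagGL S z).val i j = _
  fin_cases i <;> fin_cases j <;> simp [leviMatrix, diagGL, diagUnit]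

lemma ofInt_levi (A : GL (Fin 2) S⟦X⟧) :
    GSp.ofInt S (levi S⟦X⟧ A) = levi S⸨X⸩ (glInt S A) := by
  rw [← leviPair_self, ← leviPair_self, map_leviPair]

lemma ofInt_torusGSp_val (z : Sˣ) : (GSp.ofInt S (torusGSp S z)).1.1 =
    Matrix.diagonal fun i => HahnSeries.C (![z, 1, z, 1, z, 1] i : Sˣ).val := by
  rw [GSp.map_val, torusGSp_val, Matrix.diagonal_map (map_zero _)]
  congr 1
  funext i
  exact HahnSeries.ofPowerSeries_C _

lemma torusGSp_commute (z : Sˣ) (l : Fin 4 → ℤ) :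
    GSp.ofInt S (torusGSp S z) * diagPair S l = diagPair S l * GSp.ofInt S (torusGSp S z) := by
  refine Subtype.ext (Units.ext ?_)
  rw [GSp.coe_mul, GSp.coe_mul, ofInt_torusGSp_val, diagPair_val, Matrix.diagonal_mul_diagonal,
    Matrix.diagonal_mul_diagonal]
  congr 1
  funext i
  exact mul_comm _ _

/-- The element `diag(z, 1)` of `PGL(2)` as an element of `H S`. -/
def torusH (S : Type) [CommRing S] : Sˣ →* H S :=
  ((PSp.mk.comp (GSp.ofInt S)).comp (torusGSp S)).codRestrict (H S) fun z => by
    change PSp.mk (GSp.ofInt S (levi S⟦X⟧ (diagGL S z))) ∈ H S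
    have := mk_leviUnip_mem (diagGL S z) (one_mem (unip S⸨X⸩))
    rwa [leviUnip, mul_one, ← ofInt_levi] at this

lemma hasDet_torusGSp (z : Sˣ) : HasDet (GSp.ofInt S (torusGSp S z)) z := by
  refine ⟨diagGL S z, 1, one_mem _, ?_, ?_⟩
  · rw [leviUnip, mul_one, ← ofInt_levi]
    rfl
  · refine Units.ext ?_
    rw [detUnit_val]
    simp [diagGL, diagUnit]

lemma chi_torusH (z : Sˣ) : chi (torusH S z) = 0 := by
  refine chi_eq (isChi_iff.2 ⟨diagGL S z, 1, one_mem _, ?_, ?_⟩)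
  · rw [leviUnip, mul_one, ← ofInt_levi]
    rfl
  · rw [residueTrace_eq]
    change (0 : S) = ((1 : Matrix (Fin 6) (Fin 6) S⸨X⸩) 0 2 +
      (1 : Matrix (Fin 6) (Fin 6) S⸨X⸩) 1 3).coeff (-1)
    rw [Matrix.one_apply_ne (by decide), Matrix.one_apply_ne (by decide), add_zero]
    rfl

lemma map_torusH (f : S →+* S') (z : Sˣ) :
    H.map f (torusH S z) = torusH S' (Units.map f.toMonoidHom z) := by
  refine Subtype.ext (congrArg PSp.mk ?_)
  refine Subtype.ext (Units.ext ?_)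
  change (GSp.ofInt S (torusGSp S z)).1.1.map (laurentMap f) = (GSp.ofInt S' (torusGSp S' _)).1.1
  rw [ofInt_torusGSp_val, ofInt_torusGSp_val, Matrix.diagonal_map (map_zero _)]
  congr 1
  funext i
  change laurentMap f (HahnSeries.single 0 _) = HahnSeries.single 0 _
  rw [laurentMap_single]
  fin_cases i <;> simp

lemma stable_diagonal {l : Fin 6 → ℤ} (d : Fin 6 → S) :
    Stable l (Matrix.diagonal fun i => (HahnSeries.C (d i) : S⸨X⸩)) := by
  intro i j
  rw [Matrix.diagonal_apply]
  split_ifs with h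
  · rw [h, sub_self]
    exact ordGe_single le_rfl _
  · exact OrdGe.zero _

variable [Algebra ℂ S] [Algebra ℂ S']

lemma map_diagPair (l : Fin 4 → ℤ) : GSp.baseChange S (diagPair ℂ l) = diagPair S l := by
  refine Subtype.ext (Units.ext ?_)
  rw [GSp.map_val, diagPair_val, diagPair_val, Matrix.diagonal_map (map_zero _)]
  congr 1
  funext i
  rw [laurentMap_single, map_one]

lemma stabilizes_torusH (l : Fin 4 → ℤ) (z : Sˣ) :
    Stabilizes (Gr.mk (diagPair ℂ l)) (torusH S z) := by
  rw [Stabilizes, basePoint, Gr.map_mk, map_diagPair]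
  have h := smul_mk_conj_ofInt (diagPair S l) (torusGSp S z)
  rw [← torusGSp_commute, mul_inv_cancel_right] at h
  exact h

/-- The torus commutes with the powers of `t`, so it is diagonal in the coordinates of the lattice,
with entries `z, 1, z, 1, z, 1`; the translation by `h` only changes the coordinates. -/
lemma isFibreWeight_torusH (h : H ℂ) (l : Fin 4 → ℤ) (z : Sˣ) :
    IsFibreWeight ((h : PSp ℂ⸨X⸩) • Gr.mk (diagPair ℂ l)) (conjH h (torusH S z) : PSp S⸨X⸩)
      (z ^ (4 * (l 0 - l 1) + 2 * l 2 - 2 * l 3)) := by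
  obtain ⟨g, δ, hg, hgh⟩ := exists_hasDet h.2
  obtain ⟨μ, hμ, h0⟩ := hg.exists_isMult
  obtain ⟨δ', hδ'⟩ := hg.baseChange (S := S)
  rw [conjH_val hgh (k := torusH S z) (T := GSp.ofInt S (torusGSp S z)) rfl, hgh, Gr.smul_mk]
  have hz := hasDet_torusGSp z
  have hs : ∀ z, Stable (expo l) (GSp.ofInt S (torusGSp S z)).1.1 := fun z => by
    rw [ofInt_torusGSp_val]
    exact stable_diagonal _
  refine isFibreWeight_of_triangular hμ h0 hg.parInt hg.inv.parInt hz.parInt hz.inv.parInt (hs z) ?_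
    (hδ'.conj hz) ?_ ?_
  · rw [← map_inv, ← map_inv]
    exact hs _
  · intro i j hij
    rw [ofInt_torusGSp_val, Matrix.diagonal_apply_ne _ hij.ne']
  · intro i
    rw [ofInt_torusGSp_val, Matrix.diagonal_apply_eq]
    exact HahnSeries.coeff_single_same 0 _

/-- The powers of the variable as units. -/
def laurentUnit : Multiplicative ℤ →* (𝒢)ˣ :=
  MonoidHom.mk' (fun n => ⟨LaurentPolynomial.T n.toAdd, LaurentPolynomial.T (-n.toAdd), by
    rw [← LaurentPolynomial.T_add]; simp, by rw [← LaurentPolynomial.T_add]; simp⟩)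
    fun m n => Units.ext (LaurentPolynomial.T_add m.toAdd n.toAdd)

lemma laurentUnit_val (n : ℤ) :
    (laurentUnit (Multiplicative.ofAdd n)).val = LaurentPolynomial.T n := rfl

/-- The logarithmic derivative of `T^(-e)` is `-e`, so the formal solution is `T^(-κ e)`, whose
exponent is not an integer because `κ` is irrational. -/
lemma eq_zero_of_euler_eq_laurentUnit {κ : ℂ} (hκ : ∀ q : ℚ, (q : ℂ) ≠ κ) {e : ℤ} (he : e ≠ 0)
    {p : 𝒢} (hp : euler p = (euler 0 +
      κ • ((laurentUnit (Multiplicative.ofAdd (-e)))⁻¹.val *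
        euler (laurentUnit (Multiplicative.ofAdd (-e))).val)) * p) : p = 0 := by
  refine eq_zero_of_euler_eq_smul (κ := κ * (-e : ℤ)) ?_ ?_
  · intro n hn
    refine hκ (n / (-e : ℤ)) ?_
    have h0 : ((-e : ℤ) : ℂ) ≠ 0 := by
      exact_mod_cast neg_ne_zero.2 he
    rw [Rat.cast_div, Rat.cast_intCast, Rat.cast_intCast, hn, mul_div_cancel_right₀ _ h0]
  · have h0 : euler 0 = 0 := by
      rw [euler, map_zero]
      rfl
    rw [hp, ← map_inv, ← ofAdd_neg, neg_neg, laurentUnit_val, laurentUnit_val, euler_T, h0,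
      zero_add, mul_smul_comm, ← LaurentPolynomial.T_add, add_neg_cancel,
      LaurentPolynomial.T_zero, smul_smul, smul_mul_assoc, one_mul]

/-- The closures of orbits with a torus acting non-trivially do not support twisted D-modules. -/
theorem not_supportsChiTwisted_torus {κ : ℂ} (hκ : ∀ q : ℚ, (q : ℂ) ≠ κ) {l : Fin 4 → ℤ}
    (hl : 4 * (l 0 - l 1) + 2 * l 2 - 2 * l 3 ≠ 0) (h : H ℂ) :
    ¬ SupportsChiTwisted κ ((h : PSp ℂ⸨X⸩) • Gr.mk (diagPair ℂ l)) := by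
  set e := 4 * (l 0 - l 1) + 2 * l 2 - 2 * l 3 with he
  set t := laurentUnit (Multiplicative.ofAdd 1) with ht
  set m := laurentUnit (Multiplicative.ofAdd (-e)) with hm
  -- At `z = T` the weight is `T^e`, which the scaling by `m = T^(-e)` compensates.
  have htm : t ^ e = m⁻¹ := by
    rw [ht, hm, ← map_zpow, ← map_inv, ← ofAdd_zsmul, ← ofAdd_neg, neg_neg, smul_eq_mul, mul_one]
  have hw : ∀ (S : Type) [CommRing S] [Algebra ℂ S] (z : Sˣ), IsFibreWeight
      ((h : PSp ℂ⸨X⸩) • Gr.mk (diagPair ℂ l)) (conjH h (torusH S z) : PSp S⸨X⸩) (z ^ e) :=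
    fun S _ _ z => isFibreWeight_torusH h l z
  refine not_supportsChiTwisted (fun S _ _ => ?_) (conjH h (torusH _ (redUnits 𝒢 t))) 0 m
    (Stabilizes.conj (stabilizes_torusH l _) h) ?_ ?_ ?_ ?_ ?_
  · have := hw S 1
    rw [map_one, conjH_one, _root_.one_zpow] at this
    exact this
  · rw [chi_conjH, chi_torusH, map_zero]
  · have := hw _ (redUnits 𝒢 t)
    rwa [← map_zpow, htm, map_inv] at this
  · have := hw _ (redUnits 𝒢 t)⁻¹
    rwa [_root_.inv_zpow, ← map_zpow, htm, map_inv (redUnits 𝒢), inv_inv, map_inv, ← conjH_inv]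
      at this
  · have := hw _ (mapUnits (Red.map eulerHom) (redUnits 𝒢 t))
    rw [← map_zpow, ← map_zpow, htm, map_inv, map_inv] at this
    rw [map_conjH, map_torusH]
    exact this
  · exact fun p hp => eq_zero_of_euler_eq_laurentUnit hκ hl hp

end Torus

end Twisted

/-! ### Unipotent stabilizers -/

section Shear

local notation "𝒢" => LaurentPolynomial ℂ

variable {S : Type} [CommRing S]

lemma stable_diagPair_conj (l : Fin 4 → ℤ) {M : GSp S⸨X⸩} (hM : OrdGeM 0 M.1.1) :
    Stable (expo l) (diagPair S l * M * (diagPair S l)⁻¹).1.1 := by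
  intro i j
  rw [GSp.coe_mul, GSp.coe_mul, diagPair_inv_val, diagPair_val, Matrix.mul_diagonal,
    Matrix.diagonal_mul]
  exact (((ordGe_single le_rfl 1).mul (hM i j)).mul (ordGe_single le_rfl 1)).mono (by omega)

lemma diagPair_conj_apply_eq_zero (l : Fin 4 → ℤ) {M : GSp S⸨X⸩} {i j : Fin 6}
    (hM : M.1.1 i j = 0) : (diagPair S l * M * (diagPair S l)⁻¹).1.1 i j = 0 := by
  rw [GSp.coe_mul, GSp.coe_mul, diagPair_inv_val, diagPair_val, Matrix.mul_diagonal,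
    Matrix.diagonal_mul, hM, mul_zero, zero_mul]

lemma ordGeM_shearGSp {x : S⸨X⸩} (hx : OrdGe 0 x) : OrdGeM 0 (shearGSp x).1.1 := by
  have h0 := OrdGe.zero (R := S) 0
  have h1 := ordGe_one (R := S)
  have h2 := hx.neg
  intro i j
  rw [shearGSp_val]
  fin_cases i <;> fin_cases j <;> first | exact h0 | exact h1 | exact hx | exact h2

lemma shearGSp_apply_eq_zero (x : S⸨X⸩) {i j : Fin 6} (h : j < i) : (shearGSp x).1.1 i j = 0 := by
  rw [shearGSp_val]
  fin_cases i <;> fin_cases j <;> first | rfl | exact absurd h (by decide)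

lemma leviPair_repPair_eq (R : Type*) [CommRing R] (n : ℕ) (a b r : ℤ) :
    leviPair _ (repPair R n a b r) = leviPair _ (1, glInt R (upperGL (PowerSeries.X ^ n))) *
      diagPair R ![n + a, b, n + r, 0] := by
  rw [leviPair_mul_diagPair, one_mul, repPair, repY_eq, repX_eq]
  rfl

lemma shearConj_eq (n : ℕ) (a b r : ℤ) (z : S) : (shearConj n a b r z).1 =
    leviPair _ (1, glInt S (upperGL (PowerSeries.X ^ n))) *
      (diagPair S ![n + a, b, n + r, 0] * shearGSp (HahnSeries.single (r - b - 1) (-z)) *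
        (diagPair S ![n + a, b, n + r, 0])⁻¹) *
      (leviPair _ (1, glInt S (upperGL (PowerSeries.X ^ n))))⁻¹ := by
  change leviPair _ (repPair S n a b r) * _ * (leviPair _ (repPair S n a b r))⁻¹ = _
  rw [leviPair_repPair_eq]
  group

variable [Algebra ℂ S]

lemma baseChange_upperGL (n : ℕ) :
    GSp.baseChange S (leviPair _ (1, glInt ℂ (upperGL (PowerSeries.X ^ n)))) =
      leviPair _ (1, glInt S (upperGL (PowerSeries.X ^ n))) := by
  rw [baseChange_leviPair_one_left, glBaseChange_upperGL]

lemma mul_mul_mul_inv_eq_conj {G : Type*} [Group G] (g q t : G) :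
    g * q * t * (g * q)⁻¹ = g * (q * t * q⁻¹) * g⁻¹ := by
  group

lemma exists_isMult_mul_leviPair {g : GSp ℂ⸨X⸩} {δ : ℂˣ} (hg : HasDet g δ)
    (Q : GL (Fin 2) ℂ⟦X⟧) :
    (∃ μ : ℂ⸨X⸩ˣ, IsMult (g * leviPair _ (1, glInt ℂ Q)).1.1 μ ∧ UnitOrd 0 μ) ∧
      ParInt (g * leviPair _ (1, glInt ℂ Q)).1.1 ∧
      ParInt ((g * leviPair _ (1, glInt ℂ Q))⁻¹).1.1 := by
  obtain ⟨μ, hμ, h0⟩ := hg.exists_isMult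
  refine ⟨⟨μ * GeneralLinearGroup.det (glInt ℂ Q), hμ.mul (isMult_leviPair _), ?_⟩,
    hg.parInt.mul (parInt_leviPair_one_left Q), ?_⟩
  · have := h0.mul (unitOrd_ofPowerSeries (GeneralLinearGroup.det Q))
    rwa [zero_add, ← glInt_det_unit] at this
  · have hqi : (leviPair ℂ⸨X⸩ (1, glInt ℂ Q))⁻¹ = leviPair ℂ⸨X⸩ (1, glInt ℂ Q⁻¹) := by
      rw [← map_inv]
      exact congrArg _ (Prod.ext inv_one (map_inv (glInt ℂ) Q).symm)
    rw [_root_.mul_inv_rev, hqi]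
    exact (parInt_leviPair_one_left Q⁻¹).mul hg.inv.parInt

/-- Unipotent elements act trivially on the fibres. -/
lemma isFibreWeight_diagPair_conj {p : GSp ℂ⸨X⸩} {μ : ℂ⸨X⸩ˣ} (hμ : IsMult p.1.1 μ)
    (h0 : UnitOrd 0 μ) (hp : ParInt p.1.1) (hp' : ParInt (p⁻¹).1.1) (l : Fin 4 → ℤ) {x : S⸨X⸩}
    (hx : OrdGe 0 x) (hd : HasDet (GSp.baseChange S p *
      (diagPair S l * shearGSp x * (diagPair S l)⁻¹) * (GSp.baseChange S p)⁻¹) 1) :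
    IsFibreWeight (Gr.mk (p * diagPair ℂ l)) (PSp.mk (GSp.baseChange S p *
      (diagPair S l * shearGSp x * (diagPair S l)⁻¹) * (GSp.baseChange S p)⁻¹)) 1 := by
  have hT : diagPair S l * shearGSp x * (diagPair S l)⁻¹ ∈ unip S⸨X⸩ :=
    leviPair_conj_mem_unip _ (shearGSp_mem_unip x)
  have hTi : (diagPair S l * shearGSp x * (diagPair S l)⁻¹)⁻¹ =
      diagPair S l * shearGSp (-x) * (diagPair S l)⁻¹ := by
    rw [shearGSp_neg]
    group
  have hs' : Stable (expo l) ((diagPair S l * shearGSp x * (diagPair S l)⁻¹)⁻¹).1.1 := by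
    rw [hTi]
    exact stable_diagPair_conj _ (ordGeM_shearGSp hx.neg)
  have hα : ∀ i, ((diagPair S l * shearGSp x * (diagPair S l)⁻¹).1.1 i i).coeff 0 =
      (![1, 1, 1, 1, 1, 1] i : Sˣ) := by
    intro i
    rw [show (diagPair S l * shearGSp x * (diagPair S l)⁻¹).1.1 i i =
      (1 : Matrix (Fin 6) (Fin 6) S⸨X⸩) i i from hT i i le_rfl, Matrix.one_apply_eq]
    fin_cases i <;> exact HahnSeries.coeff_single_same 0 1
  have key := isFibreWeight_of_triangular hμ h0 hp hp' (parInt_of_mem_unip hT)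
    (parInt_of_mem_unip (inv_mem hT)) (stable_diagPair_conj _ (ordGeM_shearGSp hx)) hs' hd
    (fun i j hij => diagPair_conj_apply_eq_zero _ (shearGSp_apply_eq_zero x hij)) hα
  rwa [_root_.one_zpow] at key

/-- In the coordinates of the lattice the shear is unipotent and upper triangular, so all
determinants are `1`. -/
lemma isFibreWeight_shearH (h : H ℂ) {n : ℕ} {a b r : ℤ} (hb : b < r) (z : S) :
    IsFibreWeight ((h : PSp ℂ⸨X⸩) • pt (coweight n a b r)) (shearH h n a b r z : PSp S⸨X⸩) 1 := by
  obtain ⟨g, δ, hg, hgh⟩ := exists_hasDet h.2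
  obtain ⟨δ', hδ'⟩ := hg.baseChange (S := S)
  obtain ⟨⟨μ, hμ, h0⟩, hp, hp'⟩ := exists_isMult_mul_leviPair hg (upperGL (PowerSeries.X ^ n))
  have hx : OrdGe 0 (HahnSeries.single (r - b - 1) (-z)) := ordGe_single (by omega) _
  have hd := hδ'.conj (hasDet_of_mem_unip (shearConj n a b r z).2)
  have e : (shearH h n a b r z : PSp S⸨X⸩) = PSp.mk (GSp.baseChange S g *
      (shearConj n a b r z).1 * (GSp.baseChange S g)⁻¹) := conjH_val hgh rfl
  rw [e, pt_eq_upperGL, hgh, Gr.smul_mk, ← mul_assoc]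
  rw [shearConj_eq, ← baseChange_upperGL (S := S), ← mul_mul_mul_inv_eq_conj, ← map_mul] at hd ⊢
  exact isFibreWeight_diagPair_conj hμ h0 hp hp' _ hx hd

lemma shearH_neg (h : H ℂ) (n a b r : ℤ) (z : S) :
    shearH h n a b r (-z) = (shearH h n a b r z)⁻¹ := by
  have e : unipH (shearConj n a b r (-z)) = (unipH (shearConj n a b r z))⁻¹ :=
    Subtype.ext (congrArg PSp.mk (shearConj_neg n a b r z))
  change conjH h _ = (conjH h _)⁻¹
  rw [conjH_inv, e]

lemma shearH_zero (h : H ℂ) (n a b r : ℤ) : shearH h n a b r (0 : S) = 1 := by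
  have e : unipH (shearConj n a b r (0 : S)) = 1 := by
    refine Subtype.ext (congrArg PSp.mk ?_)
    change _ * shearGSp _ * _ = 1
    have h1 : shearGSp (0 : S⸨X⸩) = 1 := Subtype.ext (Units.ext shearMatrix_zero)
    rw [neg_zero, map_zero, h1, mul_one, mul_inv_cancel]
  change conjH h _ = 1
  rw [e, conjH_one]

lemma map_shearH {S' : Type} [CommRing S'] [Algebra ℂ S'] (f : S →ₐ[ℂ] S') (h : H ℂ)
    (n a b r : ℤ) (z : S) :
    H.map f.toRingHom (shearH h n a b r z) = shearH h n a b r (f z) := by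
  have e : H.map f.toRingHom (unipH (shearConj n a b r z)) = unipH (shearConj n a b r (f z)) :=
    Subtype.ext (congrArg PSp.mk (map_shearConj f.toRingHom n a b r z))
  change H.map f.toRingHom (conjH h _) = conjH h _
  rw [map_conjH, e]

/-- Shears act trivially on the fibres of the line bundle, so with `m = 1` the equation of `exp T`
remains, whatever `κ` is. -/
theorem not_supportsChiTwisted_of_lt {κ : ℂ} {n : ℕ} {a b r : ℤ} (hb : b < r) (h : H ℂ) :
    ¬ SupportsChiTwisted κ ((h : PSp ℂ⸨X⸩) • pt (coweight n a b r)) := by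
  have hw : ∀ (S : Type) [CommRing S] [Algebra ℂ S] (z : S), IsFibreWeight
      ((h : PSp ℂ⸨X⸩) • pt (coweight n a b r)) (shearH h n a b r z : PSp S⸨X⸩) 1 :=
    fun S _ _ z => isFibreWeight_shearH h hb z
  refine not_supportsChiTwisted (fun S _ _ => ?_) (shearH h n a b r
    (Ideal.Quotient.mk (nilradical 𝒢) (LaurentPolynomial.T 1))) (LaurentPolynomial.T 1) 1
    (stabilizes_shearH h hb _) (chi_shearH _ _ _ _ _ _) ?_ ?_ ?_ ?_
  · have := hw S 0
    rwa [shearH_zero] at this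
  · rw [map_one, inv_one]
    exact hw _ _
  · rw [map_one, ← shearH_neg]
    exact hw _ _
  · rw [map_one, map_one, inv_one, map_shearH]
    exact hw _ _
  · intro p hp
    refine eq_zero_of_euler_eq_T_mul ?_
    have h1 : euler 1 = 0 := by
      have := euler_T 0
      rwa [LaurentPolynomial.T_zero, Int.cast_zero, zero_smul] at this
    rw [Units.val_one, h1, mul_zero, smul_zero, add_zero, euler_T, Int.cast_one, one_smul] at hp
    exact hp

end Shear

/-! ### The classification of the orbits supporting twisted D-modules -/

section Classification

/-- In the excluded cases both blocks become diagonal after removal of one common integral left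
factor `P`, so a conjugate of the torus stabilizes the point, with nonzero weight exponent. -/
lemma exists_eq_leviPair_mul_diagPair {n r : ℕ} {a b : ℤ} (hab : b ≤ a)
    (h : ¬ ((n = 0 → 2 * (a - b) = r) ∧ (0 < n → b < a ∧ 0 < r))) :
    ∃ (P : GL (Fin 2) ℂ⟦X⟧) (l : Fin 4 → ℤ), 4 * (l 0 - l 1) + 2 * l 2 - 2 * l 3 ≠ 0 ∧
      pt (coweight n a b r) = Gr.mk (leviPair _ (glInt ℂ P, glInt ℂ P) * diagPair ℂ l) := by
  simp only [leviPair_mul_diagPair, pt_coweight]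
  rcases Nat.eq_zero_or_pos n with rfl | hn
  · obtain ⟨d, hd⟩ := Int.eq_ofNat_of_zero_le (sub_nonneg.2 hab)
    obtain rfl : a = b + d := by linarith
    -- For `n = 0` the lower triangular factor of the second block passes through `X` because `b ≤
    -- a`; the exponent is `4 (a - b) - 2 r`.
    refine ⟨lowerGL 1, ![b + d, b, 0, r], ?_, mk_leviPair_mul_glInt (lowerGL (-PowerSeries.X ^ d))
      _ ?_ (repY_zero_eq ℂ r)⟩
    · change 4 * (b + d - b) + 2 * 0 - 2 * (r : ℤ) ≠ 0
      omega
    · refine Units.ext ?_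
      change (repX ℂ _ _ _).val = _ * (diagUnit ![tpowR ℂ (b + d), tpowR ℂ b]).val * _
      rw [repX_val, diagUnit_tpowR]
      refine Matrix.ext fun i j => ?_
      fin_cases i <;> fin_cases j <;> simp [Matrix.mul_apply, Fin.sum_univ_two, lowerGL, add_comm]
  · by_cases hr : r = 0
    · subst hr
      -- For `r = 0` the second block is diagonal up to a column operation; the exponent `4 (n + a -
      -- b) + 2 n` is positive.
      refine ⟨1, ![n + a, b, n, 0], ?_, mk_leviPair_mul_glInt 1 (upperGL 1) ?_ ?_⟩
      · change 4 * ((n : ℤ) + a - b) + 2 * (n : ℤ) - 2 * 0 ≠ 0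
        omega
      · rw [map_one, mul_one, one_mul]
        rfl
      · refine Units.ext ?_
        rw [map_one, one_mul]
        change (repY ℂ _ _).val = (diagUnit ![tpowR ℂ (n : ℤ), tpowR ℂ 0]).val * _
        rw [repY_val, diagUnit_tpowR]
        refine Matrix.ext fun i j => ?_
        fin_cases i <;> fin_cases j <;> simp [Matrix.mul_apply, Fin.sum_univ_two, upperGL]
    · obtain rfl : a = b := by omega
      -- For `a = b` the exponents of the first block differ by `n`, so the factor `upperGL (X ^ n)`
      -- of the second block passes through it; the exponent is `4 n + 2 (n + r)`.
      refine ⟨upperGL (PowerSeries.X ^ n), ![n + a, a, n + r, 0], ?_,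
        mk_leviPair_mul_glInt (upperGL (-1)) 1 ?_ ?_⟩
      · change 4 * ((n : ℤ) + a - a) + 2 * ((n : ℤ) + r) - 2 * 0 ≠ 0
        omega
      · refine Units.ext ?_
        change (repX ℂ _ _ _).val = _ * (diagUnit ![tpowR ℂ (n + a), tpowR ℂ a]).val * _
        rw [repX_val, diagUnit_tpowR]
        refine Matrix.ext fun i j => ?_
        fin_cases i <;> fin_cases j <;> simp [Matrix.mul_apply, Fin.sum_univ_two, upperGL]
      · rw [map_one, mul_one, repY_eq]
        rfl

theorem not_supportsChiTwisted_of_not_odd {κ : ℂ} (hκ : ∀ q : ℚ, (q : ℂ) ≠ κ) {n r : ℕ} {a b : ℤ}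
    (hab : b ≤ a) (h : ¬ ((n = 0 → 2 * (a - b) = r) ∧ (0 < n → b < a ∧ 0 < r))) (h' : H ℂ) :
    ¬ SupportsChiTwisted κ ((h' : PSp ℂ⸨X⸩) • pt (coweight n a b r)) := by
  obtain ⟨P, l, hl, e⟩ := exists_eq_leviPair_mul_diagPair hab h
  have hP : PSp.mk (levi _ (glInt ℂ P)) ∈ H ℂ := by
    have := mk_leviUnip_mem P (one_mem (unip ℂ⸨X⸩))
    rwa [leviUnip, mul_one] at this
  -- The common factor `P` lies in the group and is absorbed into the translation by `h'`.
  have := not_supportsChiTwisted_torus hκ hl (h' * ⟨_, hP⟩)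
  rw [Subgroup.coe_mul, mul_smul, Gr.smul_mk] at this
  rwa [e, leviPair_self]

theorem isFullSetOfRepresentatives_oddDominant {κ : ℂ} (hκ : ∀ q : ℚ, (q : ℂ) ≠ κ) :
    IsFullSetOfRepresentatives {l | Dominant l ∧ OddDominant l} (SupportsChiTwisted κ) := by
  refine isFullSetOfRepresentatives_of_forall (fun l hl => hl.1.lDominant) ?_ ?_
  · rintro l ⟨hl, ho⟩
    obtain ⟨n, a, b, r, hn, hr, hab, rfl⟩ := lDominant_iff.1 hl.lDominant
    have hrb := (dominant_coweight_iff hn hr hab).1 hl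
    obtain ⟨h1, h2⟩ := oddDominant_coweight_iff.1 ho
    refine supportsChiTwisted_of_forall
      (fun S _ _ _ s hs => chi_eq_zero_of_stabilizes hr hrb hab s hs) fun S _ _ _ s w hw => ?_
    lift n to ℕ using hn
    lift r to ℕ using hr
    exact weight_eq_one (by exact_mod_cast h1) (by exact_mod_cast h2) hw
  · intro l hl h hh hP
    obtain ⟨n, a, b, r, hn, hr, hab, rfl⟩ := lDominant_iff.1 hl
    lift n to ℕ using hn
    lift r to ℕ using hr
    by_contra hc
    by_cases hb : b < r
    · exact not_supportsChiTwisted_of_lt hb ⟨h, hh⟩ hP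
    · refine not_supportsChiTwisted_of_not_odd hκ hab (fun ho => hc ?_) ⟨h, hh⟩ hP
      refine ⟨(dominant_coweight_iff (Int.natCast_nonneg n) (Int.natCast_nonneg r) hab).2
        (not_lt.1 hb), oddDominant_coweight_iff.2 ⟨fun h0 => ho.1 (by exact_mod_cast h0),
        fun h0 => ?_⟩⟩
      obtain ⟨h1, h2⟩ := ho.2 (by exact_mod_cast h0)
      exact ⟨h1, not_lt.1 hb, by exact_mod_cast h2⟩

end Classification

end

end Gaiotto

theorem mainTheorem8 (κ : ℂ) (hκ : ∀ q : ℚ, (q : ℂ) ≠ κ) :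
    Gaiotto.IsFullSetOfRepresentatives {l | Gaiotto.LDominant l} (fun _ => True) ∧
    Gaiotto.IsFullSetOfRepresentatives {l | Gaiotto.Dominant l} Gaiotto.SupportsChi ∧
    Gaiotto.IsFullSetOfRepresentatives {l | Gaiotto.Dominant l ∧ Gaiotto.OddDominant l}
      (Gaiotto.SupportsChiTwisted κ) := by
  exact ⟨Gaiotto.isFullSetOfRepresentatives_lDominant, Gaiotto.isFullSetOfRepresentatives_dominant,
    Gaiotto.isFullSetOfRepresentatives_oddDominant hκ⟩
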